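/- Let $(I,\cdot)$ be a Cartan datum, let $a$ be an automorphism of it of finite order $N$ with $i\cdot i'=0$ whenever $i\neq i'$ lie in the same $a$-orbit, and let $k$ be an algebraically closed field whose characteristic does not divide $N$. Let $Q_{ii'}(u,v)\in k[u,v]$ $(i,i'\in I)$ satisfy: $Q_{ii}=0$; for $i\ne i'$, $Q_{ii'}$ is homogeneous of degree $-2\,i\cdot i'$ when $u,v$ have degrees $i\cdot i$, $i'\cdot i'$, with nonzero coefficients at $u^{-2 i\cdot i'/i\cdot i}$ and $v^{-2i\cdot i'/i'\cdot i'}$; $Q_{ii'}(u,v)=Q_{i'i}(v,u)$; and $Q_{a(i)a(i')}=Q_{ii'}$. For $\nu\in\mathbb N I$ let $R(\nu)$ be the graded KLR algebra, with generators $e_w$ ($w\in\mathrm{Seq}(\nu)$), $y_l$, $\tau_l$ and the usual relations given by the $Q_{ii'}$. If $a\nu=\nu$, then $a$ acts on $R(\nu)$ by $e_w\mapsto e_{aw}$, $y_l\mapsto y_l$, $\tau_l\mapsto\tau_l$. Let $\mathcal C_\nu$ be the category of pairs $(M,\sigma)$ with $M$ a graded $R(\nu)$-module and $\sigma\colon M\to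 M$ a linear map of degree $0$ with $\sigma(rm)=a(r)\sigma(m)$ and $\sigma^N=1$. Let $\mathcal P_\nu$ and $\mathcal L_\nu$ be the full subcategories of finitely generated projective objects and of finite dimensional objects. The same definitions apply to $R(\lambda)\otimes R(\mu)$ with $a\otimes a$, and give $\mathcal P_{\lambda\sqcup\mu}$ and $\mathcal L_{\lambda\sqcup\mu}$. Let $\zeta\in\mathbb C$ be a primitive $N$-th root of unity, and fix a ring homomorphism $\mathbb Z[\zeta]\to k$. An object is *traceless* if, for some $t\ge2$ dividing $N$, it is the direct sum of $t$ graded submodules which $\sigma$ permutes cyclically. $K(\mathcal P_\nu)$ is the $\mathbb Z[\zeta,q,q^{-1}]$-module generated by the symbols $[X]$ for $X\in\mathcal P_\nu$, where $q$ acts by the grading shift $(qM)_i=M_{i-1}$, with relations $[X]=[X']+[X'']$ if $X\cong X'\oplus X''$, $[(M,\zeta\sigma)]=\zeta[(M,\sigma)]$, and $[X]=0$ if $X$ is traceless. $K(\mathcal L_\nu)$ is defined in the same way, with additivity on short exact sequences. Write $X\circ Y=R(\lambda+\mu)\otimes_{R(\lambda)\otimes R(\mu)}(X\otimes Y)$ and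 $\operatorname{Res}_{\lambda,\mu}X=e_{\lambda\mu}X$ with the induced maps $\sigma$, where $e_{\lambda\mu}$ is the image of $1$ under $R(\lambda)\otimes R(\mu)\to R(\lambda+\mu)$. Let $j$ be an $a$-orbit in $I$, regarded as the element $\sum_{i\in j}i$ of $\mathbb N I$, and put $d_j=(j\cdot j)/2$ and $q_j=q^{d_j}$. Put $[n]_j=(q_j^n-q_j^{-n})/(q_j-q_j^{-1})$ and $[n]_j!=[1]_j\cdots[n]_j$, and let ${n\brack m}_j\in\mathbb Z[q,q^{-1}]$ be the quantum binomial coefficient, with ${n\brack m}_j\,[m]_j!\,[n-m]_j!=[n]_j!$ for $0\le m\le n$. For $i\neq i'$ in $j$ the polynomial $Q_{ii'}$ is a nonzero constant; choose constants $\gamma_{ii'}\in k$ with $\gamma_{ii'}\gamma_{i'i}=Q_{ii'}$ for $i\ne i'$ in $j$ and $\gamma_{a(i)a(i')}=\gamma_{ii'}$ for $i,i'\in j$ (if these $Q_{ii'}$ are $1$, one may take $\gamma_{ii'}=1$). Let $L(j)=(L_j,\sigma)\in\mathcal C_j$, where $L_j$ has a basis of elements $[w]$ of degree $0$, for $w$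 running over the orderings of the elements of $j$; $e_{w'}[w]=\delta_{w'w}[w]$, $y_l[w]=0$, $\tau_l[w]=\gamma_{w_lw_{l+1}}[s_lw]$ and $\sigma[w]=[aw]$. Put $L(j^n)=q_j^{\binom n2}L(j)^{\circ n}$, where $L(j)^{\circ 0}=k=R(0)$, and let $P(j)^{(n)}$ be the projective cover of $L(j^n)$ in $\mathcal C_{nj}$. **Theorem.** (1) The projective covers $P(j)^{(n)}$ exist and are finitely generated. If $X\in\mathcal P_{mj}$ and $Y\in\mathcal P_{nj}$, then $X\circ Y\in\mathcal P_{(m+n)j}$, and there is a $\mathbb Z[\zeta,q,q^{-1}]$-bilinear product on $\bigoplus_{n\ge0}K(\mathcal P_{nj})$ with $[X][Y]=[X\circ Y]$ for all such $X$, $Y$. For all $m,n\ge0$, $$[P(j)^{(m)}]\,[P(j)^{(n)}]={m+n\brack n}_j\,[P(j)^{(m+n)}].$$ (2) The objects $L(j^n)$ are finite dimensional. The tensor product of objects induces isomorphisms $K(\mathcal L_{aj})\otimes_{\mathbb Z[\zeta,q,q^{-1}]}K(\mathcal L_{bj})\cong K(\mathcal L_{aj\sqcup bj})$ for all $a,b\ge0$;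 through them, the restriction functors $\operatorname{Res}_{aj,bj}$ with $a+b=n$ induce a $\mathbb Z[\zeta,q,q^{-1}]$-linear map $r\colon\bigoplus_{n}K(\mathcal L_{nj})\to\bigoplus_{a,b}K(\mathcal L_{aj})\otimes_{\mathbb Z[\zeta,q,q^{-1}]} K(\mathcal L_{bj})$, whose component at $(a,b)$ vanishes on $K(\mathcal L_{nj})$ if $a+b\ne n$. For all $n\ge0$, $$r([L(j^n)])=\sum_{a+b=n}{n\brack a}_j\,[L(j^a)]\otimes[L(j^b)].$$ -/

import Mathlib

open scoped TensorProduct DirectSum LaurentPolynomial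

noncomputable section

universe u v w

namespace FoldedKLR

/-! ## Graded algebras with an automorphism, and their equivariant graded modules -/

section Gradings

variable {k : Type u} [Field k]

/-- The coaction `m ↦ m q ^ d` (for `m` of degree `d`) of a grading. -/
def coaction {M : Type w} [AddCommGroup M] [Module k M] {deg : ℤ → Submodule k M}
    (h : DirectSum.IsInternal deg) : M →ₗ[k] (ℤ →₀ M) :=
  (DirectSum.toModule k ℤ (ℤ →₀ M)
    fun d => (Finsupp.lsingle d : M →ₗ[k] ℤ →₀ M) ∘ₗ (deg d).subtype) ∘ₗ
    (LinearEquiv.ofBijective (DirectSum.coeLinearMap deg) h).symm.toLinearMap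

theorem coaction_apply {M : Type w} [AddCommGroup M] [Module k M] {deg : ℤ → Submodule k M}
    (h : DirectSum.IsInternal deg) {d : ℤ} {m : M} (hm : m ∈ deg d) :
    coaction h m = Finsupp.single d m := by
  have : (LinearEquiv.ofBijective (DirectSum.coeLinearMap deg) h).symm m =
      DirectSum.lof k ℤ (fun d => deg d) d ⟨m, hm⟩ := by
    rw [LinearEquiv.symm_apply_eq]
    exact (DirectSum.coeLinearMap_lof deg d ⟨m, hm⟩).symm
  simp [coaction, this]

theorem isInternal_of_coaction {M : Type w} [AddCommGroup M] [Module k M]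
    (deg : ℤ → Submodule k M) (Δ : M →ₗ[k] (ℤ →₀ M))
    (h1 : ∀ d, ∀ m ∈ deg d, Δ m = Finsupp.single d m) (h2 : ∀ m, m ∈ ⨆ d, deg d) :
    DirectSum.IsInternal deg := by
  rw [DirectSum.isInternal_submodule_iff_iSupIndep_and_iSup_eq_top]
  refine ⟨?_, eq_top_iff.2 fun m _ => h2 m⟩
  intro d
  rw [Submodule.disjoint_def]
  intro x hx hx'
  have hle : (⨆ (e : ℤ) (_ : e ≠ d), deg e) ≤ LinearMap.ker (Finsupp.lapply d ∘ₗ Δ) := by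
    refine iSup₂_le fun e he m hm => ?_
    simp [h1 e m hm, he]
  have := hle hx'
  simpa [h1 d x hx] using this

theorem mem_iSup_of_internal {M : Type w} [AddCommGroup M] [Module k M]
    {deg : ℤ → Submodule k M} (h : DirectSum.IsInternal deg) (m : M) : m ∈ ⨆ d, deg d := by
  rw [h.submodule_iSup_eq_top]; trivial

/-- The total grading on a tensor product: the degree `d` piece is spanned by the `x ⊗ y`
with `x`, `y` homogeneous and `deg x + deg y = d`. -/
def tensorDeg {M N : Type w} [AddCommGroup M] [Module k M] [AddCommGroup N] [Module k N]
    (degM : ℤ → Submodule k M) (degN : ℤ → Submodule k N) (d : ℤ) : Submodule k (M ⊗[k] N) :=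
  Submodule.span k {z | ∃ i j x y, x ∈ degM i ∧ y ∈ degN j ∧ i + j = d ∧ z = x ⊗ₜ[k] y}

theorem tmul_mem_tensorDeg {M N : Type w} [AddCommGroup M] [Module k M] [AddCommGroup N]
    [Module k N] {degM : ℤ → Submodule k M} {degN : ℤ → Submodule k N} {i j : ℤ} {x : M} {y : N}
    (hx : x ∈ degM i) (hy : y ∈ degN j) : x ⊗ₜ[k] y ∈ tensorDeg degM degN (i + j) :=
  Submodule.subset_span ⟨i, j, x, y, hx, hy, rfl, rfl⟩

theorem mem_iSup_tensorDeg {M N : Type w} [AddCommGroup M] [Module k M] [AddCommGroup N]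
    [Module k N] {degM : ℤ → Submodule k M} {degN : ℤ → Submodule k N}
    (hM : DirectSum.IsInternal degM) (hN : DirectSum.IsInternal degN) (z : M ⊗[k] N) :
    z ∈ ⨆ d, tensorDeg degM degN d := by
  induction z with
  | zero => exact zero_mem _
  | add a b ha hb => exact add_mem ha hb
  | tmul x y =>
    refine Submodule.iSup_induction degM (motive := fun x => x ⊗ₜ[k] y ∈ ⨆ d, tensorDeg degM degN d)
      (mem_iSup_of_internal hM x) ?_ (by simp) (fun a b ha hb => by
        rw [TensorProduct.add_tmul]; exact add_mem ha hb)
    intro i x hx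
    refine Submodule.iSup_induction degN (motive := fun y => x ⊗ₜ[k] y ∈ ⨆ d, tensorDeg degM degN d)
      (mem_iSup_of_internal hN y) ?_ (by simp) (fun a b ha hb => by
        rw [TensorProduct.tmul_add]; exact add_mem ha hb)
    intro j y hy
    exact Submodule.mem_iSup_of_mem (i + j) (tmul_mem_tensorDeg hx hy)

/-- The coaction of the total grading on a tensor product. -/
def tensorCoaction {M N : Type w} [AddCommGroup M] [Module k M] [AddCommGroup N] [Module k N]
    {degM : ℤ → Submodule k M} {degN : ℤ → Submodule k N}
    (hM : DirectSum.IsInternal degM) (hN : DirectSum.IsInternal degN) :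
    M ⊗[k] N →ₗ[k] (ℤ →₀ M ⊗[k] N) :=
  Finsupp.lmapDomain (M ⊗[k] N) k (fun p : ℤ × ℤ => p.1 + p.2) ∘ₗ
    (finsuppTensorFinsupp k k M N ℤ ℤ).toLinearMap ∘ₗ
    TensorProduct.map (coaction hM) (coaction hN)

theorem tensorCoaction_apply {M N : Type w} [AddCommGroup M] [Module k M] [AddCommGroup N]
    [Module k N] {degM : ℤ → Submodule k M} {degN : ℤ → Submodule k N}
    (hM : DirectSum.IsInternal degM) (hN : DirectSum.IsInternal degN) {d : ℤ} {z : M ⊗[k] N}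
    (hz : z ∈ tensorDeg degM degN d) : tensorCoaction hM hN z = Finsupp.single d z := by
  have : tensorDeg degM degN d ≤
      LinearMap.eqLocus (tensorCoaction hM hN) (Finsupp.lsingle d) := by
    refine Submodule.span_le.2 ?_
    rintro _ ⟨i, j, x, y, hx, hy, rfl, rfl⟩
    simp [tensorCoaction, coaction_apply hM hx, coaction_apply hN hy, Finsupp.mapDomain_single]
  exact this hz

theorem tensorDeg_internal {M N : Type w} [AddCommGroup M] [Module k M] [AddCommGroup N]
    [Module k N] {degM : ℤ → Submodule k M} {degN : ℤ → Submodule k N}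
    (hM : DirectSum.IsInternal degM) (hN : DirectSum.IsInternal degN) :
    DirectSum.IsInternal (tensorDeg degM degN) :=
  isInternal_of_coaction _ (tensorCoaction hM hN) (fun _ _ h => tensorCoaction_apply hM hN h)
    (mem_iSup_tensorDeg hM hN)

end Gradings

/-- A `ℤ`-graded `k`-algebra with a degree preserving automorphism `aut` whose `n`-th power is
the identity, so that `ℤ/n` acts on it. -/
structure FoldedAlg (k : Type u) [Field k] (n : ℕ) where
  carrier : Type w
  [ring : Ring carrier]
  [algebra : Algebra k carrier]
  deg : ℤ → Submodule k carrier
  internal : DirectSum.IsInternal deg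
  one_mem : (1 : carrier) ∈ deg 0
  mul_mem : ∀ {i j : ℤ} {x y : carrier}, x ∈ deg i → y ∈ deg j → x * y ∈ deg (i + j)
  aut : carrier →ₐ[k] carrier
  aut_mem : ∀ {i : ℤ} {x : carrier}, x ∈ deg i → aut x ∈ deg i
  aut_pow : ∀ x, (⇑aut)^[n] x = x

attribute [instance] FoldedAlg.ring FoldedAlg.algebra

variable {k : Type u} [Field k] {n : ℕ}

/-- An object `(M, σ)`: a graded `A`-module `M` with a degree preserving `k`-linear map `σ` such
that `σ (r m) = aut r • σ m` and `σ ^ n = 1`. For `n ≥ 1` this is the same as a graded module over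
the smash product of `A` with `ℤ/n`; in terms of the pull back functor `a^*` along the inverse of
`aut`, the map `σ` is an isomorphism `a^* M → M` with `σ ∘ a^* σ ∘ ⋯ ∘ (a^*)^(n-1) σ = id`. -/
structure Obj (A : FoldedAlg.{u, w} k n) where
  carrier : Type w
  [addCommGroup : AddCommGroup carrier]
  [moduleBase : Module k carrier]
  [module : Module A.carrier carrier]
  [tower : IsScalarTower k A.carrier carrier]
  deg : ℤ → Submodule k carrier
  internal : DirectSum.IsInternal deg
  smul_mem : ∀ {i j : ℤ} {r : A.carrier} {m : carrier},
    r ∈ A.deg i → m ∈ deg j → r • m ∈ deg (i + j)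
  σ : carrier →ₗ[k] carrier
  σ_smul : ∀ (r : A.carrier) (m : carrier), σ (r • m) = A.aut r • σ m
  σ_mem : ∀ {i : ℤ} {m : carrier}, m ∈ deg i → σ m ∈ deg i
  σ_pow : ∀ m, (⇑σ)^[n] m = m

attribute [instance] Obj.addCommGroup Obj.moduleBase Obj.module Obj.tower

/-- Morphisms: module maps of degree zero commuting with the maps `σ`. -/
structure Hom {A : FoldedAlg.{u, w} k n} (X Y : Obj A) where
  map : X.carrier →ₗ[A.carrier] Y.carrier
  map_mem : ∀ {i : ℤ} {m : X.carrier}, m ∈ X.deg i → map m ∈ Y.deg i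
  map_σ : ∀ m, map (X.σ m) = Y.σ (map m)

/-- Isomorphic objects. (The inverse of a bijective morphism is a morphism.) -/
def IsIso {A : FoldedAlg.{u, w} k n} (X Y : Obj A) : Prop :=
  ∃ f : Hom X Y, Function.Bijective f.map

/-- Projective objects: lifting against epimorphisms, which are the surjective morphisms. -/
def IsProjective {A : FoldedAlg.{u, w} k n} (P : Obj A) : Prop :=
  ∀ (X Y : Obj A) (f : Hom X Y) (g : Hom P Y), Function.Surjective f.map →
    ∃ h : Hom P X, ∀ p, f.map (h.map p) = g.map p

/-- `P` is a projective cover of `L`: it is projective and there is an essential epimorphism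
from `P` onto `L`. -/
def IsProjectiveCover {A : FoldedAlg.{u, w} k n} (P L : Obj A) : Prop :=
  IsProjective P ∧ ∃ π : Hom P L, Function.Surjective π.map ∧
    ∀ (Q : Obj A) (h : Hom Q P), (Function.Surjective fun x => π.map (h.map x)) →
      Function.Surjective h.map

/-- The finitely generated projective objects. -/
def IsFGProjective {A : FoldedAlg.{u, w} k n} (X : Obj A) : Prop :=
  Module.Finite A.carrier X.carrier ∧ IsProjective X

/-- The finite dimensional objects. -/
def IsFinDim {A : FoldedAlg.{u, w} k n} (X : Obj A) : Prop :=
  Module.Finite k X.carrier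

namespace Obj

/-- The grading shift `q ^ s M`, with `(q ^ s M)_i = M_(i - s)`. -/
def shift {A : FoldedAlg.{u, w} k n} (s : ℤ) (X : Obj A) : Obj A where
  carrier := X.carrier
  deg i := X.deg (i - s)
  internal := by
    refine isInternal_of_coaction _
      (Finsupp.lmapDomain X.carrier k (fun i => i + s) ∘ₗ coaction X.internal) ?_ ?_
    · intro d m hm
      simp [coaction_apply X.internal hm, Finsupp.mapDomain_single]
    · intro m
      have h := mem_iSup_of_internal X.internal m
      have hle : (⨆ d, X.deg d) ≤ ⨆ d, X.deg (d - s) :=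
        iSup_le fun d => le_iSup_of_le (d + s) (by simp)
      exact hle h
  smul_mem {i j r m} hr hm := by
    have := X.smul_mem hr hm
    rwa [show i + (j - s) = i + j - s by ring] at this
  σ := X.σ
  σ_smul := X.σ_smul
  σ_mem hm := X.σ_mem hm
  σ_pow := X.σ_pow

/-- The twist `(M, c σ)` of `(M, σ)` by an `n`-th root of unity `c`. -/
def twist {A : FoldedAlg.{u, w} k n} (c : k) (hc : c ^ n = 1) (X : Obj A) : Obj A where
  carrier := X.carrier
  deg := X.deg
  internal := X.internal
  smul_mem := X.smul_mem
  σ := c • X.σ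
  σ_smul r m := by
    simp only [LinearMap.smul_apply, X.σ_smul]
    rw [smul_comm]
  σ_mem hm := (X.deg _).smul_mem c (X.σ_mem hm)
  σ_pow m := by
    have : ∀ t : ℕ, (⇑(c • X.σ))^[t] m = c ^ t • (⇑X.σ)^[t] m := by
      intro t
      induction t with
      | zero => simp
      | succ t ih =>
        rw [Function.iterate_succ_apply', Function.iterate_succ_apply', ih, LinearMap.smul_apply,
          map_smul, smul_smul, pow_succ']
    rw [this, hc, one_smul, X.σ_pow]

/-- The regular object: `A` as a module over itself, with `aut` as `σ`. -/
def regular (A : FoldedAlg.{u, w} k n) : Obj A where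
  carrier := A.carrier
  deg := A.deg
  internal := A.internal
  smul_mem := A.mul_mem
  σ := A.aut.toLinearMap
  σ_smul r m := by simp
  σ_mem := A.aut_mem
  σ_pow := A.aut_pow

end Obj

/-- `X` is isomorphic to the direct sum of `X'` and `X''`. -/
def IsDirectSum {A : FoldedAlg.{u, w} k n} (X X' X'' : Obj A) : Prop :=
  ∃ (f : Hom X' X) (g : Hom X'' X),
    Function.Bijective fun p : X'.carrier × X''.carrier => f.map p.1 + g.map p.2

/-- There is a short exact sequence `0 → X' → X → X'' → 0`. -/
def IsExtension {A : FoldedAlg.{u, w} k n} (X X' X'' : Obj A) : Prop :=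
  ∃ (f : Hom X' X) (g : Hom X X''), Function.Injective f.map ∧ Function.Surjective g.map ∧
    LinearMap.range f.map = LinearMap.ker g.map

/-- Traceless objects. For some `t ≥ 2` dividing `n`, the module is a direct sum of `t` graded
submodules which `σ` permutes cyclically. (The summand with index `i` is then isomorphic to
`(a^*)^i M`, where `M` is the summand with index `0`, and `(a^*)^t M ≅ M`.) -/
def IsTraceless {A : FoldedAlg.{u, w} k n} (X : Obj A) : Prop :=
  ∃ t : ℕ, 2 ≤ t ∧ t ∣ n ∧ ∃ N : ZMod t → Submodule A.carrier X.carrier,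
    DirectSum.IsInternal N ∧
    (∀ i, (N i).restrictScalars k = ⨆ d, (N i).restrictScalars k ⊓ X.deg d) ∧
    (∀ i, ((N i).restrictScalars k).map X.σ = (N (i + 1)).restrictScalars k)

/-! ## Grothendieck groups

`O` is the ring `ℤ[ζ]`, with a ring homomorphism `φ : O → k`. The groups are generated over `O`
by symbols `[X]`, and `q` acts by the grading shift; we write them down directly as modules over
`O[q, q⁻¹]`, where `q` is the variable of the ring of Laurent polynomials. -/

section Grothendieck

variable {O : Type} [CommRing O] (ζ : O) (φ : O →+* k)

/-- The relations common to both Grothendieck groups, together with additivity on those triples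
for which `E X X' X''` holds. -/
inductive KRel {A : FoldedAlg.{u, w} k n} (S : Obj A → Prop) (E : Obj A → Obj A → Obj A → Prop) :
    ({X : Obj A // S X} →₀ O[T;T⁻¹]) → Prop
  | add (X X' X'' : {X : Obj A // S X}) (h : E X X' X'') :
      KRel S E (Finsupp.single X 1 - Finsupp.single X' 1 - Finsupp.single X'' 1)
  | twist (X Y : {X : Obj A // S X}) (hc : φ ζ ^ n = 1)
      (h : IsIso Y.1 (X.1.twist (φ ζ) hc)) :
      KRel S E (Finsupp.single Y 1 - Finsupp.single X (LaurentPolynomial.C ζ))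
  | traceless (X : {X : Obj A // S X}) (h : IsTraceless X.1) : KRel S E (Finsupp.single X 1)
  | shift (X Y : {X : Obj A // S X}) (h : IsIso Y.1 (X.1.shift 1)) :
      KRel S E (Finsupp.single Y 1 - Finsupp.single X (LaurentPolynomial.T 1))

/-- The Grothendieck group on the class `S` of objects, additive on the triples in `E`. -/
abbrev KGroup {A : FoldedAlg.{u, w} k n} (S : Obj A → Prop)
    (E : Obj A → Obj A → Obj A → Prop) : Type _ :=
  ({X : Obj A // S X} →₀ O[T;T⁻¹]) ⧸ Submodule.span O[T;T⁻¹] {z | KRel ζ φ S E z}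

/-- The Grothendieck group of finitely generated projective objects (split relations). -/
abbrev KP (A : FoldedAlg.{u, w} k n) : Type _ := KGroup ζ φ (IsFGProjective (A := A)) IsDirectSum

/-- The Grothendieck group of finite dimensional objects (short exact sequences). -/
abbrev KL (A : FoldedAlg.{u, w} k n) : Type _ := KGroup ζ φ (IsFinDim (A := A)) IsExtension

/-- The class `[X]` in the Grothendieck group of projectives. -/
def clsP {A : FoldedAlg.{u, w} k n} (X : Obj A) (h : IsFGProjective X) : KP ζ φ A :=
  Submodule.Quotient.mk (Finsupp.single ⟨X, h⟩ 1)

/-- The class `[X]` in the Grothendieck group of finite dimensional objects. -/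
def clsL {A : FoldedAlg.{u, w} k n} (X : Obj A) (h : IsFinDim X) : KL ζ φ A :=
  Submodule.Quotient.mk (Finsupp.single ⟨X, h⟩ 1)

end Grothendieck

/-! ## Tensor products, induction and restriction -/

/-- The tensor product algebra, with the total grading and the diagonal automorphism. -/
def FoldedAlg.tensor (A B : FoldedAlg.{u, w} k n) : FoldedAlg.{u, w} k n where
  carrier := A.carrier ⊗[k] B.carrier
  deg := tensorDeg A.deg B.deg
  internal := tensorDeg_internal A.internal B.internal
  one_mem := by
    have := tmul_mem_tensorDeg (k := k) A.one_mem B.one_mem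
    rwa [add_zero] at this
  mul_mem {i j x y} hx hy := by
    induction hx using Submodule.span_induction with
    | zero => simp
    | add a b _ _ ha hb => rw [add_mul]; exact add_mem ha hb
    | smul c a _ ha => rw [smul_mul_assoc]; exact Submodule.smul_mem _ c ha
    | mem x hx =>
      obtain ⟨p, q, a, b, ha, hb, rfl, rfl⟩ := hx
      induction hy using Submodule.span_induction with
      | zero => simp
      | add a b _ _ ha hb => rw [mul_add]; exact add_mem ha hb
      | smul c a _ ha => rw [mul_smul_comm]; exact Submodule.smul_mem _ c ha
      | mem y hy =>
        obtain ⟨p', q', a', b', ha', hb', rfl, rfl⟩ := hy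
        rw [Algebra.TensorProduct.tmul_mul_tmul]
        have := tmul_mem_tensorDeg (k := k) (A.mul_mem ha ha') (B.mul_mem hb hb')
        rwa [show p + p' + (q + q') = p + q + (p' + q') by ring] at this
  aut := Algebra.TensorProduct.map A.aut B.aut
  aut_mem {i x} hx := by
    induction hx using Submodule.span_induction with
    | zero => simp
    | add a b _ _ ha hb => rw [map_add]; exact add_mem ha hb
    | smul c a _ ha => rw [map_smul]; exact Submodule.smul_mem _ c ha
    | mem x hx =>
      obtain ⟨p, q, a, b, ha, hb, rfl, rfl⟩ := hx
      exact tmul_mem_tensorDeg (A.aut_mem ha) (B.aut_mem hb)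
  aut_pow x := by
    have key : ∀ (t : ℕ) (a : A.carrier) (b : B.carrier),
        (⇑(Algebra.TensorProduct.map A.aut B.aut))^[t] (a ⊗ₜ[k] b) =
          (⇑A.aut)^[t] a ⊗ₜ[k] (⇑B.aut)^[t] b := by
      intro t a b
      induction t with
      | zero => rfl
      | succ t ih =>
        simp only [Function.iterate_succ_apply', ih, Algebra.TensorProduct.map_tmul]
    induction x with
    | zero => exact Function.iterate_fixed (map_zero _) n
    | add a b ha hb => rw [iterate_map_add, ha, hb]
    | tmul a b => rw [key, A.aut_pow, B.aut_pow]

namespace Obj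

/-- The action of `A ⊗ B` on `M ⊗ N`. -/
def tensorAction {A B : FoldedAlg.{u, w} k n} (X : Obj A) (Y : Obj B) :
    A.carrier ⊗[k] B.carrier →ₐ[k] Module.End k (X.carrier ⊗[k] Y.carrier) :=
  (Module.endTensorEndAlgHom (R := k) (S := k) (A := k) (M := X.carrier) (N := Y.carrier)).comp
    (Algebra.TensorProduct.map (Algebra.lsmul k k X.carrier) (Algebra.lsmul k k Y.carrier))

theorem tensorAction_tmul {A B : FoldedAlg.{u, w} k n} (X : Obj A) (Y : Obj B)
    (a : A.carrier) (b : B.carrier) (x : X.carrier) (y : Y.carrier) :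
    tensorAction X Y (a ⊗ₜ b) (x ⊗ₜ y) = (a • x) ⊗ₜ (b • y) := by
  rfl

theorem tensorAction_mem {A B : FoldedAlg.{u, w} k n} (X : Obj A) (Y : Obj B) {i j : ℤ}
    {r : A.carrier ⊗[k] B.carrier} {m : X.carrier ⊗[k] Y.carrier}
    (hr : r ∈ tensorDeg A.deg B.deg i) (hm : m ∈ tensorDeg X.deg Y.deg j) :
    tensorAction X Y r m ∈ tensorDeg X.deg Y.deg (i + j) := by
  induction hr using Submodule.span_induction with
  | zero => simp
  | add a b _ _ ha hb => rw [map_add, LinearMap.add_apply]; exact add_mem ha hb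
  | smul c a _ ha => rw [map_smul, LinearMap.smul_apply]; exact Submodule.smul_mem _ c ha
  | mem r hr =>
    obtain ⟨p, q, a, b, ha, hb, rfl, rfl⟩ := hr
    induction hm using Submodule.span_induction with
    | zero => simp
    | add a b _ _ ha hb => rw [map_add]; exact add_mem ha hb
    | smul c a _ ha => rw [map_smul]; exact Submodule.smul_mem _ c ha
    | mem y hy =>
      obtain ⟨p', q', a', b', ha', hb', rfl, rfl⟩ := hy
      rw [tensorAction_tmul]
      have := tmul_mem_tensorDeg (k := k) (X.smul_mem ha ha') (Y.smul_mem hb hb')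
      rwa [show p + p' + (q + q') = p + q + (p' + q') by ring] at this

theorem tensorAction_σ {A B : FoldedAlg.{u, w} k n} (X : Obj A) (Y : Obj B)
    (r : A.carrier ⊗[k] B.carrier) (m : X.carrier ⊗[k] Y.carrier) :
    TensorProduct.map X.σ Y.σ (tensorAction X Y r m) =
      tensorAction X Y (Algebra.TensorProduct.map A.aut B.aut r)
        (TensorProduct.map X.σ Y.σ m) := by
  induction r with
  | zero => simp
  | add a b ha hb => simp only [map_add, LinearMap.add_apply, ha, hb]
  | tmul a b =>
    induction m with
    | zero => simp
    | add x y hx hy => simp only [map_add, hx, hy]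
    | tmul x y =>
      rw [tensorAction_tmul, Algebra.TensorProduct.map_tmul, TensorProduct.map_tmul,
        TensorProduct.map_tmul, tensorAction_tmul, X.σ_smul, Y.σ_smul]

/-- The tensor product `(M ⊗ N, σ ⊗ τ)`, a module over `A ⊗ B`. -/
def tensor {A B : FoldedAlg.{u, w} k n} (X : Obj A) (Y : Obj B) : Obj (A.tensor B) where
  carrier := X.carrier ⊗[k] Y.carrier
  module := Module.compHom _ (tensorAction X Y).toRingHom
  tower := by
    let _ : Module (A.tensor B).carrier (X.carrier ⊗[k] Y.carrier) :=
      Module.compHom _ (tensorAction X Y).toRingHom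
    refine ⟨fun c r m => ?_⟩
    exact LinearMap.congr_fun (map_smul (tensorAction X Y) c r) m
  deg := tensorDeg X.deg Y.deg
  internal := tensorDeg_internal X.internal Y.internal
  smul_mem hr hm := tensorAction_mem X Y hr hm
  σ := TensorProduct.map X.σ Y.σ
  σ_smul r m := tensorAction_σ X Y r m
  σ_mem {i m} hm := by
    induction hm using Submodule.span_induction with
    | zero => simp
    | add a b _ _ ha hb => rw [map_add]; exact add_mem ha hb
    | smul c a _ ha => rw [map_smul]; exact Submodule.smul_mem _ c ha
    | mem x hx =>
      obtain ⟨p, q, a, b, ha, hb, rfl, rfl⟩ := hx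
      exact tmul_mem_tensorDeg (X.σ_mem ha) (Y.σ_mem hb)
  σ_pow x := by
    have key : ∀ (t : ℕ) (a : X.carrier) (b : Y.carrier),
        (⇑(TensorProduct.map X.σ Y.σ))^[t] (a ⊗ₜ[k] b) =
          (⇑X.σ)^[t] a ⊗ₜ[k] (⇑Y.σ)^[t] b := by
      intro t a b
      induction t with
      | zero => rfl
      | succ t ih => simp only [Function.iterate_succ_apply', ih, TensorProduct.map_tmul]
    induction x with
    | zero => exact Function.iterate_fixed (map_zero _) n
    | add a b ha hb => rw [iterate_map_add, ha, hb]
    | tmul a b => rw [key, X.σ_pow, Y.σ_pow]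

end Obj

/-- A homomorphism of graded algebras with automorphism which need not send `1` to `1`. -/
structure CornerHom (A B : FoldedAlg.{u, w} k n) where
  map : A.carrier →ₗ[k] B.carrier
  map_mul : ∀ x y, map (x * y) = map x * map y
  map_mem : ∀ {i : ℤ} {x : A.carrier}, x ∈ A.deg i → map x ∈ B.deg i
  map_aut : ∀ x, map (A.aut x) = B.aut (map x)

namespace CornerHom

variable {A B : FoldedAlg.{u, w} k n} (ι : CornerHom A B) (X : Obj A)

/-- The submodule generated by the `ι(a) ⊗ x - 1 ⊗ a x`. -/
def balance : Submodule B.carrier (B.carrier ⊗[k] X.carrier) :=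
  Submodule.span B.carrier {z | ∃ (a : A.carrier) (x : X.carrier),
    z = ι.map a ⊗ₜ[k] x - 1 ⊗ₜ[k] (a • x)}

/-- The map `b ⊗ x ↦ aut b ⊗ σ x`. -/
def indσ : B.carrier ⊗[k] X.carrier →ₗ[k] B.carrier ⊗[k] X.carrier :=
  TensorProduct.map B.aut.toLinearMap X.σ

theorem indσ_smul (b : B.carrier) (z : B.carrier ⊗[k] X.carrier) :
    indσ X (b • z) = B.aut b • indσ X z := by
  induction z with
  | zero => simp
  | add x y hx hy => simp only [smul_add, map_add, hx, hy]
  | tmul c x => simp [indσ, TensorProduct.smul_tmul']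

theorem indσ_balance : (ι.balance X).restrictScalars k ≤
    ((ι.balance X).restrictScalars k).comap (indσ X) := by
  intro z hz
  change indσ X z ∈ ι.balance X
  change z ∈ ι.balance X at hz
  induction hz using Submodule.span_induction with
  | zero => simp
  | add a b _ _ ha hb => rw [map_add]; exact add_mem ha hb
  | smul c a _ ha => rw [indσ_smul]; exact Submodule.smul_mem _ _ ha
  | mem x hx =>
    obtain ⟨a, x, rfl⟩ := hx
    refine Submodule.subset_span ⟨A.aut a, X.σ x, ?_⟩
    simp [indσ, ι.map_aut, X.σ_smul]

theorem smul_tensorDeg {i j : ℤ} {b : B.carrier} {z : B.carrier ⊗[k] X.carrier}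
    (hb : b ∈ B.deg i) (hz : z ∈ tensorDeg B.deg X.deg j) :
    b • z ∈ tensorDeg B.deg X.deg (i + j) := by
  induction hz using Submodule.span_induction with
  | zero => simp
  | add a b _ _ ha hb => rw [smul_add]; exact add_mem ha hb
  | smul c a _ ha => rw [smul_comm]; exact Submodule.smul_mem _ c ha
  | mem x hx =>
    obtain ⟨p, q, a, x, ha, hx, rfl, rfl⟩ := hx
    rw [TensorProduct.smul_tmul', ← add_assoc]
    exact tmul_mem_tensorDeg (B.mul_mem hb ha) hx

/-- The coaction on `B ⊗ X` followed by the projection to the quotient by `balance`. -/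
def indCoaction₀ : B.carrier ⊗[k] X.carrier →ₗ[k]
    (ℤ →₀ ((B.carrier ⊗[k] X.carrier) ⧸ ι.balance X)) :=
  Finsupp.mapRange.linearMap ((ι.balance X).mkQ.restrictScalars k) ∘ₗ
    tensorCoaction B.internal X.internal

theorem indCoaction₀_apply {d : ℤ} {z : B.carrier ⊗[k] X.carrier}
    (hz : z ∈ tensorDeg B.deg X.deg d) :
    ι.indCoaction₀ X z = Finsupp.single d ((ι.balance X).mkQ z) := by
  simp [indCoaction₀, tensorCoaction_apply B.internal X.internal hz]

theorem indCoaction₀_balance :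
    (ι.balance X).restrictScalars k ≤ LinearMap.ker (ι.indCoaction₀ X) := by
  intro z hz
  change z ∈ ι.balance X at hz
  rw [LinearMap.mem_ker]
  -- homogeneous case
  have hom : ∀ (b : B.carrier) (a : A.carrier) (x : X.carrier),
      ι.indCoaction₀ X (b • (ι.map a ⊗ₜ[k] x - 1 ⊗ₜ[k] (a • x))) = 0 := by
    intro b a x
    refine Submodule.iSup_induction B.deg
      (motive := fun b => ι.indCoaction₀ X (b • (ι.map a ⊗ₜ[k] x - 1 ⊗ₜ[k] (a • x))) = 0)
      (mem_iSup_of_internal B.internal b) ?_ (by simp)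
      (fun b b' hb hb' => by rw [add_smul, map_add, hb, hb', add_zero])
    intro i b hb
    refine Submodule.iSup_induction A.deg
      (motive := fun a => ι.indCoaction₀ X (b • (ι.map a ⊗ₜ[k] x - 1 ⊗ₜ[k] (a • x))) = 0)
      (mem_iSup_of_internal A.internal a) ?_ (by simp)
      (fun a a' ha ha' => by
        rw [map_add, add_smul, TensorProduct.add_tmul, TensorProduct.tmul_add, add_sub_add_comm,
          smul_add, map_add, ha, ha', add_zero])
    intro j a ha
    refine Submodule.iSup_induction X.deg
      (motive := fun x => ι.indCoaction₀ X (b • (ι.map a ⊗ₜ[k] x - 1 ⊗ₜ[k] (a • x))) = 0)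
      (mem_iSup_of_internal X.internal x) ?_ (by simp)
      (fun x x' hx hx' => by
        rw [smul_add, TensorProduct.tmul_add, TensorProduct.tmul_add, add_sub_add_comm,
          smul_add, map_add, hx, hx', add_zero])
    intro l x hx
    have h1 : ι.map a ⊗ₜ[k] x ∈ tensorDeg B.deg X.deg (j + l) :=
      tmul_mem_tensorDeg (ι.map_mem ha) hx
    have h2 : (1 : B.carrier) ⊗ₜ[k] (a • x) ∈ tensorDeg B.deg X.deg (j + l) := by
      have := tmul_mem_tensorDeg (k := k) B.one_mem (X.smul_mem ha hx)
      rwa [zero_add] at this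
    rw [ι.indCoaction₀_apply X (smul_tensorDeg X hb (sub_mem h1 h2)), Finsupp.single_eq_zero,
      Submodule.mkQ_apply, Submodule.Quotient.mk_eq_zero]
    exact Submodule.smul_mem _ _ (Submodule.subset_span ⟨a, x, rfl⟩)
  induction hz using Submodule.closure_induction with
  | zero => simp
  | add a b _ _ ha hb => rw [map_add, ha, hb, add_zero]
  | smul_mem b z hz =>
    obtain ⟨a, x, rfl⟩ := hz
    exact hom b a x

/-- The induced object `B ⊗_A X`, where `B` is a right `A`-module through `ι`; this is the quotient
of `B ⊗_k X` by the elements `b ι(a) ⊗ x - b ⊗ a x`. Since `b ⊗ x = b ι(1) ⊗ x` there, it is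
`B ι(1) ⊗_A X`. The map `σ` is induced by `b ⊗ x ↦ aut b ⊗ σ x`. -/
def ind : Obj B where
  carrier := (B.carrier ⊗[k] X.carrier) ⧸ ι.balance X
  deg d := (tensorDeg B.deg X.deg d).map ((ι.balance X).mkQ.restrictScalars k)
  internal := by
    refine isInternal_of_coaction _
      (Submodule.liftQ _ (ι.indCoaction₀ X) (ι.indCoaction₀_balance X) ∘ₗ
        (Submodule.Quotient.restrictScalarsEquiv k (ι.balance X)).symm.toLinearMap) ?_ ?_
    · rintro d _ ⟨z, hz, rfl⟩
      exact ι.indCoaction₀_apply X hz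
    · intro m
      obtain ⟨z, rfl⟩ := Submodule.mkQ_surjective _ m
      have := mem_iSup_tensorDeg B.internal X.internal z
      rw [← Submodule.map_iSup]
      exact ⟨z, this, rfl⟩
  smul_mem {i j b m} hb hm := by
    obtain ⟨z, hz, rfl⟩ := hm
    exact ⟨b • z, smul_tensorDeg X hb hz, rfl⟩
  σ := (Submodule.Quotient.restrictScalarsEquiv k (ι.balance X)).toLinearMap ∘ₗ
    Submodule.mapQ _ _ (indσ X) (ι.indσ_balance X) ∘ₗ
    (Submodule.Quotient.restrictScalarsEquiv k (ι.balance X)).symm.toLinearMap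
  σ_smul b m := by
    obtain ⟨z, rfl⟩ := Submodule.mkQ_surjective _ m
    exact congrArg (ι.balance X).mkQ (indσ_smul X b z)
  σ_mem {i m} hm := by
    obtain ⟨z, hz, rfl⟩ := hm
    refine ⟨indσ X z, ?_, rfl⟩
    induction hz using Submodule.span_induction with
    | zero => simp
    | add a b _ _ ha hb => rw [map_add]; exact add_mem ha hb
    | smul c a _ ha => rw [map_smul]; exact Submodule.smul_mem _ c ha
    | mem x hx =>
      obtain ⟨p, q, a, b, ha, hb, rfl, rfl⟩ := hx
      exact tmul_mem_tensorDeg (B.aut_mem ha) (X.σ_mem hb)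
  σ_pow m := by
    obtain ⟨z, rfl⟩ := Submodule.mkQ_surjective _ m
    have key : ∀ (t : ℕ) (a : B.carrier) (b : X.carrier),
        (⇑(indσ (B := B) X))^[t] (a ⊗ₜ[k] b) = (⇑B.aut)^[t] a ⊗ₜ[k] (⇑X.σ)^[t] b := by
      intro t a b
      induction t with
      | zero => rfl
      | succ t ih =>
        simp only [Function.iterate_succ_apply', ih]
        simp [indσ]
    have fix : (⇑(indσ (B := B) X))^[n] z = z := by
      induction z with
      | zero => exact Function.iterate_fixed (map_zero _) n
      | add a b ha hb => rw [iterate_map_add, ha, hb]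
      | tmul a b => rw [key, B.aut_pow, X.σ_pow]
    have semi : Function.Semiconj (ι.balance X).mkQ (indσ X)
        ((Submodule.Quotient.restrictScalarsEquiv k (ι.balance X)).toLinearMap ∘ₗ
          Submodule.mapQ _ _ (indσ X) (ι.indσ_balance X) ∘ₗ
          (Submodule.Quotient.restrictScalarsEquiv k (ι.balance X)).symm.toLinearMap) :=
      fun z => rfl
    rw [← (semi.iterate_right n) z, fix]

variable (Y : Obj B)

/-- The subspace `ι(1) Y` of `Y`. -/
def fixed : Submodule k Y.carrier where
  carrier := {y | ι.map 1 • y = y}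
  zero_mem' := smul_zero _
  add_mem' {a b} ha hb := by
    change _ • _ = _ at ha hb ⊢
    rw [smul_add, ha, hb]
  smul_mem' c x hx := by
    change _ • _ = _ at hx ⊢
    rw [smul_comm, hx]

theorem smul_mem_fixed (a : A.carrier) (y : Y.carrier) : ι.map a • y ∈ ι.fixed Y := by
  change ι.map 1 • ι.map a • y = _
  rw [smul_smul, ← ι.map_mul, one_mul]

/-- The projection of `Y` onto `ι(1) Y`. -/
def proj : Y.carrier →ₗ[k] ι.fixed Y :=
  (Algebra.lsmul k k Y.carrier (ι.map 1)).codRestrict _ fun y => ι.smul_mem_fixed Y 1 y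

/-- The action of `A` on `ι(1) Y` through `ι`. -/
def resAction : A.carrier →ₐ[k] Module.End k (ι.fixed Y) :=
  AlgHom.ofLinearMap
    { toFun := fun a => (Algebra.lsmul k k Y.carrier (ι.map a)).restrict
        fun y _ => ι.smul_mem_fixed Y a y
      map_add' := fun a b => by
        ext y
        change ι.map (a + b) • y.1 = ι.map a • y.1 + ι.map b • y.1
        rw [map_add, add_smul]
      map_smul' := fun c a => by
        ext y
        change ι.map (c • a) • y.1 = c • ι.map a • y.1
        rw [map_smul, smul_assoc] }
    (by ext y; exact y.2)
    (fun a b => by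
      ext y
      change ι.map (a * b) • y.1 = ι.map a • ι.map b • y.1
      rw [ι.map_mul, smul_smul])

/-- The restriction `ι(1) Y` of `Y`, on which `A` acts through `ι`. -/
def res : Obj A where
  carrier := ι.fixed Y
  module := Module.compHom _ (ι.resAction Y).toRingHom
  tower := by
    let _ : Module A.carrier (ι.fixed Y) := Module.compHom _ (ι.resAction Y).toRingHom
    refine ⟨fun c r m => ?_⟩
    change ι.resAction Y (c • r) m = c • ι.resAction Y r m
    rw [map_smul, LinearMap.smul_apply]
  deg d := (Y.deg d).comap (ι.fixed Y).subtype
  internal := by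
    refine isInternal_of_coaction _
      (Finsupp.mapRange.linearMap (ι.proj Y) ∘ₗ coaction Y.internal ∘ₗ (ι.fixed Y).subtype) ?_ ?_
    · intro d m hm
      have : ι.proj Y m.1 = m := Subtype.ext m.2
      have h : coaction Y.internal m.1 = Finsupp.single d m.1 := coaction_apply Y.internal hm
      change Finsupp.mapRange.linearMap (ι.proj Y) (coaction Y.internal m.1) = _
      rw [h, Finsupp.mapRange.linearMap_apply, Finsupp.mapRange_single, this]
    · intro m
      have : ι.proj Y m.1 = m := Subtype.ext m.2
      rw [← this]
      refine Submodule.iSup_induction Y.deg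
        (motive := fun y => ι.proj Y y ∈ ⨆ d, (Y.deg d).comap (ι.fixed Y).subtype)
        (mem_iSup_of_internal Y.internal m.1) ?_ (by simp)
        (fun a b ha hb => by rw [map_add]; exact add_mem ha hb)
      intro i y hy
      refine Submodule.mem_iSup_of_mem i ?_
      have := Y.smul_mem (ι.map_mem A.one_mem) hy
      rw [zero_add] at this
      exact this
  smul_mem hr hm := Y.smul_mem (ι.map_mem hr) hm
  σ := Y.σ.restrict fun y hy => by
    change ι.map 1 • Y.σ y = Y.σ y
    have h : ι.map 1 • y = y := hy
    conv_rhs => rw [← h]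
    rw [Y.σ_smul, ← ι.map_aut, map_one A.aut]
  σ_smul r m := by
    apply Subtype.ext
    change Y.σ (ι.map r • m.1) = ι.map (A.aut r) • Y.σ m.1
    rw [Y.σ_smul, ι.map_aut]
  σ_mem hm := Y.σ_mem hm
  σ_pow m := by
    apply Subtype.ext
    have semi : Function.Semiconj (Subtype.val : ι.fixed Y → Y.carrier) (Y.σ.restrict fun y hy => by
        change ι.map 1 • Y.σ y = Y.σ y
        have h : ι.map 1 • y = y := hy
        conv_rhs => rw [← h]
        rw [Y.σ_smul, ← ι.map_aut, map_one A.aut]) Y.σ := fun _ => rfl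
    exact (semi.iterate_right n m).trans (Y.σ_pow m.1)

end CornerHom

/-! ## Folded Cartan data and KLR algebras -/

/-- A Cartan datum: a symmetric form on `ℤ I` given by its values `i · j` on `I`. -/
structure CartanDatum (I : Type v) where
  form : I → I → ℤ
  symm : ∀ i j, form i j = form j i
  diag : ∀ i, 0 < form i i ∧ Even (form i i)
  off_diag : ∀ i j, i ≠ j → form i j ≤ 0 ∧ form i i ∣ 2 * form i j

/-- A Cartan datum with an automorphism `a` of finite order, such that distinct elements of an
orbit are orthogonal, and with the polynomials `Q i j ∈ k[u, v]`, where `u` and `v` are the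
variables with indices `0` and `1`. All degrees are doubled in `Q_homog`, so that `u` has degree
`i · i = 2 d_i`; the number `- c_ij` is `- 2 (i · j) / (i · i)`. -/
structure FoldedDatum (I : Type v) (k : Type u) [Field k] extends CartanDatum I where
  a : Equiv.Perm I
  form_a : ∀ i j, form (a i) (a j) = form i j
  finite_order : IsOfFinOrder a
  orth : ∀ i j, i ≠ j → a.SameCycle i j → form i j = 0
  Q : I → I → MvPolynomial (Fin 2) k
  Q_self : ∀ i, Q i i = 0
  Q_homog : ∀ i j, i ≠ j →
    MvPolynomial.IsWeightedHomogeneous ![form i i, form j j] (Q i j) (-(2 * form i j))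
  Q_coeff_u : ∀ i j, i ≠ j →
    (Q i j).coeff (Finsupp.single 0 (-(2 * form i j / form i i)).toNat) ≠ 0
  Q_coeff_v : ∀ i j, i ≠ j →
    (Q i j).coeff (Finsupp.single 1 (-(2 * form i j / form j j)).toNat) ≠ 0
  Q_symm : ∀ i j, Q i j = MvPolynomial.rename (Equiv.swap 0 1) (Q j i)
  Q_a : ∀ i j, Q (a i) (a j) = Q i j

/-- The value `p(x, y)` of a polynomial in two variables at commuting elements of an algebra. -/
def evalTwo {S : Type w} [Ring S] [Algebra k S] (p : MvPolynomial (Fin 2) k) (x y : S) : S :=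
  ∑ m ∈ p.support, p.coeff m • (x ^ m 0 * y ^ m 1)

/-- The value at commuting elements `x`, `y`, `z` of the polynomial
`(p(u, v) - p(u', v)) / (u - u')` in `u`, `v`, `u'`, which is
`∑ c_(s,t) (∑_(i < s) u ^ i u' ^ (s - 1 - i)) v ^ t` for `p = ∑ c_(s,t) u ^ s v ^ t`. -/
def dividedDiff {S : Type w} [Ring S] [Algebra k S] (p : MvPolynomial (Fin 2) k) (x y z : S) : S :=
  ∑ m ∈ p.support, p.coeff m •
    ((∑ i ∈ Finset.range (m 0), x ^ i * z ^ (m 0 - 1 - i)) * y ^ m 1)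

theorem map_evalTwo {S S' : Type*} [Ring S] [Algebra k S] [Ring S'] [Algebra k S']
    (f : S →ₐ[k] S') (p : MvPolynomial (Fin 2) k) (x y : S) :
    f (evalTwo p x y) = evalTwo p (f x) (f y) := by
  simp [evalTwo]

theorem map_dividedDiff {S S' : Type*} [Ring S] [Algebra k S] [Ring S'] [Algebra k S']
    (f : S →ₐ[k] S') (p : MvPolynomial (Fin 2) k) (x y z : S) :
    f (dividedDiff p x y z) = dividedDiff p (f x) (f y) (f z) := by
  simp [dividedDiff]

/-- The words `Seq(ν)` in the letters `I` with content `ν ∈ ℕ I`. -/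
@[ext]
structure Word {I : Type v} (ν : I →₀ ℕ) : Type v where
  letter : Fin ν.degree → I
  content : ∑ l, Finsupp.single (letter l) 1 = ν

namespace Word

variable {I : Type v} {ν : I →₀ ℕ}

theorem mem_support (w : Word ν) (l : Fin ν.degree) : w.1 l ∈ ν.support := by
  classical
  rw [Finsupp.mem_support_iff]
  intro h
  have h2 := DFunLike.congr_fun w.2 (w.1 l)
  rw [h, Finsupp.finsetSum_apply, Finset.sum_eq_zero_iff] at h2
  simpa using h2 l (Finset.mem_univ l)

instance : Finite (Word ν) :=
  Finite.of_injective
    (fun w l => (⟨w.1 l, w.mem_support l⟩ : {i // i ∈ ν.support}))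
    fun _ _ h => Word.ext <| funext fun l => congrArg Subtype.val (congrFun h l)

instance : Fintype (Word ν) := Fintype.ofFinite _

instance : DecidableEq (Word ν) := Classical.decEq _

/-- The word `s_l w`, with the letters in the places `l` and `l + 1` exchanged. -/
def swap (w : Word ν) (l : ℕ) (h : l + 1 < ν.degree) : Word ν :=
  ⟨w.1 ∘ Equiv.swap ⟨l, Nat.lt_of_succ_lt h⟩ ⟨l + 1, h⟩,
    (Equiv.sum_comp (Equiv.swap (⟨l, Nat.lt_of_succ_lt h⟩ : Fin ν.degree) ⟨l + 1, h⟩)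
      fun l => Finsupp.single (w.1 l) 1).trans w.2⟩

theorem swap_left (w : Word ν) (l : ℕ) (h : l + 1 < ν.degree) (h' : l < ν.degree) :
    (w.swap l h).1 ⟨l, h'⟩ = w.1 ⟨l + 1, h⟩ := by
  simp [swap]

theorem swap_right (w : Word ν) (l : ℕ) (h : l + 1 < ν.degree) (h' : l + 1 < ν.degree) :
    (w.swap l h).1 ⟨l + 1, h'⟩ = w.1 ⟨l, Nat.lt_of_succ_lt h⟩ := by
  simp [swap]

theorem swap_ne (w : Word ν) (l : ℕ) (h : l + 1 < ν.degree) (m : Fin ν.degree)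
    (h1 : m.1 ≠ l) (h2 : m.1 ≠ l + 1) : (w.swap l h).1 m = w.1 m := by
  refine congrArg w.1 (Equiv.swap_apply_of_ne_of_ne ?_ ?_) <;> simpa [Fin.ext_iff]

theorem swap_swap (w : Word ν) (l : ℕ) (h : l + 1 < ν.degree) : (w.swap l h).swap l h = w := by
  apply Word.ext
  funext m
  simp [swap]

/-- The word obtained by applying a permutation of the letters which fixes the content. -/
def relabel (a : Equiv.Perm I) (h : Finsupp.mapDomain a ν = ν) (w : Word ν) : Word ν :=
  ⟨a ∘ w.1, by
    conv_rhs => rw [← h, ← w.2]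
    rw [Finsupp.mapDomain_finsetSum]
    simp [Finsupp.mapDomain_single]⟩

/-- The concatenation of two words. -/
def append {lam μ : I →₀ ℕ} (h : lam + μ = ν) (w : Word lam) (w' : Word μ) : Word ν :=
  ⟨fun l => Fin.append w.1 w'.1 (Fin.cast (by rw [← h, map_add]) l), by
    have hd : lam.degree + μ.degree = ν.degree := by rw [← h, map_add]
    refine (Equiv.sum_comp (finCongr hd)
      fun l => Finsupp.single (Fin.append w.1 w'.1 (Fin.cast hd.symm l)) 1).symm.trans ?_
    refine Eq.trans ?_ ((congrArg₂ (· + ·) w.2 w'.2).trans h)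
    simp [Fin.sum_univ_add]⟩

end Word

/-- The generators `e_w`, `y_l`, `τ_l` of the KLR algebra; the places in a word are numbered
from `0`. -/
inductive Gen {I : Type v} (ν : I →₀ ℕ) : Type v
  | e (w : Word ν)
  | y (l : Fin ν.degree)
  | tau (l : ℕ) (h : l + 1 < ν.degree)

open Classical in
/-- The defining relations of the KLR algebra, for elements `e w`, `y l`, `τ l` of any algebra. -/
inductive Rel {I : Type v} (D : FoldedDatum I k) {ν : I →₀ ℕ} {S : Type w} [Ring S] [Algebra k S]
    (e : Word ν → S) (y : Fin ν.degree → S) (τ : ∀ l : ℕ, l + 1 < ν.degree → S) : S → S → Prop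
  | e_mul (w w') : Rel D e y τ (e w * e w') (if w = w' then e w else 0)
  | e_sum : Rel D e y τ (∑ w, e w) 1
  | y_comm (l m) : Rel D e y τ (y l * y m) (y m * y l)
  | y_e (l w) : Rel D e y τ (y l * e w) (e w * y l)
  | tau_e (l h w) : Rel D e y τ (τ l h * e w) (e (w.swap l h) * τ l h)
  | tau_comm (l m hl hm) (h : l + 1 < m) : Rel D e y τ (τ l hl * τ m hm) (τ m hm * τ l hl)
  | tau_sq (l h w) : Rel D e y τ (τ l h * τ l h * e w)
      (evalTwo (D.Q (w.1 ⟨l, by omega⟩) (w.1 ⟨l + 1, h⟩)) (y ⟨l, by omega⟩) (y ⟨l + 1, h⟩) * e w)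
  | tau_y (l h m w) : Rel D e y τ
      ((τ l h * y m - y (Equiv.swap ⟨l, by omega⟩ ⟨l + 1, h⟩ m) * τ l h) * e w)
      (if w.1 ⟨l, by omega⟩ = w.1 ⟨l + 1, h⟩ then
        if m = ⟨l, by omega⟩ then -e w else if m = ⟨l + 1, h⟩ then e w else 0
      else 0)
  | braid (l) (h : l + 2 < ν.degree) (w) : Rel D e y τ
      ((τ (l + 1) h * τ l (by omega) * τ (l + 1) h -
        τ l (by omega) * τ (l + 1) h * τ l (by omega)) * e w)
      (if w.1 ⟨l, by omega⟩ = w.1 ⟨l + 2, h⟩ then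
        dividedDiff (D.Q (w.1 ⟨l, by omega⟩) (w.1 ⟨l + 1, by omega⟩))
          (y ⟨l, by omega⟩) (y ⟨l + 1, by omega⟩) (y ⟨l + 2, h⟩) * e w
      else 0)

section KLR

variable {I : Type v} (D : FoldedDatum I k) (ν : I →₀ ℕ)

/-- The KLR algebra `R(ν)`. -/
def KLR : Type (max u v) :=
  RingQuot (Rel D (fun w => FreeAlgebra.ι k (Gen.e (ν := ν) w))
    (fun l => FreeAlgebra.ι k (Gen.y l)) (fun l h => FreeAlgebra.ι k (Gen.tau l h)))

instance : Ring (KLR D ν) := inferInstanceAs (Ring (RingQuot _))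

instance : Algebra k (KLR D ν) := inferInstanceAs (Algebra k (RingQuot _))

namespace KLR

variable {ν}

/-- The quotient map from the free algebra. -/
def mk : FreeAlgebra k (Gen ν) →ₐ[k] KLR D ν := RingQuot.mkAlgHom k _

/-- The generator of `R(ν)` with a given name. -/
def gen (g : Gen ν) : KLR D ν := mk D (FreeAlgebra.ι k g)

/-- The idempotent `e_w`. -/
def e (w : Word ν) : KLR D ν := gen D (Gen.e w)

/-- The generator `y_l`. -/
def y (l : Fin ν.degree) : KLR D ν := gen D (Gen.y l)

/-- The generator `τ_l`. -/
def tau (l : ℕ) (h : l + 1 < ν.degree) : KLR D ν := gen D (Gen.tau l h)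

end KLR

variable {D ν}

/-- An algebra homomorphism carries relations to relations. -/
theorem Rel.map {S S' : Type*} [Ring S] [Algebra k S] [Ring S'] [Algebra k S'] (f : S →ₐ[k] S')
    {e : Word ν → S} {y : Fin ν.degree → S} {τ : ∀ l : ℕ, l + 1 < ν.degree → S} {a b : S}
    (h : Rel D e y τ a b) :
    Rel D (fun w => f (e w)) (fun l => f (y l)) (fun l h => f (τ l h)) (f a) (f b) := by
  cases h with
  | e_mul w w' => simpa [apply_ite f] using Rel.e_mul (D := D) w w'
  | e_sum => simpa using Rel.e_sum (D := D)
  | y_comm l m => simpa using Rel.y_comm (D := D) l m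
  | y_e l w => simpa using Rel.y_e (D := D) l w
  | tau_e l h w => simpa using Rel.tau_e (D := D) l h w
  | tau_comm l m hl hm h => simpa using Rel.tau_comm (D := D) l m hl hm h
  | tau_sq l h w => simpa [map_evalTwo] using Rel.tau_sq (D := D) l h w
  | tau_y l h m w => simpa [apply_ite f] using Rel.tau_y (D := D) l h m w
  | braid l h w => simpa [apply_ite f, map_dividedDiff] using Rel.braid (D := D) l h w

namespace KLR

/-- The relations hold in `R(ν)`. -/
theorem rel {a b : KLR D ν} (h : Rel D (e D (ν := ν)) (y D) (tau D) a b) : a = b := by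
  have key : ∀ {a b}, Rel D (fun w => FreeAlgebra.ι k (Gen.e (ν := ν) w))
      (fun l => FreeAlgebra.ι k (Gen.y l)) (fun l h => FreeAlgebra.ι k (Gen.tau l h)) a b →
      mk D a = mk D b := fun h => RingQuot.mkAlgHom_rel k h
  cases h with
  | e_mul w w' => simpa [e, y, tau, gen, apply_ite (mk D)] using key (Rel.e_mul w w')
  | e_sum => simpa [e, y, tau, gen] using key Rel.e_sum
  | y_comm l m => simpa [e, y, tau, gen] using key (Rel.y_comm l m)
  | y_e l w => simpa [e, y, tau, gen] using key (Rel.y_e l w)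
  | tau_e l h w => simpa [e, y, tau, gen] using key (Rel.tau_e l h w)
  | tau_comm l m hl hm h => simpa [e, y, tau, gen] using key (Rel.tau_comm l m hl hm h)
  | tau_sq l h w => simpa [e, y, tau, gen, map_evalTwo] using key (Rel.tau_sq l h w)
  | tau_y l h m w => simpa [e, y, tau, gen, apply_ite (mk D)] using key (Rel.tau_y l h m w)
  | braid l h w => simpa [e, y, tau, gen, apply_ite (mk D), map_dividedDiff] using key (Rel.braid l h w)

/-- Elements of an algebra that satisfy the relations define a homomorphism from `R(ν)`. -/
def lift {S : Type*} [Ring S] [Algebra k S] (e : Word ν → S) (y : Fin ν.degree → S)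
    (τ : ∀ l : ℕ, l + 1 < ν.degree → S) (h : ∀ a b, Rel D e y τ a b → a = b) : KLR D ν →ₐ[k] S :=
  RingQuot.liftAlgHom k ⟨FreeAlgebra.lift k fun g => match g with
    | Gen.e w => e w
    | Gen.y l => y l
    | Gen.tau l h => τ l h, fun a b hab => by
      have := Rel.map (FreeAlgebra.lift k fun g => match g with
        | Gen.e w => e w
        | Gen.y l => y l
        | Gen.tau l h => τ l h) hab
      simp only [FreeAlgebra.lift_ι_apply] at this
      exact h _ _ this⟩

variable {S : Type*} [Ring S] [Algebra k S] (e' : Word ν → S) (y' : Fin ν.degree → S)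
    (τ' : ∀ l : ℕ, l + 1 < ν.degree → S) (h : ∀ a b, Rel D e' y' τ' a b → a = b)

theorem lift_e (w : Word ν) : lift e' y' τ' h (e D w) = e' w := by
  exact (RingQuot.liftAlgHom_mkAlgHom_apply k _ _ _).trans (FreeAlgebra.lift_ι_apply _ _)

theorem lift_y (l : Fin ν.degree) : lift e' y' τ' h (y D l) = y' l := by
  exact (RingQuot.liftAlgHom_mkAlgHom_apply k _ _ _).trans (FreeAlgebra.lift_ι_apply _ _)

theorem lift_tau (l : ℕ) (hl : l + 1 < ν.degree) : lift e' y' τ' h (tau D l hl) = τ' l hl := by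
  exact (RingQuot.liftAlgHom_mkAlgHom_apply k _ _ _).trans (FreeAlgebra.lift_ι_apply _ _)

/-- A property of elements which holds for scalars and generators and is closed under sums and
products holds everywhere. -/
theorem induction {p : KLR D ν → Prop} (hc : ∀ c : k, p (algebraMap k _ c))
    (he : ∀ w, p (e D w)) (hy : ∀ l, p (y D l)) (ht : ∀ l h, p (tau D l h))
    (hadd : ∀ a b, p a → p b → p (a + b)) (hmul : ∀ a b, p a → p b → p (a * b))
    (x : KLR D ν) : p x := by
  obtain ⟨z, rfl⟩ := RingQuot.mkAlgHom_surjective k _ x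
  induction z using FreeAlgebra.induction with
  | grade0 c => rw [AlgHom.commutes]; exact hc c
  | grade1 g =>
    cases g with
    | e w => exact he w
    | y l => exact hy l
    | tau l h => exact ht l h
  | mul a b ha hb => rw [map_mul]; exact hmul _ _ ha hb
  | add a b ha hb => rw [map_add]; exact hadd _ _ ha hb

end KLR

end KLR

section Grading

variable {I : Type v} (D : FoldedDatum I k) {ν : I →₀ ℕ}

namespace KLR

/-- The monomials in the `e_w` (of degree `0`), `y_l e_w` (of degree `w_l · w_l`) and `τ_l e_w`
(of degree `- w_l · w_(l+1)`). -/
inductive Mono : ℤ → KLR D ν → Prop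
  | idem (w : Word ν) : Mono 0 (e D w)
  | dot (l : Fin ν.degree) (w : Word ν) {d : ℤ} {x : KLR D ν} (hx : Mono d x) :
      Mono (D.form (w.1 l) (w.1 l) + d) (y D l * e D w * x)
  | cross (l : ℕ) (h : l + 1 < ν.degree) (w : Word ν) {d : ℤ} {x : KLR D ν} (hx : Mono d x) :
      Mono (-D.form (w.1 ⟨l, by omega⟩) (w.1 ⟨l + 1, h⟩) + d) (tau D l h * e D w * x)

/-- The degree `d` piece of `R(ν)`. -/
def deg (d : ℤ) : Submodule k (KLR D ν) := Submodule.span k {x | Mono D d x}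

variable {D}

theorem e_self (w : Word ν) : e D w * e D w = e D w := by
  simpa using rel (Rel.e_mul (D := D) (e := e D) (y := y D) (τ := tau D) w w)

theorem e_ne {w w' : Word ν} (h : w ≠ w') : e D w * e D w' = 0 := by
  simpa [h] using rel (Rel.e_mul (D := D) (e := e D) (y := y D) (τ := tau D) w w')

theorem e_sum : ∑ w : Word ν, e D w = 1 := rel (Rel.e_sum (D := D))

theorem y_e (l : Fin ν.degree) (w : Word ν) : y D l * e D w = e D w * y D l :=
  rel (Rel.y_e (D := D) l w)

theorem tau_e (l : ℕ) (h : l + 1 < ν.degree) (w : Word ν) :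
    tau D l h * e D w = e D (w.swap l h) * tau D l h :=
  rel (Rel.tau_e (D := D) l h w)

theorem one_mem_deg : (1 : KLR D ν) ∈ deg D 0 := by
  rw [← e_sum]
  exact sum_mem fun w _ => Submodule.subset_span (Mono.idem w)

theorem mono_mul {i j : ℤ} {x x' : KLR D ν} (h : Mono D i x) (h' : Mono D j x') :
    x * x' ∈ deg D (i + j) := by
  induction h with
  | idem w =>
    rw [zero_add]
    cases h' with
    | idem w' =>
      by_cases hw : w = w'
      · subst hw; rw [e_self]; exact Submodule.subset_span (Mono.idem w)
      · rw [e_ne hw]; exact zero_mem _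
    | dot l w' hx =>
      rw [← mul_assoc, ← mul_assoc, ← y_e, mul_assoc (y D l)]
      by_cases hw : w = w'
      · subst hw; rw [e_self]; exact Submodule.subset_span (Mono.dot l w hx)
      · rw [e_ne hw]; simp
    | cross l hl w' hx =>
      by_cases hw : w = w'.swap l hl
      · subst hw
        rw [← mul_assoc, ← mul_assoc, ← tau_e, mul_assoc (tau D l hl), e_self]
        exact Submodule.subset_span (Mono.cross l hl w' hx)
      · rw [tau_e, ← mul_assoc, ← mul_assoc, e_ne hw]; simp
  | @dot l w d x hx ih =>
    have key : deg D (d + j) ≤ (deg D (D.form (w.1 l) (w.1 l) + d + j)).comap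
        (LinearMap.mulLeft k (y D l * e D w)) := by
      refine Submodule.span_le.2 fun z hz => ?_
      rw [add_assoc]
      exact Submodule.subset_span (Mono.dot l w hz)
    have := key ih
    rw [mul_assoc]
    exact this
  | @cross l hl w d x hx ih =>
    have key : deg D (d + j) ≤
        (deg D (-D.form (w.1 ⟨l, by omega⟩) (w.1 ⟨l + 1, hl⟩) + d + j)).comap
        (LinearMap.mulLeft k (tau D l hl * e D w)) := by
      refine Submodule.span_le.2 fun z hz => ?_
      rw [add_assoc]
      exact Submodule.subset_span (Mono.cross l hl w hz)
    have := key ih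
    rw [mul_assoc]
    exact this

theorem mul_mem_deg {i j : ℤ} {x x' : KLR D ν} (h : x ∈ deg D i) (h' : x' ∈ deg D j) :
    x * x' ∈ deg D (i + j) := by
  induction h using Submodule.span_induction with
  | zero => simp
  | add a b _ _ ha hb => rw [add_mul]; exact add_mem ha hb
  | smul c a _ ha => rw [smul_mul_assoc]; exact Submodule.smul_mem _ c ha
  | mem x hx =>
    induction h' using Submodule.span_induction with
    | zero => simp
    | add a b _ _ ha hb => rw [mul_add]; exact add_mem ha hb
    | smul c a _ ha => rw [mul_smul_comm]; exact Submodule.smul_mem _ c ha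
    | mem x' hx' => exact mono_mul hx hx'

theorem y_mono (l : Fin ν.degree) (w : Word ν) :
    Mono D (D.form (w.1 l) (w.1 l)) (y D l * e D w) := by
  simpa [mul_assoc, e_self] using Mono.dot l w (Mono.idem w)

theorem tau_mono (l : ℕ) (h : l + 1 < ν.degree) (w : Word ν) :
    Mono D (-D.form (w.1 ⟨l, by omega⟩) (w.1 ⟨l + 1, h⟩)) (tau D l h * e D w) := by
  simpa [mul_assoc, e_self] using Mono.cross l h w (Mono.idem w)

theorem mul_sum_e (x : KLR D ν) : x = ∑ w, x * e D w := by
  rw [← Finset.mul_sum, e_sum, mul_one]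

theorem mem_iSup_deg (x : KLR D ν) : x ∈ ⨆ d, deg D d := by
  induction x using KLR.induction with
  | hc c =>
    rw [Algebra.algebraMap_eq_smul_one]
    exact Submodule.smul_mem _ c (Submodule.mem_iSup_of_mem 0 one_mem_deg)
  | he w => exact Submodule.mem_iSup_of_mem 0 (Submodule.subset_span (Mono.idem w))
  | hy l =>
    rw [mul_sum_e (y D l)]
    exact sum_mem fun w _ => Submodule.mem_iSup_of_mem _ (Submodule.subset_span (y_mono l w))
  | ht l h =>
    rw [mul_sum_e (tau D l h)]
    exact sum_mem fun w _ => Submodule.mem_iSup_of_mem _ (Submodule.subset_span (tau_mono l h w))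
  | hadd a b ha hb => exact add_mem ha hb
  | hmul a b ha hb =>
    refine Submodule.iSup_induction (deg D) (motive := fun a => a * b ∈ ⨆ d, deg D d) ha ?_
      (by simp) (fun a a' h h' => by rw [add_mul]; exact add_mem h h')
    intro i a ha
    refine Submodule.iSup_induction (deg D) (motive := fun b => a * b ∈ ⨆ d, deg D d) hb ?_
      (by simp) (fun a a' h h' => by rw [mul_add]; exact add_mem h h')
    intro j b hb
    exact Submodule.mem_iSup_of_mem _ (mul_mem_deg ha hb)

variable (D) in
/-- The image of `e_w` under the grading coaction `R(ν) → R(ν)[ℤ]`. -/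
def gradE (w : Word ν) : AddMonoidAlgebra (KLR D ν) ℤ := AddMonoidAlgebra.single 0 (e D w)

/-- `X` restricted to `e_w` is `x`, in degree `d`. -/
def Graded (d : ℤ) (w : Word ν) (X : AddMonoidAlgebra (KLR D ν) ℤ) (x : KLR D ν) : Prop :=
  X * gradE D w = AddMonoidAlgebra.single d (x * e D w)

theorem Graded.mul {d d' : ℤ} {w w' : Word ν} {X Y : AddMonoidAlgebra (KLR D ν) ℤ}
    {x y : KLR D ν} (hX : Graded d' w' X x) (hY : Graded d w Y y) (h : y * e D w = e D w' * y) :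
    Graded (d' + d) w (X * Y) (x * y) := by
  unfold Graded at *
  have h1 : AddMonoidAlgebra.single d (y * e D w) =
      gradE D w' * AddMonoidAlgebra.single d (y * e D w) := by
    rw [gradE, AddMonoidAlgebra.single_mul_single, zero_add, h, ← mul_assoc, e_self]
  rw [mul_assoc, hY, h1, ← mul_assoc, hX, AddMonoidAlgebra.single_mul_single, mul_assoc x, h,
    ← mul_assoc (e D w'), e_self, ← h, ← mul_assoc]

theorem Graded.one (w : Word ν) : Graded (D := D) 0 w 1 1 := by
  simp [Graded, gradE]

theorem Graded.sub {d : ℤ} {w : Word ν} {X Y : AddMonoidAlgebra (KLR D ν) ℤ}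
    {x y : KLR D ν} (hX : Graded d w X x) (hY : Graded d w Y y) : Graded d w (X - Y) (x - y) := by
  unfold Graded at *
  rw [sub_mul, hX, hY, sub_mul, AddMonoidAlgebra.single_sub]

theorem Graded.smul {d : ℤ} {w : Word ν} {X : AddMonoidAlgebra (KLR D ν) ℤ}
    {x : KLR D ν} (c : k) (hX : Graded d w X x) : Graded d w (c • X) (c • x) := by
  unfold Graded at *
  rw [smul_mul_assoc, hX, smul_mul_assoc, AddMonoidAlgebra.smul_single]

theorem Graded.sum {α : Type*} {s : Finset α} {d : ℤ} {w : Word ν}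
    {X : α → AddMonoidAlgebra (KLR D ν) ℤ} {x : α → KLR D ν}
    (hX : ∀ i ∈ s, Graded d w (X i) (x i)) : Graded d w (∑ i ∈ s, X i) (∑ i ∈ s, x i) := by
  unfold Graded at *
  rw [Finset.sum_mul, Finset.sum_congr rfl hX, Finset.sum_mul]
  exact (map_sum (AddMonoidAlgebra.singleAddHom d) _ _).symm

theorem Graded.congr {d : ℤ} {w : Word ν} {X Y : AddMonoidAlgebra (KLR D ν) ℤ} {x y : KLR D ν}
    (hX : Graded d w X x) (hY : Graded d w Y y) (h : x * e D w = y * e D w) :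
    X * gradE D w = Y * gradE D w := by
  unfold Graded at *
  rw [hX, hY, h]

theorem gradE_mul (w w' : Word ν) : gradE D w * gradE D w' = if w = w' then gradE D w else 0 := by
  rw [gradE, gradE, AddMonoidAlgebra.single_mul_single]
  split_ifs with h
  · subst h; rw [e_self, add_zero]
  · rw [e_ne h, AddMonoidAlgebra.single_zero]

theorem gradE_sum : ∑ w : Word ν, gradE D w = 1 := by
  unfold gradE
  refine (map_sum (AddMonoidAlgebra.singleAddHom 0) (fun w => e D w) _).symm.trans ?_
  rw [e_sum]; rfl

theorem grad_ext {X Y : AddMonoidAlgebra (KLR D ν) ℤ}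
    (h : ∀ w, X * gradE D w = Y * gradE D w) : X = Y := by
  rw [← mul_one X, ← mul_one Y, ← gradE_sum, Finset.mul_sum, Finset.mul_sum]
  exact Finset.sum_congr rfl fun w _ => h w

variable (D) in
/-- The image of `y_l` under the grading coaction. -/
def gradY (l : Fin ν.degree) : AddMonoidAlgebra (KLR D ν) ℤ :=
  ∑ w, AddMonoidAlgebra.single (D.form (w.1 l) (w.1 l)) (y D l * e D w)

variable (D) in
/-- The image of `τ_l` under the grading coaction. -/
def gradT (l : ℕ) (h : l + 1 < ν.degree) : AddMonoidAlgebra (KLR D ν) ℤ :=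
  ∑ w, AddMonoidAlgebra.single (-D.form (w.1 ⟨l, by omega⟩) (w.1 ⟨l + 1, h⟩)) (tau D l h * e D w)

theorem graded_y (l : Fin ν.degree) (w : Word ν) :
    Graded (D.form (w.1 l) (w.1 l)) w (gradY D l) (y D l) := by
  unfold Graded gradY gradE
  rw [Finset.sum_mul, Finset.sum_eq_single w]
  · rw [AddMonoidAlgebra.single_mul_single, add_zero, mul_assoc, e_self]
  · intro w' _ hw
    rw [AddMonoidAlgebra.single_mul_single, mul_assoc, e_ne hw, mul_zero,
      AddMonoidAlgebra.single_zero]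
  · simp

theorem graded_t (l : ℕ) (h : l + 1 < ν.degree) (w : Word ν) :
    Graded (-D.form (w.1 ⟨l, by omega⟩) (w.1 ⟨l + 1, h⟩)) w (gradT D l h) (tau D l h) := by
  unfold Graded gradT gradE
  rw [Finset.sum_mul, Finset.sum_eq_single w]
  · rw [AddMonoidAlgebra.single_mul_single, add_zero, mul_assoc, e_self]
  · intro w' _ hw
    rw [AddMonoidAlgebra.single_mul_single, mul_assoc, e_ne hw, mul_zero,
      AddMonoidAlgebra.single_zero]
  · simp

theorem graded_e (w w' : Word ν) : Graded 0 w (gradE D w') (e D w') := by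
  simp [Graded, gradE]

theorem y_pow_e (l : Fin ν.degree) (w : Word ν) (s : ℕ) :
    y D l ^ s * e D w = e D w * y D l ^ s :=
  Commute.pow_left (show Commute (y D l) (e D w) from y_e l w) s

theorem graded_y_pow (l : Fin ν.degree) (w : Word ν) (s : ℕ) :
    Graded (s * D.form (w.1 l) (w.1 l)) w (gradY D l ^ s) (y D l ^ s) := by
  induction s with
  | zero => simpa using Graded.one w
  | succ s ih =>
    rw [pow_succ, pow_succ]
    have := ih.mul (graded_y l w) (y_e l w)
    convert this using 1
    push_cast; ring

theorem e_evalTwo (p : MvPolynomial (Fin 2) k) (l m : Fin ν.degree) (w : Word ν) :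
    evalTwo p (y D l) (y D m) * e D w = e D w * evalTwo p (y D l) (y D m) := by
  refine Commute.sum_left _ _ _ fun s _ => Commute.smul_left ?_ _
  exact Commute.mul_left (y_pow_e l w _) (y_pow_e m w _)

theorem weight_eq {i j : I} (m : Fin 2 →₀ ℕ) (hm : m ∈ (D.Q i j).support) :
    (m 0 : ℤ) * D.form i i + m 1 * D.form j j = -(2 * D.form i j) := by
  by_cases h : i = j
  · subst h; simp [D.Q_self] at hm
  · have := D.Q_homog i j h (MvPolynomial.mem_support_iff.1 hm)
    rw [← this, Finsupp.weight_apply, Finsupp.sum_fintype _ _ (by simp)]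
    simp

theorem graded_evalTwo (l m : Fin ν.degree) (w : Word ν) :
    Graded (-(2 * D.form (w.1 l) (w.1 m))) w (evalTwo (D.Q (w.1 l) (w.1 m)) (gradY D l) (gradY D m))
      (evalTwo (D.Q (w.1 l) (w.1 m)) (y D l) (y D m)) := by
  refine Graded.sum fun s hs => Graded.smul _ ?_
  rw [← weight_eq s hs]
  exact (graded_y_pow l w _).mul (graded_y_pow m w _) (y_pow_e m w _)

theorem graded_dividedDiff (l m p : Fin ν.degree) (w : Word ν) (h : w.1 l = w.1 p) :
    Graded (-(2 * D.form (w.1 l) (w.1 m)) - D.form (w.1 l) (w.1 l)) w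
      (dividedDiff (D.Q (w.1 l) (w.1 m)) (gradY D l) (gradY D m) (gradY D p))
      (dividedDiff (D.Q (w.1 l) (w.1 m)) (y D l) (y D m) (y D p)) := by
  refine Graded.sum fun s hs => Graded.smul _ ?_
  rw [← weight_eq s hs]
  have h1 : Graded ((s 0 - 1) * D.form (w.1 l) (w.1 l)) w
      (∑ i ∈ Finset.range (s 0), gradY D l ^ i * gradY D p ^ (s 0 - 1 - i))
      (∑ i ∈ Finset.range (s 0), y D l ^ i * y D p ^ (s 0 - 1 - i)) := by
    refine Graded.sum fun i hi => ?_
    rw [Finset.mem_range] at hi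
    have := (graded_y_pow (D := D) l w i).mul (graded_y_pow p w (s 0 - 1 - i)) (y_pow_e p w _)
    rw [← h] at this
    convert this using 1
    have : ((s 0 - 1 - i : ℕ) : ℤ) = s 0 - 1 - i := by omega
    rw [this]; ring
  have := h1.mul (graded_y_pow m w (s 1)) (y_pow_e m w _)
  convert this using 1
  ring

theorem graded_tt (l m : ℕ) (h : l + 1 < ν.degree) (h' : m + 1 < ν.degree) (w : Word ν) :
    Graded (-D.form ((w.swap m h').1 ⟨l, by omega⟩) ((w.swap m h').1 ⟨l + 1, h⟩) +
      -D.form (w.1 ⟨m, by omega⟩) (w.1 ⟨m + 1, h'⟩)) w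
      (gradT D l h * gradT D m h') (tau D l h * tau D m h') :=
  (graded_t l h _).mul (graded_t m h' w) (tau_e m h' w)

theorem graded_ttt (l m p : ℕ) (h : l + 1 < ν.degree) (h' : m + 1 < ν.degree)
    (h'' : p + 1 < ν.degree) (w : Word ν) :
    Graded (-D.form (((w.swap p h'').swap m h').1 ⟨l, by omega⟩)
        (((w.swap p h'').swap m h').1 ⟨l + 1, h⟩) +
      -D.form ((w.swap p h'').1 ⟨m, by omega⟩) ((w.swap p h'').1 ⟨m + 1, h'⟩) +
      -D.form (w.1 ⟨p, by omega⟩) (w.1 ⟨p + 1, h''⟩)) w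
      (gradT D l h * gradT D m h' * gradT D p h'') (tau D l h * tau D m h' * tau D p h'') :=
  (graded_tt l m h h' _).mul (graded_t p h'' w) (tau_e p h'' w)

theorem zero_graded (d : ℤ) (w : Word ν) : Graded (D := D) d w 0 0 := by
  simp [Graded]

theorem grad_rel (a b : AddMonoidAlgebra (KLR D ν) ℤ)
    (h : Rel D (gradE D) (gradY D) (gradT D) a b) : a = b := by
  cases h with
  | e_mul w w' => simpa using gradE_mul w w'
  | e_sum => exact gradE_sum
  | y_comm l m =>
    refine grad_ext fun w => ?_
    have h1 := (graded_y (D := D) l w).mul (graded_y m w) (y_e m w)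
    have h2 := (graded_y (D := D) m w).mul (graded_y l w) (y_e l w)
    rw [add_comm] at h2
    exact h1.congr h2 (by rw [rel (Rel.y_comm (D := D) l m)])
  | y_e l w =>
    refine grad_ext fun w' => ?_
    by_cases hw : w = w'
    · subst hw
      have h1 := (graded_y (D := D) l w).mul (graded_e w w) rfl
      have h2 := (graded_e (D := D) w w).mul (graded_y l w) (y_e l w)
      rw [add_comm] at h2
      exact h1.congr h2 (by rw [y_e])
    · rw [mul_assoc, gradE_mul, if_neg hw, mul_zero, mul_assoc, graded_y l w', y_e, gradE,
        AddMonoidAlgebra.single_mul_single, ← mul_assoc, e_ne hw]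
      simp
  | tau_e l h w =>
    refine grad_ext fun w' => ?_
    by_cases hw : w = w'
    · subst hw
      have h1 := (graded_t (D := D) l h w).mul (graded_e w w) rfl
      have h2 := (graded_e (D := D) (w.swap l h) (w.swap l h)).mul (graded_t l h w) (tau_e l h w)
      rw [add_comm] at h2
      exact h1.congr h2 (by rw [tau_e])
    · have hw' : w.swap l h ≠ w'.swap l h := fun h' => hw (by
        rw [← w.swap_swap l h, h', w'.swap_swap])
      rw [mul_assoc, gradE_mul, if_neg hw, mul_zero, mul_assoc, graded_t l h w', tau_e, gradE,
        AddMonoidAlgebra.single_mul_single, ← mul_assoc, e_ne hw']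
      simp
  | tau_comm l m hl hm hlm =>
    refine grad_ext fun w => ?_
    have h1 := graded_tt (D := D) l m hl hm w
    have h2 := graded_tt (D := D) m l hm hl w
    rw [Word.swap_ne, Word.swap_ne, add_comm] at h1 h2
    · rw [add_comm] at h2
      exact h1.congr h2 (by rw [rel (Rel.tau_comm (D := D) l m hl hm hlm)])
    all_goals (simp; try omega)
  | tau_sq l h w =>
    have h1 := graded_tt (D := D) l l h h w
    rw [Word.swap_left, Word.swap_right, D.symm (w.1 ⟨l + 1, h⟩), ← neg_add, ← two_mul] at h1
    exact h1.congr (graded_evalTwo _ _ w) (rel (Rel.tau_sq (D := D) l h w))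
  | tau_y l h m w =>
    have h1 := (graded_t (D := D) l h w).mul (graded_y m w) (y_e m w)
    have h2 := (graded_y (D := D) (Equiv.swap ⟨l, by omega⟩ ⟨l + 1, h⟩ m) (w.swap l h)).mul
      (graded_t l h w) (tau_e l h w)
    have hm : (w.swap l h).1 (Equiv.swap ⟨l, by omega⟩ ⟨l + 1, h⟩ m) = w.1 m := by
      simp [Word.swap]
    rw [hm, add_comm] at h2
    have h3 := h1.sub h2
    have hr := rel (Rel.tau_y (D := D) (e := e D) (y := y D) (τ := tau D) l h m w)
    unfold Graded at h3
    rw [hr] at h3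
    rw [h3]
    split_ifs with c1 c2 c3
    · subst c2
      rw [← c1, neg_add_cancel, AddMonoidAlgebra.single_neg]; rfl
    · subst c3
      rw [← c1, neg_add_cancel]; rfl
    · simp
    · simp
  | braid l h w =>
    have h1 := graded_ttt (D := D) (l + 1) l (l + 1) h (by omega) h w
    have h2 := graded_ttt (D := D) l (l + 1) l (by omega) h (by omega) w
    have a1 : ((w.swap (l + 1) h).swap l (by omega)).1 ⟨l + 1, by omega⟩ = w.1 ⟨l, by omega⟩ :=
      (Word.swap_right _ _ _ _).trans (Word.swap_ne _ _ _ _ (by dsimp; omega) (by dsimp; omega))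
    have a2 : ((w.swap (l + 1) h).swap l (by omega)).1 ⟨l + 1 + 1, h⟩ = w.1 ⟨l + 1, by omega⟩ :=
      (Word.swap_ne _ _ _ _ (by dsimp; omega) (by dsimp; omega)).trans (Word.swap_right _ _ _ _)
    have a3 : (w.swap (l + 1) h).1 ⟨l, by omega⟩ = w.1 ⟨l, by omega⟩ :=
      Word.swap_ne _ _ _ _ (by dsimp; omega) (by dsimp; omega)
    have a4 : (w.swap (l + 1) h).1 ⟨l + 1, by omega⟩ = w.1 ⟨l + 1 + 1, h⟩ :=
      Word.swap_left _ _ _ _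
    have b1 : ((w.swap l (by omega)).swap (l + 1) h).1 ⟨l, by omega⟩ = w.1 ⟨l + 1, by omega⟩ :=
      (Word.swap_ne _ _ _ _ (by dsimp; omega) (by dsimp; omega)).trans (Word.swap_left _ _ _ _)
    have b2 : ((w.swap l (by omega)).swap (l + 1) h).1 ⟨l + 1, by omega⟩ = w.1 ⟨l + 1 + 1, h⟩ :=
      (Word.swap_left _ _ _ _).trans (Word.swap_ne _ _ _ _ (by dsimp; omega) (by dsimp; omega))
    have b3 : (w.swap l (by omega)).1 ⟨l + 1, by omega⟩ = w.1 ⟨l, by omega⟩ :=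
      Word.swap_right _ _ _ _
    have b4 : (w.swap l (by omega)).1 ⟨l + 1 + 1, h⟩ = w.1 ⟨l + 1 + 1, h⟩ :=
      Word.swap_ne _ _ _ _ (by dsimp; omega) (by dsimp; omega)
    rw [a1, a2, a3, a4] at h1
    rw [b1, b2, b3, b4] at h2
    have h3 := h1.sub (X := gradT D (l + 1) h * gradT D l (by omega) * gradT D (l + 1) h)
      (Y := gradT D l (by omega) * gradT D (l + 1) h * gradT D l (by omega))
      (by convert h2 using 1; ring)
    have hr := rel (Rel.braid (D := D) (e := e D) (y := y D) (τ := tau D) l h w)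
    unfold Graded at h3
    rw [hr] at h3
    rw [h3]
    split_ifs with c
    · have h4 := graded_dividedDiff (D := D) ⟨l, by omega⟩ ⟨l + 1, by omega⟩ ⟨l + 2, h⟩ w c
      unfold Graded at h4
      rw [h4]
      congr 1
      have c' : w.1 ⟨l + 1 + 1, h⟩ = w.1 ⟨l, by omega⟩ := c.symm
      rw [c', D.symm (w.1 ⟨l + 1, _⟩)]
      ring
    · simp

variable (D ν) in
/-- The grading coaction `R(ν) → R(ν)[ℤ]`. -/
def grad : KLR D ν →ₐ[k] AddMonoidAlgebra (KLR D ν) ℤ :=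
  lift (gradE D) (gradY D) (gradT D) grad_rel

theorem grad_mono {d : ℤ} {x : KLR D ν} (h : Mono D d x) :
    grad D ν x = AddMonoidAlgebra.single d x := by
  induction h with
  | idem w => exact lift_e _ _ _ _ w
  | dot l w hx ih =>
    rw [map_mul, map_mul, ih]
    unfold grad
    rw [lift_y, lift_e, graded_y, AddMonoidAlgebra.single_mul_single]
  | cross l h w hx ih =>
    rw [map_mul, map_mul, ih]
    unfold grad
    rw [lift_tau, lift_e, graded_t, AddMonoidAlgebra.single_mul_single]

theorem deg_internal : DirectSum.IsInternal (deg D (ν := ν)) := by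
  refine isInternal_of_coaction _
    ((AddMonoidAlgebra.coeffLinearEquiv k).toLinearMap ∘ₗ (grad D ν).toLinearMap) ?_ mem_iSup_deg
  intro d m hm
  have hle : deg D d ≤ LinearMap.eqLocus
      ((AddMonoidAlgebra.coeffLinearEquiv k).toLinearMap ∘ₗ (grad D ν).toLinearMap)
      (Finsupp.lsingle d) := by
    refine Submodule.span_le.2 fun x hx => ?_
    change (grad D ν x).coeff = Finsupp.single d x
    rw [grad_mono hx]
    rfl
  exact hle hm

end KLR

end Grading

section Folded

variable {I : Type v} (D : FoldedDatum I k)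

/-- The order of the diagram automorphism. -/
def FoldedDatum.order : ℕ := orderOf D.a

theorem Word.relabel_swap {ν : I →₀ ℕ} (h : Finsupp.mapDomain D.a ν = ν) (w : Word ν) (l : ℕ)
    (hl : l + 1 < ν.degree) : (w.relabel D.a h).swap l hl = (w.swap l hl).relabel D.a h := rfl

theorem Word.relabel_injective {ν : I →₀ ℕ} (h : Finsupp.mapDomain D.a ν = ν) :
    Function.Injective (Word.relabel (ν := ν) D.a h) := by
  intro w w' hw
  apply Word.ext
  funext l
  exact D.a.injective (congrFun (congrArg Word.letter hw) l)

theorem Word.relabel_bijective {ν : I →₀ ℕ} (h : Finsupp.mapDomain D.a ν = ν) :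
    Function.Bijective (Word.relabel (ν := ν) D.a h) :=
  Finite.injective_iff_bijective.1 (Word.relabel_injective D h)

theorem Word.relabel_iterate {ν : I →₀ ℕ} (h : Finsupp.mapDomain D.a ν = ν) (w : Word ν) :
    (Word.relabel D.a h)^[D.order] w = w := by
  have : ∀ t : ℕ, ((Word.relabel D.a h)^[t] w).1 = fun l => (D.a ^ t) (w.1 l) := by
    intro t
    induction t with
    | zero => rfl
    | succ t ih =>
      rw [Function.iterate_succ_apply', pow_succ']
      funext l
      exact congrArg D.a (congrFun ih l)
  apply Word.ext
  rw [this, FoldedDatum.order, pow_orderOf_eq_one]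
  rfl

namespace KLR

variable {D} {ν : I →₀ ℕ}

theorem aut_rel (h : Finsupp.mapDomain D.a ν = ν) (x x' : KLR D ν)
    (hr : Rel D (fun w => e D (w.relabel D.a h)) (y D) (tau D) x x') : x = x' := by
  cases hr with
  | e_mul w w' =>
    have := rel (Rel.e_mul (D := D) (e := e D) (y := y D) (τ := tau D)
      (w.relabel D.a h) (w'.relabel D.a h))
    simpa [(Word.relabel_injective D h).eq_iff] using this
  | e_sum =>
    rw [← e_sum]
    exact (Word.relabel_bijective D h).sum_comp (fun w => e D w)
  | y_comm l m => exact rel (Rel.y_comm l m)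
  | y_e l w => exact rel (Rel.y_e l _)
  | tau_e l hl w => exact rel (Rel.tau_e l hl _)
  | tau_comm l m hl hm hlm => exact rel (Rel.tau_comm l m hl hm hlm)
  | tau_sq l hl w =>
    have := rel (Rel.tau_sq (D := D) l hl (w.relabel D.a h))
    simpa [Word.relabel, D.Q_a] using this
  | tau_y l hl m w =>
    have := rel (Rel.tau_y (D := D) (e := e D) (y := y D) (τ := tau D) l hl m (w.relabel D.a h))
    by_cases c : w.1 ⟨l, by omega⟩ = w.1 ⟨l + 1, hl⟩
    · have c1 : (w.relabel D.a h).1 ⟨l, by omega⟩ = (w.relabel D.a h).1 ⟨l + 1, hl⟩ :=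
        congrArg D.a c
      rw [if_pos c1] at this
      rw [if_pos c]
      exact this
    · have c1 : ¬ (w.relabel D.a h).1 ⟨l, by omega⟩ = (w.relabel D.a h).1 ⟨l + 1, hl⟩ :=
        fun c2 => c (D.a.injective c2)
      rw [if_neg c1] at this
      rw [if_neg c]
      exact this
  | braid l hl w =>
    have := rel (Rel.braid (D := D) (e := e D) (y := y D) (τ := tau D) l hl (w.relabel D.a h))
    by_cases c : w.1 ⟨l, by omega⟩ = w.1 ⟨l + 2, hl⟩
    · have c1 : (w.relabel D.a h).1 ⟨l, by omega⟩ = (w.relabel D.a h).1 ⟨l + 2, hl⟩ :=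
        congrArg D.a c
      rw [if_pos c1] at this
      rw [if_pos c]
      simpa [Word.relabel, D.Q_a] using this
    · have c1 : ¬ (w.relabel D.a h).1 ⟨l, by omega⟩ = (w.relabel D.a h).1 ⟨l + 2, hl⟩ :=
        fun c2 => c (D.a.injective c2)
      rw [if_neg c1] at this
      rw [if_neg c]
      exact this

/-- The automorphism of `R(ν)` induced by the diagram automorphism `a` when `a ν = ν`:
`e_w ↦ e_(a w)`, `y_l ↦ y_l`, `τ_l ↦ τ_l`. -/
def aut (h : Finsupp.mapDomain D.a ν = ν) : KLR D ν →ₐ[k] KLR D ν :=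
  lift (fun w => e D (w.relabel D.a h)) (y D) (tau D) (aut_rel h)

theorem aut_e (h : Finsupp.mapDomain D.a ν = ν) (w : Word ν) :
    aut h (e D w) = e D (w.relabel D.a h) := lift_e _ _ _ _ w

theorem aut_y (h : Finsupp.mapDomain D.a ν = ν) (l : Fin ν.degree) :
    aut h (y D l) = y D l := lift_y _ _ _ _ l

theorem aut_tau (h : Finsupp.mapDomain D.a ν = ν) (l : ℕ) (hl : l + 1 < ν.degree) :
    aut h (tau D l hl) = tau D l hl := lift_tau _ _ _ _ l hl

theorem aut_mono (h : Finsupp.mapDomain D.a ν = ν) {d : ℤ} {x : KLR D ν} (hx : Mono D d x) :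
    Mono D d (aut h x) := by
  induction hx with
  | idem w => rw [aut_e]; exact Mono.idem _
  | dot l w hx ih =>
    rw [map_mul, map_mul, aut_e, aut_y]
    have := Mono.dot l (w.relabel D.a h) ih
    simpa [Word.relabel, D.form_a] using this
  | cross l hl w hx ih =>
    rw [map_mul, map_mul, aut_e, aut_tau]
    have := Mono.cross l hl (w.relabel D.a h) ih
    simpa [Word.relabel, D.form_a] using this

theorem aut_deg (h : Finsupp.mapDomain D.a ν = ν) {d : ℤ} {x : KLR D ν} (hx : x ∈ deg D d) :
    aut h x ∈ deg D d := by
  have : deg D d ≤ (deg D d).comap (aut h).toLinearMap :=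
    Submodule.span_le.2 fun x hx => Submodule.subset_span (aut_mono h hx)
  exact this hx

theorem aut_iterate (h : Finsupp.mapDomain D.a ν = ν) (x : KLR D ν) :
    (⇑(aut h))^[D.order] x = x := by
  induction x using KLR.induction with
  | hc c => exact Function.iterate_fixed (AlgHom.commutes _ c) _
  | he w =>
    have semi : Function.Semiconj (e D) (Word.relabel D.a h) (aut h) := fun w => (aut_e h w).symm
    rw [← semi.iterate_right D.order w, Word.relabel_iterate]
  | hy l => exact Function.iterate_fixed (aut_y h l) _
  | ht l hl => exact Function.iterate_fixed (aut_tau h l hl) _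
  | hadd a b ha hb => rw [iterate_map_add, ha, hb]
  | hmul a b ha hb => rw [iterate_map_mul, ha, hb]

variable (D) in
/-- The graded algebra `R(ν)` with the automorphism induced by `a`, for `a ν = ν`. -/
def folded (ν : I →₀ ℕ) (h : Finsupp.mapDomain D.a ν = ν) : FoldedAlg.{u, max u v} k D.order where
  carrier := KLR D ν
  deg := deg D
  internal := deg_internal
  one_mem := one_mem_deg
  mul_mem := mul_mem_deg
  aut := aut h
  aut_mem := aut_deg h
  aut_pow := aut_iterate h

/-! ### The inclusion of `R(λ) ⊗ R(μ)` in `R(λ + μ)` -/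

instance {A : Type*} [Ring A] [Algebra k A] {ε : A} (hε : IsIdempotentElem ε) :
    Algebra k hε.Corner :=
  RingHom.toAlgebra'
    { toFun := fun c => ⟨c • ε, c • 1, by simp [hε.eq]⟩
      map_one' := Subtype.ext (one_smul k ε)
      map_mul' := fun c d => Subtype.ext (by
        change (c * d) • ε = (c • ε) * (d • ε)
        rw [smul_mul_smul_comm, hε.eq])
      map_zero' := Subtype.ext (zero_smul k ε)
      map_add' := fun c d => Subtype.ext (add_smul c d ε) }
    fun c x => Subtype.ext (by
      have h := (Subsemigroup.mem_corner_iff hε).1 x.2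
      change (c • ε) * x.1 = x.1 * (c • ε)
      rw [smul_mul_assoc, mul_smul_comm, h.1, h.2])

/-- The inclusion of a corner. -/
def cornerVal {A : Type*} [Ring A] [Algebra k A] {ε : A} (hε : IsIdempotentElem ε) :
    hε.Corner →ₗ[k] A where
  toFun x := x.1
  map_add' _ _ := rfl
  map_smul' c x := by
    have h := (Subsemigroup.mem_corner_iff hε).1 x.2
    change (c • ε) * x.1 = c • x.1
    rw [smul_mul_assoc, h.1]

theorem cornerVal_mul {A : Type*} [Ring A] [Algebra k A] {ε : A} (hε : IsIdempotentElem ε)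
    (x y : hε.Corner) : cornerVal (k := k) hε (x * y) = cornerVal (k := k) hε x * cornerVal (k := k) hε y :=
  rfl

theorem cornerVal_one {A : Type*} [Ring A] [Algebra k A] {ε : A} (hε : IsIdempotentElem ε) :
    cornerVal (k := k) hε 1 = ε := rfl

theorem cornerVal_injective {A : Type*} [Ring A] [Algebra k A] {ε : A}
    (hε : IsIdempotentElem ε) : Function.Injective (cornerVal (k := k) hε) :=
  Subtype.val_injective

/-- The element `x ε` of the corner, for `x` commuting with `ε`. -/
def toCorner {A : Type*} [Ring A] {ε : A} (hε : IsIdempotentElem ε) (x : A)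
    (hx : x * ε = ε * x) : hε.Corner :=
  ⟨x * ε, x, by change ε * x * ε = x * ε; rw [← hx, mul_assoc, hε.eq]⟩

theorem cornerVal_toCorner {A : Type*} [Ring A] [Algebra k A] {ε : A}
    (hε : IsIdempotentElem ε) (x : A) (hx : x * ε = ε * x) :
    cornerVal (k := k) hε (toCorner hε x hx) = x * ε := rfl

theorem corner_mul {A : Type*} [Ring A] {ε : A} (hε : IsIdempotentElem ε) {a b : A}
    (hb : b * ε = ε * b) : (a * ε) * (b * ε) = a * b * ε := by
  rw [mul_assoc, ← mul_assoc ε, ← hb, mul_assoc b, hε.eq, mul_assoc]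

theorem cornerVal_pow {A : Type*} [Ring A] [Algebra k A] {ε : A} (hε : IsIdempotentElem ε)
    (x : A) (hx : x * ε = ε * x) (s : ℕ) :
    cornerVal (k := k) hε (toCorner hε x hx ^ s) = x ^ s * ε := by
  induction s with
  | zero => rw [pow_zero, pow_zero, one_mul]; rfl
  | succ s ih => rw [pow_succ, cornerVal_mul, ih, cornerVal_toCorner, corner_mul hε hx, pow_succ]

theorem pow_comm_of {A : Type*} [Ring A] {ε x : A} (hx : x * ε = ε * x) (s : ℕ) :
    x ^ s * ε = ε * x ^ s := Commute.pow_left (show Commute x ε from hx) s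

theorem cornerVal_evalTwo {A : Type*} [Ring A] [Algebra k A] {ε : A} (hε : IsIdempotentElem ε)
    (p : MvPolynomial (Fin 2) k) (x y : A) (hx : x * ε = ε * x) (hy : y * ε = ε * y) :
    cornerVal (k := k) hε (evalTwo p (toCorner hε x hx) (toCorner hε y hy)) =
      evalTwo p x y * ε := by
  simp only [evalTwo, map_sum, map_smul, cornerVal_mul, cornerVal_pow, Finset.sum_mul,
    smul_mul_assoc, corner_mul hε (pow_comm_of hy _)]

theorem cornerVal_dividedDiff {A : Type*} [Ring A] [Algebra k A] {ε : A}
    (hε : IsIdempotentElem ε) (p : MvPolynomial (Fin 2) k) (x y z : A) (hx : x * ε = ε * x)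
    (hy : y * ε = ε * y) (hz : z * ε = ε * z) :
    cornerVal (k := k) hε (dividedDiff p (toCorner hε x hx) (toCorner hε y hy) (toCorner hε z hz)) =
      dividedDiff p x y z * ε := by
  simp only [dividedDiff, map_sum, map_smul, cornerVal_mul, cornerVal_pow, Finset.sum_mul,
    smul_mul_assoc, corner_mul hε (pow_comm_of hy _), corner_mul hε (pow_comm_of hz _)]

/-- A way of extending words of content `κ` to words of content `ν`, in which the place `l` of the
word becomes the place `o + l`. -/
structure Extension (κ ν : I →₀ ℕ) (W : Type v) where
  o : ℕ
  le : o + κ.degree ≤ ν.degree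
  app : Word κ → W → Word ν
  inj : ∀ v v' w w', app v w = app v' w' → v = v' ∧ w = w'
  letter : ∀ v w l (h : l < κ.degree), (app v w).1 ⟨o + l, by omega⟩ = v.1 ⟨l, h⟩
  swap : ∀ v w l (h : l + 1 < κ.degree), app (v.swap l h) w = (app v w).swap (o + l) (by omega)

namespace Extension

variable {κ : I →₀ ℕ} {W : Type v} [Fintype W] (X : Extension κ ν W)

variable (D) in
/-- The sum of the idempotents of all extensions of `v`. -/
def idem (v : Word κ) : KLR D ν := ∑ w, e D (X.app v w)

variable (D) in
/-- The sum of the idempotents of all extensions. -/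
def eps : KLR D ν := ∑ v, X.idem D v

theorem e_idem (v v' : Word κ) (w : W) :
    e D (X.app v w) * X.idem D v' = if v = v' then e D (X.app v w) else 0 := by
  unfold idem
  rw [Finset.mul_sum]
  split_ifs with h
  · subst h
    rw [Finset.sum_eq_single w]
    · exact e_self _
    · intro w' _ hw
      exact e_ne fun h' => hw (X.inj _ _ _ _ h').2.symm
    · simp
  · exact Finset.sum_eq_zero fun w' _ => e_ne fun h' => h (X.inj _ _ _ _ h').1

theorem idem_mul (v v' : Word κ) : X.idem D v * X.idem D v' = if v = v' then X.idem D v else 0 := by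
  conv_lhs => rw [idem, Finset.sum_mul]
  simp only [e_idem]
  split_ifs with h
  · rfl
  · simp

theorem idem_eps (v : Word κ) : X.idem D v * X.eps D = X.idem D v := by
  simp [eps, Finset.mul_sum, idem_mul]

theorem eps_idem (v : Word κ) : X.eps D * X.idem D v = X.idem D v := by
  simp [eps, Finset.sum_mul, idem_mul]

theorem eps_idempotent : IsIdempotentElem (X.eps D) := by
  change X.eps D * X.eps D = X.eps D
  change (∑ v, X.idem D v) * X.eps D = ∑ v, X.idem D v
  rw [Finset.sum_mul]
  exact Finset.sum_congr rfl fun v _ => X.idem_eps v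

theorem y_idem (l : Fin ν.degree) (v : Word κ) : y D l * X.idem D v = X.idem D v * y D l := by
  simp only [idem, Finset.mul_sum, Finset.sum_mul, y_e]

theorem y_eps (l : Fin ν.degree) : y D l * X.eps D = X.eps D * y D l := by
  simp only [eps, Finset.mul_sum, Finset.sum_mul, y_idem]

theorem tau_idem (l : ℕ) (h : l + 1 < κ.degree) (h' : X.o + l + 1 < ν.degree) (v : Word κ) :
    tau D (X.o + l) h' * X.idem D v = X.idem D (v.swap l h) * tau D (X.o + l) h' := by
  simp only [idem, Finset.mul_sum, Finset.sum_mul, tau_e, X.swap]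

theorem swap_bijective (l : ℕ) (h : l + 1 < κ.degree) :
    Function.Bijective fun v : Word κ => v.swap l h :=
  Function.Involutive.bijective fun v => v.swap_swap l h

theorem tau_eps (l : ℕ) (h : l + 1 < κ.degree) (h' : X.o + l + 1 < ν.degree) :
    tau D (X.o + l) h' * X.eps D = X.eps D * tau D (X.o + l) h' := by
  simp only [eps, Finset.mul_sum, Finset.sum_mul, X.tau_idem l h]
  exact (swap_bijective l h).sum_comp fun v => X.idem D v * tau D (X.o + l) h'

/-- Equations may be checked on the idempotents of extensions. -/
theorem mul_idem_congr {x x' : KLR D ν} {v : Word κ}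
    (h : ∀ w, x * e D (X.app v w) = x' * e D (X.app v w)) : x * X.idem D v = x' * X.idem D v := by
  simp only [idem, Finset.mul_sum, h]

theorem inc_rel {ε : KLR D ν} (hε : IsIdempotentElem ε) (hX : ε = X.eps D) (x x' : hε.Corner) (hr : Rel D
    (fun v => toCorner hε (X.idem D v) (by rw [hX, X.idem_eps, X.eps_idem]))
    (fun l => toCorner hε (y D ⟨X.o + l.1, by have := X.le; omega⟩) (by rw [hX, X.y_eps]))
    (fun l h => toCorner hε (tau D (X.o + l) (by have := X.le; omega))
      (by rw [hX, X.tau_eps l h])) x x') : x = x' := by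
  have hle := X.le
  have ce : ∀ v, X.idem D v * ε = X.idem D v := fun v => by rw [hX, X.idem_eps]
  have ce' : ∀ v, ε * X.idem D v = X.idem D v := fun v => by rw [hX, X.eps_idem]
  have cx : ∀ a v, a * ε * (X.idem D v * ε) = a * X.idem D v := fun a v => by
    conv_lhs => rw [ce v, mul_assoc, ce']
  apply cornerVal_injective (k := k) hε
  cases hr with
  | e_mul v v' =>
    have := X.idem_mul (D := D) v v'
    rw [cornerVal_mul]
    simp only [cornerVal_toCorner]
    have c2 : X.idem D v * ε * (X.idem D v' * ε) = X.idem D v * X.idem D v' := cx _ _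
    refine c2.trans (this.trans ?_)
    split_ifs
    · exact (ce v).symm
    · exact (map_zero _).symm
  | e_sum =>
    rw [map_sum, cornerVal_one]
    simp only [cornerVal_toCorner, ce]
    exact hX.symm
  | y_comm l m =>
    rw [cornerVal_mul, cornerVal_mul]
    simp only [cornerVal_toCorner]
    rw [corner_mul hε (by rw [hX, X.y_eps]), corner_mul hε (by rw [hX, X.y_eps]),
      rel (Rel.y_comm (D := D) _ _)]
  | y_e l v =>
    rw [cornerVal_mul, cornerVal_mul]
    simp only [cornerVal_toCorner]
    refine (cx _ v).trans ?_
    rw [X.y_idem]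
    refine Eq.trans ?_ (corner_mul hε (by rw [hX, X.y_eps])).symm
    rw [← X.y_idem, mul_assoc, ce]
  | tau_e l h v =>
    rw [cornerVal_mul, cornerVal_mul]
    simp only [cornerVal_toCorner]
    refine (cx _ v).trans ?_
    rw [X.tau_idem l h]
    refine Eq.trans ?_ (corner_mul hε (by rw [hX, X.tau_eps l h])).symm
    rw [← X.tau_idem l h, mul_assoc, ce]
  | tau_comm l m hl hm hlm =>
    rw [cornerVal_mul, cornerVal_mul]
    simp only [cornerVal_toCorner]
    rw [corner_mul hε (by rw [hX, X.tau_eps m hm]), corner_mul hε (by rw [hX, X.tau_eps l hl]),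
      rel (Rel.tau_comm (D := D) _ _ _ _ (by omega))]
  | tau_sq l h v =>
    rw [cornerVal_mul, cornerVal_mul, cornerVal_mul, cornerVal_evalTwo]
    simp only [cornerVal_toCorner]
    rw [corner_mul hε (by rw [hX, X.tau_eps l h])]
    refine (cx _ v).trans (Eq.trans ?_ (cx _ v).symm)
    refine X.mul_idem_congr fun w => ?_
    rw [← X.letter v w, ← X.letter v w]
    exact rel (Rel.tau_sq (D := D) (X.o + l) _ (X.app v w))
  | tau_y l h m v =>
    rw [cornerVal_mul, map_sub, cornerVal_mul, cornerVal_mul]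
    simp only [cornerVal_toCorner]
    rw [corner_mul hε (by rw [hX, X.y_eps]), corner_mul hε (by rw [hX, X.tau_eps l h]), ← sub_mul]
    refine (cx _ v).trans ?_
    have hs : (⟨X.o + (Equiv.swap (⟨l, by omega⟩ : Fin κ.degree) ⟨l + 1, h⟩ m).1, by omega⟩ :
        Fin ν.degree) = Equiv.swap ⟨X.o + l, by omega⟩ ⟨X.o + l + 1, by omega⟩
          ⟨X.o + m.1, by omega⟩ := by
      simp only [Equiv.swap_apply_def, Fin.ext_iff]
      split_ifs <;> simp_all <;> omega
    rw [hs]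
    have key := fun w => rel (Rel.tau_y (D := D) (e := e D) (y := y D) (τ := tau D) (X.o + l)
      (by omega) ⟨X.o + m.1, by omega⟩ (X.app v w))
    have e1 : ∀ w, (X.app v w).1 ⟨X.o + l, by omega⟩ = v.1 ⟨l, by omega⟩ :=
      fun w => X.letter v w l _
    have e2 : ∀ w, (X.app v w).1 ⟨X.o + l + 1, by omega⟩ = v.1 ⟨l + 1, h⟩ :=
      fun w => X.letter v w (l + 1) _
    by_cases c : v.1 ⟨l, by omega⟩ = v.1 ⟨l + 1, h⟩
    · rw [if_pos c]
      have c1 : ∀ w, (X.app v w).1 ⟨X.o + l, by omega⟩ = (X.app v w).1 ⟨X.o + l + 1, by omega⟩ :=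
        fun w => (e1 w).trans (c.trans (e2 w).symm)
      by_cases c2 : m = ⟨l, by omega⟩
      · have c3 : (⟨X.o + m.1, by omega⟩ : Fin ν.degree) = ⟨X.o + l, by omega⟩ :=
          Fin.ext (congrArg (X.o + ·) (Fin.ext_iff.1 c2))
        rw [if_pos c2, map_neg, cornerVal_toCorner, ce, ← neg_one_mul (X.idem D v)]
        refine X.mul_idem_congr fun w => (key w).trans ?_
        rw [if_pos (c1 w), if_pos c3, neg_one_mul]
      · have c3 : (⟨X.o + m.1, by omega⟩ : Fin ν.degree) ≠ ⟨X.o + l, by omega⟩ := fun c4 =>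
          c2 (Fin.ext (Nat.add_left_cancel (Fin.ext_iff.1 c4)))
        rw [if_neg c2]
        by_cases c5 : m = ⟨l + 1, h⟩
        · have c6 : (⟨X.o + m.1, by omega⟩ : Fin ν.degree) = ⟨X.o + l + 1, by omega⟩ :=
            Fin.ext (congrArg (X.o + ·) (Fin.ext_iff.1 c5))
          rw [if_pos c5, cornerVal_toCorner, ce]
          refine Eq.trans ?_ (one_mul (X.idem D v))
          refine X.mul_idem_congr fun w => (key w).trans ?_
          rw [if_pos (c1 w), if_neg c3, if_pos c6, one_mul]
        · have c6 : (⟨X.o + m.1, by omega⟩ : Fin ν.degree) ≠ ⟨X.o + l + 1, by omega⟩ := fun c4 =>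
            c5 (Fin.ext (Nat.add_left_cancel (Fin.ext_iff.1 c4)))
          rw [if_neg c5, map_zero, ← zero_mul (X.idem D v)]
          refine X.mul_idem_congr fun w => (key w).trans ?_
          rw [if_pos (c1 w), if_neg c3, if_neg c6, zero_mul]
    · rw [if_neg c, map_zero, ← zero_mul (X.idem D v)]
      refine X.mul_idem_congr fun w => (key w).trans ?_
      rw [if_neg fun c1 => c ((e1 w).symm.trans (c1.trans (e2 w))), zero_mul]
  | braid l h v =>
    rw [cornerVal_mul, map_sub, cornerVal_mul, cornerVal_mul, cornerVal_mul, cornerVal_mul]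
    simp only [cornerVal_toCorner]
    rw [corner_mul hε (by rw [hX, X.tau_eps l (by omega)]),
      corner_mul hε (by rw [hX]; exact X.tau_eps (l + 1) h (by omega)),
      corner_mul hε (by rw [hX]; exact X.tau_eps (l + 1) h (by omega)),
      corner_mul hε (by rw [hX, X.tau_eps l (by omega)]), ← sub_mul]
    refine (cx _ v).trans ?_
    have key := fun w => rel (Rel.braid (D := D) (e := e D) (y := y D) (τ := tau D) (X.o + l)
      (by omega) (X.app v w))
    have e1 : ∀ w, (X.app v w).1 ⟨X.o + l, by omega⟩ = v.1 ⟨l, by omega⟩ :=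
      fun w => X.letter v w l _
    have e2 : ∀ w, (X.app v w).1 ⟨X.o + l + 1, by omega⟩ = v.1 ⟨l + 1, by omega⟩ :=
      fun w => X.letter v w (l + 1) _
    have e3 : ∀ w, (X.app v w).1 ⟨X.o + l + 2, by omega⟩ = v.1 ⟨l + 2, h⟩ :=
      fun w => X.letter v w (l + 2) _
    by_cases c : v.1 ⟨l, by omega⟩ = v.1 ⟨l + 2, h⟩
    · rw [if_pos c, cornerVal_mul, cornerVal_dividedDiff]
      refine Eq.trans ?_ (cx _ v).symm
      refine X.mul_idem_congr fun w => (key w).trans ?_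
      rw [if_pos ((e1 w).trans (c.trans (e3 w).symm)), e1, e2]
      rfl
    · rw [if_neg c, map_zero, ← zero_mul (X.idem D v)]
      refine X.mul_idem_congr fun w => (key w).trans ?_
      rw [if_neg fun c1 => c ((e1 w).symm.trans (c1.trans (e3 w))), zero_mul]

/-- The homomorphism from `R(κ)` to the corner of `R(ν)`: `e_v` goes to the sum of the idempotents
of all extensions of `v`, and the places are shifted by `o`. -/
def inc {ε : KLR D ν} (hε : IsIdempotentElem ε) (hX : ε = X.eps D) : KLR D κ →ₐ[k] hε.Corner :=
  lift _ _ _ (X.inc_rel hε hX)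

section Inc

variable {ε : KLR D ν} (hε : IsIdempotentElem ε) (hX : ε = X.eps D)

theorem inc_e (v : Word κ) : cornerVal (k := k) hε (X.inc hε hX (e D v)) = X.idem D v := by
  rw [inc, lift_e, cornerVal_toCorner, hX, X.idem_eps]

theorem inc_y (l : Fin κ.degree) (h : X.o + l.1 < ν.degree) :
    cornerVal (k := k) hε (X.inc hε hX (y D l)) = y D ⟨X.o + l.1, h⟩ * ε := by
  rw [inc, lift_y, cornerVal_toCorner]

theorem inc_tau (l : ℕ) (h : l + 1 < κ.degree) (h' : X.o + l + 1 < ν.degree) :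
    cornerVal (k := k) hε (X.inc hε hX (tau D l h)) = tau D (X.o + l) h' * ε := by
  rw [inc, lift_tau, cornerVal_toCorner]

theorem inc_eps (x : KLR D κ) : ε * cornerVal (k := k) hε (X.inc hε hX x) =
    cornerVal (k := k) hε (X.inc hε hX x) :=
  ((Subsemigroup.mem_corner_iff hε).1 (X.inc hε hX x).2).1

theorem idem_mem_deg (v : Word κ) : X.idem D v ∈ deg D 0 :=
  sum_mem fun _ _ => Submodule.subset_span (Mono.idem _)

theorem inc_mono {d : ℤ} {x : KLR D κ} (hx : Mono D d x) :
    cornerVal (k := k) hε (X.inc hε hX x) ∈ deg D d := by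
  have hle := X.le
  have ce : ∀ v, ε * X.idem D v = X.idem D v := fun v => by rw [hX, X.eps_idem]
  induction hx with
  | idem v => rw [inc_e]; exact X.idem_mem_deg v
  | dot l v hx ih =>
    rw [map_mul, cornerVal_mul, map_mul, cornerVal_mul, inc_e, inc_y X hε hX l (by omega),
      mul_assoc _ ε, ce]
    refine mul_mem_deg ?_ ih
    rw [idem, Finset.mul_sum]
    refine sum_mem fun w _ => ?_
    have := Submodule.subset_span (R := k) (Mono.dot (D := D) (⟨X.o + l.1, by omega⟩ : Fin ν.degree)
      (X.app v w) (Mono.idem (X.app v w)))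
    rw [add_zero, mul_assoc, e_self, X.letter v w] at this
    exact this
  | cross l h v hx ih =>
    rw [map_mul, cornerVal_mul, map_mul, cornerVal_mul, inc_e, inc_tau X hε hX l h (by omega),
      mul_assoc _ ε, ce]
    refine mul_mem_deg ?_ ih
    rw [idem, Finset.mul_sum]
    refine sum_mem fun w _ => ?_
    have := Submodule.subset_span (R := k) (Mono.cross (D := D) (X.o + l) (by omega)
      (X.app v w) (Mono.idem (X.app v w)))
    have e2 : (X.app v w).1 ⟨X.o + l + 1, by omega⟩ = v.1 ⟨l + 1, h⟩ := X.letter v w (l + 1) h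
    rw [add_zero, mul_assoc, e_self, X.letter v w, e2] at this
    exact this

theorem inc_deg {d : ℤ} {x : KLR D κ} (hx : x ∈ deg D d) :
    cornerVal (k := k) hε (X.inc hε hX x) ∈ deg D d := by
  have : deg D d ≤ (deg D d).comap (cornerVal (k := k) hε ∘ₗ (X.inc hε hX).toLinearMap) :=
    Submodule.span_le.2 fun x hx => X.inc_mono hε hX hx
  exact this hx

theorem aut_idem (hκ : Finsupp.mapDomain D.a κ = κ) (hν : Finsupp.mapDomain D.a ν = ν)
    (r : W → W) (hr : Function.Bijective r)
    (happ : ∀ v w, (X.app v w).relabel D.a hν = X.app (v.relabel D.a hκ) (r w)) (v : Word κ) :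
    aut hν (X.idem D v) = X.idem D (v.relabel D.a hκ) := by
  simp only [idem, map_sum, aut_e, happ]
  exact hr.sum_comp fun w => e D (X.app (v.relabel D.a hκ) w)

theorem aut_eps (hκ : Finsupp.mapDomain D.a κ = κ) (hν : Finsupp.mapDomain D.a ν = ν)
    (r : W → W) (hr : Function.Bijective r)
    (happ : ∀ v w, (X.app v w).relabel D.a hν = X.app (v.relabel D.a hκ) (r w)) :
    aut hν (X.eps D) = X.eps D := by
  simp only [eps, map_sum, X.aut_idem hκ hν r hr happ]
  exact (Word.relabel_bijective D hκ).sum_comp fun v => X.idem D v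

theorem inc_aut (hκ : Finsupp.mapDomain D.a κ = κ) (hν : Finsupp.mapDomain D.a ν = ν)
    (r : W → W) (hr : Function.Bijective r)
    (happ : ∀ v w, (X.app v w).relabel D.a hν = X.app (v.relabel D.a hκ) (r w)) (x : KLR D κ) :
    cornerVal (k := k) hε (X.inc hε hX (aut hκ x)) =
      aut hν (cornerVal (k := k) hε (X.inc hε hX x)) := by
  have hle := X.le
  have hε' : aut hν ε = ε := by rw [hX]; exact X.aut_eps hκ hν r hr happ
  induction x using KLR.induction with
  | hc c =>
    rw [AlgHom.commutes, Algebra.algebraMap_eq_smul_one, map_smul, map_one, map_smul, map_smul,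
      cornerVal_one, hε']
  | he v => rw [aut_e, inc_e, inc_e, X.aut_idem hκ hν r hr happ]
  | hy l => rw [aut_y, inc_y X hε hX l (by omega), map_mul, aut_y, hε']
  | ht l h => rw [aut_tau, inc_tau X hε hX l h (by omega), map_mul, aut_tau, hε']
  | hadd a b ha hb => simp only [map_add, ha, hb]
  | hmul a b ha hb => simp only [map_mul, cornerVal_mul, ha, hb]

end Inc

end Extension

theorem _root_.FoldedKLR.Word.append_left {lam μ ν : I →₀ ℕ} (h : lam + μ = ν) (w : Word lam)
    (w' : Word μ) (l : ℕ) (hl : l < lam.degree) (hl' : l < ν.degree) :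
    (Word.append h w w').1 ⟨l, hl'⟩ = w.1 ⟨l, hl⟩ :=
  Fin.append_left w.1 w'.1 ⟨l, hl⟩

theorem _root_.FoldedKLR.Word.append_right {lam μ ν : I →₀ ℕ} (h : lam + μ = ν) (w : Word lam)
    (w' : Word μ) (l : ℕ) (hl : l < μ.degree) (hl' : lam.degree + l < ν.degree) :
    (Word.append h w w').1 ⟨lam.degree + l, hl'⟩ = w'.1 ⟨l, hl⟩ :=
  Fin.append_right w.1 w'.1 ⟨l, hl⟩

theorem _root_.FoldedKLR.Word.append_ext {lam μ ν : I →₀ ℕ} (h : lam + μ = ν) {w1 w2 : Word ν}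
    (h1 : ∀ l (_ : l < lam.degree) (hl' : l < ν.degree), w1.1 ⟨l, hl'⟩ = w2.1 ⟨l, hl'⟩)
    (h2 : ∀ l (_ : l < μ.degree) (hl' : lam.degree + l < ν.degree),
      w1.1 ⟨lam.degree + l, hl'⟩ = w2.1 ⟨lam.degree + l, hl'⟩) : w1 = w2 := by
  have hd : lam.degree + μ.degree = ν.degree := by rw [← h, map_add]
  apply Word.ext
  funext m
  obtain ⟨m, hm⟩ := m
  by_cases c : m < lam.degree
  · exact h1 m c hm
  · obtain ⟨t, rfl⟩ := Nat.exists_eq_add_of_le (not_lt.1 c)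
    exact h2 t (by omega) hm

theorem _root_.FoldedKLR.Word.append_inj {lam μ ν : I →₀ ℕ} (h : lam + μ = ν) {w v : Word lam}
    {w' v' : Word μ} (hw : Word.append h w w' = Word.append h v v') : w = v ∧ w' = v' := by
  have hd : lam.degree + μ.degree = ν.degree := by rw [← h, map_add]
  constructor
  · apply Word.ext
    funext m
    rw [← Word.append_left h w w' m.1 m.2 (by omega), hw, Word.append_left]
  · apply Word.ext
    funext m
    rw [← Word.append_right h w w' m.1 m.2 (by omega), hw, Word.append_right]

theorem _root_.FoldedKLR.Word.append_swap_left {lam μ ν : I →₀ ℕ} (h : lam + μ = ν) (w : Word lam)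
    (w' : Word μ) (l : ℕ) (hl : l + 1 < lam.degree) (hl' : l + 1 < ν.degree) :
    Word.append h (w.swap l hl) w' = (Word.append h w w').swap l hl' := by
  apply Word.append_ext h
  · intro m hm hm'
    rw [Word.append_left h _ _ m hm]
    by_cases c1 : m = l
    · subst c1
      rw [Word.swap_left, Word.swap_left, Word.append_left]
    · by_cases c2 : m = l + 1
      · subst c2
        rw [Word.swap_right, Word.swap_right, Word.append_left]
      · rw [Word.swap_ne _ _ _ _ c1 c2, Word.swap_ne _ _ _ _ c1 c2, Word.append_left]
  · intro m hm hm'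
    rw [Word.append_right h _ _ m hm, Word.swap_ne _ _ _ _ (by simp; omega) (by simp; omega),
      Word.append_right h]

theorem _root_.FoldedKLR.Word.append_swap_right {lam μ ν : I →₀ ℕ} (h : lam + μ = ν) (w : Word lam)
    (w' : Word μ) (l : ℕ) (hl : l + 1 < μ.degree) (hl' : lam.degree + l + 1 < ν.degree) :
    Word.append h w (w'.swap l hl) = (Word.append h w w').swap (lam.degree + l) hl' := by
  apply Word.append_ext h
  · intro m hm hm'
    rw [Word.append_left h _ _ m hm, Word.swap_ne _ _ _ _ (by simp; omega) (by simp; omega),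
      Word.append_left h]
  · intro m hm hm'
    rw [Word.append_right h _ _ m hm]
    by_cases c1 : m = l
    · subst c1
      rw [Word.swap_left, Word.swap_left]
      exact (Word.append_right h w w' (m + 1) hl _).symm
    · by_cases c2 : m = l + 1
      · subst c2
        rw [Word.swap_right]
        exact ((Word.swap_right _ (lam.degree + l) hl' hm').trans
          (Word.append_right h w w' l _ _)).symm
      · rw [Word.swap_ne _ _ _ _ c1 c2,
          Word.swap_ne _ _ _ _ (by simp; omega) (by simp; omega), Word.append_right h]

theorem _root_.FoldedKLR.Word.relabel_append (a : Equiv.Perm I) {lam μ ν : I →₀ ℕ}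
    (h : lam + μ = ν) (hl : Finsupp.mapDomain a lam = lam) (hm : Finsupp.mapDomain a μ = μ)
    (hn : Finsupp.mapDomain a ν = ν) (w : Word lam) (w' : Word μ) :
    (Word.append h w w').relabel a hn = Word.append h (w.relabel a hl) (w'.relabel a hm) := by
  apply Word.append_ext h
  · intro l hl1 hl'
    rw [Word.append_left h _ _ l hl1]
    exact congrArg a (Word.append_left h w w' l hl1 hl')
  · intro l hl1 hl'
    rw [Word.append_right h _ _ l hl1]
    exact congrArg a (Word.append_right h w w' l hl1 hl')

section Inclusion

variable {lam μ : I →₀ ℕ} (h : lam + μ = ν)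

/-- Words of content `λ` are extended by words of content `μ` on the right. -/
def leftExt : Extension lam ν (Word μ) where
  o := 0
  le := by rw [← h, map_add]; omega
  app := Word.append h
  inj _ _ _ _ hw := Word.append_inj h hw
  letter v w l hl := by simpa using Word.append_left h v w l hl _
  swap v w l hl := by simpa using Word.append_swap_left h v w l hl _

/-- Words of content `μ` are extended by words of content `λ` on the left. -/
def rightExt : Extension μ ν (Word lam) where
  o := lam.degree
  le := by rw [← h, map_add]
  app v w := Word.append h w v
  inj _ _ _ _ hw := (Word.append_inj h hw).symm
  letter v w l hl := Word.append_right h w v l hl _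
  swap v w l hl := Word.append_swap_right h w v l hl _

variable (D) in
/-- The idempotent `e_(λ,μ)`: the sum of the `e_w` for the concatenations `w` of a word of content
`λ` and a word of content `μ`. -/
def corner : KLR D ν := ∑ v : Word lam, ∑ w : Word μ, e D (Word.append h v w)

theorem corner_idempotent : IsIdempotentElem (corner D h) := (leftExt h).eps_idempotent

theorem corner_left : corner D h = (leftExt h).eps D := rfl

theorem corner_right : corner D h = (rightExt h).eps D := Finset.sum_comm

theorem e_comm (w w' : Word ν) : e D w * e D w' = e D w' * e D w := by
  by_cases c : w = w'
  · rw [c]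
  · rw [e_ne c, e_ne (Ne.symm c)]

theorem tau_y_comm (l : ℕ) (hl : l + 1 < ν.degree) (m : Fin ν.degree) (h1 : m.1 ≠ l)
    (h2 : m.1 ≠ l + 1) : tau D l hl * y D m = y D m * tau D l hl := by
  have key : ∀ w, (tau D l hl * y D m) * e D w = (y D m * tau D l hl) * e D w := fun w => by
    have := rel (Rel.tau_y (D := D) (e := e D) (y := y D) (τ := tau D) l hl m w)
    rw [Equiv.swap_apply_of_ne_of_ne (by simpa [Fin.ext_iff]) (by simpa [Fin.ext_iff]),
      if_neg (by simpa [Fin.ext_iff] : ¬ m = ⟨l, Nat.lt_of_succ_lt hl⟩),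
      if_neg (by simpa [Fin.ext_iff] : ¬ m = ⟨l + 1, hl⟩), ite_self, sub_mul, sub_eq_zero] at this
    exact this
  rw [mul_sum_e (tau D l hl * y D m), mul_sum_e (y D m * tau D l hl)]
  exact Finset.sum_congr rfl fun w _ => key w

theorem corner_commute {ε : KLR D ν} (hε : IsIdempotentElem ε) {a b : hε.Corner} {x z : KLR D ν}
    (ha : cornerVal (k := k) hε a = x * ε) (hb : cornerVal (k := k) hε b = z * ε)
    (hx : x * ε = ε * x) (hz : z * ε = ε * z) (hxz : x * z = z * x) : Commute a b := by
  apply cornerVal_injective (k := k) hε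
  rw [cornerVal_mul, cornerVal_mul, ha, hb, corner_mul hε hz, corner_mul hε hx, hxz]

theorem inc_commute (x : KLR D lam) (x' : KLR D μ) :
    Commute ((leftExt h).inc (corner_idempotent (D := D) h) (corner_left h) x)
      ((rightExt h).inc (corner_idempotent (D := D) h) (corner_right h) x') := by
  have hd : lam.degree + μ.degree = ν.degree := by rw [← h, map_add]
  have hL : ∀ v, (leftExt h).idem D v * corner D h = corner D h * (leftExt h).idem D v := fun v => by
    rw [corner_left, (leftExt h).idem_eps, (leftExt h).eps_idem]
  have hR : ∀ v, (rightExt h).idem D v * corner D h = corner D h * (rightExt h).idem D v :=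
    fun v => by rw [corner_right, (rightExt h).idem_eps, (rightExt h).eps_idem]
  have hY : ∀ l, y D l * corner D h = corner D h * y D l := (leftExt h).y_eps
  have hT : ∀ l (hl : l + 1 < lam.degree) (hl' : 0 + l + 1 < ν.degree),
      tau D (0 + l) hl' * corner D h = corner D h * tau D (0 + l) hl' := (leftExt h).tau_eps
  have hT' : ∀ l (hl : l + 1 < μ.degree) (hl' : lam.degree + l + 1 < ν.degree),
      tau D (lam.degree + l) hl' * corner D h = corner D h * tau D (lam.degree + l) hl' := by
    rw [corner_right]; exact (rightExt h).tau_eps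
  have eL := fun v => (leftExt h).inc_e (corner_idempotent (D := D) h) (corner_left h) v
  have eR := fun v => (rightExt h).inc_e (corner_idempotent (D := D) h) (corner_right h) v
  have eL' : ∀ v, _ = (leftExt h).idem D v * corner D h := fun v =>
    (eL v).trans ((leftExt h).idem_eps v).symm
  have eR' : ∀ v, _ = (rightExt h).idem D v * corner D h := fun v =>
    (eR v).trans (by rw [corner_right, (rightExt h).idem_eps])
  have yL : ∀ (l : Fin lam.degree) (h' : 0 + l.1 < ν.degree),
      cornerVal (k := k) _ ((leftExt h).inc (corner_idempotent (D := D) h) (corner_left h) (y D l)) =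
        y D ⟨0 + l.1, h'⟩ * corner D h := (leftExt h).inc_y _ _
  have yR : ∀ (l : Fin μ.degree) (h' : lam.degree + l.1 < ν.degree),
      cornerVal (k := k) _ ((rightExt h).inc (corner_idempotent (D := D) h) (corner_right h)
        (y D l)) = y D ⟨lam.degree + l.1, h'⟩ * corner D h := (rightExt h).inc_y _ _
  have tL : ∀ l hl (h' : 0 + l + 1 < ν.degree),
      cornerVal (k := k) _ ((leftExt h).inc (corner_idempotent (D := D) h) (corner_left h)
        (tau D l hl)) = tau D (0 + l) h' * corner D h := (leftExt h).inc_tau _ _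
  have tR : ∀ l hl (h' : lam.degree + l + 1 < ν.degree),
      cornerVal (k := k) _ ((rightExt h).inc (corner_idempotent (D := D) h) (corner_right h)
        (tau D l hl)) = tau D (lam.degree + l) h' * corner D h := (rightExt h).inc_tau _ _
  induction x using KLR.induction with
  | hc c => rw [AlgHom.commutes]; exact Algebra.commutes _ _
  | hadd a b ha hb => rw [map_add]; exact ha.add_left hb
  | hmul a b ha hb => rw [map_mul]; exact ha.mul_left hb
  | he v =>
    induction x' using KLR.induction with
    | hc c => rw [AlgHom.commutes]; exact (Algebra.commutes _ _).symm
    | hadd a b ha hb => rw [map_add]; exact ha.add_right hb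
    | hmul a b ha hb => rw [map_mul]; exact ha.mul_right hb
    | he w =>
      refine corner_commute _ (eL' v) (eR' w) (hL v) (hR w) ?_
      simp only [Extension.idem, Finset.mul_sum, Finset.sum_mul, ]
      rw [Finset.sum_comm]
      refine Finset.sum_congr rfl fun a _ => Finset.sum_congr rfl fun b _ => e_comm _ _
    | hy l =>
      exact corner_commute _ (eL' v) (yR l (by omega)) (hL v) (hY _) ((leftExt h).y_idem _ v).symm
    | ht l hl =>
      refine corner_commute _ (eL' v) (tR l hl (by omega)) (hL v) (hT' l hl _) ?_
      change (∑ w, e D (Word.append h v w)) * _ = _ * ∑ w, e D (Word.append h v w)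
      simp only [Finset.mul_sum, Finset.sum_mul, tau_e]
      simp only [← Word.append_swap_right h v _ l hl]
      exact ((Extension.swap_bijective l hl).sum_comp
        fun w => e D (Word.append h v w) * tau D (lam.degree + l) (by omega)).symm
  | hy m =>
    induction x' using KLR.induction with
    | hc c => rw [AlgHom.commutes]; exact (Algebra.commutes _ _).symm
    | hadd a b ha hb => rw [map_add]; exact ha.add_right hb
    | hmul a b ha hb => rw [map_mul]; exact ha.mul_right hb
    | he w =>
      exact corner_commute _ (yL m (by omega)) (eR' w) (hY _) (hR w) ((rightExt h).y_idem _ w)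
    | hy l =>
      exact corner_commute _ (yL m (by omega)) (yR l (by omega)) (hY _) (hY _) (rel (Rel.y_comm _ _))
    | ht l hl =>
      exact corner_commute _ (yL m (by omega)) (tR l hl (by omega)) (hY _) (hT' l hl _)
        (tau_y_comm _ _ _ (by simp; omega) (by simp; omega)).symm
  | ht m hm =>
    induction x' using KLR.induction with
    | hc c => rw [AlgHom.commutes]; exact (Algebra.commutes _ _).symm
    | hadd a b ha hb => rw [map_add]; exact ha.add_right hb
    | hmul a b ha hb => rw [map_mul]; exact ha.mul_right hb
    | he w =>
      refine corner_commute _ (tL m hm (by omega)) (eR' w) (hT m hm _) (hR w) ?_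
      change _ * (∑ v, e D (Word.append h v w)) = (∑ v, e D (Word.append h v w)) * _
      simp only [Finset.mul_sum, Finset.sum_mul, tau_e]
      simp only [← Word.append_swap_left h _ w (0 + m) (by omega)]
      exact ((Extension.swap_bijective (0 + m) (by omega)).sum_comp
        fun v => e D (Word.append h v w) * tau D (0 + m) (by omega))
    | hy l =>
      exact corner_commute _ (tL m hm (by omega)) (yR l (by omega)) (hT m hm _) (hY _)
        (tau_y_comm _ _ _ (by simp; omega) (by simp; omega))
    | ht l hl =>
      exact corner_commute _ (tL m hm (by omega)) (tR l hl (by omega)) (hT m hm _) (hT' l hl _)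
        (rel (Rel.tau_comm _ _ _ _ (by omega)))

variable (D) in
/-- The homomorphism from `R(λ) ⊗ R(μ)` to the corner of `R(λ + μ)`. -/
def tensorInc : KLR D lam ⊗[k] KLR D μ →ₐ[k] (corner_idempotent (D := D) h).Corner :=
  Algebra.TensorProduct.lift ((leftExt h).inc (corner_idempotent h) (corner_left h))
    ((rightExt h).inc (corner_idempotent h) (corner_right h)) (inc_commute h)

theorem tensorInc_tmul (a : KLR D lam) (b : KLR D μ) : tensorInc D h (a ⊗ₜ b) =
    (leftExt h).inc (corner_idempotent h) (corner_left h) a *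
      (rightExt h).inc (corner_idempotent h) (corner_right h) b :=
  Algebra.TensorProduct.lift_tmul _ _ _ a b

variable (D) in
/-- The inclusion `R(λ) ⊗ R(μ) → R(λ + μ)` as a linear map. -/
def incMap : KLR D lam ⊗[k] KLR D μ →ₗ[k] KLR D ν :=
  cornerVal (k := k) (corner_idempotent (D := D) h) ∘ₗ (tensorInc D h).toLinearMap

theorem incMap_tmul (a : KLR D lam) (b : KLR D μ) : incMap D h (a ⊗ₜ b) =
    cornerVal (k := k) _ ((leftExt h).inc (corner_idempotent h) (corner_left h) a) *
      cornerVal (k := k) _ ((rightExt h).inc (corner_idempotent h) (corner_right h) b) :=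
  congrArg (cornerVal (k := k) _) (tensorInc_tmul h a b)

theorem incMap_mul (x x' : KLR D lam ⊗[k] KLR D μ) :
    incMap D h (x * x') = incMap D h x * incMap D h x' :=
  congrArg (cornerVal (k := k) (corner_idempotent (D := D) h)) (map_mul (tensorInc D h) x x')

theorem incMap_mem {i : ℤ} {x : KLR D lam ⊗[k] KLR D μ} (hx : x ∈ tensorDeg (deg D (ν := lam)) (deg D (ν := μ)) i) :
    incMap D h x ∈ deg D i := by
  induction hx using Submodule.span_induction with
  | zero => rw [map_zero]; exact zero_mem _
  | add a b _ _ ha hb => rw [map_add]; exact add_mem ha hb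
  | smul c a _ ha => rw [map_smul]; exact Submodule.smul_mem _ c ha
  | mem x hx =>
    obtain ⟨p, q, a, b, ha, hb, rfl, rfl⟩ := hx
    rw [incMap_tmul]
    exact mul_mem_deg ((leftExt h).inc_deg _ _ ha) ((rightExt h).inc_deg _ _ hb)

theorem incMap_aut (hl : Finsupp.mapDomain D.a lam = lam)
    (hm : Finsupp.mapDomain D.a μ = μ) (hn : Finsupp.mapDomain D.a ν = ν)
    (x : KLR D lam ⊗[k] KLR D μ) :
    incMap D h (Algebra.TensorProduct.map (aut hl) (aut hm) x) = aut hn (incMap D h x) := by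
  induction x with
  | zero => simp
  | add a b ha hb => rw [map_add, map_add, map_add, ha, hb, map_add]
  | tmul a b =>
    rw [Algebra.TensorProduct.map_tmul, incMap_tmul, incMap_tmul, map_mul]
    exact congrArg₂ (· * ·)
      ((leftExt h).inc_aut (corner_idempotent (D := D) h) (corner_left h) hl hn
        (Word.relabel D.a hm) (Word.relabel_bijective D hm)
        (fun v w => Word.relabel_append D.a h hl hm hn v w) a)
      ((rightExt h).inc_aut (corner_idempotent (D := D) h) (corner_right h) hm hn
        (Word.relabel D.a hl) (Word.relabel_bijective D hl)
        (fun v w => Word.relabel_append D.a h hl hm hn w v) b)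

variable (D) in
/-- The inclusion `R(λ) ⊗ R(μ) → R(λ + μ)`: it sends `e_v ⊗ e_w` to `e_(vw)`, and the generators
`y_l`, `τ_l` of the second factor to `y_(|λ|+l)`, `τ_(|λ|+l)`, cut down by `e_(λ,μ)`. -/
def inclusion (h : lam + μ = ν) (hl : Finsupp.mapDomain D.a lam = lam)
    (hm : Finsupp.mapDomain D.a μ = μ) (hn : Finsupp.mapDomain D.a ν = ν) :
    CornerHom ((folded D lam hl).tensor (folded D μ hm)) (folded D ν hn) where
  map := incMap D h
  map_mul := incMap_mul h
  map_mem := incMap_mem h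
  map_aut := incMap_aut h hl hm hn

end Inclusion

end KLR

end Folded
section OneColour

variable {I : Type v} (D : FoldedDatum I k)

/-- An orbit of the diagram automorphism `a`. -/
structure Orbit where
  carrier : Finset I
  exists_eq : ∃ i, ∀ x, x ∈ carrier ↔ D.a.SameCycle i x

namespace Orbit

variable {D} (j : Orbit D)

/-- The element `∑_(i ∈ j) i` of `ℕ I`, also denoted `j`. -/
def wt : I →₀ ℕ := ∑ i ∈ j.carrier, Finsupp.single i 1

/-- The integer `d_j = (j · j) / 2`; thus `q_j = q ^ d_j`. -/
def d : ℤ := (∑ i ∈ j.carrier, ∑ i' ∈ j.carrier, D.form i i') / 2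

theorem a_mem (x : I) : D.a x ∈ j.carrier ↔ x ∈ j.carrier := by
  obtain ⟨i, hi⟩ := j.exists_eq
  rw [hi, hi, Equiv.Perm.sameCycle_apply_right]

theorem sameCycle {x y : I} (hx : x ∈ j.carrier) (hy : y ∈ j.carrier) : D.a.SameCycle x y := by
  obtain ⟨i, hi⟩ := j.exists_eq
  exact ((hi x).1 hx).symm.trans ((hi y).1 hy)

theorem wt_apply [DecidableEq I] (x : I) : j.wt x = if x ∈ j.carrier then 1 else 0 := by
  simp [wt, Finsupp.finsetSum_apply, Finsupp.single_apply]

theorem mapDomain_wt : Finsupp.mapDomain D.a j.wt = j.wt := by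
  classical
  ext x
  obtain ⟨y, rfl⟩ := D.a.surjective x
  rw [Finsupp.mapDomain_apply D.a.injective, wt_apply, wt_apply]
  simp only [j.a_mem]

theorem mapDomain_nsmul (n : ℕ) : Finsupp.mapDomain D.a (n • j.wt) = n • j.wt := by
  have := map_nsmul (Finsupp.mapDomain.addMonoidHom (M := ℕ) D.a) n j.wt
  simpa [j.mapDomain_wt] using this

theorem letter_mem (w : Word j.wt) (l : Fin j.wt.degree) : w.1 l ∈ j.carrier := by
  classical
  have := w.mem_support l
  rw [Finsupp.mem_support_iff, wt_apply] at this
  by_contra h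
  exact this (if_neg h)

theorem letter_ne (w : Word j.wt) {l m : Fin j.wt.degree} (h : l ≠ m) : w.1 l ≠ w.1 m := by
  classical
  intro hw
  have h1 := DFunLike.congr_fun w.2 (w.1 l)
  rw [Finsupp.finsetSum_apply, wt_apply] at h1
  have h2 : ∑ x ∈ ({l, m} : Finset (Fin j.wt.degree)), (Finsupp.single (w.1 x) 1 : I →₀ ℕ) (w.1 l) ≤
      ∑ x, (Finsupp.single (w.1 x) 1 : I →₀ ℕ) (w.1 l) :=
    Finset.sum_le_sum_of_subset (Finset.subset_univ _)
  rw [Finset.sum_pair h, ← hw, h1] at h2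
  simp at h2
  split_ifs at h2 <;> omega

/-- The algebra `R(n j)` with its automorphism. -/
def alg (n : ℕ) : FoldedAlg.{u, max u v} k D.order :=
  KLR.folded D (n • j.wt) (j.mapDomain_nsmul n)

/-- The inclusion `R(m j) ⊗ R(n j) → R(s j)` for `m + n = s`. -/
def inclusion {m n s : ℕ} (h : m + n = s) : CornerHom ((j.alg m).tensor (j.alg n)) (j.alg s) :=
  KLR.inclusion D (by rw [← h, add_nsmul]) _ _ _

/-- The product `X ∘ Y`, induced from `R(m j) ⊗ R(n j)` to `R(s j)`, where `m + n = s`. -/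
def prod {m n s : ℕ} (h : m + n = s) (X : Obj (j.alg m)) (Y : Obj (j.alg n)) : Obj (j.alg s) :=
  (j.inclusion h).ind (X.tensor Y)

/-- The restriction from `R(s j)` to `R(m j) ⊗ R(n j)`, where `m + n = s`. -/
def res {m n s : ℕ} (h : m + n = s) (X : Obj (j.alg s)) : Obj ((j.alg m).tensor (j.alg n)) :=
  (j.inclusion h).res X

/-- A choice of constants for the action of the crossings on `L_j`. For letters `i ≠ i'` of an orbit
the polynomial `Q i i'` is a nonzero constant, and `τ_l` maps the basis vector `[w]` to
`γ (w_l) (w_(l+1)) [s_l w]`. The constant `1` is a possible choice if `Q i i' = 1` for these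
`i ≠ i'`. -/
structure Scaling where
  γ : I → I → k
  mul : ∀ i ∈ j.carrier, ∀ i' ∈ j.carrier, i ≠ i' → γ i i' * γ i' i = (D.Q i i').coeff 0
  inv : ∀ i ∈ j.carrier, ∀ i' ∈ j.carrier, γ (D.a i) (D.a i') = γ i i'

variable {j}

namespace Scaling

variable (g : Scaling j)

/-- The action of `e_w`. -/
def opE (w : Word j.wt) : Module.End k (Word j.wt →₀ k) := Finsupp.lsingle w ∘ₗ Finsupp.lapply w

/-- The action of `τ_l`. -/
def opT (l : ℕ) (h : l + 1 < j.wt.degree) : Module.End k (Word j.wt →₀ k) :=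
  Finsupp.linearCombination k fun w =>
    Finsupp.single (w.swap l h) (g.γ (w.1 ⟨l, Nat.lt_of_succ_lt h⟩) (w.1 ⟨l + 1, h⟩))

theorem opE_single (w w' : Word j.wt) (c : k) :
    opE w (Finsupp.single w' c) = if w = w' then Finsupp.single w c else 0 := by
  by_cases h : w = w'
  · subst h; simp [opE]
  · simp [opE, h]

theorem opT_single (l : ℕ) (h : l + 1 < j.wt.degree) (w : Word j.wt) (c : k) :
    g.opT l h (Finsupp.single w c) = Finsupp.single (w.swap l h)
      (c * g.γ (w.1 ⟨l, Nat.lt_of_succ_lt h⟩) (w.1 ⟨l + 1, h⟩)) := by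
  simp [opT]

theorem evalTwo_zero {S : Type*} [Ring S] [Algebra k S] (p : MvPolynomial (Fin 2) k) :
    evalTwo p (0 : S) 0 = p.coeff 0 • 1 := by
  classical
  rw [evalTwo, Finset.sum_eq_single 0]
  · simp
  · intro m _ hm
    by_cases h0 : m 0 = 0
    · have h1 : m 1 ≠ 0 := fun h1 => hm (by ext x; fin_cases x <;> simp [h0, h1])
      simp [h1]
    · simp [h0]
  · intro h
    rw [MvPolynomial.notMem_support_iff.1 h, zero_smul]

theorem swap_braid {α : Type*} [DecidableEq α] {a b c : α} (hab : a ≠ b) (hac : a ≠ c)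
    (hbc : b ≠ c) : Equiv.swap b c * Equiv.swap a b * Equiv.swap b c =
      Equiv.swap a b * Equiv.swap b c * Equiv.swap a b := by
  rw [Equiv.swap_mul_swap_mul_swap hab hac, Equiv.swap_comm a b, Equiv.swap_comm b c,
    Equiv.swap_mul_swap_mul_swap hbc.symm hac.symm, Equiv.swap_comm]

theorem op_rel (x x' : Module.End k (Word j.wt →₀ k))
    (hr : Rel D (opE (j := j)) (fun _ => 0) g.opT x x') : x = x' := by
  cases hr with
  | e_mul w w' =>
    refine Finsupp.lhom_ext fun v c => ?_
    rw [Module.End.mul_apply, opE_single]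
    by_cases h : w = w'
    · subst h
      rw [if_pos rfl]
      split_ifs with h2
      · subst h2; simp [opE_single]
      · simp [opE_single, h2]
    · rw [if_neg h]
      split_ifs with h2
      · subst h2; simp [opE_single, h]
      · simp
  | e_sum =>
    refine Finsupp.lhom_ext fun v c => ?_
    rw [LinearMap.sum_apply]
    simp [opE_single]
  | y_comm l m => rfl
  | y_e l w => simp
  | tau_e l h w =>
    refine Finsupp.lhom_ext fun v c => ?_
    rw [Module.End.mul_apply, Module.End.mul_apply, opT_single, opE_single, opE_single]
    by_cases c1 : w = v
    · subst c1
      rw [if_pos rfl, if_pos rfl, opT_single]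
    · rw [if_neg c1, if_neg, map_zero]
      intro c2
      refine c1 ?_
      rw [← w.swap_swap l h, c2, v.swap_swap]
  | tau_comm l m hl hm h =>
    refine Finsupp.lhom_ext fun v c => ?_
    have e1 : (v.swap m hm).swap l hl = (v.swap l hl).swap m hm := by
      apply Word.ext
      funext x
      refine congrArg v.1 (Equiv.congr_fun (Equiv.Perm.Disjoint.commute
        (Equiv.Perm.disjoint_swap_swap ?_)).eq.symm x)
      simp only [List.nodup_cons, List.mem_cons, List.not_mem_nil, Fin.mk.injEq, List.nodup_nil,
        or_false, not_false_eq_true, and_true]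
      omega
    rw [Module.End.mul_apply, Module.End.mul_apply, opT_single, opT_single, opT_single, opT_single,
      e1, Word.swap_ne _ _ _ _ (by simp; omega) (by simp; omega),
      Word.swap_ne _ _ _ _ (by simp; omega) (by simp; omega),
      Word.swap_ne _ _ _ _ (by simp; omega) (by simp; omega),
      Word.swap_ne _ _ _ _ (by simp; omega) (by simp; omega), mul_right_comm]
  | tau_sq l h w =>
    refine Finsupp.lhom_ext fun v c => ?_
    simp only [Module.End.mul_apply, opE_single]
    split_ifs with c1
    · subst c1
      rw [opT_single, opT_single, Word.swap_swap, Word.swap_left, Word.swap_right, evalTwo_zero,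
        LinearMap.smul_apply, Module.End.one_apply, Finsupp.smul_single, smul_eq_mul, mul_assoc,
        g.mul _ (j.letter_mem w _) _ (j.letter_mem w _)
          (j.letter_ne w (Fin.ne_of_val_ne (by dsimp; omega))), mul_comm]
    · simp
  | tau_y l h m w =>
    rw [if_neg (j.letter_ne w (Fin.ne_of_val_ne (by dsimp; omega)))]
    simp
  | braid l h w =>
    rw [if_neg (j.letter_ne w (Fin.ne_of_val_ne (by dsimp; omega)))]
    refine Finsupp.lhom_ext fun v c => ?_
    rw [Module.End.mul_apply, opE_single]
    split_ifs with c1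
    · subst c1
      rw [LinearMap.sub_apply, LinearMap.zero_apply, sub_eq_zero]
      have e1 : (((w.swap (l + 1) h).swap l (by omega)).swap (l + 1) h) =
          ((w.swap l (by omega)).swap (l + 1) h).swap l (by omega) := by
        apply Word.ext
        funext x
        have n1 : (⟨l, by omega⟩ : Fin j.wt.degree) ≠ ⟨l + 1, by omega⟩ :=
          Fin.ne_of_val_ne (by dsimp; omega)
        have n2 : (⟨l, by omega⟩ : Fin j.wt.degree) ≠ ⟨l + 1 + 1, h⟩ :=
          Fin.ne_of_val_ne (by dsimp; omega)
        have n3 : (⟨l + 1, by omega⟩ : Fin j.wt.degree) ≠ ⟨l + 1 + 1, h⟩ :=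
          Fin.ne_of_val_ne (by dsimp; omega)
        exact congrArg w.1 (Equiv.congr_fun (swap_braid n1 n2 n3) x)
      have a1 := Word.swap_right w l (by omega) (by omega)
      have a2 := Word.swap_ne w l (by omega) ⟨l + 1 + 1, h⟩ (by dsimp; omega) (by dsimp; omega)
      have a3 := Word.swap_left w (l + 1) h (by omega)
      have a4 := Word.swap_ne w (l + 1) h ⟨l, by omega⟩ (by dsimp; omega) (by dsimp; omega)
      simp only [Module.End.mul_apply, opT_single]
      rw [e1, Word.swap_right (w.swap (l + 1) h) l (by omega) (by omega),
        Word.swap_ne (w.swap (l + 1) h) l (by omega) ⟨l + 1 + 1, h⟩ (by dsimp; omega)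
          (by dsimp; omega), a3, a4, Word.swap_right w (l + 1) h h,
        Word.swap_left (w.swap l (by omega)) (l + 1) h (by omega),
        Word.swap_ne (w.swap l (by omega)) (l + 1) h ⟨l, by omega⟩ (by dsimp; omega)
          (by dsimp; omega), a1, a2, Word.swap_left w l (by omega) (by omega)]
      congr 1
      ring
    · simp

/-- The action of `R(j)` on the vector space with basis the words `[w]` of content `j`. -/
def op : KLR D j.wt →ₐ[k] Module.End k (Word j.wt →₀ k) :=
  KLR.lift (opE (j := j)) (fun _ => 0) g.opT g.op_rel

theorem op_e (w : Word j.wt) : g.op (KLR.e D w) = opE w := KLR.lift_e _ _ _ _ w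

theorem op_y (l : Fin j.wt.degree) : g.op (KLR.y D l) = 0 := KLR.lift_y _ _ _ _ l

theorem op_tau (l : ℕ) (h : l + 1 < j.wt.degree) : g.op (KLR.tau D l h) = g.opT l h :=
  KLR.lift_tau _ _ _ _ l h

theorem op_mono {d : ℤ} {x : KLR D j.wt} (hx : KLR.Mono D d x) (hd : d ≠ 0) : g.op x = 0 := by
  induction hx with
  | idem w => exact absurd rfl hd
  | dot l w hx ih => simp [op_y]
  | cross l h w hx ih =>
    rw [map_mul, ih, mul_zero]
    rw [D.orth _ _ (j.letter_ne w (Fin.ne_of_val_ne (by dsimp; omega)))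
      (j.sameCycle (j.letter_mem w _) (j.letter_mem w _)), neg_zero, zero_add] at hd
    exact hd

theorem op_deg {d : ℤ} {x : KLR D j.wt} (hx : x ∈ KLR.deg D d) (hd : d ≠ 0) : g.op x = 0 := by
  have : KLR.deg D d ≤ LinearMap.ker g.op.toLinearMap :=
    Submodule.span_le.2 fun x hx => g.op_mono hx hd
  exact this hx

/-- The map `σ`, with `σ [w] = [a w]`. -/
def sig : Module.End k (Word j.wt →₀ k) := Finsupp.lmapDomain k k (Word.relabel D.a j.mapDomain_wt)

theorem sig_single (w : Word j.wt) (c : k) :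
    sig (Finsupp.single w c) = Finsupp.single (w.relabel D.a j.mapDomain_wt) c := by
  simp [sig]

theorem sig_op (x : KLR D j.wt) (m : Word j.wt →₀ k) :
    sig (g.op x m) = g.op (KLR.aut j.mapDomain_wt x) (sig m) := by
  induction x using KLR.induction generalizing m with
  | hc c => simp [AlgHom.commutes, Module.algebraMap_end_apply]
  | he w =>
    rw [KLR.aut_e, op_e, op_e]
    induction m using Finsupp.induction_linear with
    | zero => simp
    | add a b ha hb => simp only [map_add, ha, hb]
    | single v c =>
      rw [opE_single, sig_single, opE_single]
      by_cases h : w = v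
      · subst h; simp [sig_single]
      · rw [if_neg h, if_neg fun h2 => h (Word.relabel_injective D _ h2), map_zero]
  | hy l => simp [KLR.aut_y, op_y]
  | ht l h =>
    rw [KLR.aut_tau, op_tau]
    induction m using Finsupp.induction_linear with
    | zero => simp
    | add a b ha hb => simp only [map_add, ha, hb]
    | single v c =>
      rw [opT_single, sig_single, sig_single, opT_single]
      exact congrArg (Finsupp.single _) (congrArg (c * ·)
        (g.inv _ (j.letter_mem v _) _ (j.letter_mem v _)).symm)
  | hadd a b ha hb => simp only [map_add, LinearMap.add_apply, ha, hb]
  | hmul a b ha hb => simp only [map_mul, Module.End.mul_apply, ha, hb]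

/-- The object `L(j) = (L_j, σ)` : the vector space with basis the words `[w]` of content `j`, in
degree zero, on which `e_w` projects to the line of `[w]`, the `y_l` act by zero, and `τ_l` maps
`[w]` to `γ (w_l) (w_(l+1)) [s_l w]`, together with the map `σ [w] = [a w]`. -/
def simple : Obj (KLR.folded D j.wt j.mapDomain_wt) where
  carrier := Word j.wt →₀ k
  module := Module.compHom _ g.op.toRingHom
  tower := by
    let _ : Module (KLR.folded D j.wt j.mapDomain_wt).carrier (Word j.wt →₀ k) :=
      Module.compHom _ g.op.toRingHom
    refine ⟨fun c r m => ?_⟩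
    exact LinearMap.congr_fun (map_smul g.op c r) m
  deg d := if d = 0 then ⊤ else ⊥
  internal := by
    refine isInternal_of_coaction _ (Finsupp.lsingle 0) ?_ ?_
    · intro d m hm
      by_cases hd : d = 0
      · subst hd; rfl
      · rw [if_neg hd, Submodule.mem_bot] at hm
        simp [hm]
    · intro m
      refine Submodule.mem_iSup_of_mem 0 ?_
      rw [if_pos rfl]
      trivial
  smul_mem {i l r m} hr hm := by
    change g.op r m ∈ _
    by_cases hl : l = 0
    · by_cases hi : i = 0
      · rw [if_pos (by omega)]; trivial
      · rw [g.op_deg hr hi]; exact zero_mem _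
    · rw [if_neg hl, Submodule.mem_bot] at hm
      rw [hm, map_zero]; exact zero_mem _
  σ := sig
  σ_smul r m := g.sig_op r m
  σ_mem {i m} hm := by
    by_cases hi : i = 0
    · rw [if_pos hi]; trivial
    · rw [if_neg hi, Submodule.mem_bot] at hm ⊢
      rw [hm, map_zero]
  σ_pow m := by
    induction m using Finsupp.induction_linear with
    | zero => exact Function.iterate_fixed (map_zero _) _
    | add a b ha hb => rw [iterate_map_add, ha, hb]
    | single w c =>
      have semi : Function.Semiconj (fun w => (Finsupp.single w c : Word j.wt →₀ k))
          (Word.relabel D.a j.mapDomain_wt) sig := fun w => (sig_single w c).symm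
      exact ((semi.iterate_right D.order) w).symm.trans
        (congrArg (fun w => Finsupp.single w c) (Word.relabel_iterate D _ w))

/-- The power `L(j)^(∘ n)`. It is the unit object `R(0) = k` for `n = 0`, and
`L(j)^(∘ n) ∘ L(j)` for `n + 1`. -/
def power : (n : ℕ) → Obj (j.alg n)
  | 0 => Obj.regular (j.alg 0)
  | n + 1 => (KLR.inclusion D (succ_nsmul j.wt n).symm (j.mapDomain_nsmul n) j.mapDomain_wt
      (j.mapDomain_nsmul (n + 1))).ind ((power n).tensor g.simple)

/-- The object `L(j^n)`, which is `L(j)^(∘ n)` shifted by the power `n choose 2` of `q_j`. -/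
def L (n : ℕ) : Obj (j.alg n) := (g.power n).shift (j.d * n.choose 2)

end Scaling

end Orbit

/-! ## Quantum binomial coefficients -/

section Binomial

variable (O : Type) [CommRing O]

/-- The quantum integer `[n] = q^(n-1) + q^(n-3) + ⋯ + q^(1-n)` in `q = T ^ d`. -/
def qint (d : ℤ) (n : ℕ) : O[T;T⁻¹] :=
  ∑ s ∈ Finset.range n, LaurentPolynomial.T (d * ((n : ℤ) - 1 - 2 * s))

/-- The quantum factorial `[n]! = [1] [2] ⋯ [n]`. -/
def qfac (d : ℤ) (n : ℕ) : O[T;T⁻¹] := ∏ s ∈ Finset.range n, qint O d (s + 1)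

/-- The quantum binomial coefficient in `q = T ^ d`, through the recursion
`[n+1, m+1] = q^(m+1) [n, m+1] + q^(m-n) [n, m]`. -/
def qbinom (d : ℤ) : ℕ → ℕ → O[T;T⁻¹]
  | _, 0 => 1
  | 0, _ + 1 => 0
  | n + 1, m + 1 => LaurentPolynomial.T (d * ((m : ℤ) + 1)) * qbinom d n (m + 1) +
      LaurentPolynomial.T (d * ((m : ℤ) - n)) * qbinom d n m

variable {O}

theorem qint_succ (d : ℤ) (n : ℕ) : qint O d (n + 1) =
    LaurentPolynomial.T d * qint O d n + LaurentPolynomial.T (-(d * n)) := by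
  rw [qint, Finset.sum_range_succ, qint, Finset.mul_sum]
  congr 1
  · refine Finset.sum_congr rfl fun s _ => ?_
    rw [← LaurentPolynomial.T_add]
    congr 1
    push_cast
    ring
  · congr 1
    push_cast
    ring

theorem qint_add (d : ℤ) (n m : ℕ) : qint O d (n + m) =
    LaurentPolynomial.T (d * m) * qint O d n + LaurentPolynomial.T (-(d * n)) * qint O d m := by
  induction m with
  | zero => simp [qint]
  | succ m ih =>
    rw [← add_assoc, qint_succ, ih, qint_succ, mul_add, mul_add, add_assoc, mul_left_comm,
      ← mul_assoc, ← LaurentPolynomial.T_add, ← LaurentPolynomial.T_add]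
    have h1 : d * (m : ℤ) + d = d * ((m + 1 : ℕ) : ℤ) := by push_cast; ring
    have h2 : -(d * ((n + m : ℕ) : ℤ)) = -(d * n) + -(d * m) := by push_cast; ring
    rw [h1, h2, LaurentPolynomial.T_add (-(d * (n : ℤ)))]
    ring

theorem qbinom_eq_zero (d : ℤ) : ∀ n m : ℕ, n < m → qbinom O d n m = 0
  | 0, _ + 1, _ => by rw [qbinom]
  | n + 1, m + 1, h => by
    rw [qbinom, qbinom_eq_zero d n (m + 1) (by omega), qbinom_eq_zero d n m (by omega)]
    simp

/-- The recursion computes `[n]! / ([m]! [n-m]!)`. -/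
theorem qbinom_mul (d : ℤ) (m l : ℕ) :
    qbinom O d (m + l) m * (qfac O d m * qfac O d l) = qfac O d (m + l) := by
  induction m generalizing l with
  | zero => simp [qbinom, qfac]
  | succ m ihm =>
    induction l with
    | zero =>
      have h := ihm 0
      rw [add_zero] at h
      rw [add_zero, qbinom, qbinom_eq_zero d m (m + 1) (by omega)]
      have e : ∀ s, qfac O d (s + 1) = qfac O d s * qint O d (s + 1) :=
        fun s => Finset.prod_range_succ _ _
      rw [e, mul_zero, zero_add, sub_self, mul_zero, LaurentPolynomial.T_zero, one_mul]
      linear_combination qint O d (m + 1) * h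
    | succ l ihl =>
      have h1 := ihm (l + 1)
      have e : ∀ s, qfac O d (s + 1) = qfac O d s * qint O d (s + 1) :=
        fun s => Finset.prod_range_succ _ _
      rw [show m + 1 + (l + 1) = (m + 1 + l) + 1 by omega, qbinom]
      rw [show m + (l + 1) = m + 1 + l by omega] at h1
      have h3 := qint_add (O := O) d (l + 1) (m + 1)
      rw [show l + 1 + (m + 1) = m + 1 + l + 1 by omega] at h3
      rw [e (m + 1 + l), h3]
      rw [e l, e m] at *
      push_cast at *
      have h4 : LaurentPolynomial.T (d * ((m : ℤ) - (m + 1 + l))) =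
          (LaurentPolynomial.T (-(d * ((l : ℤ) + 1))) : O[T;T⁻¹]) := by
        congr 1; ring
      rw [h4]
      linear_combination (LaurentPolynomial.T (d * ((m : ℤ) + 1)) * qint O d (l + 1)) * ihl +
        (LaurentPolynomial.T (-(d * ((l : ℤ) + 1))) * qint O d (m + 1)) * h1

end Binomial

end OneColour

end FoldedKLR

end

open FoldedKLR

noncomputable section

universe u v w

namespace FoldedKLR

section

section Components

variable {k : Type u} [Field k] {M N : Type w} [AddCommGroup M] [Module k M] [AddCommGroup N]
  [Module k N] {deg : ℤ → Submodule k M} {deg' : ℤ → Submodule k N}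

/-- The component of degree `d`. -/
def component (h : DirectSum.IsInternal deg) (d : ℤ) : M →ₗ[k] M := Finsupp.lapply d ∘ₗ coaction h

theorem component_of_mem (h : DirectSum.IsInternal deg) {d : ℤ} {m : M} (hm : m ∈ deg d) :
    component h d m = m := by
  simp [component, coaction_apply h hm]

theorem component_of_mem_ne (h : DirectSum.IsInternal deg) {d d' : ℤ} {m : M} (hm : m ∈ deg d')
    (hd : d' ≠ d) : component h d m = 0 := by
  simp [component, coaction_apply h hm, hd]

theorem homogeneous_induction (h : DirectSum.IsInternal deg) {p : M → Prop} (h0 : p 0)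
    (hd : ∀ d, ∀ m ∈ deg d, p m) (hadd : ∀ a b, p a → p b → p (a + b)) (m : M) : p m :=
  Submodule.iSup_induction deg (motive := p) (mem_iSup_of_internal h m) hd h0 hadd

theorem component_mem (h : DirectSum.IsInternal deg) (d : ℤ) (m : M) : component h d m ∈ deg d := by
  refine homogeneous_induction h (p := fun m => component h d m ∈ deg d) (by simp) ?_
    (fun a b ha hb => by rw [map_add]; exact add_mem ha hb) m
  intro d' m hm
  by_cases hd : d' = d
  · subst hd; rwa [component_of_mem h hm]
  · rw [component_of_mem_ne h hm hd]; exact zero_mem _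

theorem sum_component (h : DirectSum.IsInternal deg) (m : M) :
    ∑ d ∈ (coaction h m).support, component h d m = m := by
  have key : (coaction h m).sum (fun _ x => x) = m := by
    refine homogeneous_induction h (p := fun m => (coaction h m).sum (fun _ x => x) = m) (by simp) ?_
      ?_ m
    · intro d m hm
      rw [coaction_apply h hm, Finsupp.sum_single_index rfl]
    · intro a b ha hb
      rw [map_add, Finsupp.sum_add_index' (fun _ => rfl) (fun _ _ _ => rfl), ha, hb]
  exact key

theorem eq_zero_of_component (h : DirectSum.IsInternal deg) {m : M}
    (hm : ∀ d, component h d m = 0) : m = 0 := by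
  rw [← sum_component h m]
  exact Finset.sum_eq_zero fun d _ => hm d

theorem component_map (h : DirectSum.IsInternal deg) (h' : DirectSum.IsInternal deg') (c : ℤ)
    (f : M →+ N) (hf : ∀ d, ∀ m ∈ deg d, f m ∈ deg' (d + c)) (d : ℤ) (m : M) :
    component h' (d + c) (f m) = f (component h d m) := by
  refine homogeneous_induction h
    (p := fun m => component h' (d + c) (f m) = f (component h d m)) (by simp) ?_ ?_ m
  · intro e m hm
    by_cases hd : e = d
    · subst hd; rw [component_of_mem h hm, component_of_mem h' (hf _ _ hm)]
    · rw [component_of_mem_ne h hm hd, map_zero,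
        component_of_mem_ne h' (hf _ _ hm) (fun h => hd (by omega))]
  · intro a b ha hb
    simp only [map_add, ha, hb]

theorem component_map_zero (h : DirectSum.IsInternal deg) (h' : DirectSum.IsInternal deg')
    (f : M →+ N) (hf : ∀ d, ∀ m ∈ deg d, f m ∈ deg' d) (d : ℤ) (m : M) :
    component h' d (f m) = f (component h d m) := by
  have := component_map h h' 0 f (fun d m hm => by rw [add_zero]; exact hf d m hm) d m
  rwa [add_zero] at this

theorem eq_zero_of_mem_of_ne (h : DirectSum.IsInternal deg) {d d' : ℤ} {m : M} (hm : m ∈ deg d)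
    (hm' : m ∈ deg d') (hd : d ≠ d') : m = 0 := by
  rw [← component_of_mem h hm, component_of_mem_ne h hm' (Ne.symm hd)]

theorem finite_degrees [Module.Finite k M] (h : DirectSum.IsInternal deg) :
    {d | deg d ≠ ⊥}.Finite :=
  WellFoundedGT.finite_ne_bot_of_iSupIndep h.submodule_iSupIndep

theorem internal_comap (h : DirectSum.IsInternal deg) (P : Submodule k M)
    (hg : ∀ m ∈ P, ∀ d, component h d m ∈ P) :
    DirectSum.IsInternal fun d => (deg d).comap P.subtype := by
  have hfin : ∀ m : P, ∃ f : ℤ →₀ P, ∀ d, (f d).1 = component h d m.1 := fun m =>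
    ⟨Finsupp.onFinset (coaction h m.1).support
      (fun d => ⟨component h d m.1, hg _ m.2 d⟩) (fun d hd => by
        rw [Finsupp.mem_support_iff]
        intro h0
        exact hd (Subtype.ext h0)), fun d => rfl⟩
  choose f hf using hfin
  refine isInternal_of_coaction _
    { toFun := f
      map_add' := fun a b => ?_
      map_smul' := fun c a => ?_ } ?_ ?_
  · ext d
    rw [Finsupp.add_apply, Submodule.coe_add, hf, hf, hf, Submodule.coe_add, map_add]
  · ext d
    rw [Finsupp.smul_apply]
    change (f (c • a) d).1 = c • (f a d).1
    rw [hf, hf]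
    exact map_smul _ c a.1
  · intro d m hm
    ext d'
    change (f m d').1 = _
    rw [hf]
    have hm : m.1 ∈ deg d := hm
    by_cases hd : d = d'
    · subst hd; rw [component_of_mem h hm, Finsupp.single_eq_same]
    · rw [component_of_mem_ne h hm hd, Finsupp.single_eq_of_ne (Ne.symm hd)]; rfl
  · intro m
    have : m = ∑ d ∈ (coaction h m.1).support, (⟨component h d m.1, hg _ m.2 d⟩ : P) := by
      apply Subtype.ext
      rw [AddSubmonoidClass.coe_finsetSum]
      exact (sum_component h m.1).symm
    rw [this]
    exact sum_mem fun d _ => Submodule.mem_iSup_of_mem d (component_mem h d m.1)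

end Components

variable {k : Type u} [Field k] {n : ℕ} {A : FoldedAlg.{u, w} k n}

namespace Obj

/-- The quotient of an object by a graded submodule stable under `σ`. -/
def quot (X : Obj A) (N : Submodule A.carrier X.carrier)
    (hg : ∀ m ∈ N, ∀ d, component X.internal d m ∈ N) (hσ : ∀ m ∈ N, X.σ m ∈ N) : Obj A where
  carrier := X.carrier ⧸ N
  deg d := (X.deg d).map (N.mkQ.restrictScalars k)
  internal := by
    refine isInternal_of_coaction _
      (Submodule.liftQ (N.restrictScalars k) (Finsupp.mapRange.linearMap (N.mkQ.restrictScalars k) ∘ₗ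
        coaction X.internal) (fun m hm => ?_) ∘ₗ
        (Submodule.Quotient.restrictScalarsEquiv k N).symm.toLinearMap) ?_ ?_
    · rw [LinearMap.mem_ker]
      ext d
      change N.mkQ (component X.internal d m) = 0
      rw [Submodule.mkQ_apply, Submodule.Quotient.mk_eq_zero]
      exact hg m hm d
    · rintro d _ ⟨z, hz, rfl⟩
      change Finsupp.mapRange.linearMap (N.mkQ.restrictScalars k) (coaction X.internal z) = _
      rw [coaction_apply X.internal hz]
      simp
    · intro m
      obtain ⟨z, rfl⟩ := Submodule.mkQ_surjective _ m
      rw [← Submodule.map_iSup]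
      exact ⟨z, mem_iSup_of_internal X.internal z, rfl⟩
  smul_mem {i j b m} hb hm := by
    obtain ⟨z, hz, rfl⟩ := hm
    exact ⟨b • z, X.smul_mem hb hz, rfl⟩
  σ := (Submodule.Quotient.restrictScalarsEquiv k N).toLinearMap ∘ₗ
    Submodule.mapQ (N.restrictScalars k) (N.restrictScalars k) X.σ (fun m hm => hσ m hm) ∘ₗ
    (Submodule.Quotient.restrictScalarsEquiv k N).symm.toLinearMap
  σ_smul b m := by
    obtain ⟨z, rfl⟩ := Submodule.mkQ_surjective _ m
    exact congrArg N.mkQ (X.σ_smul b z)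
  σ_mem {i m} hm := by
    obtain ⟨z, hz, rfl⟩ := hm
    exact ⟨X.σ z, X.σ_mem hz, rfl⟩
  σ_pow m := by
    obtain ⟨z, rfl⟩ := Submodule.mkQ_surjective _ m
    have semi : Function.Semiconj N.mkQ X.σ
        ((Submodule.Quotient.restrictScalarsEquiv k N).toLinearMap ∘ₗ
          Submodule.mapQ (N.restrictScalars k) (N.restrictScalars k) X.σ (fun m hm => hσ m hm) ∘ₗ
          (Submodule.Quotient.restrictScalarsEquiv k N).symm.toLinearMap) := fun z => rfl
    rw [← (semi.iterate_right n) z, X.σ_pow]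

/-- The projection to a quotient. -/
def quotMk (X : Obj A) (N : Submodule A.carrier X.carrier)
    (hg : ∀ m ∈ N, ∀ d, component X.internal d m ∈ N) (hσ : ∀ m ∈ N, X.σ m ∈ N) :
    Hom X (X.quot N hg hσ) where
  map := N.mkQ
  map_mem hm := ⟨_, hm, rfl⟩
  map_σ _ := rfl

/-- A graded submodule stable under `σ`, as an object. -/
def sub (X : Obj A) (N : Submodule A.carrier X.carrier)
    (hg : ∀ m ∈ N, ∀ d, component X.internal d m ∈ N) (hσ : ∀ m ∈ N, X.σ m ∈ N) : Obj A where
  carrier := N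
  deg d := (X.deg d).comap (N.subtype.restrictScalars k)
  internal := internal_comap X.internal (N.restrictScalars k) hg
  smul_mem hr hm := X.smul_mem hr hm
  σ := X.σ.restrict (p := N.restrictScalars k) (q := N.restrictScalars k) fun m hm => hσ m hm
  σ_smul r m := Subtype.ext (X.σ_smul r m.1)
  σ_mem hm := X.σ_mem hm
  σ_pow m := by
    apply Subtype.ext
    have semi : Function.Semiconj (Subtype.val : N → X.carrier)
      (X.σ.restrict (p := N.restrictScalars k) (q := N.restrictScalars k) fun m hm => hσ m hm)
      X.σ := fun _ => rfl
    exact (semi.iterate_right n m).trans (X.σ_pow m.1)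

/-- The inclusion of a subobject. -/
def subVal (X : Obj A) (N : Submodule A.carrier X.carrier)
    (hg : ∀ m ∈ N, ∀ d, component X.internal d m ∈ N) (hσ : ∀ m ∈ N, X.σ m ∈ N) :
    Hom (X.sub N hg hσ) X where
  map := N.subtype
  map_mem hm := hm
  map_σ _ := rfl

end Obj

namespace Hom

/-- The identity morphism. -/
def id (X : Obj A) : Hom X X := ⟨LinearMap.id, fun h => h, fun _ => rfl⟩

/-- The composition of morphisms. -/
def comp {X Y Z : Obj A} (g : Hom Y Z) (f : Hom X Y) : Hom X Z :=
  ⟨g.map ∘ₗ f.map, fun h => g.map_mem (f.map_mem h), fun m => by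
    rw [LinearMap.comp_apply, f.map_σ, g.map_σ, LinearMap.comp_apply]⟩

theorem map_component {X Y : Obj A} (f : Hom X Y) (d : ℤ) (m : X.carrier) :
    f.map (component X.internal d m) = component Y.internal d (f.map m) :=
  (component_map_zero X.internal Y.internal f.map.toAddMonoidHom (fun _ _ h => f.map_mem h) d m).symm

theorem map_smul_base {X Y : Obj A} (f : Hom X Y) (c : k) (m : X.carrier) :
    f.map (c • m) = c • f.map m := by
  rw [← algebraMap_smul A.carrier c m, map_smul, algebraMap_smul]

/-- The inverse of a bijective morphism. -/
def inv {X Y : Obj A} (f : Hom X Y) (hf : Function.Bijective f.map) : Hom Y X where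
  map := (LinearEquiv.ofBijective f.map hf).symm.toLinearMap
  map_mem {i m} hm := by
    obtain ⟨x, rfl⟩ := hf.2 m
    have hx : (LinearEquiv.ofBijective f.map hf).symm (f.map x) = x :=
      (LinearEquiv.ofBijective f.map hf).symm_apply_apply x
    change (LinearEquiv.ofBijective f.map hf).symm (f.map x) ∈ _
    rw [hx]
    have : x = component X.internal i x := by
      apply hf.1
      rw [map_component, component_of_mem Y.internal hm]
    rw [this]
    exact component_mem _ _ _
  map_σ m := by
    obtain ⟨x, rfl⟩ := hf.2 m
    have hx : ∀ x, (LinearEquiv.ofBijective f.map hf).symm (f.map x) = x :=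
      fun x => (LinearEquiv.ofBijective f.map hf).symm_apply_apply x
    change (LinearEquiv.ofBijective f.map hf).symm (Y.σ (f.map x)) =
      X.σ ((LinearEquiv.ofBijective f.map hf).symm (f.map x))
    rw [← f.map_σ, hx, hx]

theorem inv_apply {X Y : Obj A} (f : Hom X Y) (hf : Function.Bijective f.map) (x : X.carrier) :
    (f.inv hf).map (f.map x) = x :=
  (LinearEquiv.ofBijective f.map hf).symm_apply_apply x

theorem apply_inv {X Y : Obj A} (f : Hom X Y) (hf : Function.Bijective f.map) (y : Y.carrier) :
    f.map ((f.inv hf).map y) = y :=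
  (LinearEquiv.ofBijective f.map hf).apply_symm_apply y

theorem range_graded {X Y : Obj A} (f : Hom X Y) :
    ∀ m ∈ LinearMap.range f.map, ∀ d, component Y.internal d m ∈ LinearMap.range f.map := by
  rintro _ ⟨x, rfl⟩ d
  exact ⟨_, f.map_component d x⟩

theorem range_σ {X Y : Obj A} (f : Hom X Y) :
    ∀ m ∈ LinearMap.range f.map, Y.σ m ∈ LinearMap.range f.map := by
  rintro _ ⟨x, rfl⟩
  exact ⟨_, f.map_σ x⟩

theorem ker_graded {X Y : Obj A} (f : Hom X Y) :
    ∀ m ∈ LinearMap.ker f.map, ∀ d, component X.internal d m ∈ LinearMap.ker f.map := by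
  intro m hm d
  rw [LinearMap.mem_ker] at hm ⊢
  rw [f.map_component, hm, map_zero]

theorem ker_σ {X Y : Obj A} (f : Hom X Y) :
    ∀ m ∈ LinearMap.ker f.map, X.σ m ∈ LinearMap.ker f.map := by
  intro m hm
  rw [LinearMap.mem_ker] at hm ⊢
  rw [f.map_σ, hm, map_zero]

end Hom

theorem IsIso.refl (X : Obj A) : IsIso X X := ⟨Hom.id X, Function.bijective_id⟩

theorem IsIso.symm {X Y : Obj A} (h : IsIso X Y) : IsIso Y X := by
  obtain ⟨f, hf⟩ := h
  exact ⟨f.inv hf, (LinearEquiv.ofBijective f.map hf).symm.bijective⟩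

theorem IsIso.trans {X Y Z : Obj A} (h : IsIso X Y) (h' : IsIso Y Z) : IsIso X Z := by
  obtain ⟨f, hf⟩ := h
  obtain ⟨g, hg⟩ := h'
  exact ⟨g.comp f, hg.comp hf⟩

/-- The twist by `ω ^ i` and shift by `d` of an object. -/
def Obj.ts {ω : k} (hω : ω ^ n = 1) (d : ℤ) (i : ℕ) (X : Obj A) : Obj A :=
  (X.twist (ω ^ i) (by rw [← pow_mul, mul_comm, pow_mul, hω, one_pow])).shift d

section Functors

theorem IsIso.shift {X Y : Obj A} {d : ℤ} (h : IsIso X Y) : IsIso (X.shift d) (Y.shift d) := by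
  obtain ⟨f, hf⟩ := h
  exact ⟨⟨f.map, fun h => f.map_mem h, f.map_σ⟩, hf⟩

theorem IsProjective.of_iso {X Y : Obj A} (h : IsIso X Y) (hX : IsProjective X) :
    IsProjective Y := by
  obtain ⟨f, hf⟩ := h
  intro Z Z' p q hp
  obtain ⟨r, hr⟩ := hX Z Z' p (q.comp f) hp
  refine ⟨r.comp (f.inv hf), fun y => ?_⟩
  change p.map (r.map ((f.inv hf).map y)) = _
  rw [hr]
  exact congrArg q.map (f.apply_inv hf y)

theorem IsFGProjective.of_iso {X Y : Obj A} (h : IsIso X Y) (hX : IsFGProjective X) :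
    IsFGProjective Y := by
  refine ⟨?_, hX.2.of_iso h⟩
  obtain ⟨f, hf⟩ := h
  have := hX.1
  exact Module.Finite.of_surjective f.map hf.2

theorem IsProjective.twist {X : Obj A} {c : k} (hc : c ^ n = 1) (hc0 : c ≠ 0)
    (h : IsProjective X) : IsProjective (X.twist c hc) := by
  intro Z Z' p q hp
  have hc' : (c⁻¹) ^ n = 1 := by rw [inv_pow, hc, inv_one]
  let p' : Hom (Z.twist c⁻¹ hc') (Z'.twist c⁻¹ hc') := ⟨p.map, fun h => p.map_mem h,
    fun (m : Z.carrier) => (p.map_smul_base c⁻¹ (Z.σ m)).trans (congrArg (c⁻¹ • ·) (p.map_σ m))⟩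
  let q' : Hom X (Z'.twist c⁻¹ hc') := ⟨q.map, fun h => q.map_mem h, fun (m : X.carrier) => by
    have h1 : c • q.map (X.σ m) = Z'.σ (q.map m) :=
      (q.map_smul_base c (X.σ m)).symm.trans (q.map_σ m)
    have h2 : c⁻¹ • c • q.map (X.σ m) = c⁻¹ • Z'.σ (q.map m) := congrArg (c⁻¹ • ·) h1
    rwa [inv_smul_smul₀ hc0] at h2⟩
  obtain ⟨r, hr⟩ := h _ _ p' q' hp
  refine ⟨⟨r.map, fun h => r.map_mem h, fun (m : X.carrier) => ?_⟩, hr⟩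
  have h1 : c • r.map (X.σ m) = c • (c⁻¹ • Z.σ (r.map m)) := congrArg (c • ·) (r.map_σ m)
  exact (r.map_smul_base c (X.σ m)).trans (h1.trans (smul_inv_smul₀ hc0 (Z.σ (r.map m))))

theorem IsProjective.shift {X : Obj A} {d : ℤ} (h : IsProjective X) :
    IsProjective (X.shift d) := by
  intro Z Z' p q hp
  let p' : Hom (Z.shift (-d)) (Z'.shift (-d)) := ⟨p.map, fun h => p.map_mem h, p.map_σ⟩
  let q' : Hom X (Z'.shift (-d)) := ⟨q.map, fun {i m} h => by
    have : m ∈ (X.shift d).deg (i + d) := by change m ∈ X.deg (i + d - d); rwa [add_sub_cancel_right]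
    have := q.map_mem this
    change q.map m ∈ Z'.deg (i - -d)
    rwa [sub_neg_eq_add], q.map_σ⟩
  obtain ⟨r, hr⟩ := h _ _ p' q' hp
  refine ⟨⟨r.map, fun {i m} h => ?_, r.map_σ⟩, hr⟩
  have : r.map m ∈ Z.deg (i - d - -d) := r.map_mem h
  rwa [sub_neg_eq_add, sub_add_cancel] at this

theorem IsFGProjective.ts {ω : k} {hω : ω ^ n = 1} (hω0 : ω ≠ 0) {d : ℤ} {i : ℕ} {X : Obj A}
    (h : IsFGProjective X) : IsFGProjective (X.ts hω d i) :=
  ⟨h.1, (h.2.twist _ (pow_ne_zero _ hω0)).shift⟩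

end Functors

/-- A traceless object is isomorphic to its twist by a nontrivial root of unity. -/
theorem IsTraceless.iso_twist (hn : n ≠ 0) {X : Obj A} {ω : k} (hω : ω ^ n = 1)
    (hX : IsTraceless X) :
    ∃ m : ℕ, 0 < m ∧ m < n ∧ ∀ hc : (ω ^ m) ^ n = 1, IsIso X (X.twist (ω ^ m) hc) := by
  obtain ⟨t, ht2, ⟨m, rfl⟩, N, hN, hg, hs⟩ := hX
  have : NeZero t := ⟨by omega⟩
  have hm : 0 < m := Nat.pos_of_ne_zero fun h => hn (by rw [h, mul_zero])
  refine ⟨m, hm, by nlinarith, fun hc => ?_⟩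
  set η := ω ^ m with hη
  have hηt : η ^ t = 1 := by rw [hη, ← pow_mul, mul_comm, hω]
  have hη0 : η ≠ 0 := fun h => by
    rw [h, zero_pow (by omega)] at hηt; exact zero_ne_one hηt
  let G : (ZMod t → k) → X.carrier →ₗ[A.carrier] X.carrier := fun c =>
    DirectSum.toModule A.carrier (ZMod t) X.carrier (fun l => c l • (N l).subtype) ∘ₗ
      (LinearEquiv.ofBijective (DirectSum.coeLinearMap N) hN).symm.toLinearMap
  have hG : ∀ c l x, x ∈ N l → G c x = c l • x := by
    intro c l x hx
    have : (LinearEquiv.ofBijective (DirectSum.coeLinearMap N) hN).symm x =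
        DirectSum.lof A.carrier (ZMod t) (fun d => N d) l ⟨x, hx⟩ := by
      rw [LinearEquiv.symm_apply_eq]
      exact (DirectSum.coeLinearMap_lof N l ⟨x, hx⟩).symm
    simp [G, this]
  have hGk : ∀ (c : ZMod t → k) (e : k) x, G c (e • x) = e • G c x := fun c e x => by
    rw [← algebraMap_smul A.carrier e x, map_smul, algebraMap_smul]
  have ind : ∀ {p : X.carrier → Prop}, p 0 → (∀ l, ∀ x ∈ N l, p x) →
      (∀ a b, p a → p b → p (a + b)) → ∀ x, p x := fun h0 hl ha x =>
    Submodule.iSup_induction N (motive := _) (by rw [hN.submodule_iSup_eq_top]; trivial) hl h0 ha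
  have hGG : ∀ c c' : ZMod t → k, (∀ l, c l * c' l = 1) → ∀ x, G c (G c' x) = x := by
    intro c c' hcc
    refine ind (by simp) (fun l x hx => ?_) (fun a b ha hb => by rw [map_add, map_add, ha, hb])
    rw [hG c' l x hx, hGk, hG c l x hx, smul_smul, mul_comm (c' l), hcc, one_smul]
  have hGd : ∀ c d x, x ∈ X.deg d → G c x ∈ X.deg d := by
    intro c d x hx
    have key : ∀ x, G c (component X.internal d x) = component X.internal d (G c x) := by
      refine ind (by simp) (fun l x hx => ?_)
        (fun a b ha hb => by simp only [map_add, ha, hb])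
      have hcx : component X.internal d x ∈ (N l).restrictScalars k := by
        have hx' : x ∈ (N l).restrictScalars k := hx
        rw [hg l] at hx'
        refine Submodule.iSup_induction _
          (motive := fun x => component X.internal d x ∈ (N l).restrictScalars k) hx' ?_ ?_ ?_
        · rintro e y ⟨hy, hye⟩
          by_cases h : e = d
          · subst h; rwa [component_of_mem X.internal hye]
          · rw [component_of_mem_ne X.internal hye h]; exact zero_mem _
        · rw [map_zero]; exact zero_mem _
        · intro a b ha hb; rw [map_add]; exact add_mem ha hb
      rw [hG c l x hx, hG c l _ hcx, map_smul]
    rw [← component_of_mem X.internal hx, key]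
    exact component_mem _ _ _
  refine ⟨⟨G fun l => η ^ l.val, fun h => hGd _ _ _ h, ?_⟩, ?_⟩
  · have key : ∀ x, G (fun l => η ^ l.val) (X.σ x) = η • X.σ (G (fun l => η ^ l.val) x) := by
      refine ind (by simp) (fun l x hx => ?_)
        (fun a b ha hb => by simp only [map_add, ha, hb, smul_add])
      have hσx : X.σ x ∈ N (l + 1) := by
        have : X.σ x ∈ ((N l).restrictScalars k).map X.σ := ⟨x, hx, rfl⟩
        rw [hs l] at this
        exact this
      rw [hG _ l x hx, hG _ _ _ hσx, map_smul, smul_smul, ← pow_succ', ZMod.val_add,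
        ← pow_eq_pow_mod _ hηt, pow_add η l.val, ZMod.val_one_eq_one_mod, ← pow_eq_pow_mod _ hηt,
        pow_one, pow_succ]
    exact key
  · have hinv : ∀ l : ZMod t, (η ^ l.val)⁻¹ * η ^ l.val = 1 := fun l =>
      inv_mul_cancel₀ (pow_ne_zero _ hη0)
    have h1 := hGG (fun l => (η ^ l.val)⁻¹) (fun l => η ^ l.val) hinv
    have h2 := hGG (fun l => η ^ l.val) (fun l => (η ^ l.val)⁻¹) fun l => by
      rw [mul_comm]; exact hinv l
    exact ⟨fun x y h => by rw [← h1 x, ← h1 y]; exact congrArg _ h, fun x => ⟨_, h2 x⟩⟩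

end

section

open LaurentPolynomial (T)

section LaurentSums

variable {O : Type} [CommRing O]

/-- The Laurent polynomial with finitely many prescribed coefficients. -/
def gsum (h : ℤ → O) : O[T;T⁻¹] :=
  open scoped Classical in
  if hf : h.support.Finite then AddMonoidAlgebra.ofCoeff (Finsupp.ofSupportFinite h hf) else 0

theorem gsum_coeff {h : ℤ → O} (hf : h.support.Finite) (d : ℤ) : (gsum h).coeff d = h d := by
  rw [gsum, dif_pos hf]
  rfl

theorem laurent_ext {p q : O[T;T⁻¹]} (h : ∀ d, p.coeff d = q.coeff d) : p = q :=
  AddMonoidAlgebra.ext (Finsupp.ext h)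

theorem coeff_C_mul (c : O) (p : O[T;T⁻¹]) (d : ℤ) :
    (LaurentPolynomial.C c * p).coeff d = c * p.coeff d := by
  refine (AddMonoidAlgebra.coeff_single_mul_apply p c 0 d).trans ?_
  rw [neg_zero, zero_add]

theorem coeff_T_mul (s : ℤ) (p : O[T;T⁻¹]) (d : ℤ) :
    (T s * p).coeff d = p.coeff (d - s) := by
  refine (AddMonoidAlgebra.coeff_single_mul_apply p 1 s d).trans ?_
  rw [one_mul, neg_add_eq_sub]

theorem gsum_add {h h' : ℤ → O} (hf : h.support.Finite) (hf' : h'.support.Finite) :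
    gsum (fun d => h d + h' d) = gsum h + gsum h' := by
  have h2 : (fun d => h d + h' d).support.Finite :=
    (hf.union hf').subset (Function.support_add h h')
  refine laurent_ext fun d => ?_
  rw [gsum_coeff h2, AddMonoidAlgebra.coeff_add, Finsupp.add_apply, gsum_coeff hf, gsum_coeff hf']

theorem gsum_C_mul {h : ℤ → O} (hf : h.support.Finite) (c : O) :
    gsum (fun d => c * h d) = LaurentPolynomial.C c * gsum h := by
  have h2 : (fun d => c * h d).support.Finite :=
    hf.subset fun d hd h0 => hd (by simp only [h0, mul_zero])
  refine laurent_ext fun d => ?_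
  rw [gsum_coeff h2, coeff_C_mul, gsum_coeff hf]

theorem gsum_T_mul {h : ℤ → O} (hf : h.support.Finite) (s : ℤ) :
    gsum (fun d => h (d - s)) = T s * gsum h := by
  have h2 : (fun d => h (d - s)).support.Finite :=
    hf.preimage (f := fun d => d - s) (fun a _ b _ hab => sub_left_injective hab)
  refine laurent_ext fun d => ?_
  rw [gsum_coeff h2, coeff_T_mul, gsum_coeff hf]

end LaurentSums

theorem sum_range_shift {M : Type*} [AddCommMonoid M] (g : ℕ → M) (n : ℕ) (h : g n = g 0) :
    ∑ i ∈ Finset.range n, g (i + 1) = ∑ i ∈ Finset.range n, g i := by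
  cases n with
  | zero => simp
  | succ n => rw [Finset.sum_range_succ, h, ← Finset.sum_range_succ']

variable {k : Type u} [Field k] {n : ℕ} {A : FoldedAlg.{u, w} k n}

section Spectral

variable {M : Type*} [AddCommGroup M] [Module k M]

/-- The projector to the eigenspace for the eigenvalue `ω ^ i` of an endomorphism of order `n`. -/
def spectralProj (n : ℕ) (ω : k) (ψ : M →ₗ[k] M) (i : ℕ) : M →ₗ[k] M :=
  (n : k)⁻¹ • ∑ t ∈ Finset.range n, (ω ^ i)⁻¹ ^ t • ψ ^ t

theorem spectralProj_apply (ω : k) (ψ : M →ₗ[k] M) (i : ℕ) (y : M) :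
    spectralProj n ω ψ i y = (n : k)⁻¹ • ∑ t ∈ Finset.range n, (ω ^ i)⁻¹ ^ t • (ψ ^ t) y := by
  simp [spectralProj]

theorem map_spectralProj {ω : k} (hω : ω ^ n = 1) (hω0 : ω ≠ 0) (ψ : M →ₗ[k] M) (i : ℕ) {y : M}
    (hy : (ψ ^ n) y = y) : ψ (spectralProj n ω ψ i y) = ω ^ i • spectralProj n ω ψ i y := by
  rw [spectralProj_apply, map_smul, smul_comm (ω ^ i), map_sum]
  congr 1
  rw [Finset.smul_sum, ← sum_range_shift (fun t => ω ^ i • (ω ^ i)⁻¹ ^ t • (ψ ^ t) y)]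
  · refine Finset.sum_congr rfl fun t _ => ?_
    rw [map_smul, pow_succ' (ω ^ i)⁻¹, smul_smul (ω ^ i), ← mul_assoc,
      mul_inv_cancel₀ (pow_ne_zero _ hω0), one_mul, pow_succ' ψ, Module.End.mul_apply]
  · rw [hy, inv_pow, ← pow_mul, mul_comm i n, pow_mul, hω, one_pow, inv_one, pow_zero, pow_zero,
      Module.End.one_apply]

theorem sum_spectralProj {ω : k} (hω : IsPrimitiveRoot ω n) (hn : (n : k) ≠ 0) (ψ : M →ₗ[k] M)
    (y : M) : ∑ i ∈ Finset.range n, spectralProj n ω ψ i y = y := by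
  have hn0 : n ≠ 0 := by rintro rfl; simp at hn
  simp only [spectralProj_apply, ← Finset.smul_sum]
  rw [Finset.sum_comm]
  have h0 : 0 ∈ Finset.range n := Finset.mem_range.2 (Nat.pos_of_ne_zero hn0)
  rw [Finset.sum_eq_single_of_mem 0 h0]
  · simp only [pow_zero, Module.End.one_apply, one_smul, Finset.sum_const, Finset.card_range]
    rw [← Nat.cast_smul_eq_nsmul k, smul_smul, inv_mul_cancel₀ hn, one_smul]
  · intro t ht ht0
    rw [← Finset.sum_smul]
    have h1 : ω ^ t ≠ 1 := hω.pow_ne_one_of_pos_of_lt ht0 (Finset.mem_range.1 ht)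
    have h2 : (ω ^ t)⁻¹ ≠ 1 := fun h => h1 (inv_eq_one.1 h)
    have h3 : ∑ i ∈ Finset.range n, (ω ^ i)⁻¹ ^ t = ∑ i ∈ Finset.range n, ((ω ^ t)⁻¹) ^ i :=
      Finset.sum_congr rfl fun i _ => by rw [inv_pow, inv_pow, ← pow_mul, ← pow_mul, mul_comm]
    have h4 := geom_sum_mul (ω ^ t)⁻¹ n
    rw [inv_pow, ← pow_mul, mul_comm t n, pow_mul, hω.pow_eq_one, one_pow, inv_one, sub_self,
      mul_eq_zero, or_iff_left (sub_ne_zero.2 h2)] at h4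
    rw [h3, h4, zero_smul]

theorem spectralProj_of_eigen {ω : k} (hn : (n : k) ≠ 0) (hω0 : ω ≠ 0) (ψ : M →ₗ[k] M) {i : ℕ}
    {y : M} (hy : ψ y = ω ^ i • y) : spectralProj n ω ψ i y = y := by
  have h : ∀ t, (ψ ^ t) y = (ω ^ i) ^ t • y := fun t => by
    induction t with
    | zero => simp
    | succ t ih => rw [pow_succ', Module.End.mul_apply, ih, map_smul, hy, smul_smul, pow_succ]
  rw [spectralProj_apply]
  have : ∀ t ∈ Finset.range n, (ω ^ i)⁻¹ ^ t • (ψ ^ t) y = y := fun t _ => by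
    rw [h, smul_smul, ← mul_pow, inv_mul_cancel₀ (pow_ne_zero _ hω0), one_pow, one_smul]
  rw [Finset.sum_congr rfl this, Finset.sum_const, Finset.card_range, ← Nat.cast_smul_eq_nsmul k,
    smul_smul, inv_mul_cancel₀ hn, one_smul]

end Spectral

/-- The twisted powers of `v`, with the idempotent `e` as the power of exponent zero. -/
def twistedPow (A : FoldedAlg.{u, w} k n) (e v : A.carrier) : ℕ → A.carrier
  | 0 => e
  | t + 1 => v * A.aut (twistedPow A e v t)

/-- An idempotent `e` of degree zero with a descent datum `v`: the map `y ↦ v σ(y)` is an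
automorphism of order `n` of `e X`, for all objects `X`. -/
structure Frame (A : FoldedAlg.{u, w} k n) where
  e : A.carrier
  v : A.carrier
  e_mem : e ∈ A.deg 0
  v_mem : v ∈ A.deg 0
  e_mul_e : e * e = e
  e_mul_v : e * v = v
  v_mul_e : v * A.aut e = v
  pow_n : twistedPow A e v n = e

namespace Frame

variable (F : Frame A)

/-- The map `y ↦ v σ(y)`. -/
def ψ (X : Obj A) : X.carrier →ₗ[k] X.carrier := Algebra.lsmul k k X.carrier F.v ∘ₗ X.σ

theorem ψ_apply (X : Obj A) (y : X.carrier) : F.ψ X y = F.v • X.σ y := rfl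

theorem e_smul_ψ {X : Obj A} (y : X.carrier) : F.e • F.ψ X y = F.ψ X y := by
  rw [ψ_apply, smul_smul, F.e_mul_v]

theorem ψ_e_smul {X : Obj A} (y : X.carrier) : F.ψ X (F.e • y) = F.ψ X y := by
  rw [ψ_apply, X.σ_smul, smul_smul, F.v_mul_e, ψ_apply]

theorem ψ_mem {X : Obj A} {d : ℤ} {y : X.carrier} (h : y ∈ X.deg d) : F.ψ X y ∈ X.deg d := by
  have := X.smul_mem F.v_mem (X.σ_mem h)
  rwa [zero_add] at this

theorem e_smul_mem {X : Obj A} {d : ℤ} {y : X.carrier} (h : y ∈ X.deg d) : F.e • y ∈ X.deg d := by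
  have := X.smul_mem F.e_mem h
  rwa [zero_add] at this

theorem ψ_pow {X : Obj A} {y : X.carrier} (hy : F.e • y = y) (t : ℕ) :
    (F.ψ X ^ t) y = twistedPow A F.e F.v t • (⇑X.σ)^[t] y := by
  induction t with
  | zero => simp [twistedPow, hy]
  | succ t ih =>
    rw [pow_succ', Module.End.mul_apply, ih, ψ_apply, X.σ_smul, smul_smul,
      Function.iterate_succ_apply', twistedPow]

theorem ψ_pow_n {X : Obj A} {y : X.carrier} (hy : F.e • y = y) : (F.ψ X ^ n) y = y := by
  rw [F.ψ_pow hy, F.pow_n, X.σ_pow, hy]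

/-- The `ω ^ i`-eigenspace of `ψ` on the part of degree `d` of `e X`. -/
def eig (ω : k) (d : ℤ) (i : ℕ) (X : Obj A) : Submodule k X.carrier where
  carrier := {y | y ∈ X.deg d ∧ F.e • y = y ∧ F.v • X.σ y = ω ^ i • y}
  zero_mem' := ⟨zero_mem _, smul_zero _, by simp⟩
  add_mem' {a b} ha hb := ⟨add_mem ha.1 hb.1, by rw [smul_add, ha.2.1, hb.2.1], by
    rw [map_add, smul_add, ha.2.2, hb.2.2, smul_add]⟩
  smul_mem' c x hx := ⟨Submodule.smul_mem _ _ hx.1, by rw [smul_comm, hx.2.1], by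
    rw [map_smul, smul_comm, hx.2.2, smul_comm]⟩

theorem mem_eig {ω : k} {d : ℤ} {i : ℕ} {X : Obj A} {y : X.carrier} :
    y ∈ F.eig ω d i X ↔ y ∈ X.deg d ∧ F.e • y = y ∧ F.v • X.σ y = ω ^ i • y := Iff.rfl

theorem map_mem_eig {ω : k} {d : ℤ} {i : ℕ} {X Y : Obj A} (f : Hom X Y) {y : X.carrier}
    (h : y ∈ F.eig ω d i X) : f.map y ∈ F.eig ω d i Y :=
  ⟨f.map_mem h.1, by rw [← map_smul, h.2.1], by
    rw [← f.map_σ, ← map_smul, h.2.2, f.map_smul_base]⟩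

theorem eig_add_n {ω : k} (hω : ω ^ n = 1) (d : ℤ) (i : ℕ) (X : Obj A) :
    F.eig ω d (i + n) X = F.eig ω d i X := by
  ext y
  rw [mem_eig, mem_eig, pow_add, hω, mul_one]

theorem eig_twist {ω : k} (hω : ω ^ n = 1) (hω0 : ω ≠ 0) (d : ℤ) (i : ℕ) (X : Obj A) :
    F.eig ω d (i + 1) (X.twist ω hω) = F.eig ω d i X := by
  ext (y : X.carrier)
  have h1 : F.v • (ω • X.σ y) = ω • F.v • X.σ y := smul_comm _ _ _
  have h2 : ω ^ (i + 1) • y = ω • ω ^ i • y := by rw [smul_smul, pow_succ']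
  change (_ ∧ _ ∧ F.v • (ω • X.σ y) = ω ^ (i + 1) • y) ↔ _
  rw [h1, h2, smul_right_inj hω0]
  rfl

theorem eig_shift {ω : k} (d s : ℤ) (i : ℕ) (X : Obj A) :
    F.eig ω d i (X.shift s) = F.eig ω (d - s) i X := rfl

theorem spectralProj_mem {ω : k} (hω : ω ^ n = 1) (hω0 : ω ≠ 0) {d : ℤ} {X : Obj A}
    {y : X.carrier} (hy : y ∈ X.deg d) (he : F.e • y = y) (i : ℕ) :
    spectralProj n ω (F.ψ X) i y ∈ F.eig ω d i X := by
  have key : ∀ t, (F.ψ X ^ t) y ∈ X.deg d ∧ F.e • (F.ψ X ^ t) y = (F.ψ X ^ t) y := fun t => by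
    induction t with
    | zero => exact ⟨hy, he⟩
    | succ t ih =>
      rw [pow_succ', Module.End.mul_apply]
      exact ⟨F.ψ_mem ih.1, F.e_smul_ψ _⟩
  refine ⟨?_, ?_, map_spectralProj hω hω0 (F.ψ X) i (F.ψ_pow_n he)⟩
  · rw [spectralProj_apply]
    exact Submodule.smul_mem _ _ (sum_mem fun t _ => Submodule.smul_mem _ _ (key t).1)
  · rw [spectralProj_apply, smul_comm, Finset.smul_sum]
    congr 1
    refine Finset.sum_congr rfl fun t _ => ?_
    rw [smul_comm, (key t).2]

/-- A nonzero homogeneous element of `e X` gives rise to a nonzero eigenvector. -/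
theorem exists_eigenvector {ω : k} (hω : IsPrimitiveRoot ω n) (hn : (n : k) ≠ 0) {d : ℤ}
    {X : Obj A} {y : X.carrier} (hy : y ∈ X.deg d) (he : F.e • y = y) (h0 : y ≠ 0) :
    ∃ i, ∃ z ∈ F.eig ω d i X, z ≠ 0 := by
  have hn0 : n ≠ 0 := by rintro rfl; simp at hn
  by_contra! h
  apply h0
  rw [← sum_spectralProj hω hn (F.ψ X) y]
  exact Finset.sum_eq_zero fun i _ =>
    h i _ (F.spectralProj_mem hω.pow_eq_one (hω.ne_zero hn0) hy he i)

theorem hom_ψ {X Y : Obj A} (f : Hom X Y) (y : X.carrier) : f.map (F.ψ X y) = F.ψ Y (f.map y) := by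
  rw [ψ_apply, map_smul, f.map_σ, ψ_apply]

theorem hom_spectralProj {X Y : Obj A} (f : Hom X Y) (ω : k) (i : ℕ) (y : X.carrier) :
    f.map (spectralProj n ω (F.ψ X) i y) = spectralProj n ω (F.ψ Y) i (f.map y) := by
  have key : ∀ t, f.map ((F.ψ X ^ t) y) = (F.ψ Y ^ t) (f.map y) := fun t => by
    induction t with
    | zero => rfl
    | succ t ih =>
      rw [pow_succ', Module.End.mul_apply, hom_ψ, ih, pow_succ', Module.End.mul_apply]
  rw [spectralProj_apply, spectralProj_apply, f.map_smul_base, map_sum]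
  congr 1
  exact Finset.sum_congr rfl fun t _ => by rw [f.map_smul_base, key]

/-- Eigenvectors lift along epimorphisms. -/
theorem exists_lift_eig {ω : k} (hω : IsPrimitiveRoot ω n) (hn : (n : k) ≠ 0) {X Y : Obj A}
    (f : Hom X Y) (hf : Function.Surjective f.map) {d : ℤ} {i : ℕ} {y : Y.carrier}
    (hy : y ∈ F.eig ω d i Y) : ∃ x ∈ F.eig ω d i X, f.map x = y := by
  have hn0 : n ≠ 0 := by rintro rfl; simp at hn
  have hω0 := hω.ne_zero hn0
  obtain ⟨x, rfl⟩ := hf y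
  have h1 : f.map (F.e • component X.internal d x) = f.map x := by
    rw [map_smul, f.map_component, component_of_mem Y.internal hy.1, hy.2.1]
  refine ⟨spectralProj n ω (F.ψ X) i (F.e • component X.internal d x), ?_, ?_⟩
  · exact F.spectralProj_mem hω.pow_eq_one hω0 (F.e_smul_mem (component_mem _ _ _))
      (by rw [smul_smul, F.e_mul_e]) i
  · rw [hom_spectralProj, h1, spectralProj_of_eigen hn hω0]
    exact hy.2.2

theorem finrank_eig_of_iso {ω : k} {d : ℤ} {i : ℕ} {X Y : Obj A} (h : IsIso X Y) :
    Module.finrank k (F.eig ω d i X) = Module.finrank k (F.eig ω d i Y) := by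
  obtain ⟨f, hf⟩ := h
  let g : F.eig ω d i X →ₗ[k] F.eig ω d i Y :=
    (f.map.restrictScalars k).restrict fun y hy => F.map_mem_eig f hy
  refine (LinearEquiv.ofBijective g ⟨fun a b hab => Subtype.ext (hf.1 (congrArg Subtype.val hab)),
    fun y => ⟨⟨(f.inv hf).map y.1, F.map_mem_eig _ y.2⟩, Subtype.ext (f.apply_inv hf y.1)⟩⟩).finrank_eq

theorem finrank_eig_of_extension {ω : k} (hω : IsPrimitiveRoot ω n) (hn : (n : k) ≠ 0)
    {d : ℤ} {i : ℕ} {X X' X'' : Obj A} (h : IsExtension X X' X'')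
    [Module.Finite k (F.eig ω d i X)] :
    Module.finrank k (F.eig ω d i X) =
      Module.finrank k (F.eig ω d i X') + Module.finrank k (F.eig ω d i X'') := by
  obtain ⟨f, g, hf, hg, hfg⟩ := h
  let f' : F.eig ω d i X' →ₗ[k] F.eig ω d i X :=
    (f.map.restrictScalars k).restrict fun y hy => F.map_mem_eig f hy
  let g' : F.eig ω d i X →ₗ[k] F.eig ω d i X'' :=
    (g.map.restrictScalars k).restrict fun y hy => F.map_mem_eig g hy
  have hf' : Function.Injective f' :=
    fun a b hab => Subtype.ext (hf (congrArg Subtype.val hab))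
  have hg' : LinearMap.range g' = ⊤ := LinearMap.range_eq_top.2 fun y => by
    obtain ⟨x, hx, hxy⟩ := F.exists_lift_eig hω hn g hg y.2
    exact ⟨⟨x, hx⟩, Subtype.ext hxy⟩
  have hk : LinearMap.ker g' = LinearMap.range f' := by
    ext ⟨x, hx⟩
    constructor
    · intro h
      have h0 : g.map x = 0 := congrArg Subtype.val h
      rw [← LinearMap.mem_ker, ← hfg] at h0
      obtain ⟨x', hx'⟩ := h0
      refine ⟨⟨x', ?_, ?_, ?_⟩, Subtype.ext hx'⟩
      · have : x' = component X'.internal d x' := hf (by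
          rw [f.map_component, hx', component_of_mem X.internal hx.1])
        rw [this]; exact component_mem _ _ _
      · exact hf (by rw [map_smul, hx', hx.2.1])
      · exact hf (by rw [map_smul, f.map_σ, hx', hx.2.2, f.map_smul_base, hx'])
    · rintro ⟨x', hx'⟩
      have h1 : f.map x'.1 = x := congrArg Subtype.val hx'
      refine Subtype.ext (?_ : g.map x = 0)
      rw [← LinearMap.mem_ker, ← hfg]
      exact ⟨_, h1⟩
  rw [← LinearMap.finrank_range_add_finrank_ker g', hg', hk, finrank_top,
    LinearMap.finrank_range_of_inj hf', add_comm]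

/-! ### Characters -/

section Character

variable {O : Type} [CommRing O] (ζ : O) (ω : k) (s : ℤ)

/-- The coefficients of the character. -/
def charCoeff (X : Obj A) (d : ℤ) : O :=
  ∑ i ∈ Finset.range n, (Module.finrank k (F.eig ω (d + s) i X) : O) * ζ ^ i

/-- The graded dimension of `e X`, with the eigenvalues of `ψ` taken into account. -/
def char (X : Obj A) : O[T;T⁻¹] := gsum (F.charCoeff ζ ω s X)

theorem charCoeff_support {X : Obj A} (hX : IsFinDim X) :
    (F.charCoeff ζ ω s X).support.Finite := by
  have : Module.Finite k X.carrier := hX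
  refine ((finite_degrees X.internal).preimage (f := fun d => d + s)
    (fun a _ b _ hab => add_left_injective s hab)).subset fun d hd h => hd ?_
  refine Finset.sum_eq_zero fun i _ => ?_
  have : F.eig ω (d + s) i X = ⊥ := eq_bot_iff.2 fun y hy => by rw [← h]; exact hy.1
  rw [this, finrank_bot, Nat.cast_zero, zero_mul]

theorem char_of_iso {X Y : Obj A} (h : IsIso X Y) : F.char ζ ω s X = F.char ζ ω s Y := by
  have : F.charCoeff ζ ω s X = F.charCoeff ζ ω s Y := funext fun d =>
    Finset.sum_congr rfl fun i _ => by rw [F.finrank_eig_of_iso h]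
  rw [char, this, char]

theorem char_extension {ω : k} (hω : IsPrimitiveRoot ω n) (hn : (n : k) ≠ 0) {X X' X'' : Obj A}
    (hX : IsFinDim X) (hX' : IsFinDim X') (hX'' : IsFinDim X'') (h : IsExtension X X' X'') :
    F.char ζ ω s X = F.char ζ ω s X' + F.char ζ ω s X'' := by
  have : Module.Finite k X.carrier := hX
  have h1 : F.charCoeff ζ ω s X = fun d => F.charCoeff ζ ω s X' d + F.charCoeff ζ ω s X'' d := by
    funext d
    rw [charCoeff, charCoeff, charCoeff, ← Finset.sum_add_distrib]
    refine Finset.sum_congr rfl fun i _ => ?_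
    rw [F.finrank_eig_of_extension hω hn h, Nat.cast_add, add_mul]
  rw [char, h1, gsum_add (F.charCoeff_support ζ ω s hX') (F.charCoeff_support ζ ω s hX'')]
  rfl

theorem char_twist (hζ : ζ ^ n = 1) (hω : ω ^ n = 1) (hω0 : ω ≠ 0) {X : Obj A}
    (hX : IsFinDim X) :
    F.char ζ ω s (X.twist ω hω) = LaurentPolynomial.C ζ * F.char ζ ω s X := by
  rw [char, char, ← gsum_C_mul (F.charCoeff_support ζ ω s hX)]
  congr 1
  funext d
  rw [charCoeff, charCoeff, ← sum_range_shift, Finset.mul_sum]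
  · refine Finset.sum_congr rfl fun i _ => ?_
    rw [F.eig_twist hω hω0 (d + s) i X, pow_succ']
    exact mul_left_comm _ _ _
  · have h := F.eig_add_n hω (d + s) 0 (X.twist ω hω)
    rw [zero_add] at h
    rw [h, hζ, pow_zero]

theorem char_shift (d : ℤ) {X : Obj A} (hX : IsFinDim X) :
    F.char ζ ω s (X.shift d) = T d * F.char ζ ω s X := by
  rw [char, char, ← gsum_T_mul (F.charCoeff_support ζ ω s hX)]
  congr 1
  funext e
  rw [charCoeff, charCoeff]
  refine Finset.sum_congr rfl fun i _ => ?_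
  rw [eig_shift, add_sub_right_comm]
  rfl

end Character

end Frame

theorem Obj.twist_twist {X : Obj A} {c c' : k} (hc : c ^ n = 1) (hc' : c' ^ n = 1) :
    (X.twist c hc).twist c' hc' =
      X.twist (c' * c) (by rw [mul_pow, hc, hc', one_mul]) := by
  simp only [Obj.twist]
  congr 1
  exact smul_smul _ _ _

section Lift

variable {O : Type} [CommRing O] (ζ : O) (φ : O →+* k)

/-- A function on objects which respects the relations of the Grothendieck group, except possibly
for the vanishing on traceless objects. -/
structure IsEval {S : Obj A → Prop} (E : Obj A → Obj A → Obj A → Prop) {M : Type*}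
    [AddCommGroup M] [Module O[T;T⁻¹] M] (f : {X : Obj A // S X} → M) : Prop where
  iso : ∀ X Y, IsIso X.1 Y.1 → f X = f Y
  add : ∀ X X' X'', E X.1 X'.1 X''.1 → f X = f X' + f X''
  twist : ∀ (hω : φ ζ ^ n = 1) X Y, IsIso Y.1 (X.1.twist (φ ζ) hω) →
    f Y = (LaurentPolynomial.C ζ : O[T;T⁻¹]) • f X
  shift : ∀ X Y, IsIso Y.1 (X.1.shift 1) → f Y = (T 1 : O[T;T⁻¹]) • f X

variable {ζ φ} {S : Obj A → Prop} {E : Obj A → Obj A → Obj A → Prop} {M : Type*} [AddCommGroup M]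
  [Module O[T;T⁻¹] M]

theorem Obj.twist_pow_zero (X : Obj A) {c : k} (hc : (c ^ 0) ^ n = 1) :
    X.twist (c ^ 0) hc = X := by
  simp [Obj.twist]

theorem Obj.twist_pow_succ (X : Obj A) {c : k} (hc : c ^ n = 1) {m : ℕ}
    (h : (c ^ m) ^ n = 1) (h' : (c ^ (m + 1)) ^ n = 1) :
    X.twist (c ^ (m + 1)) h' = (X.twist (c ^ m) h).twist c hc := by
  rw [Obj.twist_twist]
  simp only [pow_succ']

theorem Obj.shift_shift (X : Obj A) (a b : ℤ) : (X.shift a).shift b = X.shift (b + a) := by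
  have : ∀ i : ℤ, i - b - a = i - (b + a) := fun i => by ring
  simp only [Obj.shift, this]

theorem Obj.shift_zero (X : Obj A) : X.shift 0 = X := by
  simp [Obj.shift]

theorem IsEval.twist_pow {f : {X : Obj A // S X} → M} (hf : IsEval ζ φ E f) (hω : φ ζ ^ n = 1)
    (hS : ∀ X, S X → S (X.twist (φ ζ) hω)) (X : {X : Obj A // S X}) (m : ℕ)
    (hc : (φ ζ ^ m) ^ n = 1) : ∃ hm : S (X.1.twist (φ ζ ^ m) hc),
      f ⟨_, hm⟩ = (LaurentPolynomial.C (ζ ^ m) : O[T;T⁻¹]) • f X := by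
  induction m with
  | zero =>
    have hS' : S (X.1.twist (φ ζ ^ 0) hc) := by rw [Obj.twist_pow_zero]; exact X.2
    have : (⟨_, hS'⟩ : {X : Obj A // S X}) = X := Subtype.ext (Obj.twist_pow_zero X.1 hc)
    refine ⟨hS', ?_⟩
    rw [this, pow_zero, map_one, one_smul]
  | succ m ih =>
    have hcm : (φ ζ ^ m) ^ n = 1 := by rw [← pow_mul, mul_comm, pow_mul, hω, one_pow]
    obtain ⟨h1, h2⟩ := ih hcm
    have hS' : S (X.1.twist (φ ζ ^ (m + 1)) hc) := by
      rw [X.1.twist_pow_succ hω hcm hc]; exact hS _ h1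
    refine ⟨hS', ?_⟩
    rw [hf.twist hω ⟨_, h1⟩ ⟨_, hS'⟩ (by
      change IsIso (X.1.twist (φ ζ ^ (m + 1)) hc) ((X.1.twist (φ ζ ^ m) hcm).twist (φ ζ) hω)
      rw [X.1.twist_pow_succ hω hcm hc]; exact IsIso.refl _),
      h2, smul_smul, ← map_mul, ← pow_succ']

theorem IsEval.shift_int {f : {X : Obj A // S X} → M} (hf : IsEval ζ φ E f)
    (hS : ∀ X d, S X → S (X.shift d)) (X : {X : Obj A // S X}) (d : ℤ) :
    f ⟨_, hS X.1 d X.2⟩ = (T d : O[T;T⁻¹]) • f X := by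
  have step : ∀ d, f ⟨_, hS X.1 (1 + d) X.2⟩ =
      (T 1 : O[T;T⁻¹]) • f ⟨_, hS X.1 d X.2⟩ := fun d =>
    hf.shift _ _ (by rw [Obj.shift_shift]; exact IsIso.refl _)
  induction d with
  | zero =>
    rw [LaurentPolynomial.T_zero, one_smul]
    exact hf.iso _ _ (by simp only [Obj.shift_zero]; exact IsIso.refl _)
  | succ i ih =>
    have h := step i
    rw [ih, smul_smul, ← LaurentPolynomial.T_add] at h
    simpa only [add_comm] using h
  | pred i ih =>
    have h := step (-(i : ℤ) - 1)
    simp only [add_sub_cancel] at h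
    rw [ih] at h
    rw [sub_eq_add_neg, add_comm, LaurentPolynomial.T_add, mul_smul, h, smul_smul,
      ← LaurentPolynomial.T_add, neg_add_cancel, LaurentPolynomial.T_zero, one_smul,
      add_comm, ← sub_eq_add_neg]

theorem IsEval.ts {f : {X : Obj A // S X} → M} (hf : IsEval ζ φ E f) (hω : φ ζ ^ n = 1)
    (hS : ∀ X, S X → S (X.twist (φ ζ) hω)) (hS' : ∀ X d, S X → S (X.shift d))
    (X Y : {X : Obj A // S X}) (d : ℤ) (i : ℕ) (h : IsIso Y.1 (X.1.ts hω d i)) :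
    f Y = (LaurentPolynomial.C (ζ ^ i) * T d : O[T;T⁻¹]) • f X := by
  obtain ⟨h1, h2⟩ := hf.twist_pow hω hS X i
    (by rw [← pow_mul, mul_comm, pow_mul, hω, one_pow])
  rw [hf.iso Y ⟨_, hS' _ d h1⟩ h, hf.shift_int hS' ⟨_, h1⟩, h2, smul_smul, mul_comm]

variable (ζ φ S E) in
theorem isEval_mk (hS : ∀ X d, S X → S (X.shift d)) :
    IsEval ζ φ E (M := KGroup ζ φ S E)
      fun X => Submodule.Quotient.mk (Finsupp.single X (1 : O[T;T⁻¹])) := by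
  have key : ∀ z, KRel ζ φ S E z → (Submodule.Quotient.mk z : KGroup ζ φ S E) = 0 := fun z hz =>
    (Submodule.Quotient.mk_eq_zero _).2 (Submodule.subset_span hz)
  have hsh : ∀ X Y : {X : Obj A // S X}, IsIso Y.1 (X.1.shift 1) →
      (Submodule.Quotient.mk (Finsupp.single Y (1 : O[T;T⁻¹])) : KGroup ζ φ S E) =
        (T 1 : O[T;T⁻¹]) •
          Submodule.Quotient.mk (Finsupp.single X (1 : O[T;T⁻¹])) := fun X Y h => by
    have := key _ (KRel.shift X Y h)
    rw [Submodule.Quotient.mk_sub, sub_eq_zero] at this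
    rw [this, ← Submodule.Quotient.mk_smul, Finsupp.smul_single, smul_eq_mul, mul_one]
  refine ⟨fun X Y h => ?_, fun X X' X'' h => ?_, fun hω X Y h => ?_, hsh⟩
  · have h1 : IsIso X.1 ((Y.1.shift (-1)).shift 1) := by
      rw [Obj.shift_shift, add_neg_cancel, Obj.shift_zero]; exact h
    have h2 : IsIso Y.1 ((Y.1.shift (-1)).shift 1) := by
      rw [Obj.shift_shift, add_neg_cancel, Obj.shift_zero]; exact IsIso.refl _
    exact (hsh ⟨_, hS _ (-1) Y.2⟩ X h1).trans (hsh ⟨_, hS _ (-1) Y.2⟩ Y h2).symm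
  · have := key _ (KRel.add X X' X'' h)
    rwa [sub_sub, Submodule.Quotient.mk_sub, sub_eq_zero, Submodule.Quotient.mk_add] at this
  · have := key _ (KRel.twist X Y hω h)
    rw [Submodule.Quotient.mk_sub, sub_eq_zero] at this
    rw [this, ← Submodule.Quotient.mk_smul, Finsupp.smul_single, smul_eq_mul, mul_one]

/-- Additive functions on objects induce linear maps on Grothendieck groups. -/
theorem IsEval.exists_linear {f : {X : Obj A // S X} → M} (hf : IsEval ζ φ E f) (hn : n ≠ 0)
    (hω : φ ζ ^ n = 1)
    (htors : ∀ m, 0 < m → m < n → ∀ x : M,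
      (LaurentPolynomial.C (ζ ^ m) : O[T;T⁻¹]) • x = x → x = 0)
    (hS : ∀ X, S X → S (X.twist (φ ζ) hω)) :
    ∃ F : KGroup ζ φ S E →ₗ[O[T;T⁻¹]] M,
      ∀ X, F (Submodule.Quotient.mk (Finsupp.single X 1)) = f X := by
  have key : ∀ z, KRel ζ φ S E z → Finsupp.linearCombination O[T;T⁻¹] f z = 0 := by
    intro z hz
    cases hz with
    | add X X' X'' h => simp [hf.add X X' X'' h]
    | twist X Y hc h => simp [hf.twist hω X Y h]
    | shift X Y h => simp [hf.shift X Y h]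
    | traceless X h =>
      obtain ⟨m, hm, hmn, h⟩ := h.iso_twist hn hω
      have hc : (φ ζ ^ m) ^ n = 1 := by rw [← pow_mul, mul_comm, pow_mul, hω, one_pow]
      obtain ⟨h1, h2⟩ := hf.twist_pow hω hS X m hc
      have h3 := hf.iso X ⟨_, h1⟩ (h hc)
      rw [h2] at h3
      simpa using htors m hm hmn _ h3.symm
  refine ⟨Submodule.liftQ _ (Finsupp.linearCombination O[T;T⁻¹] f) (Submodule.span_le.2 key),
    fun X => ?_⟩
  refine (Submodule.liftQ_apply _ _ _).trans ?_
  simp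

end Lift

end

section

variable {k : Type u} [Field k] {n : ℕ} {A : FoldedAlg.{u, w} k n}

theorem exists_factor {R M N P : Type*} [Ring R] [AddCommGroup M] [Module R M] [AddCommGroup N]
    [Module R N] [AddCommGroup P] [Module R P] (f : M →ₗ[R] N) (hf : Function.Surjective f)
    (g : M →ₗ[R] P) (h : ∀ m, f m = 0 → g m = 0) : ∃ p : N →ₗ[R] P, ∀ m, p (f m) = g m := by
  refine ⟨Submodule.liftQ (LinearMap.ker f) g (fun m hm => h m hm) ∘ₗ
    (f.quotKerEquivOfSurjective hf).symm.toLinearMap, fun m => ?_⟩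
  have : (f.quotKerEquivOfSurjective hf).symm (f m) = (LinearMap.ker f).mkQ m := by
    rw [LinearEquiv.symm_apply_eq]; rfl
  rw [LinearMap.comp_apply, LinearEquiv.coe_coe, this]
  rfl

theorem component_smul (X : Obj A) {a : A.carrier} {c : ℤ} (ha : a ∈ A.deg c) (d : ℤ)
    (m : X.carrier) : component X.internal (d + c) (a • m) = a • component X.internal d m :=
  component_map X.internal X.internal c (DistribSMul.toAddMonoidHom X.carrier a)
    (fun d m hm => by
      have := X.smul_mem ha hm
      rwa [add_comm] at this) d m

theorem component_smul_of_mem (X : Obj A) {m : X.carrier} {c : ℤ} (hm : m ∈ X.deg c) (d : ℤ)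
    (a : A.carrier) : component X.internal (d + c) (a • m) = component A.internal d a • m :=
  component_map A.internal X.internal c
    ((LinearMap.toSpanSingleton A.carrier X.carrier m).toAddMonoidHom)
    (fun _ _ ha => X.smul_mem ha hm) d a

/-- The twisted power of exponent `n - 1`, moved by the automorphism: the inverse of `v`. -/
def Frame.u (F : Frame A) : A.carrier := A.aut (twistedPow A F.e F.v (n - 1))

theorem Frame.v_mul_u (F : Frame A) (hn : n ≠ 0) : F.v * F.u = F.e := by
  have h : twistedPow A F.e F.v (n - 1 + 1) = F.e := by
    rw [Nat.sub_add_cancel (Nat.one_le_iff_ne_zero.2 hn), F.pow_n]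
  exact h

theorem Frame.u_mul_v (F : Frame A) (hn : n ≠ 0) : F.u * F.v = A.aut F.e := by
  have key : ∀ t, twistedPow A F.e F.v t * (⇑A.aut)^[t] F.v = twistedPow A F.e F.v (t + 1) := by
    intro t
    induction t with
    | zero => simp [twistedPow, F.e_mul_v, F.v_mul_e]
    | succ t ih =>
      rw [twistedPow, Function.iterate_succ_apply', mul_assoc, ← map_mul, ih]
      rfl
  have h := key (n - 1)
  rw [show n - 1 + 1 = n by omega, F.pow_n] at h
  have h2 := congrArg A.aut h
  rw [map_mul, ← Function.iterate_succ_apply' (f := A.aut), show (n - 1).succ = n by omega,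
    A.aut_pow] at h2
  exact h2

theorem Frame.u_mem (F : Frame A) : F.u ∈ A.deg 0 := by
  refine A.aut_mem ?_
  induction n - 1 with
  | zero => exact F.e_mem
  | succ t ih =>
    have := A.mul_mem F.v_mem (A.aut_mem ih)
    rwa [zero_add] at this

/-- An eigenvector determines its image under `σ`. -/
theorem Frame.σ_of_mem_eig (F : Frame A) (hn : n ≠ 0) {ω : k} {d : ℤ} {i : ℕ} {X : Obj A}
    {y : X.carrier} (hy : y ∈ F.eig ω d i X) : X.σ y = ω ^ i • F.u • y := by
  rw [smul_comm, ← hy.2.2, smul_smul, F.u_mul_v hn, ← X.σ_smul, hy.2.1]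

/-- A module map from an object generated by one eigenvector, taking it to an eigenvector. -/
def Frame.homOfEig (F : Frame A) (hn : n ≠ 0) {ω : k} {d : ℤ} {i : ℕ} {X Y : Obj A}
    {x : X.carrier} (hx : x ∈ F.eig ω d i X) (hgen : ∀ m : X.carrier, ∃ a : A.carrier, m = a • x)
    (f : X.carrier →ₗ[A.carrier] Y.carrier) (hf : f x ∈ F.eig ω d i Y) : Hom X Y where
  map := f
  map_mem {e m} hm := by
    obtain ⟨a, rfl⟩ := hgen m
    have h1 := component_smul_of_mem X hx.1 (e - d) a
    rw [sub_add_cancel, component_of_mem X.internal hm] at h1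
    rw [h1, map_smul]
    have := Y.smul_mem (component_mem A.internal (e - d) a) hf.1
    rwa [sub_add_cancel] at this
  map_σ m := by
    obtain ⟨a, rfl⟩ := hgen m
    have h : f (ω ^ i • F.u • x) = ω ^ i • F.u • f x := by
      rw [← algebraMap_smul A.carrier (ω ^ i), map_smul, map_smul, algebraMap_smul]
    rw [X.σ_smul, map_smul, map_smul, Y.σ_smul, F.σ_of_mem_eig hn hx, F.σ_of_mem_eig hn hf, h]

/-- An idempotent frame generating the algebra as a two-sided ideal, such that `e A e` lives in
non-negative degrees, with scalars only in degree zero. -/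
structure Core (A : FoldedAlg.{u, w} k n) extends Frame A where
  neg : ∀ d < 0, ∀ a ∈ A.deg d, e * a * e = 0
  zero : ∀ a ∈ A.deg 0, ∃ c : k, e * a * e = c • e
  full : (1 : A.carrier) ∈ Submodule.span k {z | ∃ a b, z = a * e * b}

namespace Core

variable (F : Core A)

theorem mem_of {X : Obj A} (N : Submodule A.carrier X.carrier) {y : X.carrier}
    (h : ∀ a : A.carrier, F.e • a • y ∈ N) : y ∈ N := by
  rw [← one_smul A.carrier y]
  refine Submodule.span_induction (p := fun z _ => z • y ∈ N) ?_ ?_ ?_ ?_ F.full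
  · rintro _ ⟨a, b, rfl⟩
    rw [mul_assoc, mul_smul, mul_smul]
    exact N.smul_mem _ (h b)
  · rw [zero_smul]; exact N.zero_mem
  · intro a b _ _ ha hb
    rw [add_smul]; exact N.add_mem ha hb
  · intro c a _ ha
    rw [smul_assoc, ← algebraMap_smul A.carrier c]; exact N.smul_mem _ ha

theorem eq_zero_of {X : Obj A} {y : X.carrier} (h : ∀ a : A.carrier, F.e • a • y = 0) : y = 0 := by
  have := F.mem_of (X := X) (y := y) ⊥ (fun a => (Submodule.mem_bot _).2 (h a))
  exact (Submodule.mem_bot _).1 this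

end Core

/-- An object `L` with `e L` spanned by one eigenvector `x` with eigenvalue `1`, of degree `s`. -/
structure Cover (F : Core A) (L : Obj A) (s : ℤ) where
  x : L.carrier
  x_mem : x ∈ L.deg s
  x_ne : x ≠ 0
  e_x : F.e • x = x
  ψ_x : F.v • L.σ x = x
  span : ∀ y : L.carrier, ∃ c : k, F.e • y = c • x

namespace Cover

variable {F : Core A} {L : Obj A} {s : ℤ} (C : Cover F L s)

include C in
theorem eig_x (ω : k) : C.x ∈ F.eig ω s 0 L :=
  ⟨C.x_mem, C.e_x, by rw [C.ψ_x, pow_zero, one_smul]⟩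

theorem generates (y : L.carrier) : ∃ a : A.carrier, y = a • C.x := by
  have : y ∈ A.carrier ∙ C.x := F.mem_of _ fun a => by
    obtain ⟨c, hc⟩ := C.span (a • y)
    rw [hc, ← algebraMap_smul A.carrier c]
    exact Submodule.smul_mem _ _ (Submodule.mem_span_singleton_self _)
  obtain ⟨a, ha⟩ := Submodule.mem_span_singleton.1 this
  exact ⟨a, ha.symm⟩

include C in
theorem isFinDim : IsFinDim L := by
  have key : ∀ z : A.carrier, z ∈ Submodule.span k {z | ∃ a b, z = a * F.e * b} →
      ∃ N : Submodule k L.carrier, Module.Finite k N ∧ ∀ y : L.carrier, z • y ∈ N := by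
    intro z hz
    refine Submodule.span_induction (p := fun z _ => ∃ N : Submodule k L.carrier,
      Module.Finite k N ∧ ∀ y : L.carrier, z • y ∈ N) ?_ ?_ ?_ ?_ hz
    · rintro _ ⟨a, b, rfl⟩
      refine ⟨k ∙ (a • C.x), inferInstance, fun y => ?_⟩
      obtain ⟨c, hc⟩ := C.span (b • y)
      rw [mul_assoc, mul_smul, mul_smul, hc, smul_comm]
      exact Submodule.smul_mem _ _ (Submodule.mem_span_singleton_self _)
    · exact ⟨⊥, inferInstance, fun y => by rw [zero_smul]; exact zero_mem _⟩
    · rintro a b _ _ ⟨N, hN, h⟩ ⟨N', hN', h'⟩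
      refine ⟨N ⊔ N', inferInstance, fun y => ?_⟩
      rw [add_smul]
      exact add_mem (Submodule.mem_sup_left (h y)) (Submodule.mem_sup_right (h' y))
    · rintro c a _ ⟨N, hN, h⟩
      exact ⟨N, hN, fun y => by rw [smul_assoc]; exact N.smul_mem c (h y)⟩
  obtain ⟨N, hN, h⟩ := key 1 F.full
  have : N = ⊤ := eq_top_iff.2 fun y _ => by rw [← one_smul A.carrier y]; exact h y
  subst this
  exact Module.finite_def.2 (Module.Finite.iff_fg.1 hN)

theorem exists_smul_eq {y : L.carrier} (hy : y ≠ 0) : ∃ a : A.carrier, a • y = C.x := by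
  by_contra! h
  refine hy (F.eq_zero_of fun a => ?_)
  obtain ⟨c, hc⟩ := C.span (a • y)
  by_contra h0
  have hc0 : c ≠ 0 := by rintro rfl; exact h0 (by rw [hc, zero_smul])
  refine h (c⁻¹ • (F.e * a)) ?_
  rw [smul_assoc, mul_smul, hc, inv_smul_smul₀ hc0]

include C in
theorem injective {Y : Obj A} (f : L.carrier →ₗ[A.carrier] Y.carrier) (h : f C.x ≠ 0) :
    Function.Injective f := by
  rw [← LinearMap.ker_eq_bot, eq_bot_iff]
  intro y hy
  by_contra hy0
  obtain ⟨a, ha⟩ := C.exists_smul_eq (y := y) hy0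
  refine h ?_
  rw [← ha, map_smul, LinearMap.mem_ker.1 hy, smul_zero]

include C in
theorem eq_zero_of_mem {d : ℤ} (hd : d ≠ s) {y : L.carrier} (hy : y ∈ L.deg d)
    (he : F.e • y = y) : y = 0 := by
  obtain ⟨c, hc⟩ := C.span y
  rw [he] at hc
  exact eq_zero_of_mem_of_ne L.internal hy (hc ▸ Submodule.smul_mem _ c C.x_mem) hd

include C in
theorem exists_map {Y : Obj A} {y : Y.carrier} (hy : F.e • y = y)
    (htop : ∀ d > 0, ∀ a ∈ A.deg d, F.e • a • y = 0) :
    ∃ f : L.carrier →ₗ[A.carrier] Y.carrier, f C.x = y := by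
  have key : ∀ b : A.carrier, b • C.x = 0 → b • y = 0 := by
    intro b hb
    refine F.eq_zero_of fun a => ?_
    have hcx : ∀ d, component A.internal d (a * b) • C.x =
        component L.internal (d + s) ((a * b) • C.x) := fun d =>
      (component_smul_of_mem L C.x_mem d (a * b)).symm
    have h0 : ∀ d, F.e • component A.internal d (a * b) • y = 0 := by
      intro d
      rcases lt_trichotomy d 0 with hd | rfl | hd
      · rw [← hy, smul_smul, smul_smul, F.neg d hd _ (component_mem _ _ _), zero_smul]
      · obtain ⟨c, hc⟩ := F.zero _ (component_mem A.internal 0 (a * b))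
        have h1 : c • C.x = 0 := by
          have : (F.e * component A.internal 0 (a * b) * F.e) • C.x = 0 := by
            rw [mul_smul, mul_smul, C.e_x, hcx, mul_smul, hb, smul_zero, map_zero, smul_zero]
          rwa [hc, smul_assoc, C.e_x] at this
        have hc0 : c = 0 := (smul_eq_zero.1 h1).resolve_right C.x_ne
        rw [← hy, smul_smul, smul_smul, hc, hc0, zero_smul, zero_smul]
      · exact htop d hd _ (component_mem _ _ _)
    rw [smul_smul a, ← sum_component A.internal (a * b), Finset.sum_smul, Finset.smul_sum]
    exact Finset.sum_eq_zero fun d _ => h0 d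
  obtain ⟨p, hp⟩ := exists_factor (LinearMap.toSpanSingleton A.carrier L.carrier C.x)
    (fun y => by obtain ⟨a, rfl⟩ := C.generates y; exact ⟨a, rfl⟩)
    (LinearMap.toSpanSingleton A.carrier Y.carrier y) key
  refine ⟨p, ?_⟩
  have := hp 1
  simpa using this

/-- The generator of a twist and shift. -/
theorem eig_ts {ω : k} (hω : ω ^ n = 1) (d : ℤ) (i : ℕ) :
    C.x ∈ F.eig ω (s + d) i (L.ts hω d i) := by
  refine ⟨?_, C.e_x, ?_⟩
  · change C.x ∈ L.deg (s + d - d)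
    rw [add_sub_cancel_right]; exact C.x_mem
  · change F.v • (ω ^ i • L.σ C.x) = ω ^ i • C.x
    rw [smul_comm, C.ψ_x]

/-- An eigenvector killed by the positive part of `e A e` gives a morphism. -/
theorem exists_hom (hn : n ≠ 0) {ω : k} (hω : ω ^ n = 1) {Y : Obj A} {y : Y.carrier} {d : ℤ}
    {i : ℕ} (hy : y ∈ F.eig ω (s + d) i Y) (htop : ∀ d > 0, ∀ a ∈ A.deg d, F.e • a • y = 0) :
    ∃ f : Hom (L.ts hω d i) Y, f.map C.x = y := by
  obtain ⟨f, hf⟩ := C.exists_map hy.2.1 htop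
  exact ⟨F.homOfEig hn (C.eig_ts hω d i) (C.generates) f (by rw [← hf] at hy; exact hy), hf⟩

include C in
/-- A nonzero finite dimensional object has a subobject which is a twist and shift of `L`. -/
theorem exists_injective (hn : (n : k) ≠ 0) {ω : k} (hω : IsPrimitiveRoot ω n)
    {X : Obj A} (hX : IsFinDim X) [Nontrivial X.carrier] :
    ∃ (d : ℤ) (i : ℕ) (f : Hom (L.ts hω.pow_eq_one d i) X), Function.Injective f.map := by
  have hn0 : n ≠ 0 := by rintro rfl; simp at hn
  have : Module.Finite k X.carrier := hX
  obtain ⟨y, hy⟩ := exists_ne (0 : X.carrier)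
  have hS : {d | ∃ z ∈ X.deg d, F.e • z = z ∧ z ≠ 0}.Finite :=
    (finite_degrees X.internal).subset fun d ⟨z, hz, _, h0⟩ h => h0 (by rw [h] at hz; exact hz)
  have hne : {d | ∃ z ∈ X.deg d, F.e • z = z ∧ z ≠ 0}.Nonempty := by
    by_contra hemp
    refine hy (F.eq_zero_of fun a => ?_)
    refine eq_zero_of_component X.internal fun d => ?_
    by_contra h0
    refine hemp ⟨d, _, component_mem X.internal d _, ?_, h0⟩
    have := component_smul X F.e_mem d (F.e • a • y)
    rw [add_zero, smul_smul F.e, F.e_mul_e] at this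
    exact this.symm
  obtain ⟨d, ⟨z, hz, hze, hz0⟩, hd⟩ := hS.exists_maximal hne
  obtain ⟨i, z', hz', hz0'⟩ := F.exists_eigenvector hω hn hz hze hz0
  have htop : ∀ d > 0, ∀ a ∈ A.deg d, F.e • a • z' = 0 := by
    intro d' hd' a ha
    by_contra h0
    have h1 : d' + d ∈ {d | ∃ z ∈ X.deg d, F.e • z = z ∧ z ≠ 0} :=
      ⟨F.e • a • z', F.e_smul_mem (X.smul_mem ha hz'.1), by rw [smul_smul, F.e_mul_e], h0⟩
    have h2 : d' + d ≤ d := hd h1 (by omega)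
    omega
  obtain ⟨f, hf⟩ := C.exists_hom hn0 hω.pow_eq_one (d := d - s) (i := i) (Y := X) (y := z')
    (by rw [add_sub_cancel]; exact hz') htop
  exact ⟨d - s, i, f, C.injective (Y := X) f.map (fun h => hz0' (hf.symm.trans h))⟩

section Character

variable {O : Type} [CommRing O] (ζ : O)

include C in
theorem char_self {ω : k} (hω : IsPrimitiveRoot ω n) (hn : n ≠ 0) : F.char ζ ω s L = 1 := by
  refine laurent_ext fun d => ?_
  rw [Frame.char, gsum_coeff (F.charCoeff_support ζ ω s C.isFinDim), ← LaurentPolynomial.T_zero,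
    LaurentPolynomial.T_apply, Frame.charCoeff]
  split_ifs with h
  · subst h
    have h0 : 0 ∈ Finset.range n := Finset.mem_range.2 (Nat.pos_of_ne_zero hn)
    rw [Finset.sum_eq_single_of_mem 0 h0]
    · have : F.eig ω (0 + s) 0 L = k ∙ C.x := by
        refine le_antisymm (fun y hy => ?_) ?_
        · obtain ⟨c, hc⟩ := C.span y
          rw [hy.2.1] at hc
          exact Submodule.mem_span_singleton.2 ⟨c, hc.symm⟩
        · rw [Submodule.span_singleton_le_iff_mem, zero_add]
          exact C.eig_x ω
      rw [this, finrank_span_singleton C.x_ne]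
      simp
    · intro i hi hi0
      have : F.eig ω (0 + s) i L = ⊥ := by
        refine eq_bot_iff.2 fun y hy => (Submodule.mem_bot _).2 ?_
        obtain ⟨c, hc⟩ := C.span y
        rw [hy.2.1] at hc
        have h1 : F.v • L.σ y = y := by rw [hc, map_smul, smul_comm, C.ψ_x]
        have h2 := hy.2.2
        rw [h1, eq_comm, ← sub_eq_zero] at h2
        have h3 : (ω ^ i - 1) • y = 0 := by rw [sub_smul, one_smul, h2]
        exact (smul_eq_zero.1 h3).resolve_left
          (sub_ne_zero.2 (hω.pow_ne_one_of_pos_of_lt hi0 (Finset.mem_range.1 hi)))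
      rw [this, finrank_bot, Nat.cast_zero, zero_mul]
  · refine Finset.sum_eq_zero fun i _ => ?_
    have : F.eig ω (d + s) i L = ⊥ :=
      eq_bot_iff.2 fun y hy => C.eq_zero_of_mem (fun h' => h (by omega)) hy.1 hy.2.1
    rw [this, finrank_bot, Nat.cast_zero, zero_mul]

end Character

end Cover

section Evaluation

variable {O : Type} [CommRing O] {ζ : O} {φ : O →+* k}

theorem IsFinDim.twist {X : Obj A} {c : k} {hc : c ^ n = 1} (h : IsFinDim X) :
    IsFinDim (X.twist c hc) := h

theorem IsFinDim.shift {X : Obj A} {d : ℤ} (h : IsFinDim X) : IsFinDim (X.shift d) := h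

theorem Frame.char_isEval (F : Frame A) (hω : IsPrimitiveRoot (φ ζ) n) (hζ : ζ ^ n = 1)
    (hn : (n : k) ≠ 0) (s : ℤ) :
    IsEval ζ φ IsExtension (S := IsFinDim (A := A)) fun X => F.char ζ (φ ζ) s X.1 where
  iso X Y h := F.char_of_iso _ _ _ h
  add X X' X'' h := F.char_extension ζ s hω hn X.2 X'.2 X''.2 h
  twist hω' X Y h := by
    have hn0 : n ≠ 0 := by rintro rfl; simp at hn
    rw [F.char_of_iso _ _ _ h, F.char_twist ζ (φ ζ) s hζ hω' (hω.ne_zero hn0) X.2, smul_eq_mul]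
  shift X Y h := by rw [F.char_of_iso _ _ _ h, F.char_shift _ _ _ _ X.2, smul_eq_mul]

variable {M : Type*} [AddCommGroup M] [Module O[T;T⁻¹] M]

theorem finrank_quotient_lt {R M : Type*} [Ring R] [Algebra k R] [AddCommGroup M] [Module k M]
    [Module R M] [IsScalarTower k R M] [Module.Finite k M] (N : Submodule R M) (hN : N ≠ ⊥) :
    Module.finrank k (M ⧸ N) < Module.finrank k M := by
  have h1 : Module.finrank k (N.restrictScalars k) ≠ 0 := fun h0 => hN <| by
    have h2 := Submodule.finrank_eq_zero.1 h0
    rwa [Submodule.restrictScalars_eq_bot_iff] at h2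
  have h4 := Submodule.finrank_quotient_add_finrank (N.restrictScalars k)
  have h5 := (Submodule.Quotient.restrictScalarsEquiv k N).finrank_eq
  omega

theorem IsFinDim.of_surjective {X Y : Obj A} (f : Hom X Y) (hf : Function.Surjective f.map)
    (hX : IsFinDim X) : IsFinDim Y := by
  have : Module.Finite k X.carrier := hX
  exact Module.Finite.of_surjective (f.map.restrictScalars k) hf

/-- The cokernel of a morphism. -/
def Hom.coker {X Y : Obj A} (f : Hom X Y) : Obj A :=
  Y.quot (LinearMap.range f.map) f.range_graded f.range_σ

/-- The projection to the cokernel. -/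
def Hom.toCoker {X Y : Obj A} (f : Hom X Y) : Hom Y f.coker :=
  Y.quotMk (LinearMap.range f.map) f.range_graded f.range_σ

theorem Hom.toCoker_surjective {X Y : Obj A} (f : Hom X Y) : Function.Surjective f.toCoker.map :=
  Submodule.mkQ_surjective _

theorem Hom.isExtension_coker {X Y : Obj A} (f : Hom X Y) (hf : Function.Injective f.map) :
    IsExtension Y X f.coker :=
  ⟨f, f.toCoker, hf, f.toCoker_surjective, (Submodule.ker_mkQ (LinearMap.range f.map)).symm⟩

theorem Hom.finrank_coker_lt {X Y : Obj A} (f : Hom X Y) [Module.Finite k Y.carrier]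
    {x : X.carrier} (hx : f.map x ≠ 0) :
    Module.finrank k f.coker.carrier < Module.finrank k Y.carrier := by
  refine finrank_quotient_lt (LinearMap.range f.map) fun h0 => hx ?_
  have h3 : f.map x ∈ LinearMap.range f.map := ⟨x, rfl⟩
  rwa [h0, Submodule.mem_bot] at h3

/-- Additive functions on finite dimensional objects are determined by their value at `L`. -/
theorem Cover.eval {F : Core A} {L : Obj A} {s : ℤ} (C : Cover F L s)
    (hω : IsPrimitiveRoot (φ ζ) n) (hζ : ζ ^ n = 1) (hn : (n : k) ≠ 0)
    {f : {X : Obj A // IsFinDim X} → M} (hf : IsEval ζ φ IsExtension f)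
    (X : {X : Obj A // IsFinDim X}) : f X = F.char ζ (φ ζ) s X.1 • f ⟨L, C.isFinDim⟩ := by
  have hn0 : n ≠ 0 := by rintro rfl; simp at hn
  have hc := F.char_isEval hω hζ hn s
  have hstep : ∀ N : ℕ, ∀ X : {X : Obj A // IsFinDim X}, Module.finrank k X.1.carrier = N →
      f X = F.char ζ (φ ζ) s X.1 • f ⟨L, C.isFinDim⟩ := by
    intro N
    induction N using Nat.strong_induction_on with
    | _ N ih =>
    intro X hN
    have hfX : Module.Finite k X.1.carrier := X.2
    rcases subsingleton_or_nontrivial X.1.carrier with hs | hs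
    · have hext : IsExtension X.1 X.1 X.1 := ⟨⟨0, fun _ => by simp, fun _ => by simp⟩,
        ⟨0, fun _ => by simp, fun _ => by simp⟩, Function.injective_of_subsingleton _,
        Function.surjective_to_subsingleton _, Subsingleton.elim _ _⟩
      have h1 := hf.add X X X hext
      have h2 := hc.add X X X hext
      rw [left_eq_add] at h1 h2
      rw [h1, h2, zero_smul]
    · obtain ⟨d, i, g, hg⟩ := C.exists_injective hn hω X.2
      have hQ : IsFinDim g.coker := IsFinDim.of_surjective g.toCoker g.toCoker_surjective X.2
      have hLd : IsFinDim (L.ts hω.pow_eq_one d i) := C.isFinDim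
      have hext := g.isExtension_coker hg
      have hlt : Module.finrank k g.coker.carrier < N := by
        rw [← hN]
        exact g.finrank_coker_lt (x := C.x) fun h0 => C.x_ne (hg (h0.trans (map_zero g.map).symm))
      have e1 := hf.add X ⟨_, hLd⟩ ⟨_, hQ⟩ hext
      have e2 := hc.add X ⟨_, hLd⟩ ⟨_, hQ⟩ hext
      have e3 := hf.ts hω.pow_eq_one (fun _ h => h.twist) (fun _ _ h => h.shift)
        ⟨L, C.isFinDim⟩ ⟨_, hLd⟩ d i (IsIso.refl _)
      have e4 := hc.ts hω.pow_eq_one (fun _ h => h.twist) (fun _ _ h => h.shift)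
        ⟨L, C.isFinDim⟩ ⟨_, hLd⟩ d i (IsIso.refl _)
      simp only at e2 e4
      rw [C.char_self ζ hω hn0, smul_eq_mul, mul_one] at e4
      rw [e1, e2, e3, e4, ih _ hlt ⟨_, hQ⟩ rfl, add_smul]
  exact hstep _ X rfl

/-- Multiplication by a nontrivial power of `ζ` has no nonzero fixed Laurent polynomials. -/
theorem torsion_free [IsDomain O] (hζ : IsPrimitiveRoot ζ n) (m : ℕ) (hm : 0 < m) (hmn : m < n)
    (x : O[T;T⁻¹]) (hx : (LaurentPolynomial.C (ζ ^ m) : O[T;T⁻¹]) • x = x) : x = 0 := by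
  refine laurent_ext fun d => ?_
  have h := congrArg (fun p : O[T;T⁻¹] => p.coeff d) hx
  simp only [smul_eq_mul, coeff_C_mul] at h
  have h2 : (ζ ^ m - 1) * x.coeff d = 0 := by rw [sub_mul, one_mul, h, sub_self]
  exact (mul_eq_zero.1 h2).resolve_left
    (sub_ne_zero.2 (hζ.pow_ne_one_of_pos_of_lt hm.ne' hmn))

variable (ζ φ) in
/-- The Grothendieck group of finite dimensional objects is free on the class of `L`. -/
theorem Cover.exists_equiv [IsDomain O] {F : Core A} {L : Obj A} {s : ℤ} (C : Cover F L s)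
    (hω : IsPrimitiveRoot (φ ζ) n) (hζ : IsPrimitiveRoot ζ n) (hn : (n : k) ≠ 0) :
    ∃ Φ : KL ζ φ A ≃ₗ[O[T;T⁻¹]] O[T;T⁻¹],
      ∀ X hX, Φ (clsL ζ φ X hX) = F.char ζ (φ ζ) s X := by
  have hn0 : n ≠ 0 := by rintro rfl; simp at hn
  obtain ⟨Φ, hΦ⟩ := (F.char_isEval hω hζ.pow_eq_one hn s).exists_linear hn0 hω.pow_eq_one
    (torsion_free hζ) (fun X hX => hX.twist)
  have hev := C.eval hω hζ.pow_eq_one hn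
    (isEval_mk ζ φ (IsFinDim (A := A)) IsExtension fun X d hX => hX.shift)
  have hinv : (LinearMap.toSpanSingleton O[T;T⁻¹] (KL ζ φ A) (clsL ζ φ L C.isFinDim)) ∘ₗ Φ =
      LinearMap.id := by
    refine Submodule.linearMap_qext _ (Finsupp.lhom_ext' fun X => LinearMap.ext_ring ?_)
    change Φ (Submodule.Quotient.mk (Finsupp.single X 1)) • clsL ζ φ L C.isFinDim =
      Submodule.Quotient.mk (Finsupp.single X 1)
    rw [hΦ]
    exact (hev X).symm
  refine ⟨LinearEquiv.ofLinearMap Φ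
    (LinearMap.toSpanSingleton O[T;T⁻¹] (KL ζ φ A) (clsL ζ φ L C.isFinDim)) ?_ hinv,
    fun X hX => hΦ ⟨X, hX⟩⟩
  refine LinearMap.ext_ring ?_
  change Φ ((1 : O[T;T⁻¹]) • Submodule.Quotient.mk (Finsupp.single ⟨L, C.isFinDim⟩ 1)) = 1
  rw [one_smul, hΦ]
  exact C.char_self ζ hω hn0

end Evaluation

end

section

variable {k : Type u} [Field k] {n : ℕ} {A : FoldedAlg.{u, w} k n}

theorem Frame.u_mul_e (F : Frame A) (hn : n ≠ 0) : F.u * F.e = F.u := by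
  have key : ∀ t, twistedPow A F.e F.v t * (⇑A.aut)^[t] F.e = twistedPow A F.e F.v t := by
    intro t
    induction t with
    | zero => exact F.e_mul_e
    | succ t ih => rw [twistedPow, Function.iterate_succ_apply', mul_assoc, ← map_mul, ih]
  have h := congrArg A.aut (key (n - 1))
  rw [map_mul, ← Function.iterate_succ_apply' (f := A.aut), show (n - 1).succ = n by omega,
    A.aut_pow] at h
  exact h

theorem Frame.e_mul_twistedPow (F : Frame A) (t : ℕ) :
    F.e * twistedPow A F.e F.v t = twistedPow A F.e F.v t := by
  cases t with
  | zero => exact F.e_mul_e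
  | succ t => rw [twistedPow, ← mul_assoc, F.e_mul_v]

/-- The left ideal generated by an idempotent. -/
def leftIdeal (A : FoldedAlg.{u, w} k n) (e : A.carrier) : Submodule A.carrier A.carrier where
  carrier := {p | p * e = p}
  zero_mem' := zero_mul _
  add_mem' {a b} ha hb := by
    change _ * _ = _ at ha hb ⊢
    rw [add_mul, ha, hb]
  smul_mem' c a ha := by
    change _ * _ = _ at ha ⊢
    rw [smul_eq_mul, mul_assoc, ha]

/-- The object `A e`, with `σ(p) = aut(p) u`, and with the generator `e` in degree `s`. -/
def Frame.proj (F : Frame A) (hn : n ≠ 0) (s : ℤ) : Obj A := Obj.shift s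
  { carrier := leftIdeal A F.e
    tower := ⟨fun c a p => Subtype.ext (smul_assoc c a p.1)⟩
    deg := fun d => (A.deg d).comap ((leftIdeal A F.e).restrictScalars k).subtype
    internal := internal_comap A.internal ((leftIdeal A F.e).restrictScalars k) (by
      intro m hm d
      have hm' : m * F.e = m := hm
      have := component_map_zero A.internal A.internal (AddMonoidHom.mulRight F.e)
        (fun d m hm => by
          have := A.mul_mem hm F.e_mem
          rwa [add_zero] at this) d m
      change component A.internal d m * F.e = _
      rw [AddMonoidHom.mulRight_apply, hm'] at this
      exact this.symm)
    smul_mem := fun hr hm => A.mul_mem hr hm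
    σ := LinearMap.restrict (p := (leftIdeal A F.e).restrictScalars k)
      (q := (leftIdeal A F.e).restrictScalars k)
      (LinearMap.mulRight k F.u ∘ₗ A.aut.toLinearMap) (fun p _ => by
        change A.aut p * F.u * F.e = A.aut p * F.u
        rw [mul_assoc, F.u_mul_e hn])
    σ_smul := fun r p => Subtype.ext (by
      change A.aut (r * p.1) * F.u = A.aut r * (A.aut p.1 * F.u)
      rw [map_mul, mul_assoc])
    σ_mem := fun {i p} hp => by
      have := A.mul_mem (A.aut_mem (x := p.1) hp) F.u_mem
      rw [add_zero] at this
      exact this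
    σ_pow := fun (p : (leftIdeal A F.e).restrictScalars k) => by
      set τ := LinearMap.restrict (p := (leftIdeal A F.e).restrictScalars k)
        (q := (leftIdeal A F.e).restrictScalars k)
        (LinearMap.mulRight k F.u ∘ₗ A.aut.toLinearMap) _ with hτ
      have hτ' : ∀ q : (leftIdeal A F.e).restrictScalars k, (τ q).1 = A.aut q.1 * F.u := fun q => rfl
      have key : ∀ t, ((⇑τ)^[t] p).1 * twistedPow A F.e F.v t = (⇑A.aut)^[t] p.1 := by
        intro t
        induction t with
        | zero => exact p.2
        | succ t ih =>
          rw [Function.iterate_succ_apply', Function.iterate_succ_apply', hτ', twistedPow,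
            mul_assoc, ← mul_assoc F.u, F.u_mul_v hn, ← map_mul, F.e_mul_twistedPow, ← map_mul, ih]
      have h := key n
      rw [F.pow_n, A.aut_pow] at h
      have h2 : ((⇑τ)^[n] p).1 * F.e = ((⇑τ)^[n] p).1 := ((⇑τ)^[n] p).2
      exact Subtype.ext (h2.symm.trans h) }

/-- An object generated by an eigenvector, and free subject to this. -/
structure Rep (G : Frame A) (Z : Obj A) (s : ℤ) where
  z : Z.carrier
  z_mem : z ∈ Z.deg s
  e_z : G.e • z = z
  ψ_z : G.v • Z.σ z = z
  gen : ∀ m : Z.carrier, ∃ a : A.carrier, m = a • z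
  exists_map : ∀ (Y : Obj A) (y : Y.carrier), G.e • y = y →
    ∃ f : Z.carrier →ₗ[A.carrier] Y.carrier, f z = y

/-- The object `A e` is generated by `e`. -/
def Frame.rep (F : Frame A) (hn : n ≠ 0) (s : ℤ) : Rep F (F.proj hn s) s where
  z := (⟨F.e, F.e_mul_e⟩ : leftIdeal A F.e)
  z_mem := by
    change F.e ∈ A.deg (s - s)
    rw [sub_self]; exact F.e_mem
  e_z := Subtype.ext F.e_mul_e
  ψ_z := Subtype.ext (by
    change F.v * (A.aut F.e * F.u) = F.e
    rw [← mul_assoc, F.v_mul_e, F.v_mul_u hn])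
  gen m := by
    obtain ⟨m, hm⟩ : leftIdeal A F.e := m
    have hm' : m * F.e = m := hm
    exact ⟨m, Subtype.ext hm'.symm⟩
  exists_map Y y hy := ⟨LinearMap.toSpanSingleton A.carrier Y.carrier y ∘ₗ
    (leftIdeal A F.e).subtype, hy⟩

namespace Rep

variable {G : Frame A} {Z : Obj A} {s : ℤ} (R : Rep G Z s)

theorem eig_z (ω : k) : R.z ∈ G.eig ω s 0 Z :=
  ⟨R.z_mem, R.e_z, by rw [R.ψ_z, pow_zero, one_smul]⟩

include R in
theorem finite : Module.Finite A.carrier Z.carrier := by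
  refine Module.Finite.of_surjective (LinearMap.toSpanSingleton A.carrier Z.carrier R.z)
    fun y => ?_
  obtain ⟨a, rfl⟩ := R.gen y
  exact ⟨a, rfl⟩

theorem ext {Y : Type*} [AddCommGroup Y] [Module A.carrier Y] {f g : Z.carrier →ₗ[A.carrier] Y}
    (h : f R.z = g R.z) : f = g := by
  ext m
  obtain ⟨a, rfl⟩ := R.gen m
  rw [map_smul, map_smul, h]

theorem exists_hom (hn : n ≠ 0) {ω : k} {Y : Obj A} {y : Y.carrier} (hy : y ∈ G.eig ω s 0 Y) :
    ∃ f : Hom Z Y, f.map R.z = y := by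
  obtain ⟨f, hf⟩ := R.exists_map Y y hy.2.1
  exact ⟨G.homOfEig hn (R.eig_z ω) R.gen f (by rwa [hf]), hf⟩

include R in
theorem isProjective {ω : k} (hω : IsPrimitiveRoot ω n) (hn : (n : k) ≠ 0) : IsProjective Z := by
  have hn0 : n ≠ 0 := by rintro rfl; simp at hn
  intro X Y f g hf
  obtain ⟨x, hx, hxy⟩ := G.exists_lift_eig hω hn f hf (G.map_mem_eig g (R.eig_z ω))
  obtain ⟨h, hh⟩ := R.exists_hom hn0 hx
  have : f.map ∘ₗ h.map = g.map := R.ext (by rw [LinearMap.comp_apply, hh, hxy])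
  exact ⟨h, fun p => LinearMap.congr_fun this p⟩

include R in
theorem isFGProjective {ω : k} (hω : IsPrimitiveRoot ω n) (hn : (n : k) ≠ 0) :
    IsFGProjective Z :=
  ⟨R.finite, R.isProjective hω hn⟩

theorem surjective_of_comp {F : Core A} {L P : Obj A} {s : ℤ} (C : Cover F L s)
    (R : Rep F.toFrame P s) {M : Type*} [AddCommGroup M] [Module A.carrier M]
    (π : P.carrier →ₗ[A.carrier] L.carrier) (hπ : π R.z = C.x) (h : M →ₗ[A.carrier] P.carrier)
    (hg : ∀ q d, component P.internal d (h q) ∈ LinearMap.range h) {q : M} (hq : π (h q) = C.x) :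
    Function.Surjective h := by
  obtain ⟨a, ha⟩ := R.gen (h q)
  have hq' : a • C.x = C.x := by rw [← hπ, ← map_smul, ← ha, hπ]; exact hq
  obtain ⟨c, hc⟩ := F.zero _ (component_mem A.internal 0 a)
  have h1 : ∀ (X : Obj A) (x : X.carrier), x ∈ X.deg s → F.e • x = x →
      F.e • component X.internal s (a • x) = c • x := by
    intro X x hx he
    have := component_smul_of_mem X hx 0 a
    rw [zero_add] at this
    rw [this]
    conv_lhs => rw [← he]
    rw [smul_smul, smul_smul, hc, smul_assoc, he]
  have hc1 : c = 1 := by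
    have := h1 L C.x C.x_mem C.e_x
    rw [hq', component_of_mem _ C.x_mem, C.e_x, eq_comm, ← sub_eq_zero] at this
    have h2 : (c - 1) • C.x = 0 := by rw [sub_smul, one_smul, this]
    exact sub_eq_zero.1 ((smul_eq_zero.1 h2).resolve_right C.x_ne)
  have h2 := h1 P R.z R.z_mem R.e_z
  obtain ⟨q', hq''⟩ := hg q s
  rw [hc1, one_smul, ← ha, ← hq'', ← map_smul] at h2
  intro y
  obtain ⟨b, rfl⟩ := R.gen y
  exact ⟨b • F.e • q', by rw [map_smul, h2]⟩

theorem isProjectiveCover {F : Core A} {L P : Obj A} {s : ℤ} (C : Cover F L s)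
    (R : Rep F.toFrame P s) {ω : k} (hω : IsPrimitiveRoot ω n) (hn : (n : k) ≠ 0) :
    IsProjectiveCover P L := by
  have hn0 : n ≠ 0 := by rintro rfl; simp at hn
  obtain ⟨π, hπ⟩ := R.exists_hom hn0 (C.eig_x ω)
  refine ⟨R.isProjective hω hn, π, fun y => ?_, fun Q h hs => ?_⟩
  · obtain ⟨a, rfl⟩ := C.generates y
    exact ⟨a • R.z, by rw [map_smul, hπ]⟩
  · obtain ⟨q, hq⟩ := hs C.x
    exact surjective_of_comp C R π.map hπ h.map (fun q d => ⟨_, h.map_component d q⟩) hq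

end Rep

theorem IsProjectiveCover.unique {P P' L : Obj A} (h : IsProjectiveCover P L)
    (h' : IsProjectiveCover P' L) : IsIso P' P := by
  obtain ⟨hP, π, hπ, hess⟩ := h
  obtain ⟨hP', π', hπ', hess'⟩ := h'
  obtain ⟨f, hf⟩ := hP' P L π π' hπ
  have hfs : Function.Surjective f.map := hess P' f fun y => by
    obtain ⟨x, rfl⟩ := hπ' y
    exact ⟨x, hf x⟩
  obtain ⟨g, hg⟩ := hP P' P f (Hom.id P) hfs
  have hgs : Function.Surjective g.map := hess' P g fun y => by
    obtain ⟨x, rfl⟩ := hπ y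
    refine ⟨x, ?_⟩
    change π'.map (g.map x) = _
    rw [← hf, hg]; rfl
  refine ⟨f, fun a b hab => ?_, hfs⟩
  obtain ⟨a, rfl⟩ := hgs a
  obtain ⟨b, rfl⟩ := hgs b
  rw [hg, hg] at hab
  exact congrArg g.map hab

/-! ### Simple quotients -/

namespace Core

variable (F : Core A)

/-- The degrees of `e X` are bounded below for a finitely generated `X`. -/
theorem exists_lower_bound {X : Obj A} (hX : Module.Finite A.carrier X.carrier) :
    ∃ D : ℤ, ∀ x : X.carrier, ∀ d < D, F.e • component X.internal d x = 0 := by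
  let N : ℤ → Submodule A.carrier X.carrier := fun D =>
    { carrier := {x | ∀ a : A.carrier, ∀ d < D, F.e • component X.internal d (a • x) = 0}
      zero_mem' := fun a d _ => by rw [smul_zero, map_zero, smul_zero]
      add_mem' := fun ha hb a d hd => by rw [smul_add, map_add, smul_add, ha a d hd, hb a d hd,
        add_zero]
      smul_mem' := fun c x hx a d hd => by rw [smul_smul]; exact hx _ d hd }
  have hanti : ∀ D D', D ≤ D' → N D' ≤ N D := fun D D' h x hx a d hd =>
    hx a d (lt_of_lt_of_le hd h)
  let N' : Submodule A.carrier X.carrier :=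
    { carrier := {x | ∃ D, x ∈ N D}
      zero_mem' := ⟨0, zero_mem _⟩
      add_mem' := by
        rintro a b ⟨D, ha⟩ ⟨D', hb⟩
        exact ⟨min D D', add_mem (hanti _ _ (min_le_left _ _) ha) (hanti _ _ (min_le_right _ _) hb)⟩
      smul_mem' := by
        rintro c x ⟨D, hx⟩
        exact ⟨D, Submodule.smul_mem _ c hx⟩ }
  have hall : ∀ x, x ∈ N' := by
    intro x
    refine F.mem_of _ fun b => ?_
    refine homogeneous_induction X.internal (p := fun y => F.e • y ∈ N') ?_ ?_ ?_ (b • x)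
    · rw [smul_zero]; exact zero_mem _
    · intro c y hy
      refine ⟨c, fun a d hd => ?_⟩
      have := component_smul_of_mem X (F.e_smul_mem hy) (d - c) a
      rw [sub_add_cancel] at this
      rw [this, smul_smul, smul_smul, F.neg _ (by omega) _ (component_mem _ _ _), zero_smul]
    · intro a b ha hb
      rw [smul_add]; exact add_mem ha hb
  obtain ⟨S, hS⟩ := hX
  have hfin : ∀ T : Finset X.carrier, ∃ D, ∀ x ∈ T, x ∈ N D := by
    classical
    intro T
    induction T using Finset.induction_on with
    | empty => exact ⟨0, by simp⟩
    | insert a T _ ih =>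
      obtain ⟨D, hD⟩ := ih
      obtain ⟨D', hD'⟩ := hall a
      refine ⟨min D D', fun x hx => ?_⟩
      rcases Finset.mem_insert.1 hx with rfl | hx
      · exact hanti _ _ (min_le_right _ _) hD'
      · exact hanti _ _ (min_le_left _ _) (hD x hx)
  obtain ⟨D, hD⟩ := hfin S
  refine ⟨D, fun x d hd => ?_⟩
  have hx : x ∈ N D := by
    have : Submodule.span A.carrier (S : Set X.carrier) ≤ N D := Submodule.span_le.2 hD
    exact this (by rw [hS]; trivial)
  have := hx 1 d hd
  rwa [one_smul] at this

/-- An eigenvector `y` of lowest degree in `e X` survives in a quotient `Y` with `e Y = k y`. -/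
theorem exists_quotient (hn : (n : k) ≠ 0) {ω : k} (hω : IsPrimitiveRoot ω n) {X : Obj A} {d : ℤ}
    {i : ℕ} {y : X.carrier} (hy : y ∈ F.eig ω d i X) (hy0 : y ≠ 0)
    (hlow : ∀ x : X.carrier, ∀ c < d, F.e • component X.internal c x = 0) :
    ∃ (Y : Obj A) (p : Hom X Y), Function.Surjective p.map ∧ p.map y ≠ 0 ∧
      ∀ z : Y.carrier, ∃ c : k, F.e • z = c • p.map y := by
  have hn0 : n ≠ 0 := by rintro rfl; simp at hn
  have hω0 := hω.ne_zero hn0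
  obtain ⟨ℓ, hℓ⟩ := Module.Projective.exists_dual_eq_one k hy0
  let lam : X.carrier →ₗ[k] k := ℓ ∘ₗ spectralProj n ω (F.ψ X) i
  have hlam_y : lam y = 1 := by
    change ℓ (spectralProj n ω (F.ψ X) i y) = 1
    rw [spectralProj_of_eigen hn hω0 _ hy.2.2, hℓ]
  have hlam : ∀ z, F.e • z = z → lam (F.ψ X z) = ω ^ i * lam z := by
    intro z hz
    have hcomm : spectralProj n ω (F.ψ X) i (F.ψ X z) = F.ψ X (spectralProj n ω (F.ψ X) i z) := by
      rw [spectralProj_apply, spectralProj_apply, map_smul, map_sum]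
      congr 1
      refine Finset.sum_congr rfl fun t _ => ?_
      rw [map_smul, ← Module.End.mul_apply, ← pow_succ, pow_succ', Module.End.mul_apply]
    change ℓ (spectralProj n ω (F.ψ X) i (F.ψ X z)) = _
    rw [hcomm, map_spectralProj hω.pow_eq_one hω0 _ _ (F.ψ_pow_n hz), map_smul, smul_eq_mul]
    rfl
  have hcompe : ∀ c z, component X.internal c (F.e • z) = F.e • component X.internal c z := by
    intro c z
    have := component_smul X F.e_mem c z
    rwa [add_zero] at this
  let K : Submodule A.carrier X.carrier :=
    { carrier := {p | ∀ a : A.carrier, lam (F.e • component X.internal d (a • p)) = 0}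
      zero_mem' := fun a => by rw [smul_zero, map_zero, smul_zero, map_zero]
      add_mem' := fun ha hb a => by rw [smul_add, map_add, smul_add, map_add, ha a, hb a, add_zero]
      smul_mem' := fun c x hx a => by rw [smul_smul]; exact hx _ }
  have hKg : ∀ m ∈ K, ∀ c, component X.internal c m ∈ K := by
    intro m hm c a
    have h1 := component_smul_of_mem X (component_mem X.internal c m) (d - c) a
    have h2 := component_smul X (component_mem A.internal (d - c) a) c m
    rw [sub_add_cancel] at h1
    rw [add_sub_cancel] at h2
    rw [h1, ← h2]
    exact hm _
  have hKσ : ∀ m ∈ K, X.σ m ∈ K := by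
    intro m hm a
    set a' := (⇑A.aut)^[n - 1] a with ha'
    have haa : A.aut a' = a := by
      rw [ha', ← Function.iterate_succ_apply' (f := A.aut), show (n - 1).succ = n by omega,
        A.aut_pow]
    set u' := twistedPow A F.e F.v (n - 1) with hu'
    have h1 : F.e • a • X.σ m = F.ψ X (F.e • (u' * a') • m) := by
      have hu : A.aut u' = F.u := rfl
      rw [F.ψ_e_smul, Frame.ψ_apply, X.σ_smul, map_mul, haa, hu, smul_smul, smul_smul,
        ← F.v_mul_u hn0, mul_assoc]
    have h2 : component X.internal d (F.ψ X (F.e • (u' * a') • m)) =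
        F.ψ X (component X.internal d (F.e • (u' * a') • m)) :=
      component_map_zero X.internal X.internal (F.ψ X).toAddMonoidHom
        (fun _ _ h => F.ψ_mem h) d _
    rw [← hcompe, h1, h2, hcompe, hlam _ (by rw [smul_smul, F.e_mul_e]), hm, mul_zero]
  refine ⟨X.quot K hKg hKσ, X.quotMk K hKg hKσ, Submodule.mkQ_surjective K, fun h => ?_, ?_⟩
  · have hyK : y ∈ K := (Submodule.Quotient.mk_eq_zero K).1 h
    have := hyK 1
    rw [one_smul, component_of_mem _ hy.1, hy.2.1, hlam_y] at this
    exact one_ne_zero this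
  · intro z'
    obtain ⟨z, rfl⟩ := Submodule.mkQ_surjective K z'
    refine ⟨lam (F.e • component X.internal d z), ?_⟩
    obtain ⟨c0, hc0⟩ : ∃ c0, lam (F.e • component X.internal d z) = c0 := ⟨_, rfl⟩
    rw [hc0]
    have key : F.e • z - c0 • y ∈ K := by
      intro b
      obtain ⟨β, hβ⟩ := F.zero _ (component_mem A.internal 0 b)
      have hb : ∀ z, F.e • component X.internal d (b • F.e • z) =
          β • F.e • component X.internal d z := by
        refine homogeneous_induction X.internal (by simp) (fun c z hz => ?_)
          (fun p q hp hq => by simp only [smul_add, map_add, hp, hq])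
        have h1 := component_smul_of_mem X (F.e_smul_mem hz) (d - c) b
        rw [sub_add_cancel] at h1
        rw [h1]
        rcases lt_trichotomy c d with hc | rfl | hc
        · have hz0 := hlow z c hc
          rw [component_of_mem _ hz] at hz0
          rw [component_of_mem_ne _ hz hc.ne, hz0]
          simp
        · rw [sub_self, component_of_mem _ hz, smul_smul, smul_smul, hβ, smul_assoc]
        · rw [component_of_mem_ne _ hz hc.ne', smul_smul, smul_smul,
            F.neg _ (by omega) _ (component_mem _ _ _), zero_smul, smul_zero, smul_zero]
      have hby := hb y
      rw [hy.2.1, component_of_mem _ hy.1, hy.2.1] at hby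
      have hcy : F.e • component X.internal d (b • c0 • y) = c0 • β • y := by
        rw [smul_comm b c0 y, map_smul, smul_comm F.e c0, hby]
      rw [smul_sub, map_sub, smul_sub, hb, hcy, map_sub, map_smul lam β, map_smul lam c0, map_smul lam β, hlam_y,
        hc0]
      simp [mul_comm]
    have h2 := (Submodule.Quotient.mk_eq_zero K).2 key
    rw [Submodule.Quotient.mk_sub, sub_eq_zero] at h2
    exact h2

end Core

end

section

variable {k : Type u} [Field k] {n : ℕ} {A : FoldedAlg.{u, w} k n}

theorem Core.exists_homogeneous (F : Core A) (X : Obj A) [Nontrivial X.carrier] :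
    ∃ d, ∃ z ∈ X.deg d, F.e • z = z ∧ z ≠ 0 := by
  obtain ⟨y, hy⟩ := exists_ne (0 : X.carrier)
  by_contra hemp
  refine hy (F.eq_zero_of fun a => ?_)
  refine eq_zero_of_component X.internal fun d => ?_
  by_contra h0
  refine hemp ⟨d, _, component_mem X.internal d _, ?_, h0⟩
  have := component_smul X F.e_mem d (F.e • a • y)
  rw [add_zero, smul_smul F.e, F.e_mul_e] at this
  exact this.symm

/-- A quotient with the properties of `L`, up to twist and shift, is isomorphic to `L`. -/
theorem Cover.exists_iso {F : Core A} {L : Obj A} {s : ℤ} (C : Cover F L s) (hn : n ≠ 0) {ω : k}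
    (hω : ω ^ n = 1) {Y : Obj A} {y : Y.carrier} {d : ℤ} {i : ℕ} (hy : y ∈ F.eig ω (s + d) i Y)
    (hy0 : y ≠ 0) (hspan : ∀ z : Y.carrier, ∃ c : k, F.e • z = c • y) :
    ∃ f : Hom (L.ts hω d i) Y, Function.Bijective f.map := by
  obtain ⟨f, hf⟩ := C.exists_hom hn hω hy (fun d' hd' a ha => by
    obtain ⟨c, hc⟩ := hspan (a • y)
    have h1 : F.e • a • y ∈ Y.deg (d' + (s + d)) := F.e_smul_mem (Y.smul_mem ha hy.1)
    refine eq_zero_of_mem_of_ne Y.internal h1 (d' := s + d) ?_ (by omega)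
    rw [hc]
    exact Submodule.smul_mem _ _ hy.1)
  refine ⟨f, C.injective (Y := Y) f.map (fun h => hy0 (hf.symm.trans h)), fun z => ?_⟩
  refine F.mem_of (LinearMap.range f.map) fun a => ?_
  obtain ⟨c, hc⟩ := hspan (a • z)
  rw [hc, ← hf]
  exact ⟨c • C.x, f.map_smul_base c C.x⟩

/-- A nonzero finitely generated object has a twist and shift of `L` as a quotient. -/
theorem Cover.exists_surjective {F : Core A} {L : Obj A} {s : ℤ} (C : Cover F L s)
    (hn : (n : k) ≠ 0) {ω : k} (hω : IsPrimitiveRoot ω n) {X : Obj A}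
    (hX : Module.Finite A.carrier X.carrier) [Nontrivial X.carrier] :
    ∃ (d : ℤ) (i : ℕ) (f : Hom X (L.ts hω.pow_eq_one d i)), Function.Surjective f.map := by
  have hn0 : n ≠ 0 := by rintro rfl; simp at hn
  obtain ⟨D, hD⟩ := F.exists_lower_bound hX
  obtain ⟨d, ⟨z, hz, hze, hz0⟩, hmin⟩ := Int.exists_least_of_bdd
    (P := fun d => ∃ z ∈ X.deg d, F.e • z = z ∧ z ≠ 0) ⟨D, fun d ⟨z, hz, hze, hz0⟩ => by
      by_contra h
      have := hD z d (by omega)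
      rw [component_of_mem _ hz, hze] at this
      exact hz0 this⟩ (F.exists_homogeneous X)
  obtain ⟨i, y, hy, hy0⟩ := F.exists_eigenvector hω hn hz hze hz0
  obtain ⟨Y, p, hp, hpy, hspan⟩ := F.exists_quotient hn hω hy hy0 (fun x c hc => by
    by_contra h
    have := hmin c ⟨_, F.e_smul_mem (component_mem X.internal c x), by
      rw [smul_smul, F.e_mul_e], h⟩
    omega)
  obtain ⟨g, hg⟩ := C.exists_iso hn0 hω.pow_eq_one (d := d - s) (i := i) (Y := Y) (y := p.map y)
    (by rw [add_sub_cancel]; exact F.map_mem_eig p hy) hpy hspan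
  refine ⟨d - s, i, (g.inv hg).comp p, fun z => ?_⟩
  obtain ⟨x, hx⟩ := hp (g.map z)
  exact ⟨x, (congrArg (g.inv hg).map hx).trans (g.inv_apply hg z)⟩

/-! ### Direct sums -/

theorem IsDirectSum.exists_retractions {X X' X'' : Obj A} (h : IsDirectSum X X' X'') :
    ∃ (f : Hom X' X) (g : Hom X'' X) (p : Hom X X') (q : Hom X X''),
      (∀ x, p.map (f.map x) = x) ∧ (∀ x, q.map (g.map x) = x) ∧ (∀ x, p.map (g.map x) = 0) ∧
      (∀ x, q.map (f.map x) = 0) ∧ ∀ x, f.map (p.map x) + g.map (q.map x) = x := by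
  obtain ⟨f, g, hfg⟩ := h
  let E := LinearEquiv.ofBijective (f.map.coprod g.map) hfg
  have hE : ∀ a b, E.symm (f.map a + g.map b) = (a, b) := fun a b => E.symm_apply_apply (a, b)
  have hm : ∀ m, ∃ a b, m = f.map a + g.map b := fun m => by
    obtain ⟨⟨a, b⟩, h⟩ := hfg.2 m
    exact ⟨a, b, h.symm⟩
  have hdeg : ∀ {d : ℤ} {a b}, f.map a + g.map b ∈ X.deg d → a ∈ X'.deg d ∧ b ∈ X''.deg d := by
    intro d a b h
    have h1 := component_of_mem X.internal h
    rw [map_add, ← f.map_component, ← g.map_component] at h1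
    have h2 := congrArg E.symm h1
    rw [hE, hE, Prod.mk.injEq] at h2
    exact ⟨h2.1 ▸ component_mem _ _ _, h2.2 ▸ component_mem _ _ _⟩
  have hσ : ∀ a b, X.σ (f.map a + g.map b) = f.map (X'.σ a) + g.map (X''.σ b) := fun a b => by
    rw [map_add, f.map_σ, g.map_σ]
  refine ⟨f, g, ⟨LinearMap.fst _ _ _ ∘ₗ E.symm.toLinearMap, fun {d m} h => ?_, fun m => ?_⟩,
    ⟨LinearMap.snd _ _ _ ∘ₗ E.symm.toLinearMap, fun {d m} h => ?_, fun m => ?_⟩, fun x => ?_,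
    fun x => ?_, fun x => ?_, fun x => ?_, fun x => ?_⟩
  · obtain ⟨a, b, rfl⟩ := hm m
    change (E.symm _).1 ∈ _
    rw [hE]; exact (hdeg h).1
  · obtain ⟨a, b, rfl⟩ := hm m
    change (E.symm _).1 = X'.σ (E.symm _).1
    rw [hσ, hE, hE]
  · obtain ⟨a, b, rfl⟩ := hm m
    change (E.symm _).2 ∈ _
    rw [hE]; exact (hdeg h).2
  · obtain ⟨a, b, rfl⟩ := hm m
    change (E.symm _).2 = X''.σ (E.symm _).2
    rw [hσ, hE, hE]
  · have := hE x 0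
    rw [map_zero, add_zero] at this
    exact congrArg Prod.fst this
  · have := hE 0 x
    rw [map_zero, zero_add] at this
    exact congrArg Prod.snd this
  · have := hE 0 x
    rw [map_zero, zero_add] at this
    exact congrArg Prod.fst this
  · have := hE x 0
    rw [map_zero, add_zero] at this
    exact congrArg Prod.snd this
  · exact E.apply_symm_apply x

theorem IsDirectSum.of_retractions {X X' X'' : Obj A} (f : Hom X' X) (g : Hom X'' X) (p : Hom X X')
    (q : Hom X X'') (hpf : ∀ x, p.map (f.map x) = x) (hqg : ∀ x, q.map (g.map x) = x)
    (hpg : ∀ x, p.map (g.map x) = 0) (hqf : ∀ x, q.map (f.map x) = 0)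
    (h : ∀ x, f.map (p.map x) + g.map (q.map x) = x) : IsDirectSum X X' X'' := by
  refine ⟨f, g, fun a b hab => ?_, fun x => ⟨(p.map x, q.map x), h x⟩⟩
  have h1 := congrArg p.map hab
  have h2 := congrArg q.map hab
  simp only [map_add, hpf, hpg, add_zero] at h1
  simp only [map_add, hqf, hqg, zero_add] at h2
  exact Prod.ext h1 h2

theorem IsFGProjective.of_retract {X Y : Obj A} (f : Hom Y X) (p : Hom X Y)
    (h : ∀ y, p.map (f.map y) = y) (hX : IsFGProjective X) : IsFGProjective Y := by
  refine ⟨?_, fun Z Z' r t hr => ?_⟩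
  · have := hX.1
    exact Module.Finite.of_surjective p.map fun y => ⟨_, h y⟩
  · obtain ⟨l, hl⟩ := hX.2 Z Z' r (t.comp p) hr
    refine ⟨l.comp f, fun y => (hl _).trans ?_⟩
    exact congrArg t.map (h y)

theorem IsFGProjective.of_directSum {X X' X'' : Obj A} (h : IsDirectSum X X' X'')
    (hX' : IsFGProjective X') (hX'' : IsFGProjective X'') : IsFGProjective X := by
  obtain ⟨f, g, p, q, hpf, hqg, hpg, hqf, h⟩ := h.exists_retractions
  refine ⟨?_, fun Z Z' r t hr => ?_⟩
  · have := hX'.1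
    have := hX''.1
    exact Module.Finite.of_surjective (f.map.coprod g.map) fun x => ⟨(p.map x, q.map x), h x⟩
  · obtain ⟨l, hl⟩ := hX'.2 Z Z' r (t.comp f) hr
    obtain ⟨l', hl'⟩ := hX''.2 Z Z' r (t.comp g) hr
    refine ⟨⟨l.map ∘ₗ p.map + l'.map ∘ₗ q.map, fun hm =>
      add_mem (l.map_mem (p.map_mem hm)) (l'.map_mem (q.map_mem hm)), fun m => ?_⟩, fun x => ?_⟩
    · simp only [LinearMap.add_apply, LinearMap.comp_apply, map_add, p.map_σ, q.map_σ, l.map_σ,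
        l'.map_σ]
    · have h1 : r.map (l.map (p.map x)) = t.map (f.map (p.map x)) := hl _
      have h2 : r.map (l'.map (q.map x)) = t.map (g.map (q.map x)) := hl' _
      change r.map (l.map (p.map x) + l'.map (q.map x)) = _
      rw [map_add, h1, h2, ← map_add, h]

theorem Hom.isDirectSum_ker {X P : Obj A} (β : Hom X P) (r : Hom P X)
    (h : ∀ x, β.map (r.map x) = x) :
    IsDirectSum X P (X.sub (LinearMap.ker β.map) β.ker_graded β.ker_σ) := by
  refine ⟨r, X.subVal _ β.ker_graded β.ker_σ, ?_, ?_⟩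
  · rintro ⟨a, b⟩ ⟨a', b'⟩ hab
    have hab : r.map a + b.1 = r.map a' + b'.1 := hab
    have h1 := congrArg β.map hab
    have hb : β.map b.1 = 0 := b.2
    have hb' : β.map b'.1 = 0 := b'.2
    rw [map_add, map_add, h, h, hb, hb', add_zero, add_zero] at h1
    subst h1
    exact Prod.ext rfl (Subtype.ext (add_left_cancel hab))
  · intro x
    refine ⟨(β.map x, ⟨x - r.map (β.map x), ?_⟩), add_sub_cancel _ _⟩
    rw [LinearMap.mem_ker, map_sub, h, sub_self]

theorem isDirectSum_of_subsingleton {X : Obj A} [Subsingleton X.carrier] : IsDirectSum X X X :=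
  ⟨Hom.id X, Hom.id X, fun _ _ _ => Subsingleton.elim (α := X.carrier × X.carrier) _ _,
    fun _ => ⟨0, Subsingleton.elim _ _⟩⟩

theorem component_shift (X : Obj A) (s d : ℤ) (m : X.carrier) :
    component (X.shift s).internal (d + s) m = component X.internal d m :=
  component_map X.internal (X.shift s).internal s (AddMonoidHom.id X.carrier)
    (fun d m hm => by
      change m ∈ X.deg (d + s - s)
      rwa [add_sub_cancel_right]) d m

/-- A nonzero finitely generated projective object has a twist and shift of `P` as a summand. -/
theorem Cover.exists_summand {F : Core A} {L P : Obj A} {s : ℤ} (C : Cover F L s)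
    (R : Rep F.toFrame P s) (hn : (n : k) ≠ 0) {ω : k} (hω : IsPrimitiveRoot ω n) {X : Obj A}
    (hX : IsFGProjective X) [Nontrivial X.carrier] :
    ∃ (d : ℤ) (i : ℕ) (X' : Obj A), IsDirectSum X (P.ts hω.pow_eq_one d i) X' := by
  have hn0 : n ≠ 0 := by rintro rfl; simp at hn
  have hω0 := hω.ne_zero hn0
  obtain ⟨d, i, f, hf⟩ := C.exists_surjective hn hω hX.1
  obtain ⟨π, hπ⟩ := R.exists_hom hn0 (C.eig_x ω)
  let π' : Hom (P.ts hω.pow_eq_one d i) (L.ts hω.pow_eq_one d i) :=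
    ⟨π.map, fun hm => π.map_mem hm, fun (m : P.carrier) =>
      (π.map_smul_base (ω ^ i) (P.σ m)).trans (congrArg (ω ^ i • ·) (π.map_σ m))⟩
  have hπs : Function.Surjective π'.map := fun y => by
    obtain ⟨a, ha⟩ := C.generates y
    refine ⟨a • R.z, ?_⟩
    change π.map (a • R.z) = y
    rw [map_smul, hπ]
    exact ha.symm
  obtain ⟨β, hβ⟩ := hX.2 _ _ π' f hπs
  obtain ⟨q, hq⟩ := hf C.x
  have hβs : Function.Surjective β.map :=
    Rep.surjective_of_comp C R π.map hπ β.map (fun q e => ⟨component X.internal (e + d) q, by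
      have := β.map_component (e + d) q
      exact this.trans (component_shift (P.twist (ω ^ i) _) d e (β.map q))⟩) ((hβ q).trans hq)
  obtain ⟨r, hr⟩ := ((R.isFGProjective hω hn).ts (hω := hω.pow_eq_one) hω0 (d := d) (i := i)).2
    X _ β (Hom.id _) hβs
  exact ⟨d, i, _, β.isDirectSum_ker r hr⟩

instance finite_hom {R M N : Type*} [Ring R] [Algebra k R] [AddCommGroup M] [Module R M]
    [AddCommGroup N] [Module R N] [Module k N] [IsScalarTower k R N] [Module.Finite R M]
    [Module.Finite k N] : Module.Finite k (M →ₗ[R] N) := by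
  obtain ⟨m, f, hf⟩ := Module.Finite.exists_fin' R M
  let ev : (M →ₗ[R] N) →ₗ[k] (Fin m → N) :=
    { toFun := fun g i => g (f (Pi.single i 1))
      map_add' := fun _ _ => rfl
      map_smul' := fun _ _ => rfl }
  refine Module.Finite.of_injective ev fun g g' h => ?_
  have h2 : g ∘ₗ f = g' ∘ₗ f := LinearMap.pi_ext' fun i => LinearMap.ext_ring (congrFun h i)
  ext y
  obtain ⟨x, rfl⟩ := hf y
  exact LinearMap.congr_fun h2 x

/-- Every finitely generated projective object is built from twists and shifts of `P`. -/
theorem Cover.projective_induction {F : Core A} {L P : Obj A} {s : ℤ} (C : Cover F L s)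
    (R : Rep F.toFrame P s) (hn : (n : k) ≠ 0) {ω : k} (hω : IsPrimitiveRoot ω n)
    {Φ : Obj A → Prop} (h0 : ∀ X : Obj A, Subsingleton X.carrier → Φ X)
    (hts : ∀ d i, Φ (P.ts hω.pow_eq_one d i))
    (hsum : ∀ X X' X'', IsFGProjective X' → IsFGProjective X'' → IsDirectSum X X' X'' → Φ X' →
      Φ X'' → Φ X)
    {X : Obj A} (hX : IsFGProjective X) : Φ X := by
  have hn0 : n ≠ 0 := by rintro rfl; simp at hn
  have hω0 := hω.ne_zero hn0
  have hLf : Module.Finite k L.carrier := C.isFinDim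
  obtain ⟨π, hπ⟩ := R.exists_hom hn0 (C.eig_x ω)
  have step : ∀ N : ℕ, ∀ X : Obj A, IsFGProjective X →
      Module.finrank k (X.carrier →ₗ[A.carrier] L.carrier) = N → Φ X := by
    intro N
    induction N using Nat.strong_induction_on with
    | _ N ih =>
    intro X hX hN
    rcases subsingleton_or_nontrivial X.carrier with hs | hs
    · exact h0 X hs
    obtain ⟨d, i, X', hsd⟩ := C.exists_summand R hn hω hX
    obtain ⟨f, g, p, q, hpf, hqg, hpg, hqf, h⟩ := hsd.exists_retractions
    have hX' : IsFGProjective X' := hX.of_retract g q hqg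
    refine hsum X _ X' ((R.isFGProjective hω hn).ts hω0) hX' hsd (hts d i) (ih _ ?_ X' hX' rfl)
    have := hX.1
    rw [← hN]
    let Q : (X'.carrier →ₗ[A.carrier] L.carrier) →ₗ[k] (X.carrier →ₗ[A.carrier] L.carrier) :=
      { toFun := fun t => t ∘ₗ q.map
        map_add' := fun _ _ => rfl
        map_smul' := fun _ _ => rfl }
    have hQ : Function.Injective Q := fun t t' htt => by
      ext x
      have := LinearMap.congr_fun htt (g.map x)
      change t (q.map (g.map x)) = t' (q.map (g.map x)) at this
      rwa [hqg] at this
    rw [← LinearMap.finrank_range_of_inj hQ]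
    refine Submodule.finrank_lt fun htop => C.x_ne ?_
    let pm : X.carrier →ₗ[A.carrier] P.carrier := p.map
    have hmem : π.map ∘ₗ pm ∈ LinearMap.range Q := by rw [htop]; trivial
    obtain ⟨t, ht⟩ := hmem
    have h1 := LinearMap.congr_fun ht (f.map R.z)
    change t (q.map (f.map R.z)) = π.map (p.map (f.map R.z)) at h1
    have h2 : π.map (p.map (f.map R.z)) = C.x := (congrArg π.map (hpf R.z)).trans hπ
    have h3 : t (q.map (f.map R.z)) = 0 := (congrArg t (hqf R.z)).trans (map_zero t)
    exact (h1.trans h2).symm.trans h3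
  exact step _ X hX rfl

/-! ### Characters of projective objects -/

/-- The morphisms from `X` to the twist by `ω ^ i` and shift by `d` of `L`. -/
def homSpace (ω : k) (d : ℤ) (i : ℕ) (X L : Obj A) :
    Submodule k (X.carrier →ₗ[A.carrier] L.carrier) where
  carrier := {f | (∀ e, ∀ m ∈ X.deg e, f m ∈ L.deg (e - d)) ∧ ∀ m, f (X.σ m) = ω ^ i • L.σ (f m)}
  zero_mem' := ⟨fun _ _ _ => zero_mem _, fun _ => by simp⟩
  add_mem' ha hb := ⟨fun e m hm => add_mem (ha.1 e m hm) (hb.1 e m hm), fun m => by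
    rw [LinearMap.add_apply, ha.2, hb.2, LinearMap.add_apply, map_add, smul_add]⟩
  smul_mem' c f hf := ⟨fun e m hm => Submodule.smul_mem _ _ (hf.1 e m hm), fun m => by
    rw [LinearMap.smul_apply, hf.2, LinearMap.smul_apply, map_smul, smul_comm]⟩

/-- Precomposition with a morphism. -/
def homSpace.precomp {X Y : Obj A} (f : Hom X Y) (ω : k) (d : ℤ) (i : ℕ) (L : Obj A) :
    homSpace ω d i Y L →ₗ[k] homSpace ω d i X L where
  toFun h := ⟨h.1 ∘ₗ f.map, fun e m hm => h.2.1 e _ (f.map_mem hm), fun m => by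
    rw [LinearMap.comp_apply, f.map_σ]; exact h.2.2 _⟩
  map_add' _ _ := rfl
  map_smul' _ _ := rfl

theorem finrank_homSpace_of_iso {X Y L : Obj A} (h : IsIso X Y) (ω : k) (d : ℤ) (i : ℕ) :
    Module.finrank k (homSpace ω d i X L) = Module.finrank k (homSpace ω d i Y L) := by
  obtain ⟨f, hf⟩ := h
  refine (LinearEquiv.finrank_eq
    { homSpace.precomp f ω d i L with
      invFun := homSpace.precomp (f.inv hf) ω d i L
      left_inv := fun h => Subtype.ext (LinearMap.ext fun y =>
        congrArg h.1 (f.apply_inv hf y))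
      right_inv := fun h => Subtype.ext (LinearMap.ext fun y =>
        congrArg h.1 (f.inv_apply hf y)) }).symm

theorem finrank_homSpace_of_directSum {X X' X'' L : Obj A} (h : IsDirectSum X X' X'') (ω : k)
    (d : ℤ) (i : ℕ) (hL : IsFinDim L) (hX' : IsFGProjective X') (hX'' : IsFGProjective X'') :
    Module.finrank k (homSpace ω d i X L) =
      Module.finrank k (homSpace ω d i X' L) + Module.finrank k (homSpace ω d i X'' L) := by
  have : Module.Finite k L.carrier := hL
  have := hX'.1
  have := hX''.1
  obtain ⟨f, g, p, q, hpf, hqg, hpg, hqf, h⟩ := h.exists_retractions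
  rw [← Module.finrank_prod]
  refine LinearEquiv.finrank_eq
    { (homSpace.precomp f ω d i L).prod (homSpace.precomp g ω d i L) with
      invFun := fun t => homSpace.precomp p ω d i L t.1 + homSpace.precomp q ω d i L t.2
      left_inv := fun t => Subtype.ext (LinearMap.ext fun x => ?_)
      right_inv := fun t => Prod.ext (Subtype.ext (LinearMap.ext fun x => ?_))
        (Subtype.ext (LinearMap.ext fun x => ?_)) }
  · change t.1 (f.map (p.map x)) + t.1 (g.map (q.map x)) = t.1 x
    rw [← map_add, h]
  · change t.1.1 (p.map (f.map x)) + t.2.1 (q.map (f.map x)) = t.1.1 x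
    rw [hpf, hqf, map_zero, add_zero]
  · change t.1.1 (p.map (g.map x)) + t.2.1 (q.map (g.map x)) = t.2.1 x
    rw [hqg, hpg, map_zero, zero_add]

theorem homSpace_twist {ω : k} (hω : ω ^ n = 1) (hω0 : ω ≠ 0) (d : ℤ) (i : ℕ) (X L : Obj A) :
    homSpace ω d (i + 1) (X.twist ω hω) L = homSpace ω d i X L := by
  ext (f : X.carrier →ₗ[A.carrier] L.carrier)
  refine and_congr Iff.rfl (forall_congr' fun (m : X.carrier) => ?_)
  have h1 : f (ω • X.σ m) = ω • f (X.σ m) := by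
    rw [← algebraMap_smul A.carrier ω, map_smul, algebraMap_smul]
  change f (ω • X.σ m) = ω ^ (i + 1) • L.σ (f m) ↔ _
  rw [h1, pow_succ', mul_smul, smul_right_inj hω0]

theorem homSpace_shift (ω : k) (d s : ℤ) (i : ℕ) (X L : Obj A) :
    homSpace ω d i (X.shift s) L = homSpace ω (d - s) i X L := by
  ext (f : X.carrier →ₗ[A.carrier] L.carrier)
  refine and_congr ⟨fun h e m hm => ?_, fun h e m hm => ?_⟩ Iff.rfl
  · have := h (e + s) m (by change m ∈ X.deg (e + s - s); rwa [add_sub_cancel_right])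
    rwa [show e + s - d = e - (d - s) by ring] at this
  · have := h (e - s) m hm
    rwa [show e - s - (d - s) = e - d by ring] at this

theorem homSpace_add_n {ω : k} (hω : ω ^ n = 1) (d : ℤ) (i : ℕ) (X L : Obj A) :
    homSpace ω d (i + n) X L = homSpace ω d i X L := by
  ext f
  refine and_congr Iff.rfl (forall_congr' fun m => ?_)
  rw [pow_add, hω, mul_one]

section Character

variable {O : Type} [CommRing O] (ζ : O) (ω : k)

/-- The coefficients of the character of a projective object. -/
def homCoeff (L X : Obj A) (d : ℤ) : O :=
  ∑ i ∈ Finset.range n, (Module.finrank k (homSpace ω d i X L) : O) * ζ ^ i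

/-- The character of a projective object. -/
def homChar (L X : Obj A) : O[T;T⁻¹] := gsum (homCoeff ζ ω L X)

theorem homCoeff_support {L X : Obj A} (hL : IsFinDim L) (hX : IsFGProjective X) :
    (homCoeff ζ ω L X).support.Finite := by
  classical
  have : Module.Finite k L.carrier := hL
  obtain ⟨S, hS⟩ := hX.1
  let D : Finset ℤ := S.biUnion fun x => (coaction X.internal x).support
  have hfin := (D.finite_toSet.prod (finite_degrees L.internal)).image
    (fun p : ℤ × ℤ => p.1 - p.2)
  refine hfin.subset fun d hd => ?_
  by_contra hnot
  refine hd (Finset.sum_eq_zero fun i _ => ?_)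
  have : homSpace ω d i X L = ⊥ := by
    refine eq_bot_iff.2 fun f hf => (Submodule.mem_bot _).2 ?_
    have hSf : ∀ x ∈ S, f x = 0 := by
      intro x hx
      rw [← sum_component X.internal x, map_sum]
      refine Finset.sum_eq_zero fun e he => ?_
      have h1 := hf.1 e _ (component_mem X.internal e x)
      by_contra h0
      refine hnot ⟨(e, e - d), ⟨Finset.mem_coe.2 (Finset.mem_biUnion.2 ⟨x, hx, he⟩), fun hb => ?_⟩,
        sub_sub_cancel _ _⟩
      rw [hb, Submodule.mem_bot] at h1
      exact h0 h1
    have : Submodule.span A.carrier (S : Set X.carrier) ≤ LinearMap.ker f :=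
      Submodule.span_le.2 hSf
    rw [hS, top_le_iff, LinearMap.ker_eq_top] at this
    exact this
  rw [this, finrank_bot, Nat.cast_zero, zero_mul]

theorem homChar_of_iso {L X Y : Obj A} (h : IsIso X Y) :
    homChar ζ ω L X = homChar ζ ω L Y := by
  have : homCoeff ζ ω L X = homCoeff ζ ω L Y := funext fun d =>
    Finset.sum_congr rfl fun i _ => by rw [finrank_homSpace_of_iso h]
  rw [homChar, this, homChar]

theorem homChar_isEval {ζ : O} {φ : O →+* k} (hω : IsPrimitiveRoot (φ ζ) n) (hζ : ζ ^ n = 1)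
    (hn : (n : k) ≠ 0) {L : Obj A} (hL : IsFinDim L) :
    IsEval ζ φ IsDirectSum (S := IsFGProjective (A := A)) fun X => homChar ζ (φ ζ) L X.1 where
  iso X Y h := homChar_of_iso _ _ h
  add X X' X'' h := by
    have h1 : homCoeff ζ (φ ζ) L X.1 = fun d => homCoeff ζ (φ ζ) L X'.1 d +
        homCoeff ζ (φ ζ) L X''.1 d := by
      funext d
      rw [homCoeff, homCoeff, homCoeff, ← Finset.sum_add_distrib]
      refine Finset.sum_congr rfl fun i _ => ?_
      rw [finrank_homSpace_of_directSum h _ _ _ hL X'.2 X''.2, Nat.cast_add, add_mul]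
    rw [homChar, h1, gsum_add (homCoeff_support ζ _ hL X'.2) (homCoeff_support ζ _ hL X''.2)]
    rfl
  twist hω' X Y h := by
    have hn0 : n ≠ 0 := by rintro rfl; simp at hn
    rw [homChar_of_iso _ _ h, homChar, homChar, smul_eq_mul,
      ← gsum_C_mul (homCoeff_support ζ _ hL X.2)]
    congr 1
    funext d
    rw [homCoeff, homCoeff, ← sum_range_shift, Finset.mul_sum]
    · refine Finset.sum_congr rfl fun i _ => ?_
      rw [homSpace_twist hω' (hω.ne_zero hn0) d i X.1 L, pow_succ']
      exact mul_left_comm _ _ _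
    · have h := homSpace_add_n hω' d 0 (X.1.twist (φ ζ) hω') L
      rw [zero_add] at h
      rw [h, hζ, pow_zero]
  shift X Y h := by
    rw [homChar_of_iso _ _ h, homChar, homChar, smul_eq_mul,
      ← gsum_T_mul (homCoeff_support ζ _ hL X.2)]
    congr 1
    funext d
    rw [homCoeff, homCoeff]
    refine Finset.sum_congr rfl fun i _ => ?_
    rw [homSpace_shift]
    rfl

/-- Morphisms out of a representing object are eigenvectors. -/
theorem Rep.finrank_homSpace {G : Frame A} {Z : Obj A} {s : ℤ} (R : Rep G Z s) (hn : n ≠ 0)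
    {ω : k} (hω : ω ^ n = 1) (L : Obj A) (d : ℤ) {i j : ℕ} (hij : i + j = n) :
    Module.finrank k (homSpace ω d i Z L) = Module.finrank k (G.eig ω (s - d) j L) := by
  have hij' : ω ^ j * ω ^ i = 1 := by rw [← pow_add, add_comm, hij, hω]
  have hij'' : ω ^ i * ω ^ j = 1 := by rw [← pow_add, hij, hω]
  let ev : homSpace ω d i Z L →ₗ[k] G.eig ω (s - d) j L :=
    { toFun := fun f => ⟨f.1 R.z, f.2.1 _ _ R.z_mem, by rw [← map_smul, R.e_z], by
        have h := f.2.2 R.z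
        have h2 : ω ^ j • G.v • f.1 (Z.σ R.z) = ω ^ j • G.v • (ω ^ i • L.σ (f.1 R.z)) :=
          congrArg (fun y => ω ^ j • G.v • y) h
        rw [← map_smul, R.ψ_z, smul_comm G.v, smul_smul, hij', one_smul] at h2
        exact h2.symm⟩
      map_add' := fun _ _ => rfl
      map_smul' := fun _ _ => rfl }
  refine (LinearEquiv.ofBijective ev ⟨fun f g h => Subtype.ext (R.ext (congrArg Subtype.val h)),
    fun y => ?_⟩).finrank_eq
  have hy : y.1 ∈ G.eig ω s 0 (L.ts hω d i) := by
    refine ⟨y.2.1, y.2.2.1, ?_⟩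
    change G.v • (ω ^ i • L.σ y.1) = ω ^ 0 • y.1
    rw [smul_comm, y.2.2.2, smul_smul, hij'', pow_zero]
  obtain ⟨f, hf⟩ := R.exists_hom hn hy
  exact ⟨⟨f.map, fun e m hm => f.map_mem hm, f.map_σ⟩, Subtype.ext hf⟩

/-- The character of a representing object is conjugate to that of the represented part of `L`. -/
theorem Rep.homCoeff_eq {G : Frame A} {Z : Obj A} {s : ℤ} (R : Rep G Z s) (hn : n ≠ 0) {ω : k}
    (hω : ω ^ n = 1) {ζ : O} (hζ : ζ ^ n = 1) (bar : O →+* O) (hbar : bar ζ * ζ = 1) (L : Obj A)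
    (d : ℤ) : homCoeff ζ ω L Z d = bar (G.charCoeff ζ ω s L (-d)) := by
  have hb : ∀ j ≤ n, (bar ζ) ^ j = ζ ^ (n - j) := fun j hj => by
    have h1 : ζ ^ j * ζ ^ (n - j) = 1 := by rw [← pow_add, Nat.add_sub_cancel' hj, hζ]
    calc (bar ζ) ^ j = (bar ζ) ^ j * (ζ ^ j * ζ ^ (n - j)) := by rw [h1, mul_one]
      _ = ζ ^ (n - j) := by rw [← mul_assoc, ← mul_pow, hbar, one_pow, one_mul]
  let g : ℕ → O := fun i => (Module.finrank k (G.eig ω (s - d) (n - i) L) : O) * ζ ^ i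
  have h1 : homCoeff ζ ω L Z d = ∑ i ∈ Finset.range n, g i :=
    Finset.sum_congr rfl fun i hi => by
      rw [R.finrank_homSpace hn hω L d (j := n - i)
        (Nat.add_sub_cancel' (Finset.mem_range.1 hi).le)]
  rw [h1, Frame.charCoeff, map_sum, ← sum_range_shift g, ← Finset.sum_range_reflect]
  · refine Finset.sum_congr rfl fun j hj => ?_
    have hj := Finset.mem_range.1 hj
    rw [map_mul, map_natCast, map_pow, hb j hj.le]
    simp only [g]
    rw [show n - 1 - j + 1 = n - j by omega, Nat.sub_sub_self hj.le, neg_add_eq_sub]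
  · have := G.eig_add_n hω (s - d) 0 L
    rw [zero_add] at this
    simp only [g]
    rw [Nat.sub_self, Nat.sub_zero, this, hζ, pow_zero]

theorem Rep.homChar_self {F : Core A} {L P : Obj A} {s : ℤ} (C : Cover F L s)
    (R : Rep F.toFrame P s) (hn : (n : k) ≠ 0) {ω : k} (hω : IsPrimitiveRoot ω n) {ζ : O}
    (hζ : ζ ^ n = 1) (bar : O →+* O) (hbar : bar ζ * ζ = 1) : homChar ζ ω L P = 1 := by
  have hn0 : n ≠ 0 := by rintro rfl; simp at hn
  refine laurent_ext fun d => ?_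
  rw [homChar, gsum_coeff (homCoeff_support ζ ω C.isFinDim (R.isFGProjective hω hn)),
    R.homCoeff_eq hn0 hω.pow_eq_one hζ bar hbar,
    ← gsum_coeff (F.charCoeff_support ζ ω s C.isFinDim)]
  have h := C.char_self ζ hω hn0
  rw [Frame.char] at h
  rw [h, ← LaurentPolynomial.T_zero, LaurentPolynomial.T_apply, LaurentPolynomial.T_apply]
  by_cases hd : d = 0
  · simp [hd]
  · rw [if_neg (by omega), if_neg (by omega), map_zero]

variable {φ : O →+* k} {M : Type*} [AddCommGroup M] [Module O[T;T⁻¹] M]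

theorem IsFGProjective.twist {X : Obj A} {c : k} {hc : c ^ n = 1} (hc0 : c ≠ 0)
    (h : IsFGProjective X) : IsFGProjective (X.twist c hc) :=
  ⟨h.1, h.2.twist _ hc0⟩

theorem IsFGProjective.shift {X : Obj A} {d : ℤ} (h : IsFGProjective X) :
    IsFGProjective (X.shift d) :=
  ⟨h.1, h.2.shift⟩

/-- Additive functions on projective objects are determined by their value at `P`. -/
theorem Rep.eval {F : Core A} {L P : Obj A} {s : ℤ} (C : Cover F L s) (R : Rep F.toFrame P s)
    {ζ : O} (hω : IsPrimitiveRoot (φ ζ) n) (hζ : ζ ^ n = 1) (hn : (n : k) ≠ 0) (bar : O →+* O)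
    (hbar : bar ζ * ζ = 1) {f : {X : Obj A // IsFGProjective X} → M}
    (hf : IsEval ζ φ IsDirectSum f) (X : {X : Obj A // IsFGProjective X}) :
    f X = homChar ζ (φ ζ) L X.1 • f ⟨P, R.isFGProjective hω hn⟩ := by
  have hn0 : n ≠ 0 := by rintro rfl; simp at hn
  have hω0 := hω.ne_zero hn0
  have hc := homChar_isEval hω hζ hn C.isFinDim
  refine C.projective_induction R hn hω (Φ := fun X => ∀ hX : IsFGProjective X,
    f ⟨X, hX⟩ = homChar ζ (φ ζ) L X • f ⟨P, R.isFGProjective hω hn⟩) ?_ ?_ ?_ X.2 X.2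
  · intro X hs hX
    have h1 := hf.add ⟨X, hX⟩ ⟨X, hX⟩ ⟨X, hX⟩ isDirectSum_of_subsingleton
    have h2 := hc.add ⟨X, hX⟩ ⟨X, hX⟩ ⟨X, hX⟩ isDirectSum_of_subsingleton
    rw [left_eq_add] at h1 h2
    simp only at h2
    rw [h1, h2, zero_smul]
  · intro d i hX
    have e3 := hf.ts hω.pow_eq_one (fun _ h => h.twist hω0) (fun _ _ h => h.shift)
      ⟨P, R.isFGProjective hω hn⟩ ⟨_, hX⟩ d i (IsIso.refl _)
    have e4 := hc.ts hω.pow_eq_one (fun _ h => h.twist hω0) (fun _ _ h => h.shift)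
      ⟨P, R.isFGProjective hω hn⟩ ⟨_, hX⟩ d i (IsIso.refl _)
    simp only at e4
    rw [R.homChar_self C hn hω hζ bar hbar, smul_eq_mul, mul_one] at e4
    rw [e3, e4]
  · intro X X' X'' hX' hX'' h ih ih' hX
    have e1 := hf.add ⟨X, hX⟩ ⟨X', hX'⟩ ⟨X'', hX''⟩ h
    have e2 := hc.add ⟨X, hX⟩ ⟨X', hX'⟩ ⟨X'', hX''⟩ h
    simp only at e2
    rw [e1, e2, ih hX', ih' hX'', add_smul]

/-- The Grothendieck group of projective objects is free on the class of `P`. -/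
theorem Rep.exists_equiv [IsDomain O] {F : Core A} {L P : Obj A} {s : ℤ} (C : Cover F L s)
    (R : Rep F.toFrame P s) {ζ : O} (hω : IsPrimitiveRoot (φ ζ) n) (hζ : IsPrimitiveRoot ζ n)
    (hn : (n : k) ≠ 0) :
    ∃ Φ : KP ζ φ A →ₗ[O[T;T⁻¹]] O[T;T⁻¹],
      ∀ X hX, Φ (clsP ζ φ X hX) = homChar ζ (φ ζ) L X := by
  have hn0 : n ≠ 0 := by rintro rfl; simp at hn
  obtain ⟨Φ, hΦ⟩ := (homChar_isEval hω hζ.pow_eq_one hn C.isFinDim).exists_linear hn0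
    hω.pow_eq_one (torsion_free hζ) (fun X hX => hX.twist (hω.ne_zero hn0))
  exact ⟨Φ, fun X hX => hΦ ⟨X, hX⟩⟩

end Character

end

section

variable {k : Type u} [Field k] {n : ℕ} {A B : FoldedAlg.{u, w} k n}

/-! ### Additive functors -/

theorem IsIso.of_inverse {X Y : Obj A} (f : Hom X Y) (g : Hom Y X) (h : ∀ x, g.map (f.map x) = x)
    (h' : ∀ y, f.map (g.map y) = y) : IsIso X Y :=
  ⟨f, Function.LeftInverse.injective h, Function.RightInverse.surjective h'⟩

/-- An additive functor on objects and morphisms which is compatible with twists and shifts. -/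
structure AdditiveFunctor (A B : FoldedAlg.{u, w} k n) where
  obj : Obj A → Obj B
  map : ∀ {X Y : Obj A}, Hom X Y → Hom (obj X) (obj Y)
  map_comp : ∀ {X Y Z : Obj A} (g : Hom Y Z) (f : Hom X Y) m,
    (map g).map ((map f).map m) = (map (g.comp f)).map m
  map_id : ∀ {X : Obj A} (f : Hom X X), (∀ x, f.map x = x) → ∀ m, (map f).map m = m
  map_add : ∀ {X Y : Obj A} (f g h : Hom X Y), (∀ x, f.map x + g.map x = h.map x) →
    ∀ m, (map f).map m + (map g).map m = (map h).map m
  twist : ∀ X (c : k) (hc : c ^ n = 1), IsIso (obj (X.twist c hc)) ((obj X).twist c hc)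
  shift : ∀ X (d : ℤ), IsIso (obj (X.shift d)) ((obj X).shift d)

namespace AdditiveFunctor

variable (Φ : AdditiveFunctor A B)

theorem isIso {X Y : Obj A} (h : IsIso X Y) : IsIso (Φ.obj X) (Φ.obj Y) := by
  obtain ⟨f, hf⟩ := h
  refine IsIso.of_inverse (Φ.map f) (Φ.map (f.inv hf)) (fun x => ?_) (fun y => ?_)
  · rw [Φ.map_comp]; exact Φ.map_id _ (f.inv_apply hf) x
  · rw [Φ.map_comp]; exact Φ.map_id _ (f.apply_inv hf) y

theorem map_zero {X Y : Obj A} (f : Hom X Y) (hf : ∀ x, f.map x = 0) (m) : (Φ.map f).map m = 0 := by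
  have := Φ.map_add f f f (fun x => by rw [hf, add_zero]) m
  rwa [add_eq_left] at this

theorem isDirectSum {X X' X'' : Obj A} (h : IsDirectSum X X' X'') :
    IsDirectSum (Φ.obj X) (Φ.obj X') (Φ.obj X'') := by
  obtain ⟨f, g, p, q, hpf, hqg, hpg, hqf, h⟩ := h.exists_retractions
  refine IsDirectSum.of_retractions (Φ.map f) (Φ.map g) (Φ.map p) (Φ.map q) (fun x => ?_)
    (fun x => ?_) (fun x => ?_) (fun x => ?_) (fun x => ?_)
  · rw [Φ.map_comp]; exact Φ.map_id _ hpf x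
  · rw [Φ.map_comp]; exact Φ.map_id _ hqg x
  · rw [Φ.map_comp]; exact Φ.map_zero _ hpg x
  · rw [Φ.map_comp]; exact Φ.map_zero _ hqf x
  · rw [Φ.map_comp, Φ.map_comp, Φ.map_add _ _ (Hom.id X) h]
    exact Φ.map_id _ (fun _ => rfl) x

theorem isEval {O : Type} [CommRing O] {ζ : O} {φ : O →+* k} {S : Obj A → Prop}
    {E : Obj A → Obj A → Obj A → Prop} {S' : Obj B → Prop} {E' : Obj B → Obj B → Obj B → Prop}
    {M : Type*} [AddCommGroup M] [Module O[T;T⁻¹] M] {f : {X : Obj B // S' X} → M}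
    (hf : IsEval ζ φ E' f) (hS : ∀ X, S X → S' (Φ.obj X))
    (add : ∀ X X' X'', E X X' X'' → E' (Φ.obj X) (Φ.obj X') (Φ.obj X'')) :
    IsEval ζ φ E fun X : {X : Obj A // S X} => f ⟨Φ.obj X.1, hS X.1 X.2⟩ where
  iso _ _ h := hf.iso _ _ (Φ.isIso h)
  add _ _ _ h := hf.add _ _ _ (add _ _ _ h)
  twist hω X _ h := hf.twist hω ⟨Φ.obj X.1, hS X.1 X.2⟩ _ ((Φ.isIso h).trans (Φ.twist _ _ hω))
  shift X _ h := hf.shift ⟨Φ.obj X.1, hS X.1 X.2⟩ _ ((Φ.isIso h).trans (Φ.shift _ _))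

theorem isIso_ts {ω : k} (hω : ω ^ n = 1) (d : ℤ) (i : ℕ) (X : Obj A) :
    IsIso (Φ.obj (X.ts hω d i)) ((Φ.obj X).ts hω d i) :=
  (Φ.shift _ _).trans (Φ.twist _ _ _).shift

end AdditiveFunctor

/-! ### Tensor products -/

theorem map_mem_of_mem_span {M N : Type*} [AddCommGroup M] [Module k M] [AddCommGroup N]
    [Module k N] (f : M →ₗ[k] N) {s : Set M} {p : Submodule k N} (h : ∀ x ∈ s, f x ∈ p) {x : M}
    (hx : x ∈ Submodule.span k s) : f x ∈ p :=
  (Submodule.span_le.2 h : Submodule.span k s ≤ p.comap f) hx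

theorem map_tensorDeg {M N M' N' : Type w} [AddCommGroup M] [Module k M] [AddCommGroup N]
    [Module k N] [AddCommGroup M'] [Module k M'] [AddCommGroup N'] [Module k N']
    {degM : ℤ → Submodule k M} {degN : ℤ → Submodule k N} {degM' : ℤ → Submodule k M'}
    {degN' : ℤ → Submodule k N'} (f : M →ₗ[k] M') (g : N →ₗ[k] N') (c : ℤ)
    (h : ∀ i j x y, x ∈ degM i → y ∈ degN j → f x ⊗ₜ[k] g y ∈ tensorDeg degM' degN' (i + j + c))
    {d : ℤ} {z : M ⊗[k] N} (hz : z ∈ tensorDeg degM degN d) :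
    TensorProduct.map f g z ∈ tensorDeg degM' degN' (d + c) := by
  refine map_mem_of_mem_span (TensorProduct.map f g) ?_ hz
  rintro _ ⟨p, q, a, b, ha, hb, rfl, rfl⟩
  exact h _ _ _ _ ha hb

theorem map_tensorDeg_zero {M N M' N' : Type w} [AddCommGroup M] [Module k M] [AddCommGroup N]
    [Module k N] [AddCommGroup M'] [Module k M'] [AddCommGroup N'] [Module k N']
    {degM : ℤ → Submodule k M} {degN : ℤ → Submodule k N} {degM' : ℤ → Submodule k M'}
    {degN' : ℤ → Submodule k N'} (f : M →ₗ[k] M') (g : N →ₗ[k] N')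
    (hf : ∀ i, ∀ x ∈ degM i, f x ∈ degM' i) (hg : ∀ i, ∀ x ∈ degN i, g x ∈ degN' i)
    {d : ℤ} {z : M ⊗[k] N} (hz : z ∈ tensorDeg degM degN d) :
    TensorProduct.map f g z ∈ tensorDeg degM' degN' d := by
  have := map_tensorDeg (degM' := degM') (degN' := degN') f g 0 (fun i j x y hx hy => by
    rw [add_zero]; exact tmul_mem_tensorDeg (hf _ _ hx) (hg _ _ hy)) hz
  rwa [add_zero] at this

theorem tensorAction_map {X X' : Obj A} {Y Y' : Obj B} (f : X.carrier →ₗ[A.carrier] X'.carrier)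
    (g : Y.carrier →ₗ[B.carrier] Y'.carrier) (r : A.carrier ⊗[k] B.carrier)
    (m : X.carrier ⊗[k] Y.carrier) :
    TensorProduct.map (f.restrictScalars k) (g.restrictScalars k) (Obj.tensorAction X Y r m) =
      Obj.tensorAction X' Y' r
        (TensorProduct.map (f.restrictScalars k) (g.restrictScalars k) m) := by
  induction r with
  | zero => simp
  | add a b ha hb => simp only [map_add, LinearMap.add_apply, ha, hb]
  | tmul a b =>
    induction m with
    | zero => simp
    | add x y hx hy => simp only [map_add, hx, hy]
    | tmul x y =>
      rw [Obj.tensorAction_tmul, TensorProduct.map_tmul, TensorProduct.map_tmul,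
        Obj.tensorAction_tmul]
      exact congrArg₂ (· ⊗ₜ[k] ·) (f.map_smul a x) (g.map_smul b y)

/-- The tensor product of module maps. -/
def tensorMap {X X' : Obj A} {Y Y' : Obj B} (f : X.carrier →ₗ[A.carrier] X'.carrier)
    (g : Y.carrier →ₗ[B.carrier] Y'.carrier) :
    (X.tensor Y).carrier →ₗ[(A.tensor B).carrier] (X'.tensor Y').carrier where
  toFun := TensorProduct.map (f.restrictScalars k) (g.restrictScalars k)
  map_add' := map_add _
  map_smul' r m := tensorAction_map f g r m

/-- The tensor product of morphisms. -/
def Hom.tensor {X X' : Obj A} {Y Y' : Obj B} (f : Hom X X') (g : Hom Y Y') :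
    Hom (X.tensor Y) (X'.tensor Y') where
  map := tensorMap f.map g.map
  map_mem hz := map_tensorDeg_zero _ _ (fun _ _ h => f.map_mem h) (fun _ _ h => g.map_mem h) hz
  map_σ := by
    have h1 : (f.map.restrictScalars k) ∘ₗ X.σ = X'.σ ∘ₗ f.map.restrictScalars k :=
      LinearMap.ext fun x => f.map_σ x
    have h2 : (g.map.restrictScalars k) ∘ₗ Y.σ = Y'.σ ∘ₗ g.map.restrictScalars k :=
      LinearMap.ext fun x => g.map_σ x
    have h3 : TensorProduct.map (f.map.restrictScalars k) (g.map.restrictScalars k) ∘ₗ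
        TensorProduct.map X.σ Y.σ = TensorProduct.map X'.σ Y'.σ ∘ₗ
          TensorProduct.map (f.map.restrictScalars k) (g.map.restrictScalars k) := by
      rw [← TensorProduct.map_comp, ← TensorProduct.map_comp, h1, h2]
    exact fun m => LinearMap.congr_fun h3 m

theorem Hom.tensor_comp {X X' X'' : Obj A} {Y Y' Y'' : Obj B} (f : Hom X X') (g : Hom Y Y')
    (f' : Hom X' X'') (g' : Hom Y' Y'') (m : (X.tensor Y).carrier) :
    (f'.tensor g').map ((f.tensor g).map m) = ((f'.comp f).tensor (g'.comp g)).map m :=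
  TensorProduct.map_map _ _ _ _ m

theorem Hom.tensor_eq_self {X : Obj A} {Y : Obj B} (f : Hom X X) (g : Hom Y Y)
    (hf : ∀ x, f.map x = x) (hg : ∀ y, g.map y = y) (m : (X.tensor Y).carrier) :
    (f.tensor g).map m = m := by
  have h1 : f.map.restrictScalars k = LinearMap.id := LinearMap.ext hf
  have h2 : g.map.restrictScalars k = LinearMap.id := LinearMap.ext hg
  change TensorProduct.map (f.map.restrictScalars k) (g.map.restrictScalars k) m = m
  rw [h1, h2, TensorProduct.map_id]
  rfl

theorem tensor_twist_left (X : Obj A) (Y : Obj B) (c : k) (hc : c ^ n = 1) :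
    IsIso ((X.twist c hc).tensor Y) ((X.tensor Y).twist c hc) :=
  ⟨⟨(LinearMap.id : (X.tensor Y).carrier →ₗ[(A.tensor B).carrier] (X.tensor Y).carrier),
    fun h => h, fun m => LinearMap.congr_fun (TensorProduct.map_smul_left c X.σ Y.σ) m⟩,
    Function.bijective_id⟩

theorem tensor_twist_right (X : Obj A) (Y : Obj B) (c : k) (hc : c ^ n = 1) :
    IsIso (X.tensor (Y.twist c hc)) ((X.tensor Y).twist c hc) :=
  ⟨⟨(LinearMap.id : (X.tensor Y).carrier →ₗ[(A.tensor B).carrier] (X.tensor Y).carrier),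
    fun h => h, fun m => LinearMap.congr_fun (TensorProduct.map_smul_right c X.σ Y.σ) m⟩,
    Function.bijective_id⟩

theorem tensorDeg_shift_left {M N : Type w} [AddCommGroup M] [Module k M] [AddCommGroup N]
    [Module k N] (degM : ℤ → Submodule k M) (degN : ℤ → Submodule k N) (s d : ℤ) :
    tensorDeg (fun i => degM (i - s)) degN d ≤ tensorDeg degM degN (d - s) := by
  refine Submodule.span_le.2 ?_
  rintro _ ⟨i, j, x, y, hx, hy, rfl, rfl⟩
  rw [show i + j - s = i - s + j by ring]
  exact tmul_mem_tensorDeg hx hy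

theorem tensorDeg_shift_right {M N : Type w} [AddCommGroup M] [Module k M] [AddCommGroup N]
    [Module k N] (degM : ℤ → Submodule k M) (degN : ℤ → Submodule k N) (s d : ℤ) :
    tensorDeg degM (fun i => degN (i - s)) d ≤ tensorDeg degM degN (d - s) := by
  refine Submodule.span_le.2 ?_
  rintro _ ⟨i, j, x, y, hx, hy, rfl, rfl⟩
  rw [show i + j - s = i + (j - s) by ring]
  exact tmul_mem_tensorDeg hx hy

theorem tensor_shift_left (X : Obj A) (Y : Obj B) (s : ℤ) :
    IsIso ((X.shift s).tensor Y) ((X.tensor Y).shift s) :=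
  ⟨⟨(LinearMap.id : (X.tensor Y).carrier →ₗ[(A.tensor B).carrier] (X.tensor Y).carrier),
    fun {_ _} h => tensorDeg_shift_left X.deg Y.deg s _ h, fun _ => rfl⟩, Function.bijective_id⟩

theorem tensor_shift_right (X : Obj A) (Y : Obj B) (s : ℤ) :
    IsIso (X.tensor (Y.shift s)) ((X.tensor Y).shift s) :=
  ⟨⟨(LinearMap.id : (X.tensor Y).carrier →ₗ[(A.tensor B).carrier] (X.tensor Y).carrier),
    fun {_ _} h => tensorDeg_shift_right X.deg Y.deg s _ h, fun _ => rfl⟩, Function.bijective_id⟩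

/-- Tensoring with an object on the right. -/
def tensorRight (Y : Obj B) : AdditiveFunctor A (A.tensor B) where
  obj X := X.tensor Y
  map f := f.tensor (Hom.id Y)
  map_comp g f m := Hom.tensor_comp f (Hom.id Y) g (Hom.id Y) m
  map_id f hf m := Hom.tensor_eq_self f (Hom.id Y) hf (fun _ => rfl) m
  map_add {X X'} f g h H m := by
    have h1 : f.map.restrictScalars k + g.map.restrictScalars k = h.map.restrictScalars k :=
      LinearMap.ext H
    have h2 := TensorProduct.map_add_left (f.map.restrictScalars k) (g.map.restrictScalars k)
      (LinearMap.id : Y.carrier →ₗ[k] Y.carrier)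
    rw [h1] at h2
    exact (LinearMap.congr_fun h2 m).symm
  twist X c hc := tensor_twist_left X Y c hc
  shift X d := tensor_shift_left X Y d

/-- Tensoring with an object on the left. -/
def tensorLeft (X : Obj A) : AdditiveFunctor B (A.tensor B) where
  obj Y := X.tensor Y
  map f := (Hom.id X).tensor f
  map_comp g f m := Hom.tensor_comp (Hom.id X) f (Hom.id X) g m
  map_id f hf m := Hom.tensor_eq_self (Hom.id X) f (fun _ => rfl) hf m
  map_add {Y Y'} f g h H m := by
    have h1 : f.map.restrictScalars k + g.map.restrictScalars k = h.map.restrictScalars k :=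
      LinearMap.ext H
    have h2 := TensorProduct.map_add_right (LinearMap.id : X.carrier →ₗ[k] X.carrier)
      (f.map.restrictScalars k) (g.map.restrictScalars k)
    rw [h1] at h2
    exact (LinearMap.congr_fun h2 m).symm
  twist Y c hc := tensor_twist_right X Y c hc
  shift Y d := tensor_shift_right X Y d

theorem IsFinDim.tensor {X : Obj A} {Y : Obj B} (hX : IsFinDim X) (hY : IsFinDim Y) :
    IsFinDim (X.tensor Y) := by
  have : Module.Finite k X.carrier := hX
  have : Module.Finite k Y.carrier := hY
  exact Module.Finite.tensorProduct k X.carrier Y.carrier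

theorem IsExtension.tensor_left {X X' X'' : Obj A} (h : IsExtension X X' X'') (Y : Obj B) :
    IsExtension (X.tensor Y) (X'.tensor Y) (X''.tensor Y) := by
  obtain ⟨f, g, hf, hg, hfg⟩ := h
  have hex : Function.Exact (f.map.restrictScalars k) (g.map.restrictScalars k) := fun x => by
    change x ∈ LinearMap.ker g.map ↔ x ∈ LinearMap.range f.map
    rw [hfg]
  refine ⟨f.tensor (Hom.id Y), g.tensor (Hom.id Y),
    Module.Flat.rTensor_preserves_injective_linearMap (M := Y.carrier) (f.map.restrictScalars k) hf,
    LinearMap.rTensor_surjective Y.carrier (g := g.map.restrictScalars k) hg, ?_⟩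
  ext m
  exact (rTensor_exact Y.carrier hex hg m).symm

theorem IsExtension.tensor_right {Y Y' Y'' : Obj B} (h : IsExtension Y Y' Y'') (X : Obj A) :
    IsExtension (X.tensor Y) (X.tensor Y') (X.tensor Y'') := by
  obtain ⟨f, g, hf, hg, hfg⟩ := h
  have hex : Function.Exact (f.map.restrictScalars k) (g.map.restrictScalars k) := fun x => by
    change x ∈ LinearMap.ker g.map ↔ x ∈ LinearMap.range f.map
    rw [hfg]
  refine ⟨(Hom.id X).tensor f, (Hom.id X).tensor g,
    Module.Flat.lTensor_preserves_injective_linearMap (M := X.carrier) (f.map.restrictScalars k) hf,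
    LinearMap.lTensor_surjective X.carrier (g := g.map.restrictScalars k) hg, ?_⟩
  ext m
  exact (lTensor_exact X.carrier hex hg m).symm

/-- The element `a ⊗ b` of the algebra `A ⊗ B`. -/
def tmul (a : A.carrier) (b : B.carrier) : (A.tensor B).carrier :=
  (a ⊗ₜ[k] b : A.carrier ⊗[k] B.carrier)

/-- The element `x ⊗ y` of the object `X ⊗ Y`. -/
def Obj.tmul {X : Obj A} {Y : Obj B} (x : X.carrier) (y : Y.carrier) : (X.tensor Y).carrier :=
  (x ⊗ₜ[k] y : X.carrier ⊗[k] Y.carrier)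

theorem tmul_mul_tmul (a a' : A.carrier) (b b' : B.carrier) :
    tmul a b * tmul a' b' = tmul (a * a') (b * b') :=
  Algebra.TensorProduct.tmul_mul_tmul a a' b b'

theorem aut_tmul (a : A.carrier) (b : B.carrier) :
    (A.tensor B).aut (tmul a b) = tmul (A.aut a) (B.aut b) := rfl

theorem tmul_mem {i j : ℤ} {a : A.carrier} {b : B.carrier} (ha : a ∈ A.deg i) (hb : b ∈ B.deg j) :
    tmul a b ∈ (A.tensor B).deg (i + j) := tmul_mem_tensorDeg ha hb

theorem tensor_carrier_induction {p : (A.tensor B).carrier → Prop} (h0 : p 0)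
    (ht : ∀ a b, p (tmul a b)) (hadd : ∀ a b, p a → p b → p (a + b)) (z) : p z :=
  TensorProduct.induction_on (motive := p) z h0 ht hadd

theorem tensor_deg_induction {p : (A.tensor B).carrier → Prop} {d : ℤ} (h0 : p 0)
    (ht : ∀ i j, i + j = d → ∀ a ∈ A.deg i, ∀ b ∈ B.deg j, p (tmul a b))
    (hadd : ∀ a b, p a → p b → p (a + b)) (hsmul : ∀ (c : k) a, p a → p (c • a)) {z}
    (hz : z ∈ (A.tensor B).deg d) : p z := by
  change z ∈ tensorDeg A.deg B.deg d at hz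
  induction hz using Submodule.span_induction with
  | zero => exact h0
  | add a b _ _ ha hb => exact hadd _ _ ha hb
  | smul c a _ ha => exact hsmul _ _ ha
  | mem a ha =>
    obtain ⟨i, j, x, y, hx, hy, hij, rfl⟩ := ha
    exact ht i j hij x hx y hy

theorem tmul_smul_left (c : k) (a : A.carrier) (b : B.carrier) :
    tmul (c • a) b = c • tmul a b := rfl

theorem tmul_smul_right (c : k) (a : A.carrier) (b : B.carrier) :
    tmul a (c • b) = c • tmul a b := TensorProduct.tmul_smul c a b

theorem tmul_zero_right (a : A.carrier) : tmul a (0 : B.carrier) = 0 := TensorProduct.tmul_zero _ a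

theorem tmul_zero_left (b : B.carrier) : tmul (0 : A.carrier) b = 0 := TensorProduct.zero_tmul _ b

theorem tmul_add_right (a : A.carrier) (b b' : B.carrier) :
    tmul a (b + b') = tmul a b + tmul a b' := TensorProduct.tmul_add a b b'

theorem tmul_add_left (a a' : A.carrier) (b : B.carrier) :
    tmul (a + a') b = tmul a b + tmul a' b := TensorProduct.add_tmul a a' b

theorem tmul_smul_tmul {X : Obj A} {Y : Obj B} (a : A.carrier) (b : B.carrier) (x : X.carrier)
    (y : Y.carrier) : tmul a b • Obj.tmul x y = Obj.tmul (a • x) (b • y) := rfl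

theorem Obj.tmul_mem {X : Obj A} {Y : Obj B} {i j : ℤ} {x : X.carrier} {y : Y.carrier}
    (hx : x ∈ X.deg i) (hy : y ∈ Y.deg j) : Obj.tmul x y ∈ (X.tensor Y).deg (i + j) :=
  tmul_mem_tensorDeg hx hy

theorem Obj.tmul_smul_smul {X : Obj A} {Y : Obj B} (c c' : k) (x : X.carrier) (y : Y.carrier) :
    Obj.tmul (c • x) (c' • y) = (c * c') • Obj.tmul x y := TensorProduct.smul_tmul_smul c c' x y

theorem Obj.tensor_induction {X : Obj A} {Y : Obj B} {p : (X.tensor Y).carrier → Prop} (h0 : p 0)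
    (ht : ∀ x y, p (Obj.tmul x y)) (hadd : ∀ a b, p a → p b → p (a + b)) (z) : p z :=
  TensorProduct.induction_on (motive := p) z h0 ht hadd

theorem Obj.tmul_ne_zero {X : Obj A} {Y : Obj B} {x : X.carrier} {y : Y.carrier} (hx : x ≠ 0)
    (hy : y ≠ 0) : Obj.tmul x y ≠ 0 := by
  have key : ∀ {M : Type w} [AddCommGroup M] [Module k M] {x : M}, x ≠ 0 →
      ∃ f : M →ₗ[k] k, f x ≠ 0 := by
    intro M _ _ x hx
    by_contra! h
    exact hx ((Module.forall_dual_apply_eq_zero_iff k x).1 h)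
  obtain ⟨f, hf⟩ := key hx
  obtain ⟨g, hg⟩ := key hy
  intro h
  have h1 : x ⊗ₜ[k] y = 0 := h
  have h2 := congrArg (LinearMap.mul' k k) (congrArg (TensorProduct.map f g) h1)
  rw [TensorProduct.map_tmul, LinearMap.mul'_apply, map_zero, map_zero] at h2
  exact mul_ne_zero hf hg h2

theorem twistedPow_tensor (e v : A.carrier) (e' v' : B.carrier) (t : ℕ) :
    twistedPow (A.tensor B) (tmul e e') (tmul v v') t =
      tmul (twistedPow A e v t) (twistedPow B e' v' t) := by
  induction t with
  | zero => rfl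
  | succ t ih => rw [twistedPow, ih, aut_tmul, tmul_mul_tmul, twistedPow, twistedPow]

/-- The tensor product of frames. -/
def Frame.tensor (F : Frame A) (G : Frame B) : Frame (A.tensor B) where
  e := tmul F.e G.e
  v := tmul F.v G.v
  e_mem := by
    have := tmul_mem F.e_mem G.e_mem
    rwa [add_zero] at this
  v_mem := by
    have := tmul_mem F.v_mem G.v_mem
    rwa [add_zero] at this
  e_mul_e := by rw [tmul_mul_tmul, F.e_mul_e, G.e_mul_e]
  e_mul_v := by rw [tmul_mul_tmul, F.e_mul_v, G.e_mul_v]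
  v_mul_e := by rw [aut_tmul, tmul_mul_tmul, F.v_mul_e, G.v_mul_e]
  pow_n := by rw [twistedPow_tensor, F.pow_n, G.pow_n]

/-- The tensor product of cores. -/
def Core.tensor (F : Core A) (G : Core B) : Core (A.tensor B) where
  toFrame := F.toFrame.tensor G.toFrame
  neg d hd a ha := by
    change tmul F.e G.e * a * tmul F.e G.e = 0
    refine tensor_deg_induction (p := fun a => tmul F.e G.e * a * tmul F.e G.e = 0) (by simp)
      (fun i j hij a ha b hb => ?_) (fun a b ha hb => by rw [mul_add, add_mul, ha, hb, add_zero])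
      (fun c a ha => by rw [mul_smul_comm, smul_mul_assoc, ha, smul_zero]) ha
    rw [tmul_mul_tmul, tmul_mul_tmul]
    by_cases hi : i < 0
    · rw [F.neg i hi a ha, tmul_zero_left]
    · rw [G.neg j (by omega) b hb, tmul_zero_right]
  zero a ha := by
    change ∃ c : k, tmul F.e G.e * a * tmul F.e G.e = c • tmul F.e G.e
    refine tensor_deg_induction
      (p := fun a => ∃ c : k, tmul F.e G.e * a * tmul F.e G.e = c • tmul F.e G.e)
      ⟨0, by simp⟩ (fun i j hij a ha b hb => ?_) ?_ ?_ ha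
    · rw [tmul_mul_tmul, tmul_mul_tmul]
      rcases lt_trichotomy i 0 with hi | hi | hi
      · exact ⟨0, by rw [F.neg i hi a ha, tmul_zero_left, zero_smul]⟩
      · obtain rfl : j = 0 := by omega
        obtain ⟨c, hc⟩ := F.zero a (hi ▸ ha)
        obtain ⟨c', hc'⟩ := G.zero b hb
        exact ⟨c * c', by rw [hc, hc', tmul_smul_left, tmul_smul_right, smul_smul]⟩
      · exact ⟨0, by rw [G.neg j (by omega) b hb, tmul_zero_right, zero_smul]⟩
    · rintro a b ⟨c, hc⟩ ⟨c', hc'⟩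
      exact ⟨c + c', by rw [mul_add, add_mul, hc, hc', add_smul]⟩
    · rintro c a ⟨c', hc'⟩
      exact ⟨c * c', by rw [mul_smul_comm, smul_mul_assoc, hc', smul_smul]⟩
  full := by
    change tmul 1 1 ∈ Submodule.span k {z | ∃ a b, z = a * tmul F.e G.e * b}
    refine Submodule.span_induction (p := fun (a : A.carrier) _ => tmul a (1 : B.carrier) ∈
      Submodule.span k {z | ∃ a b, z = a * tmul F.e G.e * b}) ?_
      (by rw [tmul_zero_left]; exact zero_mem _)
      (fun x y _ _ hx hy => by rw [tmul_add_left]; exact add_mem hx hy)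
      (fun c x _ hx => by rw [tmul_smul_left]; exact Submodule.smul_mem _ c hx) F.full
    rintro _ ⟨a, b, rfl⟩
    refine Submodule.span_induction (p := fun (z : B.carrier) _ => tmul (a * F.e * b) z ∈
      Submodule.span k {z | ∃ a b, z = a * tmul F.e G.e * b}) ?_
      (by rw [tmul_zero_right]; exact zero_mem _)
      (fun x y _ _ hx hy => by rw [tmul_add_right]; exact add_mem hx hy)
      (fun c x _ hx => by rw [tmul_smul_right]; exact Submodule.smul_mem _ c hx) G.full
    rintro _ ⟨a', b', rfl⟩
    exact Submodule.subset_span ⟨tmul a a', tmul b b', by rw [tmul_mul_tmul, tmul_mul_tmul]⟩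

/-- The tensor product of covers. -/
def Cover.tensor {F : Core A} {G : Core B} {L : Obj A} {L' : Obj B} {s s' : ℤ} (C : Cover F L s)
    (C' : Cover G L' s') : Cover (F.tensor G) (L.tensor L') (s + s') where
  x := Obj.tmul C.x C'.x
  x_mem := Obj.tmul_mem C.x_mem C'.x_mem
  x_ne := Obj.tmul_ne_zero C.x_ne C'.x_ne
  e_x := (tmul_smul_tmul F.e G.e C.x C'.x).trans (by rw [C.e_x, C'.e_x])
  ψ_x := (tmul_smul_tmul F.v G.v (L.σ C.x) (L'.σ C'.x)).trans (by rw [C.ψ_x, C'.ψ_x])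
  span y := by
    change ∃ c : k, tmul F.e G.e • y = c • Obj.tmul C.x C'.x
    refine Obj.tensor_induction (p := fun y => ∃ c : k,
      tmul F.e G.e • y = c • Obj.tmul C.x C'.x) ⟨0, by simp⟩ (fun a b => ?_) ?_ y
    · obtain ⟨c, hc⟩ := C.span a
      obtain ⟨c', hc'⟩ := C'.span b
      exact ⟨c * c', by rw [tmul_smul_tmul, hc, hc', Obj.tmul_smul_smul]⟩
    · rintro a b ⟨c, hc⟩ ⟨c', hc'⟩
      exact ⟨c + c', by rw [smul_add, hc, hc', add_smul]⟩

/-- The tensor product of representing objects. -/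
def Rep.tensor {F : Frame A} {G : Frame B} {Z : Obj A} {Z' : Obj B} {s s' : ℤ} (R : Rep F Z s)
    (R' : Rep G Z' s') : Rep (F.tensor G) (Z.tensor Z') (s + s') where
  z := Obj.tmul R.z R'.z
  z_mem := Obj.tmul_mem R.z_mem R'.z_mem
  e_z := (tmul_smul_tmul F.e G.e R.z R'.z).trans (by rw [R.e_z, R'.e_z])
  ψ_z := (tmul_smul_tmul F.v G.v (Z.σ R.z) (Z'.σ R'.z)).trans (by rw [R.ψ_z, R'.ψ_z])
  gen m := by
    refine Obj.tensor_induction (p := fun m => ∃ a, m = a • Obj.tmul R.z R'.z) ⟨0, by simp⟩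
      (fun x y => ?_) ?_ m
    · obtain ⟨a, rfl⟩ := R.gen x
      obtain ⟨b, rfl⟩ := R'.gen y
      exact ⟨tmul a b, rfl⟩
    · rintro x y ⟨a, rfl⟩ ⟨b, rfl⟩
      exact ⟨a + b, by rw [add_smul]⟩
  exists_map Y y hy := by
    obtain ⟨p, hp⟩ := R.exists_map (Obj.regular A) F.e F.e_mul_e
    obtain ⟨q, hq⟩ := R'.exists_map (Obj.regular B) G.e G.e_mul_e
    let toX : (A.tensor B).carrier → ((Obj.regular A).tensor (Obj.regular B)).carrier := fun m => m
    have h : ∀ r m : (A.tensor B).carrier, r • toX m = toX (r * m) := by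
      intro r m
      refine tensor_carrier_induction (p := fun r => r • toX m = toX (r * m)) ?_ (fun a b => ?_)
        (fun a b ha hb => ?_) r
      · rw [zero_smul, zero_mul]; rfl
      · refine tensor_carrier_induction (p := fun m => tmul a b • toX m = toX (tmul a b * m)) ?_
          (fun x y => ?_) (fun x y hx hy => ?_) m
        · rw [mul_zero]
          change tmul a b • (0 : ((Obj.regular A).tensor (Obj.regular B)).carrier) = 0
          rw [smul_zero]
        · rw [tmul_mul_tmul]; rfl
        · rw [mul_add]; exact (smul_add _ (toX x) (toX y)).trans (congrArg₂ (· + ·) hx hy)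
      · rw [add_smul, ha, hb, add_mul]; rfl
    let f : (Z.tensor Z').carrier →ₗ[(A.tensor B).carrier] Y.carrier :=
      { toFun := fun m => (show (A.tensor B).carrier from tensorMap p q m) • y
        map_add' := fun a b => by
          have := map_add (tensorMap p q) a b
          refine (congrArg (fun c : (A.tensor B).carrier => c • y) this).trans ?_
          exact add_smul (R := (A.tensor B).carrier) _ _ y
        map_smul' := fun r m => by
          have := ((tensorMap p q).map_smul r m).trans (h r _)
          refine (congrArg (fun c : (A.tensor B).carrier => c • y) this).trans ?_
          exact mul_smul (α := (A.tensor B).carrier) _ _ y }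
    refine ⟨f, ?_⟩
    have h1 : tensorMap p q (Obj.tmul R.z R'.z) = (tmul F.e G.e : (A.tensor B).carrier) :=
      congrArg₂ (fun (a : A.carrier) (b : B.carrier) => tmul a b) hp hq
    exact (congrArg (fun c : (A.tensor B).carrier => c • y) h1).trans hy

end

section

variable {k : Type u} [Field k] {n : ℕ} {A B : FoldedAlg.{u, w} k n}

/-! ### Induction -/

/-- The `B`-linear map `b ⊗ x ↦ b f(x)`. -/
def smulLift (B : FoldedAlg.{u, w} k n) {N M : Type*} [AddCommGroup N] [Module k N]
    [AddCommGroup M] [Module k M] [Module B.carrier M] [IsScalarTower k B.carrier M]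
    (f : N →ₗ[k] M) : B.carrier ⊗[k] N →ₗ[B.carrier] M :=
  TensorProduct.AlgebraTensorModule.lift
    { toFun := fun b => (Algebra.lsmul k k M b) ∘ₗ f
      map_add' := fun a b => LinearMap.ext fun x => add_smul a b (f x)
      map_smul' := fun a b => LinearMap.ext fun x => mul_smul a b (f x) }

theorem smulLift_tmul {N M : Type*} [AddCommGroup N] [Module k N]
    [AddCommGroup M] [Module k M] [Module B.carrier M] [IsScalarTower k B.carrier M]
    (f : N →ₗ[k] M) (b : B.carrier) (x : N) : smulLift B f (b ⊗ₜ[k] x) = b • f x := rfl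

namespace CornerHom

variable (ι : CornerHom A B)

/-- The map `X → B ⊗_A X`, `x ↦ 1 ⊗ x`. -/
def unit (X : Obj A) : X.carrier →ₗ[k] (ι.ind X).carrier where
  toFun x := (ι.balance X).mkQ ((1 : B.carrier) ⊗ₜ[k] x)
  map_add' x y := by rw [TensorProduct.tmul_add, map_add]; rfl
  map_smul' c x := by
    rw [TensorProduct.tmul_smul]; rfl

theorem smul_unit {X : Obj A} (b : B.carrier) (x : X.carrier) :
    b • ι.unit X x = (ι.balance X).mkQ (b ⊗ₜ[k] x) := by
  change (ι.balance X).mkQ (b • ((1 : B.carrier) ⊗ₜ[k] x)) = _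
  rw [TensorProduct.smul_tmul', smul_eq_mul, mul_one]

theorem map_smul_unit {X : Obj A} (a : A.carrier) (x : X.carrier) :
    ι.map a • ι.unit X x = ι.unit X (a • x) := by
  rw [smul_unit]
  exact (Submodule.Quotient.eq _).2 (Submodule.subset_span ⟨a, x, rfl⟩)

theorem unit_mem {X : Obj A} {d : ℤ} {x : X.carrier} (hx : x ∈ X.deg d) :
    ι.unit X x ∈ (ι.ind X).deg d := by
  refine ⟨(1 : B.carrier) ⊗ₜ[k] x, ?_, rfl⟩
  have := tmul_mem_tensorDeg (k := k) B.one_mem hx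
  rwa [zero_add] at this

theorem σ_unit {X : Obj A} (x : X.carrier) : (ι.ind X).σ (ι.unit X x) = ι.unit X (X.σ x) := by
  change (ι.balance X).mkQ (B.aut 1 ⊗ₜ[k] X.σ x) = _
  rw [map_one]
  rfl

theorem ind_induction {X : Obj A} {p : (ι.ind X).carrier → Prop} (h0 : p 0)
    (hu : ∀ (b : B.carrier) x, p (b • ι.unit X x)) (hadd : ∀ y z, p y → p z → p (y + z)) (y) :
    p y := by
  obtain ⟨z, rfl⟩ := Submodule.mkQ_surjective _ y
  induction z with
  | zero => rw [map_zero]; exact h0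
  | tmul b x => rw [← smul_unit]; exact hu b x
  | add y z hy hz => rw [map_add]; exact hadd _ _ hy hz

theorem ind_deg_induction {X : Obj A} {p : (ι.ind X).carrier → Prop} {d : ℤ} (h0 : p 0)
    (hu : ∀ i j, i + j = d → ∀ b ∈ B.deg i, ∀ x ∈ X.deg j, p (b • ι.unit X x))
    (hsmul : ∀ (c : k) y, p y → p (c • y)) (hadd : ∀ y z, p y → p z → p (y + z)) {y}
    (hy : y ∈ (ι.ind X).deg d) : p y := by
  obtain ⟨z, hz, rfl⟩ := hy
  change z ∈ tensorDeg B.deg X.deg d at hz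
  induction hz using Submodule.span_induction with
  | zero => rw [map_zero]; exact h0
  | add a b _ _ ha hb => rw [map_add]; exact hadd _ _ ha hb
  | smul c a _ ha => rw [map_smul]; exact hsmul _ _ ha
  | mem a ha =>
    obtain ⟨i, j, b, x, hb, hx, hij, rfl⟩ := ha
    exact (ι.smul_unit b x) ▸ hu i j hij b hb x hx

theorem ind_ext {X : Obj A} {M : Type*} [AddCommGroup M] [Module B.carrier M]
    {f g : (ι.ind X).carrier →ₗ[B.carrier] M} (h : ∀ x, f (ι.unit X x) = g (ι.unit X x)) :
    f = g := by
  ext y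
  exact ι.ind_induction (p := fun y => f y = g y) (by rw [map_zero, map_zero])
    (fun b x => by rw [map_smul, map_smul, h])
    (fun y z hy hz => by rw [map_add, map_add, hy, hz]) y

/-- The universal property of `B ⊗_A X`. -/
def indLift {X : Obj A} {M : Type*} [AddCommGroup M] [Module k M] [Module B.carrier M]
    [IsScalarTower k B.carrier M] (f : X.carrier →ₗ[k] M)
    (hf : ∀ a x, ι.map a • f x = f (a • x)) : (ι.ind X).carrier →ₗ[B.carrier] M :=
  (ι.balance X).liftQ (smulLift B f) (Submodule.span_le.2 (by
    rintro _ ⟨a, x, rfl⟩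
    change smulLift B f _ = 0
    rw [map_sub, smulLift_tmul, smulLift_tmul, hf, one_smul, sub_self]))

theorem indLift_unit {X : Obj A} {M : Type*} [AddCommGroup M] [Module k M] [Module B.carrier M]
    [IsScalarTower k B.carrier M] (f : X.carrier →ₗ[k] M)
    (hf : ∀ a x, ι.map a • f x = f (a • x)) (x : X.carrier) :
    ι.indLift f hf (ι.unit X x) = f x := by
  change smulLift B f ((1 : B.carrier) ⊗ₜ[k] x) = f x
  rw [smulLift_tmul, one_smul]

/-- A morphism from an induced object, from a map compatible with the structures. -/
def indHom {X : Obj A} {Y : Obj B} (f : X.carrier →ₗ[k] Y.carrier)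
    (hf : ∀ a x, ι.map a • f x = f (a • x)) (hd : ∀ d, ∀ x ∈ X.deg d, f x ∈ Y.deg d)
    (hσ : ∀ x, f (X.σ x) = Y.σ (f x)) : Hom (ι.ind X) Y where
  map := ι.indLift f hf
  map_mem {d y} hy := by
    refine ι.ind_deg_induction (p := fun y => ι.indLift f hf y ∈ Y.deg d)
      (by rw [map_zero]; exact zero_mem _) (fun i j hij b hb x hx => ?_) (fun c y hy => ?_)
      (fun y z hy hz => by rw [map_add]; exact add_mem hy hz) hy
    · rw [map_smul, ι.indLift_unit, ← hij]
      exact Y.smul_mem hb (hd j x hx)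
    · rw [← algebraMap_smul B.carrier c y, map_smul, algebraMap_smul]
      exact Submodule.smul_mem _ c hy
  map_σ y := ι.ind_induction (p := fun y => ι.indLift f hf ((ι.ind X).σ y) =
      Y.σ (ι.indLift f hf y)) (by simp)
    (fun b x => by
      rw [(ι.ind X).σ_smul, ι.σ_unit, map_smul, map_smul, ι.indLift_unit, ι.indLift_unit, hσ,
        Y.σ_smul])
    (fun y z hy hz => by simp only [map_add, hy, hz]) y

theorem indHom_unit {X : Obj A} {Y : Obj B} (f : X.carrier →ₗ[k] Y.carrier)
    (hf : ∀ a x, ι.map a • f x = f (a • x)) (hd : ∀ d, ∀ x ∈ X.deg d, f x ∈ Y.deg d)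
    (hσ : ∀ x, f (X.σ x) = Y.σ (f x)) (x : X.carrier) :
    (ι.indHom f hf hd hσ).map (ι.unit X x) = f x := ι.indLift_unit f hf x

/-- Induction of morphisms. -/
def indMap {X Y : Obj A} (f : Hom X Y) : Hom (ι.ind X) (ι.ind Y) :=
  ι.indHom (ι.unit Y ∘ₗ f.map.restrictScalars k)
    (fun a x => by
      change ι.map a • ι.unit Y (f.map x) = ι.unit Y (f.map (a • x))
      rw [ι.map_smul_unit, f.map.map_smul])
    (fun _ _ hx => ι.unit_mem (f.map_mem hx))
    (fun x => by
      change ι.unit Y (f.map (X.σ x)) = (ι.ind Y).σ (ι.unit Y (f.map x))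
      rw [ι.σ_unit, f.map_σ])

theorem indMap_unit {X Y : Obj A} (f : Hom X Y) (x : X.carrier) :
    (ι.indMap f).map (ι.unit X x) = ι.unit Y (f.map x) := ι.indHom_unit _ _ _ _ x

theorem ind_twist (X : Obj A) (c : k) (hc : c ^ n = 1) :
    IsIso (ι.ind (X.twist c hc)) ((ι.ind X).twist c hc) :=
  ⟨⟨(LinearMap.id : (ι.ind X).carrier →ₗ[B.carrier] (ι.ind X).carrier), fun h => h, fun y =>
    ι.ind_induction (X := X) (p := fun y => (ι.ind (X.twist c hc)).σ y = c • (ι.ind X).σ y)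
      (by rw [map_zero, smul_zero]; exact map_zero (ι.ind (X.twist c hc)).σ) (fun b x => by
        refine ((ι.ind (X.twist c hc)).σ_smul b (ι.unit (X.twist c hc) x)).trans ?_
        rw [(ι.ind X).σ_smul, ι.σ_unit, smul_comm c]
        refine congrArg (B.aut b • ·) ((ι.σ_unit (X := X.twist c hc) x).trans ?_)
        exact map_smul (ι.unit X) c (X.σ x))
      (fun y z hy hz => by
        rw [map_add, smul_add, ← hy, ← hz]
        exact map_add (ι.ind (X.twist c hc)).σ y z) y⟩, Function.bijective_id⟩

theorem ind_shift (X : Obj A) (s : ℤ) : IsIso (ι.ind (X.shift s)) ((ι.ind X).shift s) :=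
  ⟨⟨(LinearMap.id : (ι.ind X).carrier →ₗ[B.carrier] (ι.ind X).carrier), fun {d y} h => by
    obtain ⟨z, hz, rfl⟩ := h
    exact ⟨z, tensorDeg_shift_right B.deg X.deg s d hz, rfl⟩, fun _ => rfl⟩, Function.bijective_id⟩

/-- Induction as an additive functor. -/
def indFunctor : AdditiveFunctor A B where
  obj := ι.ind
  map := ι.indMap
  map_comp {X Y Z} g f m := by
    have : (ι.indMap g).map ∘ₗ (ι.indMap f).map = (ι.indMap (g.comp f)).map :=
      ι.ind_ext fun x => by
        rw [LinearMap.comp_apply, ι.indMap_unit, ι.indMap_unit, ι.indMap_unit]; rfl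
    exact LinearMap.congr_fun this m
  map_id {X} f hf m := by
    have : (ι.indMap f).map = LinearMap.id := ι.ind_ext fun x => by
      rw [ι.indMap_unit, hf]; rfl
    exact LinearMap.congr_fun this m
  map_add {X Y} f g h H m := by
    have : (ι.indMap f).map + (ι.indMap g).map = (ι.indMap h).map := ι.ind_ext fun x => by
      rw [LinearMap.add_apply, ι.indMap_unit, ι.indMap_unit, ι.indMap_unit, ← H, map_add]
    exact LinearMap.congr_fun this m
  twist := ι.ind_twist
  shift := ι.ind_shift

end CornerHom

theorem CornerHom.map_twistedPow (ι : CornerHom A B) (e v : A.carrier) (t : ℕ) :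
    twistedPow B (ι.map e) (ι.map v) t = ι.map (twistedPow A e v t) := by
  induction t with
  | zero => rfl
  | succ t ih => rw [twistedPow, ih, ← ι.map_aut, ← ι.map_mul, twistedPow]

/-- The image of a frame. -/
def Frame.map (ι : CornerHom A B) (F : Frame A) : Frame B where
  e := ι.map F.e
  v := ι.map F.v
  e_mem := ι.map_mem F.e_mem
  v_mem := ι.map_mem F.v_mem
  e_mul_e := by rw [← ι.map_mul, F.e_mul_e]
  e_mul_v := by rw [← ι.map_mul, F.e_mul_v]
  v_mul_e := by rw [← ι.map_aut, ← ι.map_mul, F.v_mul_e]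
  pow_n := by rw [ι.map_twistedPow, F.pow_n]

/-! ### Restriction -/

namespace CornerHom

variable (ι : CornerHom A B)

/-- The inclusion of the restriction of `Y` into `Y`. -/
def resVal (Y : Obj B) : (ι.res Y).carrier →ₗ[k] Y.carrier := (ι.fixed Y).subtype

/-- Restriction of morphisms. -/
def resMap {X Y : Obj B} (f : Hom X Y) : Hom (ι.res X) (ι.res Y) where
  map :=
    { toFun := fun x => ⟨f.map x.1, by
        change ι.map 1 • f.map x.1 = f.map x.1
        rw [← map_smul]; exact congrArg f.map x.2⟩
      map_add' := fun x y => Subtype.ext (map_add f.map x.1 y.1)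
      map_smul' := fun a x => Subtype.ext (map_smul f.map (ι.map a) x.1) }
  map_mem h := f.map_mem h
  map_σ x := Subtype.ext (f.map_σ x.1)

/-- Restriction as an additive functor. -/
def resFunctor : AdditiveFunctor B A where
  obj := ι.res
  map := ι.resMap
  map_comp _ _ _ := rfl
  map_id _ hf m := Subtype.ext (hf m.1)
  map_add _ _ _ H m := Subtype.ext (H m.1)
  twist X _ _ := ⟨⟨(LinearMap.id : (ι.res X).carrier →ₗ[A.carrier] (ι.res X).carrier),
    fun h => h, fun _ => rfl⟩, Function.bijective_id⟩
  shift X _ := ⟨⟨(LinearMap.id : (ι.res X).carrier →ₗ[A.carrier] (ι.res X).carrier),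
    fun h => h, fun _ => rfl⟩, Function.bijective_id⟩

theorem isExtension_res {X X' X'' : Obj B} (h : IsExtension X X' X'') :
    IsExtension (ι.res X) (ι.res X') (ι.res X'') := by
  obtain ⟨f, g, hf, hg, hfg⟩ := h
  refine ⟨ι.resMap f, ι.resMap g, fun x y hxy => Subtype.ext (hf (congrArg Subtype.val hxy)), ?_,
    ?_⟩
  · intro y
    obtain ⟨x, hx⟩ := hg y.1
    refine ⟨⟨ι.map 1 • x, ι.smul_mem_fixed X 1 x⟩, Subtype.ext ?_⟩
    change g.map (ι.map 1 • x) = y.1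
    rw [map_smul, hx]
    exact y.2
  · ext x
    constructor
    · rintro ⟨y, rfl⟩
      refine Subtype.ext ?_
      have : f.map y.1 ∈ LinearMap.ker g.map := hfg ▸ ⟨y.1, rfl⟩
      exact this
    · intro hx
      have : x.1 ∈ LinearMap.range f.map := hfg ▸ (congrArg Subtype.val hx : g.map x.1 = 0)
      obtain ⟨y, hy⟩ := this
      refine ⟨⟨ι.map 1 • y, ι.smul_mem_fixed X' 1 y⟩, Subtype.ext ?_⟩
      change f.map (ι.map 1 • y) = x.1
      rw [map_smul, hy]
      exact x.2

theorem isFinDim_res {X : Obj B} (h : IsFinDim X) : IsFinDim (ι.res X) := by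
  have : Module.Finite k X.carrier := h
  exact Module.Finite.of_injective (ι.fixed X).subtype Subtype.val_injective

/-- One half of Frobenius reciprocity. -/
def frobenius {X : Obj A} {Y : Obj B} (f : Hom X (ι.res Y)) : Hom (ι.ind X) Y :=
  ι.indHom (ι.resVal Y ∘ₗ f.map.restrictScalars k)
    (fun a x => (congrArg Subtype.val (map_smul f.map a x)).symm)
    (fun _ _ hx => f.map_mem hx) (fun x => congrArg Subtype.val (f.map_σ x))

theorem frobenius_unit {X : Obj A} {Y : Obj B} (f : Hom X (ι.res Y)) (x : X.carrier) :
    (ι.frobenius f).map (ι.unit X x) = (f.map x).1 := ι.indHom_unit _ _ _ _ x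

end CornerHom

theorem Frame.finrank_eig_res (F : Frame A) (ι : CornerHom A B) (ω : k) (d : ℤ) (i : ℕ)
    (Y : Obj B) : Module.finrank k (F.eig ω d i (ι.res Y)) =
      Module.finrank k ((F.map ι).eig ω d i Y) := by
  let g : F.eig ω d i (ι.res Y) →ₗ[k] (F.map ι).eig ω d i Y :=
    { toFun := fun y => ⟨y.1.1, y.2.1, congrArg Subtype.val y.2.2.1, congrArg Subtype.val y.2.2.2⟩
      map_add' := fun _ _ => rfl
      map_smul' := fun _ _ => rfl }
  refine (LinearEquiv.ofBijective g ⟨fun x y h => ?_, fun y => ?_⟩).finrank_eq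
  · exact Subtype.ext (Subtype.ext (congrArg (fun z : (F.map ι).eig ω d i Y => z.1) h))
  · have hy : ι.map 1 • y.1 = y.1 := by
      have h : ι.map F.e • y.1 = y.1 := y.2.2.1
      conv_rhs => rw [← h]
      conv_lhs => rw [← h]
      rw [smul_smul, ← ι.map_mul, one_mul]
    exact ⟨⟨⟨y.1, hy⟩, y.2.1, Subtype.ext y.2.2.1, Subtype.ext y.2.2.2⟩, rfl⟩

theorem Frame.charCoeff_res {O : Type} [CommRing O] (ζ : O) (F : Frame A) (ι : CornerHom A B)
    (ω : k) (s d : ℤ) (Y : Obj B) :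
    F.charCoeff ζ ω s (ι.res Y) d = (F.map ι).charCoeff ζ ω s Y d :=
  Finset.sum_congr rfl fun i _ => by rw [F.finrank_eig_res]

theorem Frame.char_res {O : Type} [CommRing O] (ζ : O) (F : Frame A) (ι : CornerHom A B)
    (ω : k) (s : ℤ) (Y : Obj B) : F.char ζ ω s (ι.res Y) = (F.map ι).char ζ ω s Y :=
  congrArg gsum (funext fun d => F.charCoeff_res ζ ι ω s d Y)

/-- Induction of representing objects. -/
def Rep.ind {G : Frame A} {Z : Obj A} {s : ℤ} (R : Rep G Z s) (ι : CornerHom A B) :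
    Rep (G.map ι) (ι.ind Z) s where
  z := ι.unit Z R.z
  z_mem := ι.unit_mem R.z_mem
  e_z := (ι.map_smul_unit G.e R.z).trans (by rw [R.e_z])
  ψ_z := by
    rw [ι.σ_unit]
    exact (ι.map_smul_unit G.v _).trans (by rw [R.ψ_z])
  gen m := by
    refine ι.ind_induction (p := fun m => ∃ a : B.carrier, m = a • ι.unit Z R.z) ⟨0, by simp⟩
      (fun b x => ?_) ?_ m
    · obtain ⟨a, rfl⟩ := R.gen x
      exact ⟨b * ι.map a, by rw [mul_smul, ι.map_smul_unit]⟩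
    · rintro x y ⟨a, rfl⟩ ⟨b, rfl⟩
      exact ⟨a + b, by rw [add_smul]⟩
  exists_map Y y hy := by
    have hy1 : ι.map 1 • y = y := by
      have h : ι.map G.e • y = y := hy
      conv_rhs => rw [← h]
      conv_lhs => rw [← h]
      rw [smul_smul, ← ι.map_mul, one_mul]
    obtain ⟨f, hf⟩ := R.exists_map (ι.res Y) ⟨y, hy1⟩ (Subtype.ext hy)
    refine ⟨ι.indLift (ι.resVal Y ∘ₗ f.restrictScalars k)
      (fun a x => (congrArg (ι.resVal Y) (map_smul f a x)).symm), ?_⟩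
    exact (ι.indLift_unit _ _ _).trans (congrArg (ι.resVal Y) hf)

end

section

variable {k : Type u} [Field k] {n : ℕ} {A B E : FoldedAlg.{u, w} k n}

/-! ### Classes of products and restrictions -/

/-- The composition of additive functors. -/
def AdditiveFunctor.comp (Ψ : AdditiveFunctor B E) (Φ : AdditiveFunctor A B) :
    AdditiveFunctor A E where
  obj X := Ψ.obj (Φ.obj X)
  map f := Ψ.map (Φ.map f)
  map_comp g f m := (Ψ.map_comp _ _ m).trans (by
    have h := Ψ.map_add ((Φ.map g).comp (Φ.map f)) ⟨0, fun _ => zero_mem _, fun _ => by simp⟩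
      (Φ.map (g.comp f)) (fun x => (add_zero _).trans (Φ.map_comp g f x)) m
    rw [Ψ.map_zero ⟨0, fun _ => zero_mem _, fun _ => by simp⟩ (fun _ => rfl), add_zero] at h
    exact h)
  map_id f hf m := Ψ.map_id _ (Φ.map_id f hf) m
  map_add f g h H m := Ψ.map_add _ _ _ (Φ.map_add f g h H) m
  twist X c hc := (Ψ.isIso (Φ.twist X c hc)).trans (Ψ.twist _ c hc)
  shift X d := (Ψ.isIso (Φ.shift X d)).trans (Ψ.shift _ d)

theorem AdditiveFunctor.subsingleton (Φ : AdditiveFunctor A B) {X : Obj A}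
    (h : Subsingleton X.carrier) : Subsingleton (Φ.obj X).carrier := by
  refine ⟨fun x y => ?_⟩
  have key : ∀ x : (Φ.obj X).carrier, x = 0 := fun x =>
    (Φ.map_id (Hom.id X) (fun _ => rfl) x).symm.trans
      (Φ.map_zero (Hom.id X) (fun _ => Subsingleton.elim _ _) x)
  rw [key x, key y]

theorem isFGProjective_of_subsingleton {X : Obj A} (h : Subsingleton X.carrier) :
    IsFGProjective X :=
  ⟨inferInstance, fun Y _ f g _ => ⟨⟨0, fun _ => by simp, fun _ => by simp⟩, fun p => by
    rw [Subsingleton.elim p 0, map_zero, map_zero, map_zero]⟩⟩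

section

variable {O : Type} [CommRing O] {ζ : O} {φ : O →+* k}

theorem AdditiveFunctor.isFGProjective (Φ : AdditiveFunctor A B) {F : Core A} {L P : Obj A} {s : ℤ}
    (C : Cover F L s) (R : Rep F.toFrame P s) (hn : (n : k) ≠ 0) {ω : k}
    (hω : IsPrimitiveRoot ω n) (hP : IsFGProjective (Φ.obj P)) {X : Obj A}
    (hX : IsFGProjective X) : IsFGProjective (Φ.obj X) := by
  have hn0 : n ≠ 0 := by rintro rfl; simp at hn
  refine C.projective_induction R hn hω (Φ := fun X => IsFGProjective (Φ.obj X))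
    (fun X h => isFGProjective_of_subsingleton (Φ.subsingleton h)) (fun d i => ?_)
    (fun X X' X'' _ _ h h' h'' => IsFGProjective.of_directSum (Φ.isDirectSum h) h' h'') hX
  exact (hP.ts (hω.ne_zero hn0)).of_iso (Φ.isIso_ts hω.pow_eq_one d i P).symm

theorem AdditiveFunctor.clsP_eq (Φ : AdditiveFunctor A B) {F : Core A} {L P : Obj A} {s : ℤ}
    (C : Cover F L s) (R : Rep F.toFrame P s) (hω : IsPrimitiveRoot (φ ζ) n) (hζ : ζ ^ n = 1)
    (hn : (n : k) ≠ 0) (bar : O →+* O) (hbar : bar ζ * ζ = 1) (hP : IsFGProjective (Φ.obj P))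
    {X : Obj A} (hX : IsFGProjective X) (h : IsFGProjective (Φ.obj X)) :
    clsP ζ φ (Φ.obj X) h = homChar ζ (φ ζ) L X • clsP ζ φ (Φ.obj P) hP :=
  R.eval C hω hζ hn bar hbar (Φ.isEval (isEval_mk ζ φ (IsFGProjective (A := B)) IsDirectSum
    fun _ _ hX => hX.shift) (fun _ hX => Φ.isFGProjective C R hn hω hP hX)
    (fun _ _ _ h => Φ.isDirectSum h)) ⟨X, hX⟩

theorem AdditiveFunctor.clsL_eq (Φ : AdditiveFunctor A B) {F : Core A} {L : Obj A} {s : ℤ}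
    (C : Cover F L s) (hω : IsPrimitiveRoot (φ ζ) n) (hζ : ζ ^ n = 1)
    (hn : (n : k) ≠ 0) (hΦ : ∀ X, IsFinDim X → IsFinDim (Φ.obj X))
    (hE : ∀ X X' X'', IsExtension X X' X'' → IsExtension (Φ.obj X) (Φ.obj X') (Φ.obj X''))
    {X : Obj A} (hX : IsFinDim X) :
    clsL ζ φ (Φ.obj X) (hΦ X hX) =
      F.char ζ (φ ζ) s X • clsL ζ φ (Φ.obj L) (hΦ L C.isFinDim) :=
  C.eval hω hζ hn (Φ.isEval (isEval_mk ζ φ (IsFinDim (A := B)) IsExtension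
    fun _ _ hX => hX.shift) hΦ hE) ⟨X, hX⟩

theorem Cover.clsL_eq {F : Core A} {L : Obj A} {s : ℤ}
    (C : Cover F L s) (hω : IsPrimitiveRoot (φ ζ) n) (hζ : ζ ^ n = 1)
    (hn : (n : k) ≠ 0) {X : Obj A} (hX : IsFinDim X) :
    clsL ζ φ X hX = F.char ζ (φ ζ) s X • clsL ζ φ L C.isFinDim :=
  C.eval hω hζ hn (isEval_mk ζ φ (IsFinDim (A := A)) IsExtension fun _ _ hX => hX.shift) ⟨X, hX⟩

theorem clsP_of_iso {X Y : Obj A} (h : IsIso X Y) (hX : IsFGProjective X)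
    (hY : IsFGProjective Y) : clsP ζ φ X hX = clsP ζ φ Y hY :=
  (isEval_mk ζ φ (IsFGProjective (A := A)) IsDirectSum fun _ _ hX => hX.shift).iso ⟨X, hX⟩ ⟨Y, hY⟩ h

/-- The tensor product of finite dimensional objects on Grothendieck groups. -/
theorem exists_tensor_equiv [IsDomain O] {F : Core A} {G : Core B} {L : Obj A} {L' : Obj B}
    {s s' : ℤ} (C : Cover F L s) (C' : Cover G L' s') (hω : IsPrimitiveRoot (φ ζ) n)
    (hζ : IsPrimitiveRoot ζ n) (hn : (n : k) ≠ 0) :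
    ∃ t : KL ζ φ A ⊗[O[T;T⁻¹]] KL ζ φ B ≃ₗ[O[T;T⁻¹]] KL ζ φ (A.tensor B),
      ∀ X Y (hX : IsFinDim X) (hY : IsFinDim Y),
        t (clsL ζ φ X hX ⊗ₜ clsL ζ φ Y hY) = clsL ζ φ (X.tensor Y) (hX.tensor hY) := by
  obtain ⟨Φ, hΦ⟩ := C.exists_equiv ζ φ hω hζ hn
  obtain ⟨Ψ, hΨ⟩ := C'.exists_equiv ζ φ hω hζ hn
  obtain ⟨Θ, hΘ⟩ := (C.tensor C').exists_equiv ζ φ hω hζ hn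
  refine ⟨(TensorProduct.congr Φ Ψ).trans ((TensorProduct.lid O[T;T⁻¹] O[T;T⁻¹]).trans Θ.symm),
    fun X Y hX hY => ?_⟩
  rw [LinearEquiv.trans_apply, LinearEquiv.trans_apply, TensorProduct.congr_tmul,
    TensorProduct.lid_tmul, hΦ, hΨ, LinearEquiv.symm_apply_eq]
  have h1 := (tensorRight Y).clsL_eq C hω hζ.pow_eq_one hn (fun _ hX => hX.tensor hY)
    (fun _ _ _ h => h.tensor_left Y) hX
  have h2 := (tensorLeft L).clsL_eq C' hω hζ.pow_eq_one hn (fun _ hX => C.isFinDim.tensor hX)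
    (fun _ _ _ h => h.tensor_right L) hY
  change clsL ζ φ (X.tensor Y) _ = _ • clsL ζ φ (L.tensor Y) _ at h1
  change clsL ζ φ (L.tensor Y) _ = _ • clsL ζ φ (L.tensor L') _ at h2
  have hn0 : n ≠ 0 := by rintro rfl; simp at hn
  rw [h1, h2, map_smul, map_smul, hΘ, (C.tensor C').char_self ζ hω hn0]
  simp only [smul_eq_mul, mul_one]

theorem exists_bilinear {R : Type*} [CommRing R] {M : ℕ → Type*} [∀ a, AddCommGroup (M a)]
    [∀ a, Module R (M a)] (χ : ∀ a, M a →ₗ[R] R) (z : ∀ a b, M (a + b)) :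
    ∃ mul : (⨁ a, M a) →ₗ[R] (⨁ a, M a) →ₗ[R] ⨁ a, M a, ∀ a b x y,
      mul (DirectSum.of M a x) (DirectSum.of M b y) =
        DirectSum.of M (a + b) (χ a x • χ b y • z a b) := by
  let m : ∀ a b, M a →ₗ[R] M b →ₗ[R] ⨁ a, M a := fun a b => LinearMap.mk₂ R
    (fun x y => χ a x • χ b y • DirectSum.lof R ℕ M (a + b) (z a b))
    (fun x x' y => by rw [map_add, add_smul]) (fun c x y => by rw [map_smul, smul_assoc])
    (fun x y y' => by rw [map_add, add_smul, smul_add])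
    (fun c x y => by rw [map_smul, smul_assoc, smul_comm])
  refine ⟨DirectSum.toModule _ _ _ fun a =>
    (DirectSum.toModule R ℕ (M a →ₗ[R] ⨁ a, M a) fun b => (m a b).flip).flip, fun a b x y => ?_⟩
  simp only [← DirectSum.lof_eq_of R, DirectSum.toModule_lof, LinearMap.flip_apply]
  simp only [m, LinearMap.mk₂_apply, map_smul]

/-- The multiplication table of a family of covers, on Grothendieck groups of projectives. -/
theorem exists_product [IsDomain O] {A : ℕ → FoldedAlg.{u, w} k n}
    (ι : ∀ a b, CornerHom ((A a).tensor (A b)) (A (a + b))) {F : ∀ a, Core (A a)}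
    {L : ∀ a, Obj (A a)} {s : ℕ → ℤ} (C : ∀ a, Cover (F a) (L a) (s a))
    (hω : IsPrimitiveRoot (φ ζ) n) (hζ : IsPrimitiveRoot ζ n) (hn : (n : k) ≠ 0) (bar : O →+* O)
    (hbar : bar ζ * ζ = 1) (c : ℕ → ℕ → O[T;T⁻¹])
    (hc : ∀ a b, ((F a).tensor (F b)).char ζ (φ ζ) (s a + s b) ((ι a b).res (L (a + b))) = c a b)
    (hc' : ∀ a b d, bar ((c a b).coeff (-d)) = (c a b).coeff d) :
    ∃ mul : (⨁ a, KP ζ φ (A a)) →ₗ[O[T;T⁻¹]] (⨁ a, KP ζ φ (A a)) →ₗ[O[T;T⁻¹]]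
        ⨁ a, KP ζ φ (A a),
      (∀ (a b : ℕ) (X : Obj (A a)) (Y : Obj (A b)) (hX : IsFGProjective X)
        (hY : IsFGProjective Y), ∃ h : IsFGProjective ((ι a b).ind (X.tensor Y)),
          mul (DirectSum.of (fun a => KP ζ φ (A a)) a (clsP ζ φ X hX))
              (DirectSum.of (fun a => KP ζ φ (A a)) b (clsP ζ φ Y hY)) =
            DirectSum.of (fun a => KP ζ φ (A a)) (a + b)
              (clsP ζ φ ((ι a b).ind (X.tensor Y)) h)) ∧
      ∀ (P : ∀ a, Obj (A a)) (hP : ∀ a, IsFGProjective (P a)),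
        (∀ a, IsProjectiveCover (P a) (L a)) → ∀ a b : ℕ,
          mul (DirectSum.of (fun a => KP ζ φ (A a)) a (clsP ζ φ (P a) (hP a)))
              (DirectSum.of (fun a => KP ζ φ (A a)) b (clsP ζ φ (P b) (hP b))) =
            c a b • DirectSum.of (fun a => KP ζ φ (A a)) (a + b)
                (clsP ζ φ (P (a + b)) (hP (a + b))) := by
  have hn0 : n ≠ 0 := by rintro rfl; simp at hn
  let Q : ∀ a, Obj (A a) := fun a => (F a).toFrame.proj hn0 (s a)
  let R : ∀ a, Rep (F a).toFrame (Q a) (s a) := fun a => (F a).toFrame.rep hn0 (s a)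
  have hQ : ∀ a, IsFGProjective (Q a) := fun a => (R a).isFGProjective hω hn
  let R₂ : ∀ a b, Rep (((F a).tensor (F b)).toFrame.map (ι a b))
      ((ι a b).ind ((Q a).tensor (Q b))) (s a + s b) := fun a b => ((R a).tensor (R b)).ind (ι a b)
  have hQQ : ∀ a b, IsFGProjective ((ι a b).ind ((Q a).tensor (Q b))) := fun a b =>
    (R₂ a b).isFGProjective hω hn
  have hQY : ∀ a b (Y : Obj (A b)), IsFGProjective Y →
      IsFGProjective ((ι a b).ind ((Q a).tensor Y)) := fun a b Y hY =>
    ((ι a b).indFunctor.comp (tensorLeft (Q a))).isFGProjective (C b) (R b) hn hω (hQQ a b) hY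
  have hXY : ∀ a b (X : Obj (A a)) (Y : Obj (A b)), IsFGProjective X → IsFGProjective Y →
      IsFGProjective ((ι a b).ind (X.tensor Y)) := fun a b X Y hX hY =>
    ((ι a b).indFunctor.comp (tensorRight Y)).isFGProjective (C a) (R a) hn hω (hQY a b Y hY) hX
  have hcls : ∀ a b (X : Obj (A a)) (Y : Obj (A b)) (hX : IsFGProjective X)
      (hY : IsFGProjective Y), clsP ζ φ ((ι a b).ind (X.tensor Y)) (hXY a b X Y hX hY) =
        homChar ζ (φ ζ) (L a) X • homChar ζ (φ ζ) (L b) Y •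
          clsP ζ φ ((ι a b).ind ((Q a).tensor (Q b))) (hQQ a b) := fun a b X Y hX hY => by
    have h1 := ((ι a b).indFunctor.comp (tensorRight Y)).clsP_eq (C a) (R a) hω hζ.pow_eq_one hn
      bar hbar (hQY a b Y hY) hX (hXY a b X Y hX hY)
    have h2 := ((ι a b).indFunctor.comp (tensorLeft (Q a))).clsP_eq (C b) (R b) hω hζ.pow_eq_one hn
      bar hbar (hQQ a b) hY (hQY a b Y hY)
    exact h1.trans (congrArg (homChar ζ (φ ζ) (L a) X • ·) h2)
  have hχ := fun a => (R a).exists_equiv (C a) hω hζ hn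
  choose χ hχ using hχ
  obtain ⟨mul, hmul⟩ := exists_bilinear (M := fun a => KP ζ φ (A a)) χ
    fun a b => clsP ζ φ ((ι a b).ind ((Q a).tensor (Q b))) (hQQ a b)
  have hof : ∀ a (p : O[T;T⁻¹]) (x : KP ζ φ (A a)),
      p • DirectSum.of (fun a => KP ζ φ (A a)) a x =
        DirectSum.of (fun a => KP ζ φ (A a)) a (p • x) := fun a p x =>
    (map_smul (DirectSum.lof O[T;T⁻¹] ℕ (fun a => KP ζ φ (A a)) a) p x).symm
  have hQP : ∀ a, IsProjectiveCover (Q a) (L a) := fun a => (R a).isProjectiveCover (C a) hω hn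
  refine ⟨mul, fun a b X Y hX hY => ⟨hXY a b X Y hX hY, ?_⟩, fun P hP hPL a b => ?_⟩
  · rw [hmul, hχ, hχ, hcls a b X Y hX hY]
  · have e : ∀ a, clsP ζ φ (P a) (hP a) = clsP ζ φ (Q a) (hQ a) := fun a =>
      clsP_of_iso ((hQP a).unique (hPL a)) _ _
    rw [e, e, e, hmul, hχ, hχ, (R a).homChar_self (C a) hn hω hζ.pow_eq_one bar hbar,
      (R b).homChar_self (C b) hn hω hζ.pow_eq_one bar hbar, one_smul, one_smul, hof]
    refine congrArg _ ?_
    have h1 := (R (a + b)).eval (C (a + b)) hω hζ.pow_eq_one hn bar hbar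
      (isEval_mk ζ φ (IsFGProjective (A := A (a + b))) IsDirectSum fun _ _ hX => hX.shift)
      ⟨_, hQQ a b⟩
    have h2 : homChar ζ (φ ζ) (L (a + b)) ((ι a b).ind ((Q a).tensor (Q b))) = c a b := by
      refine laurent_ext fun d => ?_
      rw [homChar, gsum_coeff (homCoeff_support ζ (φ ζ) (C (a + b)).isFinDim (hQQ a b)),
        (R₂ a b).homCoeff_eq hn0 hω.pow_eq_one hζ.pow_eq_one bar hbar, ← Frame.charCoeff_res,
        ← hc' a b d, ← hc a b, Frame.char, gsum_coeff (Frame.charCoeff_support _ _ _ _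
          ((ι a b).isFinDim_res (C (a + b)).isFinDim))]
    rw [← h2]
    exact h1

/-- The restrictions of a family of covers, on Grothendieck groups of finite dimensional
objects. -/
theorem exists_coproduct [IsDomain O] {A : ℕ → FoldedAlg.{u, w} k n}
    (ι : ∀ {a b s}, a + b = s → CornerHom ((A a).tensor (A b)) (A s)) {F : ∀ a, Core (A a)}
    {L : ∀ a, Obj (A a)} {s : ℕ → ℤ} (C : ∀ a, Cover (F a) (L a) (s a))
    (hω : IsPrimitiveRoot (φ ζ) n) (hζ : IsPrimitiveRoot ζ n) (hn : (n : k) ≠ 0)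
    (hL : ∀ a, IsFinDim (L a)) (c : ℕ → ℕ → O[T;T⁻¹])
    (hc : ∀ a b, ((F a).tensor (F b)).char ζ (φ ζ) (s a + s b)
      ((ι (rfl : a + b = a + b)).res (L (a + b))) = c (a + b) a) :
    ∃ t : ∀ a b : ℕ, KL ζ φ (A a) ⊗[O[T;T⁻¹]] KL ζ φ (A b) ≃ₗ[O[T;T⁻¹]]
        KL ζ φ ((A a).tensor (A b)),
      (∀ (a b : ℕ) (X : Obj (A a)) (Y : Obj (A b)) (hX : IsFinDim X) (hY : IsFinDim Y),
        ∃ h : IsFinDim (X.tensor Y),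
          t a b (clsL ζ φ X hX ⊗ₜ clsL ζ φ Y hY) = clsL ζ φ (X.tensor Y) h) ∧
      ∃ r : (⨁ a : ℕ, KL ζ φ (A a)) →ₗ[O[T;T⁻¹]]
          ⨁ p : ℕ × ℕ, KL ζ φ (A p.1) ⊗[O[T;T⁻¹]] KL ζ φ (A p.2),
        (∀ (s a b : ℕ) (h : a + b = s) (X : Obj (A s)) (hX : IsFinDim X),
          ∃ hR : IsFinDim ((ι h).res X),
            t a b (r (DirectSum.of (fun a => KL ζ φ (A a)) s (clsL ζ φ X hX)) (a, b)) =
              clsL ζ φ ((ι h).res X) hR) ∧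
        (∀ (s a b : ℕ), a + b ≠ s → ∀ x : KL ζ φ (A s),
          r (DirectSum.of (fun a => KL ζ φ (A a)) s x) (a, b) = 0) ∧
        ∀ s : ℕ, r (DirectSum.of (fun a => KL ζ φ (A a)) s (clsL ζ φ (L s) (hL s))) =
          ∑ p ∈ Finset.HasAntidiagonal.antidiagonal s, c s p.1 •
            DirectSum.of (fun p : ℕ × ℕ => KL ζ φ (A p.1) ⊗[O[T;T⁻¹]] KL ζ φ (A p.2)) p
              (clsL ζ φ (L p.1) (hL p.1) ⊗ₜ clsL ζ φ (L p.2) (hL p.2)) := by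
  have hn0 : n ≠ 0 := by rintro rfl; simp at hn
  choose t ht using fun a b => exists_tensor_equiv (ζ := ζ) (φ := φ) (C a) (C b) hω hζ hn
  choose Φ hΦ using fun a => (C a).exists_equiv ζ φ hω hζ hn
  let V := ⨁ p : ℕ × ℕ, KL ζ φ (A p.1) ⊗[O[T;T⁻¹]] KL ζ φ (A p.2)
  let v : ℕ → V := fun s =>
    ∑ p ∈ Finset.HasAntidiagonal.antidiagonal s, c s p.1 •
      DirectSum.of (fun p : ℕ × ℕ => KL ζ φ (A p.1) ⊗[O[T;T⁻¹]] KL ζ φ (A p.2)) p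
        (clsL ζ φ (L p.1) (hL p.1) ⊗ₜ clsL ζ φ (L p.2) (hL p.2))
  let r : (⨁ a : ℕ, KL ζ φ (A a)) →ₗ[O[T;T⁻¹]] V := DirectSum.toModule _ _ _ fun s =>
    (LinearMap.toSpanSingleton O[T;T⁻¹] V (v s)) ∘ₗ (Φ s).toLinearMap
  have hr : ∀ s x, r (DirectSum.of (fun a => KL ζ φ (A a)) s x) = Φ s x • v s := fun s x => by
    simp only [r, ← DirectSum.lof_eq_of O[T;T⁻¹], DirectSum.toModule_lof]
    rfl
  have hv : ∀ s (p : ℕ × ℕ), v s p = if p.1 + p.2 = s then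
      c s p.1 • (clsL ζ φ (L p.1) (hL p.1) ⊗ₜ clsL ζ φ (L p.2) (hL p.2)) else 0 := by
    intro s p
    simp only [v]
    rw [DFinsupp.finsetSum_apply]
    split_ifs with h
    · rw [Finset.sum_eq_single p]
      · rw [DirectSum.smul_apply, DirectSum.of_eq_same]
      · intro q _ hq
        rw [DirectSum.smul_apply, DirectSum.of_eq_of_ne _ _ _ hq.symm, smul_zero]
      · intro hp
        exact absurd (Finset.HasAntidiagonal.mem_antidiagonal.2 h) hp
    · refine Finset.sum_eq_zero fun q hq => ?_
      rw [DirectSum.smul_apply, DirectSum.of_eq_of_ne, smul_zero]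
      rintro rfl
      exact h (Finset.HasAntidiagonal.mem_antidiagonal.1 hq)
  refine ⟨t, fun a b X Y hX hY => ⟨hX.tensor hY, ht a b X Y hX hY⟩, r, ?_, ?_, ?_⟩
  · rintro s a b rfl X hX
    refine ⟨(ι rfl).isFinDim_res hX, ?_⟩
    rw [hr, DirectSum.smul_apply, hv, if_pos rfl, map_smul, map_smul, ht, hΦ]
    have h1 := (ι (rfl : a + b = a + b)).resFunctor.clsL_eq (C (a + b)) hω hζ.pow_eq_one hn
      (fun _ h => (ι rfl).isFinDim_res h) (fun _ _ _ h => (ι rfl).isExtension_res h) hX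
    have h2 := ((C a).tensor (C b)).clsL_eq hω hζ.pow_eq_one hn
      ((ι (rfl : a + b = a + b)).isFinDim_res (hL (a + b)))
    rw [hc] at h2
    exact (h1.trans (congrArg ((F (a + b)).char ζ (φ ζ) _ X • ·) h2)).symm
  · intro s a b h x
    rw [hr, DirectSum.smul_apply, hv, if_neg h, smul_zero]
  · intro s
    rw [hr, hΦ, (C s).char_self ζ hω hn0, one_smul]

end

end

section

/-- Elements of a ring which satisfy the relations of a KLR algebra for pairwise orthogonal
letters, normalised so that the crossings `t l` of distinct letters are involutions. -/
structure NilHecke (A : Type*) [Ring A] (W : Type*) [Fintype W] [DecidableEq W] (C : Type*)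
    [DecidableEq C] where
  len : ℕ
  letters : Finset C
  ltr : W → ℕ → C
  sw : ℕ → W → W
  e : W → A
  y : ℕ → A
  t : ℕ → A
  ltr_mem : ∀ w l, l < len → ltr w l ∈ letters
  sw_left : ∀ w l, l + 1 < len → ltr (sw l w) l = ltr w (l + 1)
  sw_right : ∀ w l, l + 1 < len → ltr (sw l w) (l + 1) = ltr w l
  sw_ne : ∀ w l i, l + 1 < len → i ≠ l → i ≠ l + 1 → ltr (sw l w) i = ltr w i
  sw_sw : ∀ w l, l + 1 < len → sw l (sw l w) = w
  e_mul : ∀ w w', e w * e w' = if w = w' then e w else 0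
  e_sum : ∑ w, e w = 1
  y_e : ∀ l w, y l * e w = e w * y l
  y_comm : ∀ l m, y l * y m = y m * y l
  t_e : ∀ l w, l + 1 < len → t l * e w = e (sw l w) * t l
  t_comm : ∀ l m, l + 1 < m → m + 1 < len → t l * t m = t m * t l
  t_sq : ∀ l w, l + 1 < len →
    t l * t l * e w = if ltr w l = ltr w (l + 1) then 0 else e w
  braid : ∀ l, l + 2 < len → t (l + 1) * t l * t (l + 1) = t l * t (l + 1) * t l
  t_y : ∀ l m, l + 1 < len → m ≠ l → m ≠ l + 1 → t l * y m = y m * t l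
  t_y_left : ∀ l w, l + 1 < len →
    (y (l + 1) * t l - t l * y l) * e w = if ltr w l = ltr w (l + 1) then e w else 0
  t_y_right : ∀ l w, l + 1 < len →
    (t l * y (l + 1) - y l * t l) * e w = if ltr w l = ltr w (l + 1) then e w else 0

namespace NilHecke

variable {A : Type*} [Ring A] {W : Type*} [Fintype W] [DecidableEq W] {C : Type*} [DecidableEq C]
  (H : NilHecke A W C)

theorem e_self (w : W) : H.e w * H.e w = H.e w := by rw [H.e_mul, if_pos rfl]

theorem e_ne {w w' : W} (h : w ≠ w') : H.e w * H.e w' = 0 := by rw [H.e_mul, if_neg h]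

/-- The product `t_(p-1) ⋯ t_(p-m)`, which moves the strand in place `p - m` to place `p`. -/
def R (p : ℕ) : ℕ → A
  | 0 => 1
  | m + 1 => R p m * H.t (p - (m + 1))

/-- The effect of `R p m` on words. -/
def rot (p : ℕ) : ℕ → W → W
  | 0, b => b
  | m + 1, b => rot p m (H.sw (p - (m + 1)) b)

/-- The product `R p m'` for the largest `m' ≤ m` such that `b` has the letter `c` in place
`p - m'`, or zero if there is none. -/
def G (p : ℕ) (b : W) (c : C) : ℕ → A
  | 0 => if H.ltr b p = c then 1 else 0
  | m + 1 => if H.ltr b (p - (m + 1)) = c then H.R p (m + 1) else G p b c m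

def Z (p : ℕ) : A := ∑ b, ∑ c ∈ H.letters, H.G p b c p * H.e b

/-- The sum, over all ways to reorder the letters in the places `0, …, p - 1`, of the crossings
which perform this reordering, and in which any two equal letters cross. -/
def X : ℕ → A
  | 0 => 1
  | p + 1 => X p * H.Z p

variable {H}

theorem R_e {p m : ℕ} (hm : m ≤ p) (hp : p < H.len) (b : W) :
    H.R p m * H.e b = H.e (H.rot p m b) * H.R p m := by
  induction m generalizing b with
  | zero => simp [R, rot]
  | succ m ih =>
    rw [R, mul_assoc, H.t_e _ _ (by omega), ← mul_assoc, ih (by omega), mul_assoc]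
    rfl

theorem ltr_rot {p m : ℕ} (hm : m ≤ p) (hp : p < H.len) (b : W) (i : ℕ) :
    H.ltr (H.rot p m b) i = if i < p - m then H.ltr b i else if i < p then H.ltr b (i + 1) else
      if i = p then H.ltr b (p - m) else H.ltr b i := by
  induction m generalizing b with
  | zero =>
    rw [rot]
    split_ifs <;> first | rfl | omega | (subst_vars; rfl)
  | succ m ih =>
    rw [rot, ih (by omega)]
    have h1 := H.sw_left b (p - (m + 1)) (by omega)
    have h2 := H.sw_right b (p - (m + 1)) (by omega)
    rw [show p - (m + 1) + 1 = p - m by omega] at h1 h2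
    split_ifs <;> first
      | omega
      | exact H.sw_ne b _ _ (by omega) (by omega) (by omega)
      | exact h2
      | (rw [show i = p - (m + 1) by omega, h1]; congr 1; omega)

theorem R_t_far {p m l : ℕ} (hm : m ≤ p) (hp : p < H.len) (hl : l + 1 < p - m) :
    H.R p m * H.t l = H.t l * H.R p m := by
  induction m with
  | zero => simp [R]
  | succ m ih =>
    rw [R, mul_assoc, ← H.t_comm l _ (by omega) (by omega), ← mul_assoc, ih (by omega) (by omega),
      mul_assoc]

theorem R_t_shift {p m l : ℕ} (hm : m ≤ p) (hp : p < H.len) (h1 : p - m ≤ l) (h2 : l + 1 < p) :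
    H.R p m * H.t (l + 1) = H.t l * H.R p m := by
  induction m with
  | zero => omega
  | succ m ih =>
    rcases Nat.lt_or_ge (p - (m + 1)) l with h | h
    · rw [R, mul_assoc, H.t_comm _ (l + 1) (by omega) (by omega), ← mul_assoc,
        ih (by omega) (by omega), mul_assoc]
    · obtain ⟨m, rfl⟩ : ∃ m', m = m' + 1 := ⟨m - 1, by omega⟩
      obtain rfl : l = p - (m + 1 + 1) := by omega
      rw [R, R, show p - (m + 1) = p - (m + 1 + 1) + 1 by omega, mul_assoc, mul_assoc,
        ← mul_assoc (H.t _), H.braid _ (by omega), ← mul_assoc, ← mul_assoc,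
        R_t_far (by omega) (by omega) (by omega)]
      simp only [mul_assoc]

theorem R_y {p m i : ℕ} (hm : m ≤ p) (hp : p < H.len) (hi : p < i) :
    H.R p m * H.y i = H.y i * H.R p m := by
  induction m with
  | zero => simp [R]
  | succ m ih =>
    rw [R, mul_assoc, H.t_y _ _ (by omega) (by omega) (by omega), ← mul_assoc, ih (by omega),
      mul_assoc]

theorem G_cases (p : ℕ) (b : W) (c : C) (m : ℕ) :
    H.G p b c m = 0 ∨ ∃ m' ≤ m, H.ltr b (p - m') = c ∧ H.G p b c m = H.R p m' := by
  induction m with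
  | zero =>
    rw [G]
    split_ifs with h
    · exact Or.inr ⟨0, le_rfl, h, rfl⟩
    · exact Or.inl rfl
  | succ m ih =>
    rw [G]
    split_ifs with h
    · exact Or.inr ⟨m + 1, le_rfl, h, rfl⟩
    · exact ih.imp_right fun ⟨m', h1, h2⟩ => ⟨m', by omega, h2⟩

theorem G_congr {p : ℕ} {b b' : W} (c : C) {m : ℕ}
    (h : ∀ i, p - m ≤ i → i ≤ p → H.ltr b i = H.ltr b' i) : H.G p b c m = H.G p b' c m := by
  induction m with
  | zero => rw [G, G, h p (by omega) le_rfl]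
  | succ m ih =>
    rw [G, G, h (p - (m + 1)) le_rfl (by omega), ih fun i h1 h2 => h i (by omega) h2]

theorem G_t_far {p m l : ℕ} (hm : m ≤ p) (hp : p < H.len) (hl : l + 1 < p - m) (b : W) (c : C) :
    H.G p b c m * H.t l = H.t l * H.G p b c m := by
  rcases H.G_cases p b c m with h | ⟨m', h1, -, h⟩
  · simp [h]
  · rw [h, R_t_far (by omega) hp (by omega)]

theorem Z_e (p : ℕ) (b : W) : H.Z p * H.e b = ∑ c ∈ H.letters, H.G p b c p * H.e b := by
  rw [Z, Finset.sum_mul, Finset.sum_eq_single b]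
  · rw [Finset.sum_mul]
    exact Finset.sum_congr rfl fun c _ => by rw [mul_assoc, e_self]
  · intro b' _ h
    rw [Finset.sum_mul]
    exact Finset.sum_eq_zero fun c _ => by rw [mul_assoc, e_ne _ h, mul_zero]
  · simp

theorem Z_y {p i : ℕ} (hp : p < H.len) (hi : p < i) : H.Z p * H.y i = H.y i * H.Z p := by
  rw [Z, Finset.sum_mul, Finset.mul_sum]
  refine Finset.sum_congr rfl fun b _ => ?_
  rw [Finset.sum_mul, Finset.mul_sum]
  refine Finset.sum_congr rfl fun c _ => ?_
  rw [mul_assoc, ← H.y_e, ← mul_assoc, ← mul_assoc]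
  congr 1
  rcases H.G_cases p b c p with h | ⟨m', h1, -, h⟩
  · simp [h]
  · rw [h, R_y h1 hp hi]

theorem X_y {p i : ℕ} (hp : p ≤ H.len) (hi : p ≤ i) : H.X p * H.y i = H.y i * H.X p := by
  induction p with
  | zero => simp [X]
  | succ p ih =>
    rw [X, mul_assoc, Z_y (by omega) (by omega), ← mul_assoc, ih (by omega) (by omega), mul_assoc]

theorem G_t {p l : ℕ} (hp : p < H.len) (hl : l + 1 ≤ p)
    (IH : ∀ l b, l + 1 < p →
      H.X p * H.t l * H.e b = if H.ltr b l = H.ltr b (l + 1) then 0 else H.X p * H.e b)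
    {m : ℕ} (hm : m ≤ p) (hlm : p - m ≤ l) (b : W) (c : C) :
    H.X p * H.G p (H.sw l b) c m * H.t l * H.e b =
      if H.ltr b l = H.ltr b (l + 1) then 0 else H.X p * H.G p b c m * H.e b := by
  have far : ∀ m, l + 1 < p - m → H.X p * H.G p (H.sw l b) c m * H.t l * H.e b =
      if H.ltr b l = H.ltr b (l + 1) then 0 else H.X p * H.G p b c m * H.e b := by
    intro m h
    have e1 : H.G p (H.sw l b) c m = H.G p b c m :=
      G_congr c fun i h1 h2 => H.sw_ne b l i (by omega) (by omega) (by omega)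
    rw [e1, mul_assoc (H.X p), G_t_far (by omega) hp h]
    rcases H.G_cases p b c m with h0 | ⟨m', h1, h2, h0⟩
    · simp [h0]
    · have k1 : H.ltr (H.rot p m' b) l = H.ltr b l := by
        rw [ltr_rot (by omega) hp, if_pos (by omega)]
      have k2 : H.ltr (H.rot p m' b) (l + 1) = H.ltr b (l + 1) := by
        rw [ltr_rot (by omega) hp, if_pos (by omega)]
      rw [h0, ← mul_assoc, mul_assoc _ _ (H.e b), R_e (m := m') (by omega) hp, ← mul_assoc,
        IH l _ (by omega), k1, k2, ite_mul, zero_mul, mul_assoc, mul_assoc,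
        R_e (m := m') (by omega) hp]
  induction m with
  | zero => omega
  | succ m ih =>
    rcases Nat.lt_or_ge (p - (m + 1)) l with h | h
    · rw [G, G, H.sw_ne b l _ (by omega) (by omega) (by omega)]
      by_cases hc : H.ltr b (p - (m + 1)) = c
      · rw [if_pos hc, if_pos hc]
        obtain ⟨l, rfl⟩ : ∃ l', l = l' + 1 := ⟨l - 1, by omega⟩
        have k1 : H.ltr (H.rot p (m + 1) b) l = H.ltr b (l + 1) := by
          rw [ltr_rot hm hp, if_neg (by omega), if_pos (by omega)]
        have k2 : H.ltr (H.rot p (m + 1) b) (l + 1) = H.ltr b (l + 1 + 1) := by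
          rw [ltr_rot hm hp, if_neg (by omega), if_pos (by omega)]
        rw [mul_assoc (H.X p), R_t_shift hm hp (by omega) (by omega), ← mul_assoc,
          mul_assoc _ _ (H.e b), R_e hm hp, ← mul_assoc,
          IH l _ (by omega), k1, k2, ite_mul, zero_mul, mul_assoc, mul_assoc, R_e hm hp]
      · rw [if_neg hc, if_neg hc, ih (by omega) (by omega)]
    · obtain rfl : l = p - (m + 1) := by omega
      have hs : p - (m + 1) + 1 = p - m := by omega
      have e1 := H.sw_left b (p - (m + 1)) (by omega)
      have e2 := H.sw_right b (p - (m + 1)) (by omega)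
      have e3 := H.t_sq (p - (m + 1)) b (by omega)
      rw [hs] at e1 e2 e3
      rw [hs] at far ⊢
      rw [G, G, e1]
      have step : ∀ b' : W, H.G p b' c m = if H.ltr b' (p - m) = c then H.R p m else
          match m with
          | 0 => 0
          | m' + 1 => H.G p b' c m' := by
        intro b'
        cases m with
        | zero => rw [G]; rfl
        | succ m' => rw [G]
      rw [step, step, e2]
      by_cases c1 : H.ltr b (p - m) = c
      · rw [if_pos c1, if_pos c1, mul_assoc, mul_assoc, R, mul_assoc, ← mul_assoc _ _ (H.e b), e3,
          c1]
        by_cases c2 : H.ltr b (p - (m + 1)) = c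
        · rw [if_pos c2, if_pos c2]; simp
        · rw [if_neg c2, if_neg c2, if_neg c2, mul_assoc]
      · rw [if_neg c1, if_neg c1]
        by_cases c2 : H.ltr b (p - (m + 1)) = c
        · rw [if_pos c2, if_pos c2, if_neg (fun c3 => c1 (c3.symm.trans c2)), R, mul_assoc (H.X p)]
        · rw [if_neg c2, if_neg c2]
          cases m with
          | zero => simp
          | succ m' => exact far m' (by omega)

/-- The symmetry of `X` on the right. -/
theorem X_t {p l : ℕ} (hp : p ≤ H.len) (hl : l + 1 < p) (b : W) :
    H.X p * H.t l * H.e b = if H.ltr b l = H.ltr b (l + 1) then 0 else H.X p * H.e b := by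
  induction p generalizing l b with
  | zero => omega
  | succ p ih =>
    rw [X, mul_assoc (H.X p), mul_assoc (H.X p), mul_assoc, H.t_e _ _ (by omega), ← mul_assoc,
      ← mul_assoc, mul_assoc (H.X p), Z_e, Finset.mul_sum, Finset.sum_mul]
    have : ∀ c, H.X p * (H.G p (H.sw l b) c p * H.e (H.sw l b)) * H.t l =
        if H.ltr b l = H.ltr b (l + 1) then 0 else H.X p * H.G p b c p * H.e b := fun c => by
      rw [← G_t hp (by omega) (fun l b h => ih (by omega) h b) le_rfl (by omega) b c]
      simp only [mul_assoc]
      rw [← H.t_e _ _ (by omega)]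
    simp only [this]
    split_ifs with h
    · simp
    · rw [mul_assoc, Z_e, Finset.mul_sum]
      simp only [mul_assoc]

/-- The commutation of `y p` with the strand which is moved to place `p`. -/
theorem X_y_R {p m : ℕ} (hp : p < H.len) (hm : m + 1 ≤ p) (b : W) :
    H.X p * (H.y p * H.R p (m + 1) - H.R p (m + 1) * H.y (p - (m + 1))) * H.e b =
      H.X p * H.G p b (H.ltr b (p - (m + 1))) m * H.e b := by
  induction m generalizing b with
  | zero =>
    have := H.t_y_left (p - (0 + 1)) b (by omega)
    rw [show p - (0 + 1) + 1 = p by omega] at this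
    rw [R, R, one_mul, mul_assoc, this, G, mul_assoc]
    by_cases h : H.ltr b (p - (0 + 1)) = H.ltr b p
    · rw [if_pos h, if_pos h.symm, one_mul]
    · rw [if_neg h, if_neg (Ne.symm h), zero_mul]
  | succ m ih =>
    have hs : p - (m + 1 + 1) + 1 = p - (m + 1) := by omega
    have e1 := H.t_y_left (p - (m + 1 + 1)) b (by omega)
    have e2 := H.sw_right b (p - (m + 1 + 1)) (by omega)
    have e3 := H.t_e (p - (m + 1 + 1)) b (by omega)
    rw [hs] at e1 e2
    have ih' := ih (by omega) (H.sw (p - (m + 1 + 1)) b)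
    rw [e2] at ih'
    have e4 : H.X p * (H.y p * H.R p (m + 1 + 1) - H.R p (m + 1 + 1) * H.y (p - (m + 1 + 1))) *
        H.e b = H.X p * (H.y p * H.R p (m + 1) - H.R p (m + 1) * H.y (p - (m + 1))) *
          H.e (H.sw (p - (m + 1 + 1)) b) * H.t (p - (m + 1 + 1)) +
        H.X p * (H.R p (m + 1) * ((H.y (p - (m + 1)) * H.t (p - (m + 1 + 1)) -
          H.t (p - (m + 1 + 1)) * H.y (p - (m + 1 + 1))) * H.e b)) := by
      rw [mul_assoc _ _ (H.t _), ← e3, show H.R p (m + 1 + 1) = H.R p (m + 1) * H.t (p - (m + 1 + 1)) from rfl]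
      noncomm_ring
    rw [e4, ih', e1, G]
    have e5 : H.X p * H.G p (H.sw (p - (m + 1 + 1)) b) (H.ltr b (p - (m + 1 + 1))) m *
        H.e (H.sw (p - (m + 1 + 1)) b) * H.t (p - (m + 1 + 1)) =
        if H.ltr b (p - (m + 1 + 1)) = H.ltr b (p - (m + 1)) then 0 else
          H.X p * H.G p b (H.ltr b (p - (m + 1 + 1))) m * H.e b := by
      rw [mul_assoc _ _ (H.t _), ← e3, G_congr (b' := b) _ fun i h1 h2 =>
        H.sw_ne b _ i (by omega) (by omega) (by omega), ← mul_assoc, mul_assoc (H.X p),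
        G_t_far (by omega) hp (by omega)]
      rcases H.G_cases p b (H.ltr b (p - (m + 1 + 1))) m with h0 | ⟨m', h1, h2, h0⟩
      · simp [h0]
      · have e6 := X_t hp.le (l := p - (m + 1 + 1)) (by omega) (H.rot p m' b)
        have k1 : H.ltr (H.rot p m' b) (p - (m + 1 + 1)) = H.ltr b (p - (m + 1 + 1)) := by
          rw [ltr_rot (by omega) hp, if_pos (by omega)]
        have k2 : H.ltr (H.rot p m' b) (p - (m + 1)) = H.ltr b (p - (m + 1)) := by
          rw [ltr_rot (by omega) hp, if_pos (by omega)]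
        rw [hs, k1, k2] at e6
        rw [h0, ← mul_assoc, mul_assoc _ _ (H.e b), R_e (m := m') (by omega) hp, ← mul_assoc, e6,
          ite_mul, zero_mul, mul_assoc, mul_assoc, R_e (m := m') (by omega) hp]
    rw [e5]
    by_cases h : H.ltr b (p - (m + 1 + 1)) = H.ltr b (p - (m + 1))
    · rw [if_pos h, if_pos h, if_pos h.symm, zero_add, mul_assoc]
    · rw [if_neg h, if_neg h, if_neg (Ne.symm h)]
      simp

theorem e_X_e_eq_zero {p i : ℕ} (hp : p ≤ H.len) (hi : p ≤ i) {b b' : W}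
    (h : H.ltr b' i ≠ H.ltr b i) : H.e b' * H.X p * H.e b = 0 := by
  induction p generalizing b with
  | zero =>
    rw [X, mul_one, e_ne]
    rintro rfl
    exact h rfl
  | succ p ih =>
    rw [X, mul_assoc, mul_assoc (H.X p), Z_e, Finset.mul_sum, Finset.mul_sum]
    refine Finset.sum_eq_zero fun c _ => ?_
    rcases H.G_cases p b c p with h0 | ⟨m', h1, h2, h0⟩
    · simp [h0]
    · rw [h0, R_e h1 (by omega), ← mul_assoc, ← mul_assoc, ih (by omega) (by omega), zero_mul]
      rwa [ltr_rot h1 (by omega), if_neg (by omega), if_neg (by omega), if_neg (by omega)]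

theorem e_X_succ_e {p : ℕ} (hp : p < H.len) (b : W) :
    H.e b * H.X (p + 1) * H.e b = H.e b * H.X p * H.G p b (H.ltr b p) p * H.e b := by
  rw [X, mul_assoc, mul_assoc (H.X p), Z_e, Finset.mul_sum, Finset.mul_sum,
    Finset.sum_eq_single (H.ltr b p)]
  · simp only [mul_assoc]
  · intro c _ hc
    rcases H.G_cases p b c p with h0 | ⟨m', h1, h2, h0⟩
    · simp [h0]
    · rw [h0, R_e h1 hp, ← mul_assoc, ← mul_assoc, e_X_e_eq_zero hp.le le_rfl, zero_mul]
      rw [ltr_rot h1 (by omega), if_neg (by omega), if_neg (by omega), if_pos rfl, h2]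
      exact Ne.symm hc
  · exact fun h => absurd (H.ltr_mem b p hp) h

/-- The elements which interpolate between `e b * X p * e b` and `e b * X (p + 1) * e b`. -/
def U (H : NilHecke A W C) (p : ℕ) (b : W) (m : ℕ) : A :=
  H.e b * H.X p * H.G p b (H.ltr b p) m * H.e b

theorem U_zero (p : ℕ) (b : W) : H.U p b 0 = H.e b * H.X p * H.e b := by
  simp [U, G]

theorem U_self {p : ℕ} (hp : p < H.len) (b : W) : H.U p b p = H.e b * H.X (p + 1) * H.e b :=
  (e_X_succ_e hp b).symm

theorem U_of_ne {p m : ℕ} {b : W} (h : H.ltr b (p - (m + 1)) ≠ H.ltr b p) :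
    H.U p b m = H.U p b (m + 1) := by
  rw [U, U, G.eq_2, if_neg h]

theorem U_of_eq {p m : ℕ} (hp : p < H.len) (hm : m + 1 ≤ p) {b : W}
    (h : H.ltr b (p - (m + 1)) = H.ltr b p) :
    H.U p b m = H.y p * H.U p b (m + 1) - H.U p b (m + 1) * H.y (p - (m + 1)) := by
  have := congrArg (H.e b * ·) (X_y_R hp hm b)
  simp only [h] at this
  rw [U, U, G.eq_2, if_pos h, mul_assoc, mul_assoc, ← mul_assoc (H.X p), ← this]
  simp only [mul_sub, sub_mul, ← mul_assoc]
  rw [H.y_e p b, mul_assoc _ (H.e b) (H.y _), ← H.y_e (p - (m + 1)) b,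
    mul_assoc (H.e b) (H.X p) (H.y p), X_y hp.le le_rfl]
  simp only [← mul_assoc]

/-- The number of occurrences of the letter `c` in `b` before place `p`. -/
def count (H : NilHecke A W C) (b : W) (c : C) (p : ℕ) : ℕ :=
  ∑ i ∈ Finset.range p, if H.ltr b i = c then 1 else 0

theorem count_succ (b : W) (c : C) (p : ℕ) :
    H.count b c (p + 1) = H.count b c p + if H.ltr b p = c then 1 else 0 :=
  Finset.sum_range_succ _ _

/-- The number of earlier occurrences in `b` of the letter in place `p`. -/
def δ (H : NilHecke A W C) (b : W) (p : ℕ) : ℕ := H.count b (H.ltr b p) p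

/-- Monomials in `y 0, …, y (p - 1)`. -/
def ymon (H : NilHecke A W C) (α : ℕ → ℕ) : ℕ → A
  | 0 => 1
  | p + 1 => H.ymon α p * H.y p ^ α p

theorem ymon_congr {α β : ℕ → ℕ} {p : ℕ} (h : ∀ i < p, α i = β i) : H.ymon α p = H.ymon β p := by
  induction p with
  | zero => rfl
  | succ p ih => rw [ymon, ymon, ih fun i hi => h i (by omega), h p (by omega)]

theorem ymon_e (α : ℕ → ℕ) (p : ℕ) (w : W) : H.ymon α p * H.e w = H.e w * H.ymon α p := by
  have hy : ∀ l s, H.y l ^ s * H.e w = H.e w * H.y l ^ s := fun l s =>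
    (Commute.pow_left (H.y_e l w) s).eq
  induction p with
  | zero => simp [ymon]
  | succ p ih => rw [ymon, mul_assoc, hy, ← mul_assoc, ih, mul_assoc]

end NilHecke

end

section

namespace NilHecke

variable {A : Type*} [Ring A] {W : Type*} [Fintype W] [DecidableEq W] {C : Type*} [DecidableEq C]
  {H : NilHecke A W C}

/-! ### Counting letters -/

theorem count_sw {l q : ℕ} (hl : l + 1 < H.len) (hq : l + 1 < q) (b : W) (c : C) :
    H.count (H.sw l b) c q = H.count b c q := by
  induction q, hq using Nat.le_induction with
  | base =>
    rw [count_succ, count_succ, count_succ, count_succ, H.sw_left b l hl, H.sw_right b l hl]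
    have : H.count (H.sw l b) c l = H.count b c l :=
      Finset.sum_congr rfl fun i hi => by
        rw [Finset.mem_range] at hi
        rw [H.sw_ne b l i hl (by omega) (by omega)]
    omega
  | succ q hq ih => rw [count_succ, count_succ, ih, H.sw_ne b l q hl (by omega) (by omega)]

theorem count_rot {p m : ℕ} (hm : m ≤ p) (hp : p < H.len) (b : W) (c : C) :
    H.count (H.rot p m b) c (p + 1) = H.count b c (p + 1) := by
  induction m generalizing b with
  | zero => rfl
  | succ m ih => rw [rot, ih (by omega), count_sw (by omega) (by omega)]

/-- The number of pairs of equal letters in the places before `p`. -/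
def pairs (H : NilHecke A W C) (b : W) (p : ℕ) : ℕ := ∑ c ∈ H.letters, (H.count b c p).choose 2

theorem count_rot_succ {p m : ℕ} (hm : m ≤ p) (hp : p < H.len) (b : W) (c : C) :
    H.count b c (p + 1) =
      H.count (H.rot p m b) c p + if H.ltr b (p - m) = c then 1 else 0 := by
  have h : H.ltr (H.rot p m b) p = H.ltr b (p - m) := by
    rw [ltr_rot hm hp, if_neg (by omega), if_neg (by omega), if_pos rfl]
  rw [← count_rot hm hp, count_succ, h]

theorem pairs_succ {p m : ℕ} (hm : m ≤ p) (hp : p < H.len) (b : W) :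
    H.pairs b (p + 1) + 1 =
      H.pairs (H.rot p m b) p + H.count b (H.ltr b (p - m)) (p + 1) := by
  have h1 : ∀ c, (H.count b c (p + 1)).choose 2 = (H.count (H.rot p m b) c p).choose 2 +
      if H.ltr b (p - m) = c then H.count (H.rot p m b) c p else 0 := fun c => by
    rw [count_rot_succ hm hp]
    split_ifs
    · rw [Nat.choose_succ_succ' _ 1, Nat.choose_one_right, add_comm]
    · rfl
  have h2 := H.ltr_mem b (p - m) (by omega)
  rw [pairs, Finset.sum_congr rfl fun c _ => h1 c, Finset.sum_add_distrib,
    Finset.sum_ite_eq, if_pos h2, count_rot_succ hm hp, if_pos rfl, pairs, add_assoc]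

theorem pairs_succ_eq {p : ℕ} (hp : p < H.len) (b : W) :
    H.pairs b (p + 1) = H.pairs b p + H.δ b p := by
  have := pairs_succ (m := 0) (Nat.zero_le p) hp b
  rw [rot, Nat.sub_zero, count_succ, if_pos rfl] at this
  rw [δ]
  omega

theorem pairs_zero (b : W) : H.pairs b 0 = 0 := by simp [pairs, count]

/-! ### Degrees -/

variable {k : Type*} [Field k] [Algebra k A]

/-- A grading for which `y l` has degree `g`, crossings of distinct letters have degree zero, and
crossings of equal letters have degree `-g`. -/
structure IsGraded (H : NilHecke A W C) (deg : ℤ → Submodule k A) (g : ℤ) : Prop where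
  g_pos : 0 < g
  mul_mem : ∀ {i j : ℤ} {x z : A}, x ∈ deg i → z ∈ deg j → x * z ∈ deg (i + j)
  e_mem : ∀ w, H.e w ∈ deg 0
  y_mem : ∀ l, H.y l ∈ deg g
  t_mem : ∀ l w, l + 1 < H.len →
    H.t l * H.e w ∈ deg (if H.ltr w l = H.ltr w (l + 1) then -g else 0)
  gen : ∀ V : ℤ → Submodule k A, (∀ w, H.e w ∈ V 0) →
    (∀ d x l w, x ∈ V d → H.y l * H.e w * x ∈ V (g + d)) →
    (∀ d x l w, l + 1 < H.len → x ∈ V d →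
      H.t l * H.e w * x ∈ V ((if H.ltr w l = H.ltr w (l + 1) then -g else 0) + d)) →
    ∀ d, deg d ≤ V d

namespace IsGraded

variable {deg : ℤ → Submodule k A} {g : ℤ}

theorem one_mem (hH : H.IsGraded deg g) : (1 : A) ∈ deg 0 := by
  rw [← H.e_sum]
  exact sum_mem fun w _ => hH.e_mem w

theorem R_mem (hH : H.IsGraded deg g) {p m : ℕ} (hm : m ≤ p) (hp : p < H.len) (b : W) :
    H.R p m * H.e b ∈
      deg (-g * ((H.count b (H.ltr b (p - m)) (p + 1) : ℤ) - H.count b (H.ltr b (p - m)) (p - m)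
        - 1)) := by
  induction m generalizing b with
  | zero =>
    rw [R, one_mul, Nat.sub_zero, count_succ, if_pos rfl]
    convert hH.e_mem b using 2
    push_cast
    ring
  | succ m ih =>
    have hs : p - (m + 1) + 1 = p - m := by omega
    have h1 := ih (by omega) (H.sw (p - (m + 1)) b)
    have h2 := hH.t_mem (p - (m + 1)) b (by omega)
    have h3 := H.sw_right b (p - (m + 1)) (by omega)
    rw [hs] at h2 h3
    rw [R, mul_assoc, ← e_self, ← mul_assoc (H.t _), H.t_e _ _ (by omega), mul_assoc (H.e _),
      ← mul_assoc]
    have h4 := hH.mul_mem h1 h2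
    rw [h3, count_sw (by omega) (by omega)] at h4
    have h5 : H.count (H.sw (p - (m + 1)) b) (H.ltr b (p - (m + 1))) (p - m) =
        H.count b (H.ltr b (p - (m + 1))) (p - (m + 1)) +
          if H.ltr b (p - m) = H.ltr b (p - (m + 1)) then 1 else 0 := by
      have h6 := H.sw_left b (p - (m + 1)) (by omega)
      rw [hs] at h6
      rw [← hs, count_succ, hs, h6]
      congr 1
      refine Finset.sum_congr rfl fun i hi => ?_
      rw [Finset.mem_range] at hi
      rw [H.sw_ne b _ i (by omega) (by omega) (by omega)]
    rw [h5] at h4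
    convert h4 using 2
    by_cases h : H.ltr b (p - m) = H.ltr b (p - (m + 1))
    · rw [if_pos h, if_pos h.symm]; push_cast; ring
    · rw [if_neg h, if_neg (Ne.symm h)]; push_cast; ring

theorem G_mem (hH : H.IsGraded deg g) {p m : ℕ} (hm : m ≤ p) (hp : p < H.len) (b : W) (c : C) :
    H.G p b c m * H.e b ∈
      deg (-g * ((H.count b c (p + 1) : ℤ) - H.count b c (p - m) - 1)) := by
  induction m with
  | zero =>
    rw [G]
    split_ifs with h
    · subst h
      simpa [R] using hH.R_mem hm hp b
    · simp
  | succ m ih =>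
    rw [G]
    split_ifs with h
    · subst h
      exact hH.R_mem hm hp b
    · have := ih (by omega)
      rwa [show p - m = p - (m + 1) + 1 by omega, count_succ b c (p - (m + 1)), if_neg h,
        add_zero] at this

theorem X_mem (hH : H.IsGraded deg g) {p : ℕ} (hp : p ≤ H.len) (b : W) :
    H.X p * H.e b ∈ deg (-g * H.pairs b p) := by
  induction p generalizing b with
  | zero =>
    rw [X, one_mul, pairs_zero]
    simpa using hH.e_mem b
  | succ p ih =>
    rw [X, mul_assoc, Z_e, Finset.mul_sum]
    refine sum_mem fun c _ => ?_
    have h1 := hH.G_mem le_rfl (Nat.lt_of_succ_le hp) b c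
    rcases H.G_cases p b c p with h0 | ⟨m, hm, h2, h0⟩
    · simp [h0]
    · rw [h0] at h1 ⊢
      have h3 := pairs_succ (H := H) (p := p) hm (by omega) b
      rw [h2] at h3
      rw [Nat.sub_self, show H.count b c 0 = 0 by simp [count]] at h1
      have h4 := hH.mul_mem (ih (Nat.le_of_succ_le hp) (H.rot p m b)) h1
      rw [mul_assoc, ← mul_assoc (H.e _), ← R_e (p := p) hm (by omega), mul_assoc (H.R p m), e_self] at h4
      convert h4 using 2
      have h5 : (H.pairs b (p + 1) : ℤ) + 1 = H.pairs (H.rot p m b) p + H.count b c (p + 1) := by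
        exact_mod_cast h3
      push_cast
      linear_combination -g * h5

theorem ymon_mem (hH : H.IsGraded deg g) (α : ℕ → ℕ) (p : ℕ) :
    H.ymon α p ∈ deg (g * ∑ i ∈ Finset.range p, (α i : ℤ)) := by
  have hy : ∀ l s : ℕ, H.y l ^ s ∈ deg (g * s) := by
    intro l s
    induction s with
    | zero => simpa using hH.one_mem
    | succ s ih =>
      rw [pow_succ]
      convert hH.mul_mem ih (hH.y_mem l) using 2
      push_cast
      ring
  induction p with
  | zero => simpa [ymon] using hH.one_mem
  | succ p ih =>
    rw [ymon, Finset.sum_range_succ, mul_add]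
    exact hH.mul_mem ih (hy p _)

/-- The polynomials of degree `d` in the `y l`, with coefficients in the span of the `e w`. -/
def poly (H : NilHecke A W C) (k : Type*) [Field k] [Algebra k A] (g d : ℤ) : Submodule k A :=
  Submodule.span k {z | ∃ (s : List ℕ) (w : W), d = g * s.length ∧ z = (s.map H.y).prod * H.e w}

theorem poly_mul_e {d : ℤ} {f : A} (hf : f ∈ poly H k g d) (w : W) :
    f * H.e w ∈ poly H k g d := by
  refine map_mem_of_mem_span (LinearMap.mulRight k (H.e w)) ?_ hf
  rintro _ ⟨s, w', rfl, rfl⟩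
  rw [LinearMap.mulRight_apply, mul_assoc, H.e_mul]
  split_ifs
  · exact Submodule.subset_span ⟨s, w', rfl, rfl⟩
  · simp

theorem poly_comm {d : ℤ} {f x : A} (hf : f ∈ poly H k g d) (hy : ∀ l, x * H.y l = H.y l * x)
    (he : ∀ w, x * H.e w = H.e w * x) : x * f = f * x := by
  have h : poly H k g d ≤ Subalgebra.toSubmodule (Subalgebra.centralizer k {x}) := by
    refine Submodule.span_le.2 ?_
    rintro _ ⟨s, w, -, rfl⟩
    refine Subalgebra.mul_mem _ (list_prod_mem fun a ha => ?_) ?_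
    · obtain ⟨l, -, rfl⟩ := List.mem_map.1 ha
      rintro _ rfl
      exact hy l
    · rintro _ rfl
      exact he w
  exact h hf x rfl

theorem e_poly {d : ℤ} {f : A} (hf : f ∈ poly H k g d) (w : W) : H.e w * f = f * H.e w :=
  poly_comm hf (fun l => (H.y_e l w).symm) fun w' => by
    rw [H.e_mul, H.e_mul]
    split_ifs with h1 h2 h2
    · rw [h1]
    · exact absurd h1.symm h2
    · exact absurd h2.symm h1
    · rfl

theorem y_poly {d : ℤ} {f : A} (hf : f ∈ poly H k g d) (l : ℕ) :
    H.y l * f ∈ poly H k g (g + d) := by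
  refine map_mem_of_mem_span (LinearMap.mulLeft k (H.y l)) ?_ hf
  rintro _ ⟨s, w', rfl, rfl⟩
  refine Submodule.subset_span ⟨l :: s, w', ?_, ?_⟩
  · rw [List.length_cons]; push_cast; ring
  · rw [List.map_cons, List.prod_cons, mul_assoc]; rfl

theorem poly_y {d : ℤ} {f : A} (hf : f ∈ poly H k g d) (l : ℕ) : f * H.y l = H.y l * f :=
  (poly_comm hf (H.y_comm l) (H.y_e l)).symm

theorem poly_eq_bot (hg : 0 < g) {d : ℤ} (hd : d < 0) {f : A} (hf : f ∈ poly H k g d) :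
    f = 0 := by
  have : poly H k g d ≤ ⊥ := by
    refine Submodule.span_le.2 ?_
    rintro _ ⟨s, w, h, rfl⟩
    have : 0 ≤ g * (s.length : ℤ) := by positivity
    omega
  exact this hf

theorem poly_zero (hg : 0 < g) {f : A} (hf : f ∈ poly H k g 0) (b : W) :
    ∃ c : k, f * H.e b = c • H.e b := by
  have := map_mem_of_mem_span (LinearMap.mulRight k (H.e b)) (p := k ∙ H.e b) ?_ hf
  · obtain ⟨c, hc⟩ := Submodule.mem_span_singleton.1 this
    exact ⟨c, hc.symm⟩
  · rintro _ ⟨s, w', h, rfl⟩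
    have hs : s.length = 0 := by
      rcases mul_eq_zero.1 h.symm with h | h
      · omega
      · exact_mod_cast h
    rw [LinearMap.mulRight_apply, List.length_eq_zero_iff.1 hs, List.map_nil, List.prod_nil,
      one_mul, H.e_mul]
    split_ifs with h1
    · exact h1 ▸ Submodule.mem_span_singleton_self _
    · simp

/-- Moving a crossing to the left of a polynomial. -/
theorem exists_mul_t (s : List ℕ) (l : ℕ) (hl : l + 1 < H.len) (w : W) :
    ∃ h ∈ poly H k g (g * s.length), ∃ h' ∈ poly H k g (g * s.length - g),
      (H.ltr w l ≠ H.ltr w (l + 1) → h' = 0) ∧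
      (s.map H.y).prod * (H.t l * H.e w) = H.t l * (H.e w * h) + H.e w * h' := by
  induction s with
  | nil =>
    refine ⟨H.e w, Submodule.subset_span ⟨[], w, rfl, by simp⟩, 0, zero_mem _, fun _ => rfl, ?_⟩
    rw [e_self]
    simp
  | cons m s ih =>
    obtain ⟨h, hh, h', hh', h0, eq⟩ := ih
    have key : ∃ (m' : ℕ) (c : k), (H.ltr w l ≠ H.ltr w (l + 1) → c = 0) ∧
        H.y m * (H.t l * H.e w) = H.t l * H.y m' * H.e w + c • H.e w := by
      by_cases h1 : m = l
      · subst h1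
        have := H.t_y_right m w hl
        refine ⟨m + 1, if H.ltr w m = H.ltr w (m + 1) then -1 else 0, fun h => if_neg h, ?_⟩
        rw [sub_mul] at this
        split_ifs at this ⊢
        · rw [← mul_assoc, neg_one_smul, sub_eq_iff_eq_add.1 this]; abel
        · rw [← mul_assoc, zero_smul, add_zero]; exact (sub_eq_zero.1 this).symm
      · by_cases h2 : m = l + 1
        · subst h2
          have := H.t_y_left l w hl
          refine ⟨l, if H.ltr w l = H.ltr w (l + 1) then 1 else 0, fun h => if_neg h, ?_⟩
          rw [sub_mul] at this
          split_ifs at this ⊢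
          · rw [← mul_assoc, one_smul, sub_eq_iff_eq_add.1 this, add_comm]
          · rw [← mul_assoc, zero_smul, add_zero]; exact sub_eq_zero.1 this
        · exact ⟨m, 0, fun _ => rfl, by
            rw [zero_smul, add_zero, ← mul_assoc, H.t_y l m hl h1 h2]⟩
    obtain ⟨m', c, hc, eq'⟩ := key
    refine ⟨H.y m' * h, ?_, c • h + H.y m * h', ?_, ?_, ?_⟩
    · convert y_poly hh m' using 2
      rw [List.length_cons]; push_cast; ring
    · refine add_mem (Submodule.smul_mem _ c ?_) ?_
      · convert hh using 2
        rw [List.length_cons]; push_cast; ring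
      · convert y_poly hh' m using 2
        rw [List.length_cons]; push_cast; ring
    · intro hne
      rw [hc hne, h0 hne]
      simp
    · rw [List.map_cons, List.prod_cons, mul_assoc, eq, mul_add, ← mul_assoc (H.t l), ← mul_assoc,
        eq', add_mul, ← mul_assoc (H.y m) (H.e w), H.y_e, mul_assoc (H.t l), H.y_e]
      simp only [mul_assoc, smul_mul_assoc, mul_add, mul_smul_comm, add_assoc]

/-- The elements `X * f` for `f` a polynomial of degree `d`. -/
def symPoly (H : NilHecke A W C) (k : Type*) [Field k] [Algebra k A] (g d : ℤ) : Submodule k A :=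
  (poly H k g d).map (LinearMap.mulLeft k (H.X H.len))

theorem X_poly_t (l : ℕ) (hl : l + 1 < H.len) (w : W) {i : ℤ} {f : A}
    (hf : f ∈ poly H k g i) : H.X H.len * f * (H.t l * H.e w) ∈
      symPoly H k g (i + if H.ltr w l = H.ltr w (l + 1) then -g else 0) := by
  induction hf using Submodule.span_induction with
  | zero => simp
  | add a b _ _ ha hb => rw [mul_add, add_mul]; exact add_mem ha hb
  | smul c a _ ha => rw [mul_smul_comm, smul_mul_assoc]; exact Submodule.smul_mem _ c ha
  | mem x hx =>
    obtain ⟨s, w', rfl, rfl⟩ := hx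
    rw [mul_assoc, mul_assoc, H.t_e l w hl, ← mul_assoc (H.e w'), H.e_mul]
    by_cases h1 : w' = H.sw l w
    swap
    · rw [if_neg h1]; simp
    rw [if_pos h1]
    split_ifs with h2
    · obtain ⟨h, hh, h', hh', h0, eq⟩ := exists_mul_t (k := k) (g := g) s l hl w
      rw [h1, ← H.t_e l w hl, eq, mul_add, ← mul_assoc, ← mul_assoc, X_t le_rfl hl, if_pos h2,
        zero_mul, zero_add]
      exact ⟨H.e w * h', by rw [e_poly hh']; exact poly_mul_e hh' w, rfl⟩
    · obtain ⟨h, hh, h', hh', h0, eq⟩ := exists_mul_t (k := k) (g := g) s l hl w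
      rw [h1, ← H.t_e l w hl, eq, mul_add, ← mul_assoc, ← mul_assoc, X_t le_rfl hl, if_neg h2,
        h0 h2, mul_zero, mul_zero, add_zero, add_zero, mul_assoc]
      exact ⟨H.e w * h, by rw [e_poly hh]; exact poly_mul_e hh w, rfl⟩

/-- The right ideal generated by `X` consists of the `X * f` for polynomials `f`. -/
theorem X_poly_mul (hH : H.IsGraded deg g) {d i : ℤ} {a f : A} (ha : a ∈ deg d)
    (hf : f ∈ poly H k g i) : H.X H.len * f * a ∈ symPoly H k g (i + d) := by
  let V : ℤ → Submodule k A := fun d =>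
    { carrier := {a | ∀ i, ∀ f ∈ poly H k g i, H.X H.len * f * a ∈ symPoly H k g (i + d)}
      zero_mem' := fun i f _ => by simp
      add_mem' := fun ha hb i f hf => by
        rw [mul_add]
        exact add_mem (ha i f hf) (hb i f hf)
      smul_mem' := fun c a ha i f hf => by
        rw [mul_smul_comm]
        exact Submodule.smul_mem _ c (ha i f hf) }
  refine hH.gen V ?_ ?_ ?_ d ha i f hf
  · intro w i f hf
    rw [mul_assoc, add_zero]
    exact ⟨_, poly_mul_e hf w, rfl⟩
  · intro d x l w hx i f hf
    rw [← mul_assoc, ← mul_assoc, mul_assoc _ f, poly_y hf, mul_assoc _ _ (H.e w), mul_assoc (H.y l)]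
    have := hx _ _ (y_poly (poly_mul_e hf w) l)
    rwa [show g + i + d = i + (g + d) by ring] at this
  · intro d x l w hl hx i f hf
    obtain ⟨h, hh, eq⟩ := X_poly_t l hl w hf
    have := hx _ h hh
    rw [← mul_assoc, ← eq]
    rwa [add_assoc] at this

theorem one_poly : (1 : A) ∈ poly H k g 0 := by
  rw [← H.e_sum]
  exact sum_mem fun w _ => Submodule.subset_span ⟨[], w, by simp, by simp⟩

theorem exists_X_mul (hH : H.IsGraded deg g) {d : ℤ} {a : A} (ha : a ∈ deg d) :
    ∃ f ∈ poly H k g d, H.X H.len * a = H.X H.len * f := by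
  obtain ⟨f, hf, h⟩ := hH.X_poly_mul ha one_poly
  rw [zero_add] at hf
  exact ⟨f, hf, by rw [mul_one] at h; exact h.symm⟩

theorem X_mul_eq_zero (hH : H.IsGraded deg g) {d : ℤ} (hd : d < 0) {a : A} (ha : a ∈ deg d) :
    H.X H.len * a = 0 := by
  obtain ⟨f, hf, h⟩ := hH.exists_X_mul ha
  rw [h, poly_eq_bot hH.g_pos hd hf, mul_zero]

theorem exists_X_mul_e (hH : H.IsGraded deg g) {a : A} (ha : a ∈ deg 0) (b : W) :
    ∃ c : k, H.X H.len * a * H.e b = c • (H.X H.len * H.e b) := by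
  obtain ⟨f, hf, h⟩ := hH.exists_X_mul ha
  obtain ⟨c, hc⟩ := poly_zero hH.g_pos hf b
  exact ⟨c, by rw [h, mul_assoc, hc, mul_smul_comm]⟩

/-- The part of degree `d` of the left ideal generated by the `y l`. -/
def leftIdeal (H : NilHecke A W C) (deg : ℤ → Submodule k A) (g d : ℤ) : Submodule k A :=
  Submodule.span k {z | ∃ a ∈ deg (d - g), ∃ l, z = a * H.y l}

theorem mul_leftIdeal (hH : H.IsGraded deg g) {i d : ℤ} {a z : A} (ha : a ∈ deg i)
    (hz : z ∈ leftIdeal H deg g d) : a * z ∈ leftIdeal H deg g (i + d) := by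
  refine map_mem_of_mem_span (LinearMap.mulLeft k a) ?_ hz
  rintro _ ⟨a', ha', l, rfl⟩
  refine Submodule.subset_span ⟨a * a', ?_, l, (mul_assoc _ _ _).symm⟩
  have := hH.mul_mem ha ha'
  rwa [show i + (d - g) = i + d - g by ring] at this

theorem U_mem (hH : H.IsGraded deg g) {p m : ℕ} (hp : p < H.len) (hm : m ≤ p) (b : W) :
    H.U p b (p - m) ∈ deg (g * H.count b (H.ltr b p) m - g * H.pairs b (p + 1)) ∧
    H.U p b (p - m) - H.y p ^ H.count b (H.ltr b p) m * H.U p b p ∈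
      leftIdeal H deg g (g * H.count b (H.ltr b p) m - g * H.pairs b (p + 1)) ∧
    H.U p b (p - m) ∈ Submodule.span k {z | ∃ i ≤ H.count b (H.ltr b p) m, ∃ a,
      z = H.y p ^ i * (H.U p b p * a)} := by
  induction m with
  | zero =>
    have h0 : H.count b (H.ltr b p) 0 = 0 := by simp [count]
    rw [h0, Nat.sub_zero, pow_zero, one_mul, sub_self]
    refine ⟨?_, zero_mem _, Submodule.subset_span ⟨0, le_rfl, 1, by simp⟩⟩
    rw [U_self hp, mul_assoc]
    convert hH.mul_mem (hH.e_mem b) (hH.X_mem (p := p + 1) (by omega) b) using 2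
    push_cast
    ring
  | succ m ih =>
    obtain ⟨h1, h2, h3⟩ := ih (by omega)
    obtain ⟨q, hq⟩ : ∃ q, q = p - (m + 1) := ⟨_, rfl⟩
    have hq1 : p - m = q + 1 := by omega
    have hq2 : p - (q + 1) = m := by omega
    rw [hq1] at h1 h2 h3
    rw [← hq, count_succ]
    by_cases h : H.ltr b m = H.ltr b p
    · have hU := U_of_eq (m := q) hp (by omega) (b := b) (by rw [hq2, h])
      have e1 : g * ((H.count b (H.ltr b p) m + 1 : ℕ) : ℤ) - g * H.pairs b (p + 1) =
          g + (g * H.count b (H.ltr b p) m - g * H.pairs b (p + 1)) := by push_cast; ring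
      rw [if_pos h, e1]
      have h4 : H.U p b (q + 1) * H.y (p - (q + 1)) ∈
          leftIdeal H deg g (g + (g * H.count b (H.ltr b p) m - g * H.pairs b (p + 1))) :=
        Submodule.subset_span ⟨_, by rwa [add_sub_cancel_left], _, rfl⟩
      refine ⟨?_, ?_, ?_⟩
      · rw [hU]
        refine sub_mem (hH.mul_mem (hH.y_mem p) h1) ?_
        rw [add_comm]
        exact hH.mul_mem h1 (hH.y_mem _)
      · have h5 := sub_mem (hH.mul_leftIdeal (hH.y_mem p) h2) h4
        rw [hU, pow_succ']
        convert h5 using 1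
        noncomm_ring
      · rw [hU]
        refine sub_mem ?_ ?_
        · refine map_mem_of_mem_span (LinearMap.mulLeft k (H.y p)) ?_ h3
          rintro _ ⟨i, hi, a, rfl⟩
          exact Submodule.subset_span ⟨i + 1, by omega, a, by
            rw [pow_succ', mul_assoc, LinearMap.mulLeft_apply]⟩
        · refine map_mem_of_mem_span (LinearMap.mulRight k (H.y (p - (q + 1)))) ?_ h3
          rintro _ ⟨i, hi, a, rfl⟩
          exact Submodule.subset_span ⟨i, by omega, a * H.y (p - (q + 1)), by
            simp only [mul_assoc, LinearMap.mulRight_apply]⟩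
    · rw [if_neg h, add_zero, U_of_ne (by rwa [hq2])]
      exact ⟨h1, h2, h3⟩

/-- The element which generates, up to a shift, the same left ideal as `idem`. -/
def bottom (H : NilHecke A W C) (b : W) : A := H.e b * H.X H.len * H.e b

theorem sum_δ (b : W) {p : ℕ} (hp : p ≤ H.len) :
    ∑ i ∈ Finset.range p, (H.δ b i : ℤ) = H.pairs b p := by
  induction p with
  | zero => simp [pairs_zero]
  | succ p ih =>
    rw [Finset.sum_range_succ, ih (by omega), pairs_succ_eq (by omega)]
    push_cast
    rfl

theorem e_sub_mem (hH : H.IsGraded deg g) (b : W) {p : ℕ} (hp : p ≤ H.len) :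
    H.e b - H.ymon (H.δ b) p * (H.e b * H.X p * H.e b) ∈ leftIdeal H deg g 0 := by
  induction p with
  | zero => simp [ymon, X, e_self]
  | succ p ih =>
    obtain ⟨-, h1, -⟩ := hH.U_mem (m := p) (by omega) le_rfl b
    rw [Nat.sub_self, U_zero, U_self (by omega)] at h1
    have h2 := hH.mul_leftIdeal (hH.ymon_mem (H.δ b) p) h1
    rw [sum_δ b (by omega), pairs_succ_eq (by omega), ← δ] at h2
    have e1 : g * (H.pairs b p : ℤ) + (g * (H.δ b p) - g * ((H.pairs b p + H.δ b p : ℕ) : ℤ)) =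
      0 := by push_cast; ring
    rw [e1] at h2
    have := add_mem (ih (by omega)) h2
    rw [ymon]
    convert this using 1
    noncomm_ring

theorem e_mem_span (hH : H.IsGraded deg g) (b : W) {p : ℕ} (hp : p ≤ H.len) :
    H.e b ∈ Submodule.span k {z | ∃ α : ℕ → ℕ, (∀ i, α i ≤ H.δ b i) ∧ ∃ a,
      z = H.ymon α p * (H.e b * H.X p * H.e b * a)} := by
  induction p with
  | zero =>
    exact Submodule.subset_span ⟨0, fun i => Nat.zero_le _, 1, by simp [ymon, X, e_self]⟩
  | succ p ih =>
    obtain ⟨-, -, h1⟩ := hH.U_mem (m := p) (by omega) le_rfl b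
    rw [Nat.sub_self, U_zero, U_self (by omega)] at h1
    have key : ∀ α : ℕ → ℕ, (∀ i, α i ≤ H.δ b i) → ∀ z ∈ Submodule.span k
        {z | ∃ i ≤ H.count b (H.ltr b p) p, ∃ a,
          z = H.y p ^ i * (H.e b * H.X (p + 1) * H.e b * a)}, ∀ a, H.ymon α p * (z * a) ∈
        Submodule.span k {z | ∃ α : ℕ → ℕ, (∀ i, α i ≤ H.δ b i) ∧ ∃ a,
          z = H.ymon α (p + 1) * (H.e b * H.X (p + 1) * H.e b * a)} := by
      intro α hα z hz a
      refine map_mem_of_mem_span (LinearMap.mulLeft k (H.ymon α p) ∘ₗ LinearMap.mulRight k a) ?_ hz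
      rintro _ ⟨i, hi, a', rfl⟩
      refine Submodule.subset_span ⟨Function.update α p i, ?_, a' * a, ?_⟩
      · intro i'
        by_cases h : i' = p
        · subst h; rw [Function.update_self]; exact hi
        · rw [Function.update_of_ne h]; exact hα i'
      · rw [ymon, Function.update_self, ymon_congr (α := Function.update α p i) (β := α)
          fun i' hi' => Function.update_of_ne hi'.ne _ _]
        simp [mul_assoc]
    refine Submodule.span_le.2 ?_ (ih (by omega))
    rintro _ ⟨α, hα, a, rfl⟩
    exact key α hα _ h1 a

/-- A primitive idempotent. -/
def idem (H : NilHecke A W C) (b : W) : A := H.ymon (H.δ b) H.len * bottom H b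

theorem idem_e (b : W) : idem H b * H.e b = idem H b := by
  rw [idem, bottom, mul_assoc, mul_assoc _ (H.e b), e_self]

theorem e_idem (b : W) : H.e b * idem H b = idem H b := by
  rw [idem, ← mul_assoc, ← ymon_e, bottom, mul_assoc, ← mul_assoc (H.e b), ← mul_assoc (H.e b),
    e_self]

theorem idem_mem (hH : H.IsGraded deg g) (b : W) : idem H b ∈ deg 0 := by
  have h1 := hH.mul_mem (hH.e_mem b) (hH.X_mem le_rfl b)
  have := hH.mul_mem (hH.ymon_mem (H.δ b) H.len) h1
  rw [sum_δ b le_rfl] at this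
  rw [idem, bottom, mul_assoc (H.e b)]
  convert this using 2
  ring

theorem bottom_mul_eq_zero (hH : H.IsGraded deg g) (b : W) {d : ℤ} (hd : d < 0) {a : A}
    (ha : a ∈ deg d) : bottom H b * a = 0 := by
  have := hH.mul_mem (hH.e_mem b) ha
  rw [zero_add] at this
  rw [bottom, mul_assoc, mul_assoc, hH.X_mul_eq_zero hd this, mul_zero]

theorem idem_mul_eq_zero (hH : H.IsGraded deg g) (b : W) {d : ℤ} (hd : d < 0) {a : A}
    (ha : a ∈ deg d) : idem H b * a = 0 := by
  rw [idem, mul_assoc, hH.bottom_mul_eq_zero b hd ha, mul_zero]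

theorem exists_idem_mul_e (hH : H.IsGraded deg g) (b : W) {a : A} (ha : a ∈ deg 0) :
    ∃ c : k, idem H b * a * H.e b = c • idem H b := by
  have := hH.mul_mem (hH.e_mem b) ha
  rw [zero_add] at this
  obtain ⟨c, hc⟩ := hH.exists_X_mul_e this b
  refine ⟨c, ?_⟩
  rw [idem, bottom]
  simp only [mul_assoc] at hc ⊢
  rw [hc, mul_smul_comm, mul_smul_comm]

theorem mul_e_sub_idem (hH : H.IsGraded deg g) (b : W) {z : A}
    (hz : ∀ d < 0, ∀ a ∈ deg d, z * a = 0) : z * (H.e b - idem H b) = 0 := by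
  have h1 := hH.e_sub_mem b le_rfl
  have : leftIdeal H deg g 0 ≤ LinearMap.ker (LinearMap.mulLeft k z) := by
    refine Submodule.span_le.2 ?_
    rintro _ ⟨a, ha, l, rfl⟩
    rw [zero_sub] at ha
    change z * (a * H.y l) = 0
    rw [← mul_assoc, hz _ (neg_lt_zero.2 hH.g_pos) a ha, zero_mul]
  exact this h1

theorem idem_idem (hH : H.IsGraded deg g) (b : W) : idem H b * idem H b = idem H b := by
  have := hH.mul_e_sub_idem b fun d hd a ha => hH.idem_mul_eq_zero b hd ha
  rw [mul_sub, idem_e, sub_eq_zero] at this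
  exact this.symm

theorem bottom_idem (hH : H.IsGraded deg g) (b : W) : bottom H b * idem H b = bottom H b := by
  have := hH.mul_e_sub_idem b fun d hd a ha => hH.bottom_mul_eq_zero b hd ha
  rw [mul_sub, sub_eq_zero, bottom, mul_assoc _ (H.e b), e_self] at this
  exact this.symm

theorem e_mem_span_idem (hH : H.IsGraded deg g) (b : W) :
    H.e b ∈ Submodule.span k {z | ∃ a a', z = a * idem H b * a'} := by
  refine Submodule.span_le.2 ?_ (hH.e_mem_span b le_rfl)
  rintro _ ⟨α, -, a, rfl⟩
  refine Submodule.subset_span ⟨H.ymon α H.len * bottom H b, a, ?_⟩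
  rw [mul_assoc _ (bottom H b), hH.bottom_idem, mul_assoc _ (bottom H b), bottom]

theorem idem_ne_zero (hH : H.IsGraded deg g) {b : W} (hb : H.e b ≠ 0) : idem H b ≠ 0 := by
  intro h
  have := hH.e_mem_span_idem b
  have h2 : Submodule.span k {z | ∃ a a', z = a * idem H b * a'} = ⊥ := by
    rw [Submodule.span_eq_bot]
    rintro _ ⟨a, a', rfl⟩
    rw [h, mul_zero, zero_mul]
  rw [h2] at this
  exact hb this

end IsGraded

end NilHecke

end

section
variable {k : Type u} [Field k] {n : ℕ}

namespace Orbit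

variable {I : Type v} {D : FoldedDatum I k} (j : Orbit D)

/-- An element of the orbit. -/
def base : I := j.exists_eq.choose

theorem base_mem : j.base ∈ j.carrier :=
  (j.exists_eq.choose_spec _).2 (Equiv.Perm.SameCycle.refl _ _)

/-- The common value of `i · i` for `i` in the orbit. -/
def size : ℤ := D.form j.base j.base

variable {j}

theorem form_self {i : I} (hi : i ∈ j.carrier) : D.form i i = j.size := by
  have h : ∀ (s : ℕ) x, D.form ((D.a ^ s) x) ((D.a ^ s) x) = D.form x x := by
    intro s
    induction s with
    | zero => simp
    | succ s ih => intro x; rw [pow_succ', Equiv.Perm.mul_apply, D.form_a, ih]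
  obtain ⟨s, rfl⟩ := j.sameCycle j.base_mem hi
  rw [size]
  obtain ⟨s, rfl | rfl⟩ := Int.eq_nat_or_neg s
  · rw [zpow_natCast, h]
  · rw [zpow_neg, zpow_natCast]
    conv_rhs => rw [← (D.a ^ s).apply_symm_apply j.base]
    exact (h _ _).symm

theorem size_pos : 0 < j.size := (D.diag _).1

theorem form_ne {i i' : I} (hi : i ∈ j.carrier) (hi' : i' ∈ j.carrier) (h : i ≠ i') :
    D.form i i' = 0 := D.orth _ _ h (j.sameCycle hi hi')

theorem Q_support {i i' : I} (hi : i ∈ j.carrier) (hi' : i' ∈ j.carrier) (h : i ≠ i')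
    {m : Fin 2 →₀ ℕ} (hm : (D.Q i i').coeff m ≠ 0) : m = 0 := by
  have h1 := D.Q_homog i i' h hm
  rw [form_ne hi hi' h, Finsupp.weight_apply, Finsupp.sum_fintype _ _ (by simp)] at h1
  simp only [Fin.sum_univ_two, Matrix.cons_val_zero, Matrix.cons_val_one, form_self hi,
    form_self hi', nsmul_eq_mul, mul_zero, neg_zero, ← add_mul] at h1
  have h2 : (m 0 : ℤ) + m 1 = 0 := (mul_eq_zero.1 h1).resolve_right j.size_pos.ne'
  ext x
  fin_cases x <;> simp <;> omega

theorem evalTwo_Q {i i' : I} (hi : i ∈ j.carrier) (hi' : i' ∈ j.carrier) (h : i ≠ i')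
    {S : Type*} [Ring S] [Algebra k S] (x z : S) :
    evalTwo (D.Q i i') x z = (D.Q i i').coeff 0 • 1 := by
  rw [evalTwo, Finset.sum_eq_single 0]
  · simp
  · intro m hm h0
    exact absurd (Q_support hi hi' h (MvPolynomial.mem_support_iff.1 hm)) h0
  · intro h0
    rw [MvPolynomial.notMem_support_iff.1 h0, zero_smul]

theorem dividedDiff_Q {i i' : I} (hi : i ∈ j.carrier) (hi' : i' ∈ j.carrier)
    {S : Type*} [Ring S] [Algebra k S] (x z z' : S) : dividedDiff (D.Q i i') x z z' = 0 := by
  by_cases h : i = i'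
  · subst h
    rw [D.Q_self, dividedDiff]
    simp
  · refine Finset.sum_eq_zero fun m hm => ?_
    rw [Q_support hi hi' h (MvPolynomial.mem_support_iff.1 hm)]
    simp

theorem Q_coeff_ne {i i' : I} (hi : i ∈ j.carrier) (hi' : i' ∈ j.carrier) (h : i ≠ i') :
    (D.Q i i').coeff 0 ≠ 0 := by
  have := D.Q_coeff_u i i' h
  rw [form_ne hi hi' h] at this
  simpa using this

namespace Scaling

variable (g : j.Scaling) {ν : I →₀ ℕ}

theorem γ_ne {i i' : I} (hi : i ∈ j.carrier) (hi' : i' ∈ j.carrier) (h : i ≠ i') :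
    g.γ i i' ≠ 0 := by
  have h1 := g.mul i hi i' hi' h
  intro h0
  rw [h0, zero_mul] at h1
  exact Q_coeff_ne hi hi' h h1.symm

variable (j) in
/-- The letter of a word in a given place. -/
def letter (w : Word ν) (l : ℕ) : I := if h : l < ν.degree then w.1 ⟨l, h⟩ else j.base

variable (ν) in
/-- The condition that all letters of the words of content `ν` are in the orbit. -/
def _root_.FoldedKLR.Orbit.Covers (j : Orbit D) : Prop := ∀ i ∈ ν.support, i ∈ j.carrier

theorem letter_of_lt (w : Word ν) {l : ℕ} (h : l < ν.degree) : letter j w l = w.1 ⟨l, h⟩ :=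
  dif_pos h

theorem letter_mem (hν : j.Covers ν) (w : Word ν) (l : ℕ) : letter j w l ∈ j.carrier := by
  rw [letter]
  split_ifs
  · exact hν _ (w.mem_support _)
  · exact j.base_mem

/-- The word `s_l w`, which is `w` if there is no place `l + 1`. -/
def swap (l : ℕ) (w : Word ν) : Word ν := if h : l + 1 < ν.degree then w.swap l h else w

/-- The generators `y_l`, indexed by all natural numbers. -/
def dot (l : ℕ) : KLR D ν := if h : l < ν.degree then KLR.y D ⟨l, h⟩ else 0

open Classical in
/-- The factor by which a crossing is rescaled. -/
def factor (i i' : I) : k := if i = i' then 1 else (g.γ i i')⁻¹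

/-- The rescaled generators `τ_l`. -/
def cross (l : ℕ) : KLR D ν := if h : l + 1 < ν.degree then
  ∑ w, g.factor (letter j w l) (letter j w (l + 1)) • (KLR.tau D l h * KLR.e D w) else 0

theorem factor_ne {i i' : I} (hi : i ∈ j.carrier) (hi' : i' ∈ j.carrier) :
    g.factor i i' ≠ 0 := by
  rw [factor]
  split_ifs with h
  · exact one_ne_zero
  · exact inv_ne_zero (g.γ_ne hi hi' h)

theorem cross_e (l : ℕ) (h : l + 1 < ν.degree) (w : Word ν) : g.cross l * KLR.e D w =
    g.factor (letter j w l) (letter j w (l + 1)) • (KLR.tau D l h * KLR.e D w) := by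
  rw [cross, dif_pos h, Finset.sum_mul, Finset.sum_eq_single w]
  · rw [smul_mul_assoc, mul_assoc, KLR.e_self]
  · intro w' _ hw
    rw [smul_mul_assoc, mul_assoc, KLR.e_ne hw, mul_zero, smul_zero]
  · simp

theorem swap_of_lt {l : ℕ} (h : l + 1 < ν.degree) (w : Word ν) : swap l w = w.swap l h := dif_pos h

theorem letter_swap_left {l : ℕ} (h : l + 1 < ν.degree) (w : Word ν) :
    letter j (swap l w) l = letter j w (l + 1) := by
  rw [swap_of_lt h, letter_of_lt _ (by omega), letter_of_lt _ h, Word.swap_left]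

theorem letter_swap_right {l : ℕ} (h : l + 1 < ν.degree) (w : Word ν) :
    letter j (swap l w) (l + 1) = letter j w l := by
  rw [swap_of_lt h, letter_of_lt _ h, letter_of_lt _ (by omega), Word.swap_right]

theorem letter_swap_ne {l m : ℕ} (h : l + 1 < ν.degree) (w : Word ν) (h1 : m ≠ l)
    (h2 : m ≠ l + 1) : letter j (swap l w) m = letter j w m := by
  by_cases hm : m < ν.degree
  · rw [swap_of_lt h, letter_of_lt _ hm, letter_of_lt _ hm, Word.swap_ne _ _ _ _ h1 h2]
  · rw [letter, dif_neg hm, letter, dif_neg hm]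

theorem e_ext {a b : KLR D ν} (h : ∀ w, a * KLR.e D w = b * KLR.e D w) : a = b := by
  rw [KLR.mul_sum_e a, KLR.mul_sum_e b]
  exact Finset.sum_congr rfl fun w _ => h w

theorem cross_mul_e (l : ℕ) (h : l + 1 < ν.degree) (w : Word ν) :
    g.cross l * KLR.e D w = KLR.e D (swap l w) * g.cross l := by
  have h1 : ∀ w' : Word ν, KLR.e D w' * g.cross l =
      g.factor (letter j (swap l w') l) (letter j (swap l w') (l + 1)) •
        (KLR.tau D l h * KLR.e D (swap l w')) := by
    intro w'
    have h2 : ∀ v, KLR.e D w' * (KLR.tau D l h * KLR.e D v) =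
        if v = swap l w' then KLR.tau D l h * KLR.e D (swap l w') else 0 := by
      intro v
      rw [KLR.tau_e]
      by_cases hv : v = swap l w'
      · subst hv
        rw [if_pos rfl, swap_of_lt h, Word.swap_swap, ← mul_assoc, KLR.e_self, KLR.tau_e,
          Word.swap_swap]
      · rw [if_neg hv, ← mul_assoc, KLR.e_ne, zero_mul]
        rintro rfl
        rw [swap_of_lt h, Word.swap_swap] at hv
        exact hv rfl
    rw [cross, dif_pos h, Finset.mul_sum, Finset.sum_eq_single (swap l w')]
    · rw [mul_smul_comm, h2, if_pos rfl]
    · intro v _ hv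
      rw [mul_smul_comm, h2, if_neg hv, smul_zero]
    · simp
  rw [h1, swap_of_lt h, swap_of_lt h, Word.swap_swap, ← g.cross_e l h]

theorem cross_dot (l : ℕ) (h : l + 1 < ν.degree) (w : Word ν)
    (m : Fin ν.degree) : (g.cross l * KLR.y D m -
      KLR.y D (Equiv.swap ⟨l, by omega⟩ ⟨l + 1, h⟩ m) * g.cross l) * KLR.e D w =
      g.factor (letter j w l) (letter j w (l + 1)) •
      ((KLR.tau D l h * KLR.y D m -
        KLR.y D (Equiv.swap ⟨l, by omega⟩ ⟨l + 1, h⟩ m) * KLR.tau D l h) * KLR.e D w) := by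
  rw [sub_mul, sub_mul, smul_sub, mul_assoc, KLR.y_e, ← mul_assoc, g.cross_e l h,
    mul_assoc (KLR.y D _) (g.cross l), g.cross_e l h, mul_smul_comm, smul_mul_assoc,
    mul_assoc (KLR.tau D l h), ← KLR.y_e]
  simp only [mul_assoc]

theorem cross_cross_e {a b : ℕ} (ha : a + 1 < ν.degree) (hb : b + 1 < ν.degree) (w : Word ν) :
    g.cross a * g.cross b * KLR.e D w =
      (g.factor (letter j (swap b w) a) (letter j (swap b w) (a + 1)) *
        g.factor (letter j w b) (letter j w (b + 1))) •
      (KLR.tau D a ha * KLR.tau D b hb * KLR.e D w) := by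
  rw [mul_assoc, g.cross_e b hb, mul_smul_comm, KLR.tau_e, ← mul_assoc, ← swap_of_lt hb,
    g.cross_e a ha, smul_mul_assoc, smul_smul, mul_comm, swap_of_lt hb, mul_assoc, ← KLR.tau_e,
    mul_assoc]

open Classical in
/-- The elements of `R(ν)` which satisfy the normalised relations. -/
def nilHecke (hν : j.Covers ν) : NilHecke (KLR D ν) (Word ν) I where
  len := ν.degree
  letters := j.carrier
  ltr := letter j
  sw := swap
  e := KLR.e D
  y := dot
  t := g.cross
  ltr_mem w l _ := letter_mem hν w l
  sw_left w l h := letter_swap_left h w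
  sw_right w l h := letter_swap_right h w
  sw_ne w l i h h1 h2 := letter_swap_ne h w h1 h2
  sw_sw w l h := by rw [swap_of_lt h, swap_of_lt h, Word.swap_swap]
  e_mul w w' := by
    split_ifs with h
    · rw [← h, KLR.e_self]
    · exact KLR.e_ne h
  e_sum := KLR.e_sum
  y_e l w := by
    rw [dot]
    split_ifs
    · exact KLR.y_e _ _
    · simp
  y_comm l m := by
    rw [dot, dot]
    split_ifs
    · exact KLR.rel (Rel.y_comm _ _)
    all_goals simp
  t_e l w h := g.cross_mul_e l h w
  t_comm l m h hm := by
    refine e_ext fun w => ?_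
    have hl : l + 1 < ν.degree := by omega
    rw [g.cross_cross_e hl hm, g.cross_cross_e hm hl, letter_swap_ne hm w (by omega) (by omega),
      letter_swap_ne hm w (by omega) (by omega), letter_swap_ne hl w (by omega) (by omega),
      letter_swap_ne hl w (by omega) (by omega), mul_comm (g.factor _ _),
      KLR.rel (Rel.tau_comm l m hl hm h)]
  t_sq l w h := by
    rw [g.cross_cross_e h h, letter_swap_left h, letter_swap_right h,
      KLR.rel (Rel.tau_sq l h w)]
    have e1 := letter_of_lt (j := j) w (by omega : l < ν.degree)
    have e2 := letter_of_lt (j := j) w h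
    rw [← e1, ← e2]
    split_ifs with c
    · rw [c, D.Q_self, evalTwo]
      simp
    · have m1 := letter_mem hν w l
      have m2 := letter_mem hν w (l + 1)
      rw [evalTwo_Q m1 m2 c, smul_mul_assoc, one_mul, smul_smul, ← g.mul _ m1 _ m2 c, factor,
        factor, if_neg c, if_neg (Ne.symm c)]
      have n1 := g.γ_ne m1 m2 c
      have n2 := g.γ_ne m2 m1 (Ne.symm c)
      rw [show (g.γ (letter j w (l + 1)) (letter j w l))⁻¹ *
        (g.γ (letter j w l) (letter j w (l + 1)))⁻¹ * (g.γ (letter j w l) (letter j w (l + 1)) *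
        g.γ (letter j w (l + 1)) (letter j w l)) = 1 by field_simp, one_smul]
  braid l h := by
    refine e_ext fun w => ?_
    have h' : l + 1 < ν.degree := by omega
    have key : ∀ a b c (ha : a + 1 < ν.degree) (hb : b + 1 < ν.degree) (hc : c + 1 < ν.degree),
        g.cross a * g.cross b * g.cross c * KLR.e D w =
        (g.factor (letter j (swap b (swap c w)) a) (letter j (swap b (swap c w)) (a + 1)) *
        g.factor (letter j (swap c w) b) (letter j (swap c w) (b + 1)) *
        g.factor (letter j w c) (letter j w (c + 1))) •
        (KLR.tau D a ha * KLR.tau D b hb * KLR.tau D c hc * KLR.e D w) := by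
      intro a b c ha hb hc
      rw [mul_assoc, g.cross_e c hc, mul_smul_comm, KLR.tau_e, ← mul_assoc, ← swap_of_lt hc,
        g.cross_cross_e ha hb, smul_mul_assoc, smul_smul, mul_comm, swap_of_lt hc,
        mul_assoc (_ * _) (KLR.e D _), ← KLR.tau_e]
      simp only [mul_assoc]
    rw [key _ _ _ h h' h, key _ _ _ h' h h']
    have e1 : letter j (swap (l + 1) w) l = letter j w l := letter_swap_ne h w (by omega) (by omega)
    have e2 : letter j (swap (l + 1) w) (l + 1) = letter j w (l + 2) := letter_swap_left h w
    have e3 : letter j (swap (l + 1) w) (l + 2) = letter j w (l + 1) := letter_swap_right h w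
    have e4 : letter j (swap l w) l = letter j w (l + 1) := letter_swap_left h' w
    have e5 : letter j (swap l w) (l + 1) = letter j w l := letter_swap_right h' w
    have e6 : letter j (swap l w) (l + 2) = letter j w (l + 2) :=
      letter_swap_ne h' w (by omega) (by omega)
    have e7 : ∀ v, letter j (swap l v) (l + 1) = letter j v l := letter_swap_right h'
    have e8 : ∀ v, letter j (swap l v) (l + 2) = letter j v (l + 2) :=
      fun v => letter_swap_ne h' v (by omega) (by omega)
    have e9 : ∀ v, letter j (swap (l + 1) v) l = letter j v l :=
      fun v => letter_swap_ne h v (by omega) (by omega)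
    have e10 : ∀ v, letter j (swap (l + 1) v) (l + 1) = letter j v (l + 2) := letter_swap_left h
    rw [show l + 1 + 1 = l + 2 from rfl, e7, e8, e1, e3, e2, e9, e10, e4, e6, e5]
    congr 1
    · ring
    · have := KLR.rel (Rel.braid (D := D) (e := KLR.e D) (y := KLR.y D) (τ := KLR.tau D) l h w)
      rw [dividedDiff_Q (hν _ (w.mem_support _)) (hν _ (w.mem_support _)), zero_mul, ite_self,
        sub_mul, sub_eq_zero] at this
      exact this
  t_y l m h h1 h2 := by
    refine e_ext fun w => ?_
    by_cases hm : m < ν.degree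
    · rw [dot, dif_pos hm]
      have h3 := g.cross_dot l h w ⟨m, hm⟩
      rw [Equiv.swap_apply_of_ne_of_ne (by simpa [Fin.ext_iff]) (by simpa [Fin.ext_iff]),
        KLR.tau_y_comm l h ⟨m, hm⟩ h1 h2, sub_self, zero_mul, smul_zero, sub_mul,
        sub_eq_zero] at h3
      exact h3
    · rw [dot, dif_neg hm]
      simp
  t_y_left l w h := by
    have h3 := g.cross_dot l h w ⟨l, by omega⟩
    have h4 := KLR.rel (Rel.tau_y (D := D) (e := KLR.e D) (y := KLR.y D) (τ := KLR.tau D) l h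
      ⟨l, by omega⟩ w)
    rw [h4, Equiv.swap_apply_left, if_pos rfl] at h3
    rw [dot, dif_pos h, dot, dif_pos (by omega), ← neg_sub, neg_mul, h3,
      letter_of_lt w (by omega : l < ν.degree), letter_of_lt w h]
    split_ifs with c
    · rw [factor, if_pos c, one_smul, neg_neg]
    · simp
  t_y_right l w h := by
    have h3 := g.cross_dot l h w ⟨l + 1, h⟩
    have h4 := KLR.rel (Rel.tau_y (D := D) (e := KLR.e D) (y := KLR.y D) (τ := KLR.tau D) l h
      ⟨l + 1, h⟩ w)
    rw [if_neg (Fin.ne_of_val_ne (by dsimp; omega)), if_pos rfl] at h4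
    rw [h4, Equiv.swap_apply_right] at h3
    rw [dot, dif_pos h, dot, dif_pos (by omega), h3,
      letter_of_lt w (by omega : l < ν.degree), letter_of_lt w h]
    split_ifs with c
    · rw [factor, if_pos c, one_smul]
    · simp

theorem tau_e_eq (hν : j.Covers ν) (l : ℕ) (h : l + 1 < ν.degree) (w : Word ν) :
    KLR.tau D l h * KLR.e D w = (g.factor (letter j w l) (letter j w (l + 1)))⁻¹ •
      (g.cross l * KLR.e D w) := by
  rw [g.cross_e l h, smul_smul, inv_mul_cancel₀
    (g.factor_ne (letter_mem hν _ _) (letter_mem hν _ _)), one_smul]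

open Classical in
theorem degree_cross (hν : j.Covers ν) (l : ℕ) (h : l + 1 < ν.degree) (w : Word ν) :
    -D.form (w.1 ⟨l, by omega⟩) (w.1 ⟨l + 1, h⟩) =
      if letter j w l = letter j w (l + 1) then -j.size else 0 := by
  rw [letter_of_lt w (by omega : l < ν.degree), letter_of_lt w h]
  split_ifs with c
  · rw [c, form_self (hν _ (w.mem_support _))]
  · rw [form_ne (hν _ (w.mem_support _)) (hν _ (w.mem_support _)) c, neg_zero]

open Classical in
theorem isGraded (hν : j.Covers ν) : (g.nilHecke hν).IsGraded (KLR.deg D) j.size where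
  g_pos := j.size_pos
  mul_mem := KLR.mul_mem_deg
  e_mem w := Submodule.subset_span (KLR.Mono.idem w)
  y_mem l := by
    change dot l ∈ _
    rw [dot]
    split_ifs with h
    · rw [KLR.mul_sum_e (KLR.y D ⟨l, h⟩)]
      refine sum_mem fun w _ => Submodule.subset_span ?_
      rw [← form_self (hν _ (w.mem_support ⟨l, h⟩))]
      exact KLR.y_mono _ w
    · exact zero_mem _
  t_mem l w h := by
    change g.cross l * KLR.e D w ∈ KLR.deg D (if letter j w l = letter j w (l + 1) then _ else _)
    rw [g.cross_e l h, ← degree_cross hν l h w]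
    exact Submodule.smul_mem _ _ (Submodule.subset_span (KLR.tau_mono l h w))
  gen V he hy ht d := by
    refine Submodule.span_le.2 fun x hx => ?_
    induction hx with
    | idem w => exact he w
    | @dot l w d x hx ih =>
      have := hy d x l w ih
      rw [form_self (hν _ (w.mem_support l))]
      change Scaling.dot l.1 * KLR.e D w * x ∈ _ at this
      rwa [Scaling.dot, dif_pos l.2] at this
    | @cross l h w d x hx ih =>
      have := ht d x l w h ih
      change g.cross l * KLR.e D w * x ∈ V ((if letter j w l = letter j w (l + 1) then _ else _) + d)
        at this
      rw [← degree_cross hν l h w] at this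
      rw [g.tau_e_eq hν l h w, smul_mul_assoc]
      exact Submodule.smul_mem _ _ this

end Scaling

end Orbit

end

section
variable {k : Type u} [Field k] {n : ℕ}

namespace Orbit.Scaling

variable {I : Type v} {D : FoldedDatum I k} {j : Orbit D} (g : j.Scaling) {ν : I →₀ ℕ}
  (p : Fin ν.degree → k)

/-! ### A representation by divided differences on functions on the orbit of a point -/

/-- The action of `e_w` on functions. -/
def funE (w : Word ν) : Module.End k (Equiv.Perm (Fin ν.degree) × Word ν → k) where
  toFun f x := if w = x.2 then f x else 0
  map_add' f f' := by ext x; by_cases h : w = x.2 <;> simp [h]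
  map_smul' c f := by ext x; by_cases h : w = x.2 <;> simp [h]

/-- The action of `y_l` on functions. -/
def funY (l : Fin ν.degree) : Module.End k (Equiv.Perm (Fin ν.degree) × Word ν → k) where
  toFun f x := p (x.1 l) * f x
  map_add' f f' := by ext x; simp [mul_add]
  map_smul' c f := by ext x; simp [mul_left_comm]

open Classical in
/-- The action of `τ_l` on functions. -/
def funT (l : ℕ) (h : l + 1 < ν.degree) :
    Module.End k (Equiv.Perm (Fin ν.degree) × Word ν → k) where
  toFun f x := if x.2.1 ⟨l, Nat.lt_of_succ_lt h⟩ = x.2.1 ⟨l + 1, h⟩ then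
      (f (x.1 * Equiv.swap ⟨l, Nat.lt_of_succ_lt h⟩ ⟨l + 1, h⟩, x.2) - f x) /
        (p (x.1 ⟨l, Nat.lt_of_succ_lt h⟩) - p (x.1 ⟨l + 1, h⟩))
    else g.γ (x.2.1 ⟨l + 1, h⟩) (x.2.1 ⟨l, Nat.lt_of_succ_lt h⟩) *
      f (x.1 * Equiv.swap ⟨l, Nat.lt_of_succ_lt h⟩ ⟨l + 1, h⟩, x.2.swap l h)
  map_add' f f' := by
    ext x
    simp only [Pi.add_apply]
    split_ifs <;> ring
  map_smul' c f := by
    ext x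
    simp only [Pi.smul_apply, smul_eq_mul, RingHom.id_apply]
    split_ifs <;> ring

variable {p}

theorem funE_apply (w : Word ν) (f : Equiv.Perm (Fin ν.degree) × Word ν → k) (π) (w') :
    funE w f (π, w') = if w = w' then f (π, w') else 0 := rfl

theorem funY_apply (l : Fin ν.degree) (f : Equiv.Perm (Fin ν.degree) × Word ν → k) (π) (w') :
    funY p l f (π, w') = p (π l) * f (π, w') := rfl

theorem funT_eq {l : ℕ} (h : l + 1 < ν.degree) (f : Equiv.Perm (Fin ν.degree) × Word ν → k) (π) {w'}
    (hw : w'.1 ⟨l, Nat.lt_of_succ_lt h⟩ = w'.1 ⟨l + 1, h⟩) :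
    g.funT p l h f (π, w') = (f (π * Equiv.swap ⟨l, Nat.lt_of_succ_lt h⟩ ⟨l + 1, h⟩, w') -
      f (π, w')) / (p (π ⟨l, Nat.lt_of_succ_lt h⟩) - p (π ⟨l + 1, h⟩)) := if_pos hw

theorem funT_ne {l : ℕ} (h : l + 1 < ν.degree) (f : Equiv.Perm (Fin ν.degree) × Word ν → k) (π) {w'}
    (hw : w'.1 ⟨l, Nat.lt_of_succ_lt h⟩ ≠ w'.1 ⟨l + 1, h⟩) :
    g.funT p l h f (π, w') = g.γ (w'.1 ⟨l + 1, h⟩) (w'.1 ⟨l, Nat.lt_of_succ_lt h⟩) *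
      f (π * Equiv.swap ⟨l, Nat.lt_of_succ_lt h⟩ ⟨l + 1, h⟩, w'.swap l h) := if_neg hw

theorem _root_.FoldedKLR.Word.swap_comm (w : Word ν) {l m : ℕ} (hl : l + 1 < ν.degree)
    (hm : m + 1 < ν.degree) (h : l + 1 < m) :
    (w.swap m hm).swap l hl = (w.swap l hl).swap m hm := by
  apply Word.ext
  funext x
  refine congrArg w.1 (Equiv.congr_fun (Equiv.Perm.Disjoint.commute
    (Equiv.Perm.disjoint_swap_swap ?_)).eq.symm x)
  simp only [List.nodup_cons, List.mem_cons, List.not_mem_nil, Fin.mk.injEq, List.nodup_nil,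
    or_false, not_false_eq_true, and_true]
  omega

theorem _root_.FoldedKLR.Word.swap_braid (w : Word ν) {l : ℕ} (h : l + 2 < ν.degree) :
    ((w.swap (l + 1) h).swap l (by omega)).swap (l + 1) h =
      ((w.swap l (by omega)).swap (l + 1) h).swap l (by omega) := by
  apply Word.ext
  funext x
  have n1 : (⟨l, by omega⟩ : Fin ν.degree) ≠ ⟨l + 1, by omega⟩ :=
    Fin.ne_of_val_ne (by dsimp; omega)
  have n2 : (⟨l, by omega⟩ : Fin ν.degree) ≠ ⟨l + 1 + 1, h⟩ := Fin.ne_of_val_ne (by dsimp; omega)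
  have n3 : (⟨l + 1, by omega⟩ : Fin ν.degree) ≠ ⟨l + 1 + 1, h⟩ :=
    Fin.ne_of_val_ne (by dsimp; omega)
  exact congrArg w.1 (Equiv.congr_fun (Scaling.swap_braid n1 n2 n3) x)

theorem fun_tau_comm {l m : ℕ} (hl : l + 1 < ν.degree) (hm : m + 1 < ν.degree) (h : l + 1 < m) :
    g.funT p l hl * g.funT p m hm = g.funT p m hm * g.funT p l hl := by
  refine LinearMap.ext fun f => funext fun ⟨π, w⟩ => ?_
  have e1 := Word.swap_comm w hl hm h
  have n1 : (⟨l, by omega⟩ : Fin ν.degree) ≠ ⟨m, by omega⟩ := Fin.ne_of_val_ne (by dsimp; omega)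
  have n2 : (⟨l, by omega⟩ : Fin ν.degree) ≠ ⟨m + 1, hm⟩ := Fin.ne_of_val_ne (by dsimp; omega)
  have n3 : (⟨l + 1, hl⟩ : Fin ν.degree) ≠ ⟨m, by omega⟩ := Fin.ne_of_val_ne (by dsimp; omega)
  have n4 : (⟨l + 1, hl⟩ : Fin ν.degree) ≠ ⟨m + 1, hm⟩ := Fin.ne_of_val_ne (by dsimp; omega)
  have e2 : ∀ π : Equiv.Perm (Fin ν.degree), π * Equiv.swap ⟨m, by omega⟩ ⟨m + 1, hm⟩ *
      Equiv.swap ⟨l, by omega⟩ ⟨l + 1, hl⟩ =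
      π * Equiv.swap ⟨l, by omega⟩ ⟨l + 1, hl⟩ * Equiv.swap ⟨m, by omega⟩ ⟨m + 1, hm⟩ := by
    intro π
    rw [mul_assoc, mul_assoc, (Equiv.Perm.Disjoint.commute
      (Equiv.Perm.disjoint_swap_swap (x := (⟨m, by omega⟩ : Fin ν.degree)) (y := ⟨m + 1, hm⟩)
        (z := ⟨l, by omega⟩) (t := ⟨l + 1, hl⟩) ?_)).eq]
    simp only [List.nodup_cons, List.mem_cons, List.not_mem_nil, Fin.mk.injEq, List.nodup_nil,
      or_false, not_false_eq_true, and_true]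
    omega
  have a1 := Word.swap_ne w m hm ⟨l, by omega⟩ (by dsimp; omega) (by dsimp; omega)
  have a2 := Word.swap_ne w m hm ⟨l + 1, hl⟩ (by dsimp; omega) (by dsimp; omega)
  have a3 := Word.swap_ne w l hl ⟨m, by omega⟩ (by dsimp; omega) (by dsimp; omega)
  have a4 := Word.swap_ne w l hl ⟨m + 1, hm⟩ (by dsimp; omega) (by dsimp; omega)
  have b1 := Equiv.swap_apply_of_ne_of_ne n1 n2
  have b2 := Equiv.swap_apply_of_ne_of_ne n3 n4
  have b3 := Equiv.swap_apply_of_ne_of_ne n1.symm n3.symm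
  have b4 := Equiv.swap_apply_of_ne_of_ne n2.symm n4.symm
  rw [Module.End.mul_apply, Module.End.mul_apply]
  by_cases c1 : w.1 ⟨l, by omega⟩ = w.1 ⟨l + 1, hl⟩
  · by_cases c2 : w.1 ⟨m, by omega⟩ = w.1 ⟨m + 1, hm⟩
    · rw [g.funT_eq hl _ _ c1, g.funT_eq hm _ _ c2, g.funT_eq hm _ _ c2, g.funT_eq hm _ _ c2,
        g.funT_eq hl _ _ c1, g.funT_eq hl _ _ c1, e2]
      simp only [Equiv.Perm.mul_apply, b1, b2, b3, b4]
      ring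
    · have c1' : (w.swap m hm).1 ⟨l, by omega⟩ = (w.swap m hm).1 ⟨l + 1, hl⟩ := by
        rw [a1, a2, c1]
      rw [g.funT_eq hl _ _ c1, g.funT_ne hm _ _ c2, g.funT_ne hm _ _ c2, g.funT_ne hm _ _ c2,
        g.funT_eq hl _ _ c1', e2]
      simp only [Equiv.Perm.mul_apply, b1, b2]
      ring
  · by_cases c2 : w.1 ⟨m, by omega⟩ = w.1 ⟨m + 1, hm⟩
    · have c2' : (w.swap l hl).1 ⟨m, by omega⟩ = (w.swap l hl).1 ⟨m + 1, hm⟩ := by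
        rw [a3, a4, c2]
      rw [g.funT_ne hl _ _ c1, g.funT_eq hm _ _ c2', g.funT_eq hm _ _ c2, g.funT_ne hl _ _ c1,
        g.funT_ne hl _ _ c1, e2]
      simp only [Equiv.Perm.mul_apply, b3, b4]
      ring
    · have c1' : (w.swap m hm).1 ⟨l, by omega⟩ ≠ (w.swap m hm).1 ⟨l + 1, hl⟩ := by
        rwa [a1, a2]
      have c2' : (w.swap l hl).1 ⟨m, by omega⟩ ≠ (w.swap l hl).1 ⟨m + 1, hm⟩ := by
        rwa [a3, a4]
      rw [g.funT_ne hl _ _ c1, g.funT_ne hm _ _ c2', g.funT_ne hm _ _ c2, g.funT_ne hl _ _ c1', e2,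
        e1, a1, a2, a3, a4]
      ring

open Classical in
theorem fun_tau_y {l : ℕ} (hp : Function.Injective p) (h : l + 1 < ν.degree) (m : Fin ν.degree)
    (f : Equiv.Perm (Fin ν.degree) × Word ν → k) (π) (w : Word ν) :
    (g.funT p l h * funY p m - funY p (Equiv.swap ⟨l, by omega⟩ ⟨l + 1, h⟩ m) * g.funT p l h) f
      (π, w) = if w.1 ⟨l, by omega⟩ = w.1 ⟨l + 1, h⟩ then
        if m = ⟨l, by omega⟩ then -f (π, w) else if m = ⟨l + 1, h⟩ then f (π, w) else 0 else 0 := by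
  have n1 : (⟨l, by omega⟩ : Fin ν.degree) ≠ ⟨l + 1, h⟩ := Fin.ne_of_val_ne (by dsimp; omega)
  have n2 : p (π ⟨l, by omega⟩) - p (π ⟨l + 1, h⟩) ≠ 0 :=
    sub_ne_zero.2 fun h => n1 (π.injective (hp h))
  rw [LinearMap.sub_apply, Pi.sub_apply, Module.End.mul_apply, Module.End.mul_apply, funY_apply]
  by_cases c : w.1 ⟨l, by omega⟩ = w.1 ⟨l + 1, h⟩
  · rw [if_pos c, g.funT_eq h _ _ c, g.funT_eq h _ _ c, funY_apply, funY_apply,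
      Equiv.Perm.mul_apply]
    split_ifs with c1 c2
    · subst c1
      rw [Equiv.swap_apply_left]
      field_simp
      ring
    · subst c2
      rw [Equiv.swap_apply_right]
      field_simp
      ring
    · rw [Equiv.swap_apply_of_ne_of_ne c1 c2]
      ring
  · rw [if_neg c, g.funT_ne h _ _ c, g.funT_ne h _ _ c, funY_apply, Equiv.Perm.mul_apply]
    ring

theorem fun_tau_sq {l : ℕ} (hν : j.Covers ν) (h : l + 1 < ν.degree)
    (f : Equiv.Perm (Fin ν.degree) × Word ν → k) (π) (w : Word ν) :
    (g.funT p l h * g.funT p l h) f (π, w) =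
      (D.Q (w.1 ⟨l, by omega⟩) (w.1 ⟨l + 1, h⟩)).coeff 0 * f (π, w) := by
  rw [Module.End.mul_apply]
  by_cases c : w.1 ⟨l, by omega⟩ = w.1 ⟨l + 1, h⟩
  · rw [g.funT_eq h _ _ c, g.funT_eq h _ _ c, g.funT_eq h _ _ c, Equiv.Perm.mul_apply,
      Equiv.Perm.mul_apply, Equiv.swap_apply_left, Equiv.swap_apply_right,
      Equiv.mul_swap_mul_self, c, D.Q_self, MvPolynomial.coeff_zero, zero_mul,
      ← neg_sub (p (π ⟨l, _⟩)), div_neg]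
    ring
  · have c' : (w.swap l h).1 ⟨l, by omega⟩ ≠ (w.swap l h).1 ⟨l + 1, h⟩ := by
      rw [Word.swap_left, Word.swap_right]
      exact Ne.symm c
    rw [g.funT_ne h _ _ c, g.funT_ne h _ _ c', Word.swap_left, Word.swap_right, Word.swap_swap,
      Equiv.mul_swap_mul_self, ← g.mul _ (hν _ (w.mem_support _)) _ (hν _ (w.mem_support _)) c]
    ring

theorem fun_braid {l : ℕ} (hp : Function.Injective p) (h : l + 2 < ν.degree) :
    g.funT p (l + 1) h * g.funT p l (by omega) * g.funT p (l + 1) h =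
      g.funT p l (by omega) * g.funT p (l + 1) h * g.funT p l (by omega) := by
  refine LinearMap.ext fun f => funext fun ⟨π, w⟩ => ?_
  have h' : l + 1 < ν.degree := by omega
  obtain ⟨a, ha⟩ : ∃ a : Fin ν.degree, a = ⟨l, by omega⟩ := ⟨_, rfl⟩
  obtain ⟨b, hb⟩ : ∃ b : Fin ν.degree, b = ⟨l + 1, by omega⟩ := ⟨_, rfl⟩
  obtain ⟨c, hc⟩ : ∃ c : Fin ν.degree, c = ⟨l + 1 + 1, h⟩ := ⟨_, rfl⟩
  have n1 : a ≠ b := by subst ha hb; exact Fin.ne_of_val_ne (by dsimp; omega)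
  have n2 : a ≠ c := by subst ha hc; exact Fin.ne_of_val_ne (by dsimp; omega)
  have n3 : b ≠ c := by subst hb hc; exact Fin.ne_of_val_ne (by dsimp; omega)
  have d1 : p (π a) - p (π b) ≠ 0 := sub_ne_zero.2 fun h => n1 (π.injective (hp h))
  have d2 : p (π a) - p (π c) ≠ 0 := sub_ne_zero.2 fun h => n2 (π.injective (hp h))
  have d3 : p (π b) - p (π c) ≠ 0 := sub_ne_zero.2 fun h => n3 (π.injective (hp h))
  have d4 : p (π b) - p (π a) ≠ 0 := sub_ne_zero.2 fun h => n1 (π.injective (hp h.symm))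
  have d5 : p (π c) - p (π a) ≠ 0 := sub_ne_zero.2 fun h => n2 (π.injective (hp h.symm))
  have d6 : p (π c) - p (π b) ≠ 0 := sub_ne_zero.2 fun h => n3 (π.injective (hp h.symm))
  have s1 : ∀ v : Word ν, (v.swap l h').1 a = v.1 b := fun v => by
    subst ha hb; exact Word.swap_left v l h' _
  have s2 : ∀ v : Word ν, (v.swap l h').1 b = v.1 a := fun v => by
    subst ha hb; exact Word.swap_right v l h' _
  have s3 : ∀ v : Word ν, (v.swap l h').1 c = v.1 c := fun v => by
    subst hc; exact Word.swap_ne v l h' _ (by dsimp; omega) (by dsimp; omega)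
  have t1 : ∀ v : Word ν, (v.swap (l + 1) h).1 a = v.1 a := fun v => by
    subst ha; exact Word.swap_ne v (l + 1) h _ (by dsimp; omega) (by dsimp; omega)
  have t2 : ∀ v : Word ν, (v.swap (l + 1) h).1 b = v.1 c := fun v => by
    subst hb hc; exact Word.swap_left v (l + 1) h _
  have t3 : ∀ v : Word ν, (v.swap (l + 1) h).1 c = v.1 b := fun v => by
    subst hb hc; exact Word.swap_right v (l + 1) h _
  have Se : ∀ f π (v : Word ν), v.1 a = v.1 b → g.funT p l h' f (π, v) =
      (f (π * Equiv.swap a b, v) - f (π, v)) / (p (π a) - p (π b)) := fun f π v hv => by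
    subst ha hb; exact g.funT_eq h' f π hv
  have Sn : ∀ f π (v : Word ν), v.1 a ≠ v.1 b → g.funT p l h' f (π, v) =
      g.γ (v.1 b) (v.1 a) * f (π * Equiv.swap a b, v.swap l h') := fun f π v hv => by
    subst ha hb; exact g.funT_ne h' f π hv
  have Te : ∀ f π (v : Word ν), v.1 b = v.1 c → g.funT p (l + 1) h f (π, v) =
      (f (π * Equiv.swap b c, v) - f (π, v)) / (p (π b) - p (π c)) := fun f π v hv => by
    subst hb hc; exact g.funT_eq h f π hv
  have Tn : ∀ f π (v : Word ν), v.1 b ≠ v.1 c → g.funT p (l + 1) h f (π, v) =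
      g.γ (v.1 c) (v.1 b) * f (π * Equiv.swap b c, v.swap (l + 1) h) := fun f π v hv => by
    subst hb hc; exact g.funT_ne h f π hv
  have u1 : Equiv.swap a b c = c := Equiv.swap_apply_of_ne_of_ne n2.symm n3.symm
  have u2 : Equiv.swap b c a = a := Equiv.swap_apply_of_ne_of_ne n1 n2
  have br : π * Equiv.swap b c * Equiv.swap a b * Equiv.swap b c =
      π * Equiv.swap a b * Equiv.swap b c * Equiv.swap a b := by
    have := congrArg (π * ·) (Scaling.swap_braid n1 n2 n3)
    simpa only [mul_assoc] using this
  have wbr := Word.swap_braid w h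
  rw [Module.End.mul_apply, Module.End.mul_apply, Module.End.mul_apply, Module.End.mul_apply]
  by_cases c1 : w.1 a = w.1 b
  · by_cases c2 : w.1 b = w.1 c
    · simp only [Te _ _ _ c2, Se _ _ _ c1, Equiv.Perm.mul_apply, Equiv.swap_apply_left,
        Equiv.swap_apply_right, u1, u2, Equiv.mul_swap_mul_self, br]
      field_simp
      ring
    · have k1 : (w.swap (l + 1) h).1 a ≠ (w.swap (l + 1) h).1 b := by
        rw [t1, t2, c1]; exact c2
      have k2 : ((w.swap (l + 1) h).swap l h').1 b = ((w.swap (l + 1) h).swap l h').1 c := by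
        rw [s2, s3, t1, t3, c1]
      simp only [Tn _ _ _ c2, Se _ _ _ c1, Sn _ _ _ k1, Te _ _ _ k2, t1, t2,
        Equiv.Perm.mul_apply, Equiv.swap_apply_right, u1, u2, br]
      field_simp
  · by_cases c2 : w.1 b = w.1 c
    · have k1 : (w.swap l h').1 b ≠ (w.swap l h').1 c := by
        rw [s2, s3, ← c2]; exact c1
      have k2 : ((w.swap l h').swap (l + 1) h).1 a = ((w.swap l h').swap (l + 1) h).1 b := by
        rw [t1, t2, s1, s3, c2]
      simp only [Te _ _ _ c2, Sn _ _ _ c1, Tn _ _ _ k1, Se _ _ _ k2, s2, s3,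
        Equiv.Perm.mul_apply, Equiv.swap_apply_left, u1, u2, br]
      field_simp
    · by_cases c3 : w.1 a = w.1 c
      · have k1 : (w.swap (l + 1) h).1 a = (w.swap (l + 1) h).1 b := by
          rw [t1, t2, c3]
        have k2 : (w.swap (l + 1) h).1 b ≠ (w.swap (l + 1) h).1 c := by
          rw [t2, t3]; exact Ne.symm c2
        have k3 : (w.swap l h').1 b = (w.swap l h').1 c := by
          rw [s2, s3, c3]
        have k4 : (w.swap l h').1 a ≠ (w.swap l h').1 b := by
          rw [s1, s2]; exact Ne.symm c1
        simp only [Tn _ _ _ c2, Se _ _ _ k1, Tn _ _ _ k2, Sn _ _ _ c1, Te _ _ _ k3, Sn _ _ _ k4,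
          t2, s1, s2, t3, Equiv.Perm.mul_apply, Equiv.swap_apply_left,
          Equiv.swap_apply_right, u1, u2, br, Word.swap_swap, Equiv.mul_swap_mul_self, c3]
        field_simp
      · have k1 : (w.swap (l + 1) h).1 a ≠ (w.swap (l + 1) h).1 b := by
          rw [t1, t2]; exact c3
        have k2 : ((w.swap (l + 1) h).swap l h').1 b ≠ ((w.swap (l + 1) h).swap l h').1 c := by
          rw [s2, s3, t1, t3]; exact c1
        have k3 : (w.swap l h').1 b ≠ (w.swap l h').1 c := by
          rw [s2, s3]; exact c3
        have k4 : ((w.swap l h').swap (l + 1) h).1 a ≠ ((w.swap l h').swap (l + 1) h).1 b := by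
          rw [t1, t2, s1, s3]; exact c2
        simp only [Tn _ _ _ c2, Sn _ _ _ k1, Tn _ _ _ k2, Sn _ _ _ c1, Tn _ _ _ k3, Sn _ _ _ k4,
          t1, t2, s1, s2, s3, t3, br, wbr]
        ring

theorem fun_rel (hν : j.Covers ν) (hp : Function.Injective p)
    (x x' : Module.End k (Equiv.Perm (Fin ν.degree) × Word ν → k))
    (hr : Rel D funE (funY p) (g.funT p) x x') : x = x' := by
  cases hr with
  | e_mul w w' =>
    refine LinearMap.ext fun f => funext fun ⟨π, v⟩ => ?_
    rw [Module.End.mul_apply, funE_apply, funE_apply]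
    by_cases c : w = w'
    · subst c
      rw [if_pos rfl, funE_apply]
      split_ifs <;> rfl
    · rw [if_neg c, LinearMap.zero_apply]
      split_ifs with h1 h2
      · exact absurd (h1.trans h2.symm) c
      all_goals rfl
  | e_sum =>
    refine LinearMap.ext fun f => funext fun ⟨π, v⟩ => ?_
    rw [LinearMap.sum_apply, Finset.sum_apply, Finset.sum_eq_single v]
    · rw [funE_apply, if_pos rfl, Module.End.one_apply]
    · intro w _ hw
      rw [funE_apply, if_neg hw]
    · simp
  | y_comm l m =>
    refine LinearMap.ext fun f => funext fun ⟨π, v⟩ => ?_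
    simp only [Module.End.mul_apply, funY_apply]
    ring
  | y_e l w =>
    refine LinearMap.ext fun f => funext fun ⟨π, v⟩ => ?_
    simp only [Module.End.mul_apply, funY_apply, funE_apply, mul_ite, mul_zero]
  | tau_e l h w =>
    refine LinearMap.ext fun f => funext fun ⟨π, v⟩ => ?_
    rw [Module.End.mul_apply, Module.End.mul_apply, funE_apply]
    by_cases c : v.1 ⟨l, by omega⟩ = v.1 ⟨l + 1, h⟩
    · have hv : v.swap l h = v := by
        apply Word.ext
        funext m
        change v.1 (Equiv.swap _ _ m) = _
        by_cases c1 : m = ⟨l, by omega⟩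
        · rw [c1, Equiv.swap_apply_left, c]
        · by_cases c2 : m = ⟨l + 1, h⟩
          · rw [c2, Equiv.swap_apply_right, c]
          · rw [Equiv.swap_apply_of_ne_of_ne c1 c2]
      have hw : w.swap l h = v ↔ w = v :=
        ⟨fun h' => by rw [← w.swap_swap l h, h', hv], fun h' => by rw [h', hv]⟩
      simp only [hw]
      rw [g.funT_eq h _ _ c, g.funT_eq h _ _ c, funE_apply, funE_apply]
      split_ifs <;> simp
    · have hw : w.swap l h = v ↔ w = v.swap l h :=
        ⟨fun h' => by rw [← h', w.swap_swap l h], fun h' => by rw [h', v.swap_swap]⟩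
      simp only [hw]
      rw [g.funT_ne h _ _ c, g.funT_ne h _ _ c, funE_apply]
      split_ifs <;> simp
  | tau_comm l m hl hm h => exact g.fun_tau_comm hl hm h
  | tau_sq l h w =>
    refine LinearMap.ext fun f => funext fun ⟨π, v⟩ => ?_
    rw [Module.End.mul_apply, g.fun_tau_sq hν, Module.End.mul_apply, funE_apply]
    by_cases c : w.1 ⟨l, by omega⟩ = w.1 ⟨l + 1, h⟩
    · rw [c, D.Q_self, evalTwo]
      split_ifs with c1
      · rw [← c1, c, D.Q_self]
        simp
      · simp
    · rw [evalTwo_Q (hν _ (w.mem_support _)) (hν _ (w.mem_support _)) c, LinearMap.smul_apply,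
        Module.End.one_apply, Pi.smul_apply, funE_apply, smul_eq_mul]
      split_ifs with c1
      · rw [c1]
      · simp
  | tau_y l h m w =>
    refine LinearMap.ext fun f => funext fun ⟨π, v⟩ => ?_
    rw [Module.End.mul_apply, g.fun_tau_y hp]
    by_cases c : w = v
    · subst c
      split_ifs
      · rw [LinearMap.neg_apply, Pi.neg_apply, funE_apply, if_pos rfl]
      · rfl
      · rfl
      · rfl
    · rw [funE_apply, if_neg c, neg_zero, ite_self, ite_self, ite_self]
      split_ifs
      · rw [LinearMap.neg_apply, Pi.neg_apply, funE_apply, if_neg c, neg_zero]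
      · rw [funE_apply, if_neg c]
      · rfl
      · rfl
  | braid l h w =>
    rw [dividedDiff_Q (hν _ (w.mem_support _)) (hν _ (w.mem_support _)), zero_mul, ite_self,
      g.fun_braid hp h, sub_self, zero_mul]

theorem e_ne_zero [Infinite k] (g : j.Scaling) (hν : j.Covers ν) (w : Word ν) : KLR.e D w ≠ 0 := by
  have p : Fin ν.degree ↪ k := Fin.valEmbedding.trans (Infinite.natEmbedding k)
  intro h
  have h1 := congrArg (KLR.lift (D := D) funE (funY p) (g.funT p) (g.fun_rel hν p.injective)) h
  rw [KLR.lift_e, map_zero] at h1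
  have h2 := congrFun (LinearMap.congr_fun h1 fun _ => 1) (1, w)
  rw [funE_apply, if_pos rfl] at h2
  exact one_ne_zero h2

end Orbit.Scaling

end

section

namespace NilHecke

variable {A : Type*} [Ring A] {W : Type*} [Fintype W] [DecidableEq W] {C : Type*} [DecidableEq C]
  {H : NilHecke A W C}

/-! ### Crossings of distinct letters -/

/-- `Path ls w w'` says that the crossings with the numbers in the list `ls` (the last one first)
lead from `w` to `w'`, and that each of them exchanges distinct letters. -/
inductive Path (H : NilHecke A W C) : List ℕ → W → W → Prop
  | nil (w : W) : Path H [] w w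
  | cons {ls : List ℕ} {w w' : W} {l : ℕ} (h : Path H ls w w') (hl : l + 1 < H.len)
      (hne : H.ltr w' l ≠ H.ltr w' (l + 1)) : Path H (l :: ls) w (H.sw l w')

/-- The product of the crossings in a list. -/
def cross (H : NilHecke A W C) (ls : List ℕ) : A := (ls.map H.t).prod

theorem cross_cons (l : ℕ) (ls : List ℕ) : H.cross (l :: ls) = H.t l * H.cross ls := by
  simp [cross]

theorem cross_append (ls ls' : List ℕ) : H.cross (ls ++ ls') = H.cross ls * H.cross ls' := by
  simp [cross]

/-- The permutation of the places given by the crossings in a list. -/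
def placePerm (ls : List ℕ) : Equiv.Perm ℕ := (ls.map fun l => Equiv.swap l (l + 1)).prod

theorem placePerm_cons (l : ℕ) (ls : List ℕ) (i : ℕ) :
    placePerm (l :: ls) i = Equiv.swap l (l + 1) (placePerm ls i) := by
  simp [placePerm]

theorem placePerm_div {r : ℕ} {ls : List ℕ} (h : ∀ l ∈ ls, l / r = (l + 1) / r) (i : ℕ) :
    placePerm ls i / r = i / r := by
  induction ls with
  | nil => rfl
  | cons l ls ih =>
    rw [placePerm_cons, ← ih fun l' hl' => h l' (List.mem_cons_of_mem _ hl')]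
    have h1 := h l List.mem_cons_self
    by_cases c1 : placePerm ls i = l
    · rw [c1, Equiv.swap_apply_left, h1]
    · by_cases c2 : placePerm ls i = l + 1
      · rw [c2, Equiv.swap_apply_right, h1]
      · rw [Equiv.swap_apply_of_ne_of_ne c1 c2]

theorem t_y_ne {l : ℕ} (hl : l + 1 < H.len) {w : W} (h : H.ltr w l ≠ H.ltr w (l + 1)) (i : ℕ) :
    H.t l * H.y i * H.e w = H.y (Equiv.swap l (l + 1) i) * H.t l * H.e w := by
  by_cases c1 : i = l
  · have := H.t_y_left l w hl
    rw [if_neg h, sub_mul, sub_eq_zero] at this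
    rw [c1, Equiv.swap_apply_left, this]
  · by_cases c2 : i = l + 1
    · have := H.t_y_right l w hl
      rw [if_neg h, sub_mul, sub_eq_zero] at this
      rw [c2, Equiv.swap_apply_right, this]
    · rw [Equiv.swap_apply_of_ne_of_ne c1 c2, H.t_y l i hl c1 c2]

namespace Path

variable {ls ls' : List ℕ} {w w' w'' : W}

theorem cross_e (h : Path H ls w w') : H.cross ls * H.e w = H.e w' * H.cross ls := by
  induction h with
  | nil w => simp [cross]
  | cons h hl hne ih => rw [cross_cons, mul_assoc, ih, ← mul_assoc, H.t_e _ _ hl, mul_assoc]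

theorem trans (h : Path H ls w w') (h' : Path H ls' w' w'') : Path H (ls' ++ ls) w w'' := by
  induction h' with
  | nil w => exact h
  | cons h' hl hne ih => exact cons (ih h) hl hne

theorem reverse (h : Path H ls w w') : Path H ls.reverse w' w := by
  induction h with
  | nil w => exact nil w
  | @cons ls w w' l h hl hne ih =>
    rw [List.reverse_cons]
    refine trans ?_ ih
    have h1 := cons (nil (H := H) (H.sw l w')) hl
      (by rw [H.sw_left _ _ hl, H.sw_right _ _ hl]; exact Ne.symm hne)
    rwa [H.sw_sw _ _ hl] at h1

theorem cross_reverse_mul (h : Path H ls w w') :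
    H.cross ls.reverse * H.cross ls * H.e w = H.e w := by
  induction h with
  | nil w => simp [cross]
  | @cons ls w w' l h hl hne ih =>
    have h1 := H.t_sq l w' hl
    rw [if_neg hne] at h1
    rw [List.reverse_cons, cross_append, cross_cons, cross_cons]
    have : H.cross ls.reverse * (H.t l * H.cross []) * (H.t l * H.cross ls) * H.e w =
        H.cross ls.reverse * (H.t l * H.t l * (H.cross ls * H.e w)) := by
      simp [cross, mul_assoc]
    rw [this, h.cross_e, ← mul_assoc (H.t l * H.t l), h1, ← h.cross_e, ← mul_assoc, ih]

theorem cross_y (h : Path H ls w w') (i : ℕ) :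
    H.cross ls * H.y i * H.e w = H.y (placePerm ls i) * H.cross ls * H.e w := by
  induction h with
  | nil w => simp [cross, placePerm]
  | @cons ls w w' l h hl hne ih =>
    rw [cross_cons, placePerm_cons, mul_assoc, mul_assoc, ← mul_assoc (H.cross ls), ih, mul_assoc,
      h.cross_e, ← mul_assoc, ← mul_assoc, t_y_ne hl hne, mul_assoc, ← h.cross_e]
    simp only [mul_assoc]

theorem ltr_placePerm (h : Path H ls w w') (i : ℕ) : H.ltr w' (placePerm ls i) = H.ltr w i := by
  induction h with
  | nil w => rfl
  | @cons ls w w' l h hl hne ih =>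
    rw [placePerm_cons, ← ih]
    by_cases c1 : placePerm ls i = l
    · rw [c1, Equiv.swap_apply_left, H.sw_right _ _ hl]
    · by_cases c2 : placePerm ls i = l + 1
      · rw [c2, Equiv.swap_apply_right, H.sw_left _ _ hl]
      · rw [Equiv.swap_apply_of_ne_of_ne c1 c2, H.sw_ne _ _ _ hl c1 c2]

theorem placePerm_lt (h : Path H ls w w') {i : ℕ} (hi : i < H.len) :
    placePerm ls i < H.len := by
  induction h with
  | nil w => exact hi
  | @cons ls w w' l h hl hne ih =>
    rw [placePerm_cons]
    by_cases c1 : placePerm ls i = l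
    · rw [c1, Equiv.swap_apply_left]; exact hl
    · by_cases c2 : placePerm ls i = l + 1
      · rw [c2, Equiv.swap_apply_right]; omega
      · rwa [Equiv.swap_apply_of_ne_of_ne c1 c2]

theorem cross_mem {k : Type*} [Field k] [Algebra k A] {deg : ℤ → Submodule k A} {g : ℤ}
    (hH : H.IsGraded deg g) (h : Path H ls w w') : H.cross ls * H.e w ∈ deg 0 := by
  induction h with
  | nil w => simpa [cross] using hH.e_mem w
  | @cons ls w w' l h hl hne ih =>
    have h1 := hH.t_mem l w' hl
    rw [if_neg hne] at h1
    have h2 := hH.mul_mem h1 ih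
    rw [mul_assoc, ← mul_assoc (H.e w'), ← h.cross_e, mul_assoc _ (H.e w), e_self, ← mul_assoc,
      ← cross_cons] at h2
    exact h2

end Path

theorem exists_path_rot {p m : ℕ} (hm : m ≤ p) (hp : p < H.len) (b : W)
    (h : ∀ m' < m, H.ltr b (p - m') ≠ H.ltr b (p - m)) : ∃ ls, Path H ls b (H.rot p m b) := by
  induction m generalizing b with
  | zero => exact ⟨[], Path.nil b⟩
  | succ m ih =>
    have hs : p - (m + 1) + 1 = p - m := by omega
    have h1 := H.sw_right b (p - (m + 1)) (by omega)
    rw [hs] at h1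
    obtain ⟨ls, hls⟩ := ih (by omega) (H.sw (p - (m + 1)) b) fun m' hm' => by
      rw [h1, H.sw_ne _ _ _ (by omega) (by omega) (by omega)]
      exact h m' (by omega)
    refine ⟨_, (Path.cons (Path.nil b) (by omega) ?_).trans hls⟩
    rw [hs]
    exact Ne.symm (h m (by omega))

/-- Words with the same letters are connected by exchanges of distinct letters. -/
theorem exists_path (hext : ∀ w w', (∀ l < H.len, H.ltr w l = H.ltr w' l) → w = w') {p : ℕ}
    (hp : p ≤ H.len) (b b' : W) (h : ∀ i < H.len, p ≤ i → H.ltr b i = H.ltr b' i)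
    (hc : ∀ c, H.count b c p = H.count b' c p) : ∃ ls, Path H ls b b' := by
  induction p generalizing b with
  | zero =>
    obtain rfl := hext b b' fun l hl => h l hl (Nat.zero_le _)
    exact ⟨[], Path.nil b⟩
  | succ p ih =>
    have ex : ∃ m, m ≤ p ∧ H.ltr b (p - m) = H.ltr b' p := by
      by_contra hcon
      push Not at hcon
      have h1 := hc (H.ltr b' p)
      have h2 : H.count b (H.ltr b' p) (p + 1) = 0 :=
        Finset.sum_eq_zero fun i hi => by
          rw [Finset.mem_range] at hi
          have := hcon (p - i) (by omega)
          rw [show p - (p - i) = i by omega] at this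
          exact if_neg this
      rw [h2, count_succ, if_pos rfl] at h1
      omega
    classical
    obtain ⟨hm, hb⟩ := Nat.find_spec ex
    have hmin := fun m' (hm' : m' < Nat.find ex) => Nat.find_min ex hm'
    generalize Nat.find ex = m at hm hb hmin
    obtain ⟨ls, hls⟩ := H.exists_path_rot hm (by omega) b fun m' hm' h' =>
      hmin m' hm' ⟨by omega, by rw [h', hb]⟩
    have h3 : H.ltr (H.rot p m b) p = H.ltr b' p := by
      rw [ltr_rot hm (by omega), if_neg (by omega), if_neg (by omega), if_pos rfl, hb]
    obtain ⟨ls', hls'⟩ := ih (by omega) (H.rot p m b) (fun i hi hpi => by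
      rcases Nat.eq_or_lt_of_le hpi with rfl | hpi
      · exact h3
      · rw [ltr_rot hm (by omega), if_neg (by omega), if_neg (by omega), if_neg (by omega)]
        exact h i hi hpi) fun c => by
      have h4 := hc c
      rw [count_succ b', ← count_rot hm (by omega), count_succ, h3] at h4
      omega
    exact ⟨_, hls.trans hls'⟩

/-! ### Modules generated by a vector which is killed by the `y l` -/

variable {k : Type*} [Field k] [Algebra k A] {deg : ℤ → Submodule k A} {g : ℤ}
  {M : Type*} [AddCommGroup M] [Module k M] [Module A M] [IsScalarTower k A M] {x : M} {b : W}

theorem leftIdeal_smul (hy : ∀ l, H.y l • x = 0) {d : ℤ} {a : A}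
    (ha : a ∈ IsGraded.leftIdeal H deg g d) : a • x = 0 := by
  refine map_mem_of_mem_span ((LinearMap.toSpanSingleton A M x).restrictScalars k) (p := ⊥) ?_ ha
  rintro _ ⟨a, -, l, rfl⟩
  change (a * H.y l) • x = 0
  rw [mul_smul, hy, smul_zero]

theorem poly_smul (hy : ∀ l, H.y l • x = 0) {d : ℤ} (hd : 0 < d) {f : A} (hf : f ∈ IsGraded.poly H k g d) : f • x = 0 := by
  refine map_mem_of_mem_span ((LinearMap.toSpanSingleton A M x).restrictScalars k) (p := ⊥) ?_ hf
  rintro _ ⟨s, w, rfl, rfl⟩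
  change ((s.map H.y).prod * H.e w) • x = 0
  rcases List.eq_nil_or_concat s with rfl | ⟨s, l, rfl⟩
  · simp at hd
  · rw [List.concat_eq_append, List.map_append, List.prod_append, List.map_singleton,
      List.prod_singleton, mul_assoc, H.y_e, mul_smul, mul_smul, hy, smul_zero, smul_zero]

theorem idem_smul (hH : H.IsGraded deg g) (hy : ∀ l, H.y l • x = 0) (hx : H.e b • x = x) :
    IsGraded.idem H b • x = x := by
  have := leftIdeal_smul hy (hH.e_sub_mem b le_rfl)
  rw [sub_smul, hx, sub_eq_zero] at this
  exact this.symm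

theorem exists_idem_smul (hH : H.IsGraded deg g) (hy : ∀ l, H.y l • x = 0) (hx : H.e b • x = x)
    {d : ℤ} {a : A} (ha : a ∈ deg d) : ∃ c : k, (IsGraded.idem H b * a) • x = c • x := by
  rcases lt_trichotomy d 0 with hd | rfl | hd
  · exact ⟨0, by rw [hH.idem_mul_eq_zero b hd ha, zero_smul, zero_smul]⟩
  · obtain ⟨c, hc⟩ := hH.exists_idem_mul_e b ha
    refine ⟨c, ?_⟩
    rw [← hx, ← mul_smul, hc, smul_assoc, idem_smul hH hy hx, hx]
  · refine ⟨0, ?_⟩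
    have h1 := hH.mul_mem (hH.e_mem b) ha
    rw [zero_add] at h1
    obtain ⟨f, hf, h⟩ := hH.exists_X_mul h1
    rw [IsGraded.idem, IsGraded.bottom, mul_assoc, mul_assoc, mul_assoc, h, mul_smul, mul_smul,
      mul_smul, poly_smul hy hd hf, smul_zero, smul_zero, smul_zero, zero_smul]

/-- The vectors which interpolate between `x` and the vector of lowest degree. -/
def low (H : NilHecke A W C) (b : W) (x : M) (p : ℕ) : M := (H.e b * H.X p) • x

theorem low_zero (hx : H.e b • x = x) : H.low b x 0 = x := by
  rw [low, X, mul_one, hx]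

theorem e_low (p : ℕ) : H.e b • H.low b x p = H.low b x p := by
  rw [low, ← mul_smul, ← mul_assoc, e_self]

theorem y_low (hy : ∀ l, H.y l • x = 0) {p i : ℕ} (hp : p ≤ H.len) (hi : p ≤ i) :
    H.y i • H.low b x p = 0 := by
  rw [low, ← mul_smul, ← mul_assoc, H.y_e, mul_assoc, ← X_y hp hi, ← mul_assoc, mul_smul, hy,
    smul_zero]

theorem y_pow_low (hH : H.IsGraded deg g) (hy : ∀ l, H.y l • x = 0) (hx : H.e b • x = x) {p : ℕ}
    (hp : p < H.len) : H.y p ^ H.δ b p • H.low b x (p + 1) = H.low b x p := by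
  obtain ⟨-, h1, -⟩ := hH.U_mem (m := p) hp le_rfl b
  have h2 := leftIdeal_smul hy h1
  have h3 : ∀ p, (H.e b * H.X p * H.e b) • x = H.low b x p := fun p => by
    rw [mul_smul, hx]; rfl
  rw [Nat.sub_self, U_zero, U_self hp, sub_smul, mul_smul (H.y p ^ _), h3, h3, sub_eq_zero] at h2
  exact h2.symm

theorem y_pow_low_eq_zero (hH : H.IsGraded deg g) (hy : ∀ l, H.y l • x = 0) (hx : H.e b • x = x)
    {p s : ℕ} (hp : p < H.len) (hs : H.δ b p < s) : H.y p ^ s • H.low b x (p + 1) = 0 := by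
  obtain ⟨s, rfl⟩ := Nat.exists_eq_add_of_lt hs
  rw [show H.δ b p + s + 1 = s + (1 + H.δ b p) by ring, pow_add, pow_add, mul_smul, mul_smul,
    y_pow_low hH hy hx hp, pow_one, y_low hy hp.le le_rfl, smul_zero]

theorem ymon_low (hH : H.IsGraded deg g) (hy : ∀ l, H.y l • x = 0) (hx : H.e b • x = x) {p : ℕ}
    (hp : p ≤ H.len) : H.ymon (H.δ b) p • H.low b x p = x := by
  induction p with
  | zero => rw [ymon, one_smul, low_zero hx]
  | succ p ih => rw [ymon, mul_smul, y_pow_low hH hy hx hp, ih (by omega)]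

theorem ymon_y_pow (α : ℕ → ℕ) (p i s : ℕ) :
    H.ymon α p * H.y i ^ s = H.y i ^ s * H.ymon α p := by
  have h1 : ∀ l, Commute (H.y l) (H.y i) := fun l => H.y_comm l i
  induction p with
  | zero => simp [ymon]
  | succ p ih =>
    rw [ymon, mul_assoc, ((h1 p).pow_pow _ _).eq, ← mul_assoc, ih, mul_assoc]

theorem ymon_low_independent (hH : H.IsGraded deg g) (hy : ∀ l, H.y l • x = 0)
    (hx : H.e b • x = x) (hx0 : x ≠ 0) {Ω : Type*} (α : Ω → ℕ → ℕ)
    (hα : ∀ ω, ∀ i < H.len, α ω i ≤ H.δ b i) (c : Ω → k) {p : ℕ} (hp : p ≤ H.len) (s : Finset Ω)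
    (hs : ∀ ω ∈ s, ∀ ω' ∈ s, (∀ i < p, α ω i = α ω' i) → ω = ω')
    (h0 : ∑ ω ∈ s, c ω • (H.ymon (α ω) p • H.low b x p) = 0) : ∀ ω ∈ s, c ω = 0 := by
  classical
  induction p generalizing s with
  | zero =>
    intro ω hω
    have h1 : s = {ω} := Finset.eq_singleton_iff_unique_mem.2
      ⟨hω, fun ω' hω' => hs ω' hω' ω hω (by simp)⟩
    rw [h1, Finset.sum_singleton, ymon, one_smul, low_zero hx] at h0
    exact (smul_eq_zero.1 h0).resolve_right hx0
  | succ p ih =>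
    by_contra hcon
    push Not at hcon
    obtain ⟨ω₀, hω₀, hmin⟩ := (s.filter fun ω => c ω ≠ 0).exists_min_image (fun ω => α ω p)
      (by obtain ⟨ω, hω, h⟩ := hcon; exact ⟨ω, Finset.mem_filter.2 ⟨hω, h⟩⟩)
    rw [Finset.mem_filter] at hω₀
    have h1 := congrArg (H.y p ^ (H.δ b p - α ω₀ p) • ·) h0
    simp only [smul_zero] at h1
    rw [Finset.smul_sum] at h1
    refine hω₀.2 (ih (by omega) (s.filter fun ω => α ω p = α ω₀ p) ?_ ?_ ω₀
      (Finset.mem_filter.2 ⟨hω₀.1, rfl⟩))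
    · intro ω hω ω' hω' h
      rw [Finset.mem_filter] at hω hω'
      refine hs ω hω.1 ω' hω'.1 fun i hi => ?_
      rcases Nat.lt_succ_iff_lt_or_eq.1 hi with hi | rfl
      · exact h i hi
      · rw [hω.2, hω'.2]
    · rw [← h1, Finset.sum_filter]
      refine Finset.sum_congr rfl fun ω hω => ?_
      have hle := hα ω₀ p (by omega)
      have h2 : H.y p ^ (H.δ b p - α ω₀ p) • c ω • H.ymon (α ω) (p + 1) • H.low b x (p + 1) =
          c ω • H.ymon (α ω) p • H.y p ^ (H.δ b p - α ω₀ p + α ω p) • H.low b x (p + 1) := by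
        rw [smul_comm (_ : A) (c ω), ymon]
        simp only [← mul_smul]
        rw [← mul_assoc, ← ymon_y_pow, pow_add, mul_assoc]
      rw [h2]
      split_ifs with h3
      · rw [h3, Nat.sub_add_cancel hle, y_pow_low hH hy hx (by omega)]
      · by_cases h4 : c ω = 0
        · rw [h4, zero_smul]
        · have h5 := hmin ω (Finset.mem_filter.2 ⟨hω, h4⟩)
          rw [y_pow_low_eq_zero hH hy hx (by omega) (by omega), smul_zero, smul_zero]

theorem e_smul_mem_span (hH : H.IsGraded deg g) (hx : H.e b • x = x)
    (hM : ∀ m : M, ∃ c : k, IsGraded.idem H b • m = c • x) (m : M) :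
    H.e b • m ∈ Submodule.span k {z | ∃ α : ℕ → ℕ, (∀ i, α i ≤ H.δ b i) ∧
      z = H.ymon α H.len • H.low b x H.len} := by
  suffices h : ∀ a ∈ Submodule.span k {z | ∃ α : ℕ → ℕ, (∀ i, α i ≤ H.δ b i) ∧
      ∃ a, z = H.ymon α H.len * (H.e b * H.X H.len * H.e b * a)}, a • m ∈ _ from
    h _ (hH.e_mem_span b le_rfl)
  intro a key
  refine map_mem_of_mem_span ((LinearMap.toSpanSingleton A M m).restrictScalars k) ?_ key
  rintro _ ⟨α, hα, a, rfl⟩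
  obtain ⟨c, hc⟩ := hM (a • m)
  have h1 : (H.e b * H.X H.len * H.e b * a) • m = c • H.low b x H.len := by
    change (IsGraded.bottom H b * a) • m = _
    rw [← hH.bottom_idem, mul_smul, mul_smul, hc, smul_comm, IsGraded.bottom, mul_smul, hx]
    rfl
  change (_ * (H.e b * H.X H.len * H.e b * a)) • m ∈ _
  rw [mul_smul, h1, smul_comm]
  exact Submodule.smul_mem _ _ (Submodule.subset_span ⟨α, hα, rfl⟩)

end NilHecke

end

section

open LaurentPolynomial (T)

/-! ## Eigenspaces of permutations -/

section Permutation

variable {k : Type*} [Field k] {Ω : Type*} (π : Equiv.Perm Ω)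

/-- The eigenvectors, with eigenvalue `c`, of the action of a permutation on functions. -/
def permEig (c : k) : Submodule k (Ω → k) where
  carrier := {f | ∀ α, f α = c * f (π α)}
  zero_mem' _ := by simp
  add_mem' hf hg α := by
    rw [Pi.add_apply, hf, hg, Pi.add_apply, mul_add]
  smul_mem' a f hf α := by
    rw [Pi.smul_apply, hf, Pi.smul_apply, smul_eq_mul, smul_eq_mul, mul_left_comm]

theorem apply_eq_of_mem_permEig {c : k} {f : Ω → k} (hf : f ∈ permEig π c) (s : ℕ) (α : Ω) :
    f α = c ^ s * f ((π ^ s) α) := by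
  induction s with
  | zero => simp
  | succ s ih => rw [ih, hf, ← mul_assoc, ← pow_succ, pow_succ' π, Equiv.Perm.mul_apply]

/-- The representative of the orbit of `α`. -/
def orbitRep (α : Ω) : Ω := (Quotient.mk (Equiv.Perm.SameCycle.setoid π) α).out

theorem orbitRep_sameCycle (α : Ω) : π.SameCycle (orbitRep π α) α :=
  Quotient.exact (s := Equiv.Perm.SameCycle.setoid π) (Quotient.out_eq _)

theorem orbitRep_eq {α β : Ω} (h : π.SameCycle α β) : orbitRep π α = orbitRep π β :=
  congrArg Quotient.out (Quotient.sound (s := Equiv.Perm.SameCycle.setoid π) h)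

theorem exists_pow_orbitRep [Finite Ω] (α : Ω) : ∃ s : ℕ, (π ^ s) (orbitRep π α) = α := by
  obtain ⟨s, -, h⟩ := (orbitRep_sameCycle π α).exists_pow_eq''
  exact ⟨s, h.2⟩

/-- The powers of `c` are constant along the coincidences in the orbit of `α`. -/
def IsCompatible (c : k) (α : Ω) : Prop :=
  ∀ s t : ℕ, (π ^ s) α = (π ^ t) α → c ^ s = c ^ t

/-- Eigenvectors are determined by arbitrary values at representatives of the compatible orbits. -/
theorem finrank_permEig [Fintype Ω] {c : k} (hc : c ≠ 0) :
    Module.finrank k (permEig π c) =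
      Nat.card {α : Ω // orbitRep π α = α ∧ IsCompatible π c α} := by
  classical
  let R := {α : Ω // orbitRep π α = α ∧ IsCompatible π c α}
  let g : permEig π c →ₗ[k] (R → k) :=
    { toFun := fun f α => f.1 α.1
      map_add' := fun _ _ => rfl
      map_smul' := fun _ _ => rfl }
  choose m hm using exists_pow_orbitRep π
  have hrep : ∀ α, orbitRep π (orbitRep π α) = orbitRep π α :=
    fun α => orbitRep_eq π (orbitRep_sameCycle π α)
  have hb : Function.Bijective g := by
    constructor
    · rw [← LinearMap.ker_eq_bot, LinearMap.ker_eq_bot']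
      rintro ⟨f, hf⟩ h0
      refine Subtype.ext (funext fun α => ?_)
      have h1 := apply_eq_of_mem_permEig π hf (m α) (orbitRep π α)
      rw [hm] at h1
      have h2 : f (orbitRep π α) = 0 := by
        by_cases hcomp : IsCompatible π c (orbitRep π α)
        · exact congrFun h0 (⟨orbitRep π α, hrep α, hcomp⟩ : R)
        · rw [IsCompatible] at hcomp
          push Not at hcomp
          obtain ⟨s, t, hst, hne⟩ := hcomp
          have h3 := apply_eq_of_mem_permEig π hf s (orbitRep π α)
          have h4 := apply_eq_of_mem_permEig π hf t (orbitRep π α)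
          rw [h3, hst] at h4
          have h5 := (mul_eq_mul_right_iff.1 h4).resolve_left hne
          rw [h3, hst, h5, mul_zero]
      rw [h2] at h1
      exact (mul_eq_zero.1 h1.symm).resolve_left (pow_ne_zero _ hc)
    · intro f
      let F : Ω → k := fun α =>
        if h : IsCompatible π c (orbitRep π α) then
          (c ^ m α)⁻¹ * f ⟨orbitRep π α, hrep α, h⟩ else 0
      have hF : F ∈ permEig π c := by
        intro α
        have e1 : orbitRep π (π α) = orbitRep π α :=
          orbitRep_eq π (Equiv.Perm.sameCycle_apply_left.2 (Equiv.Perm.SameCycle.refl π α))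
        change (if h : _ then _ else _) = c * (if h : _ then _ else _)
        by_cases h : IsCompatible π c (orbitRep π α)
        · have h' : IsCompatible π c (orbitRep π (π α)) := by rwa [e1]
          rw [dif_pos h, dif_pos h']
          have e2 : c ^ m (π α) = c ^ (m α + 1) := h _ _ (by
            rw [← e1, hm, pow_succ', Equiv.Perm.mul_apply, e1, hm])
          have e3 : f ⟨orbitRep π (π α), hrep _, h'⟩ = f ⟨orbitRep π α, hrep α, h⟩ :=
            congrArg f (Subtype.ext e1)
          rw [e2, e3, pow_succ]
          field_simp
        · rw [dif_neg h, dif_neg (by rwa [e1]), mul_zero]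
      refine ⟨⟨F, hF⟩, funext fun α => ?_⟩
      obtain ⟨α, h1, h2⟩ := α
      change (if h : _ then _ else _) = _
      rw [dif_pos (by rwa [h1])]
      have e2 : c ^ m α = c ^ 0 := h2 _ _ (by
        have := hm α
        rw [h1] at this
        rw [this]; rfl)
      rw [e2, pow_zero, inv_one, one_mul]
      exact congrArg f (Subtype.ext h1)
  rw [(LinearEquiv.ofBijective g hb).finrank_eq, Module.finrank_fintype_fun_eq_card,
    Nat.card_eq_fintype_card]

/-- The sum of the powers of a primitive root with exponents divisible by `m`. -/
theorem sum_pow_dvd {O : Type*} [CommRing O] [IsDomain O] {ζ : O} {m t : ℕ} (hm : 0 < m)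
    (ht : 0 < t) (hζ : IsPrimitiveRoot ζ (m * t)) :
    ∑ i ∈ Finset.range (m * t), (if m ∣ i then ζ ^ i else 0) = if t = 1 then 1 else 0 := by
  have e1 : (Finset.range (m * t)).filter (m ∣ ·) = (Finset.range t).image (m * ·) := by
    ext i
    simp only [Finset.mem_filter, Finset.mem_range, Finset.mem_image]
    constructor
    · rintro ⟨h, s, rfl⟩
      exact ⟨s, lt_of_mul_lt_mul_left h (Nat.zero_le m), rfl⟩
    · rintro ⟨s, h, rfl⟩
      exact ⟨Nat.mul_lt_mul_of_pos_left h hm, dvd_mul_right m s⟩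
  rw [← Finset.sum_filter, e1, Finset.sum_image fun a _ b _ h => Nat.eq_of_mul_eq_mul_left hm h]
  simp only [pow_mul]
  split_ifs with h
  · simp [h]
  · exact (hζ.pow (by positivity) rfl).geom_sum_eq_zero (by omega)

theorem sum_isCompatible {O : Type*} [CommRing O] [IsDomain O] {ζ : O} {n : ℕ} (hn : n ≠ 0)
    (hζ : IsPrimitiveRoot ζ n) {ω : k} (hω : IsPrimitiveRoot ω n) (hπ : π ^ n = 1) (α : Ω) :
    ∑ i ∈ Finset.range n, (open scoped Classical in if IsCompatible π (ω ^ i) α then ζ ^ i else 0) =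
      open scoped Classical in if π α = α then 1 else 0 := by
  classical
  have hper : Function.IsPeriodicPt π n α := by
    change (⇑π)^[n] α = α
    rw [← Equiv.Perm.coe_pow, hπ]; rfl
  obtain ⟨m, hm⟩ := hper.minimalPeriod_dvd
  set t := Function.minimalPeriod π α with ht
  have ht0 : 0 < t := Function.minimalPeriod_pos_of_mem_periodicPts
    ⟨n, Nat.pos_of_ne_zero hn, hper⟩
  have hm0 : 0 < m := Nat.pos_of_ne_zero fun h => hn (by rw [hm, h, mul_zero])
  have hcomp : ∀ i, IsCompatible π (ω ^ i) α ↔ m ∣ i := by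
    intro i
    have h1 : IsCompatible π (ω ^ i) α ↔ (ω ^ i) ^ t = 1 := by
      constructor
      · intro h
        have := h t 0 (by
          rw [Equiv.Perm.coe_pow]
          exact Function.iterate_minimalPeriod)
        rwa [pow_zero] at this
      · intro h
        have key : ∀ s s' : ℕ, s ≤ s' → (π ^ s) α = (π ^ s') α → (ω ^ i) ^ s = (ω ^ i) ^ s' := by
          intro s s' hss h2
          obtain ⟨d, rfl⟩ := Nat.exists_eq_add_of_le hss
          rw [pow_add, Equiv.Perm.mul_apply] at h2
          have h3 : Function.IsPeriodicPt π d α := by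
            change (⇑π)^[d] α = α
            rw [← Equiv.Perm.coe_pow]
            exact ((π ^ s).injective h2).symm
          obtain ⟨e, rfl⟩ := h3.minimalPeriod_dvd
          rw [pow_add, pow_mul _ _ e, ← ht, h, one_pow, mul_one]
        intro s s' h2
        rcases le_total s s' with h3 | h3
        · exact key s s' h3 h2
        · exact (key s' s h3 h2.symm).symm
    rw [h1, ← pow_mul, hω.pow_eq_one_iff_dvd, hm, mul_comm i t, Nat.mul_dvd_mul_iff_left ht0]
  simp only [hcomp]
  rw [show n = m * t by rw [hm, mul_comm]] at hζ ⊢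
  convert sum_pow_dvd hm0 ht0 hζ using 2
  rw [ht, Function.minimalPeriod_eq_one_iff_isFixedPt]
  rfl

theorem sum_finrank_permEig [Fintype Ω] {O : Type*} [CommRing O] [IsDomain O] {ζ : O} {n : ℕ}
    (hn : n ≠ 0) (hζ : IsPrimitiveRoot ζ n) {ω : k} (hω : IsPrimitiveRoot ω n) (hπ : π ^ n = 1) :
    ∑ i ∈ Finset.range n, (Module.finrank k (permEig π (ω ^ i)) : O) * ζ ^ i =
      (Nat.card {α : Ω // π α = α} : O) := by
  classical
  have h1 : ∀ i, (Module.finrank k (permEig π (ω ^ i)) : O) * ζ ^ i =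
      ∑ α : Ω, if orbitRep π α = α then (if IsCompatible π (ω ^ i) α then ζ ^ i else 0) else 0 := by
    intro i
    rw [finrank_permEig π (pow_ne_zero i (hω.ne_zero hn)), Nat.card_eq_fintype_card,
      Fintype.card_subtype, Finset.natCast_card_filter, Finset.sum_mul]
    refine Finset.sum_congr rfl fun α _ => ?_
    by_cases c1 : orbitRep π α = α <;> by_cases c2 : IsCompatible π (ω ^ i) α <;> simp [c1, c2]
  simp only [h1]
  rw [Finset.sum_comm, Nat.card_eq_fintype_card, Fintype.card_subtype, Finset.natCast_card_filter]
  refine Finset.sum_congr rfl fun α _ => ?_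
  by_cases c1 : orbitRep π α = α
  · simp only [if_pos c1]
    convert sum_isCompatible π hn hζ hω hπ α
  · simp only [if_neg c1, Finset.sum_const_zero]
    rw [if_neg]
    intro h
    refine c1 ?_
    obtain ⟨s, hs⟩ := (orbitRep_sameCycle π α).symm
    rw [← hs]
    exact Equiv.Perm.zpow_apply_eq_self_of_apply_eq_self h s

end Permutation

/-! ## Objects with a permuted basis -/

variable {k : Type u} [Field k] {n : ℕ} {A B : FoldedAlg.{u, w} k n}

/-- A homogeneous basis of `e X` which is permuted by the map `ψ`. -/
structure Frame.PermBasis (F : Frame A) (X : Obj A) (Ω : Type) where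
  vec : Ω → X.carrier
  wt : Ω → ℤ
  perm : Equiv.Perm Ω
  indep : LinearIndependent k vec
  mem : ∀ α, vec α ∈ X.deg (wt α)
  e_vec : ∀ α, F.e • vec α = vec α
  span : ∀ y, F.e • y ∈ Submodule.span k (Set.range vec)
  ψ_vec : ∀ α, F.v • X.σ (vec α) = vec (perm α)

namespace Frame.PermBasis

variable {F : Frame A} {X : Obj A} {Ω : Type} (b : F.PermBasis X Ω)

theorem wt_perm (α : Ω) : b.wt (b.perm α) = b.wt α := by
  by_contra h
  have h1 : b.vec (b.perm α) ∈ X.deg (b.wt α) := by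
    rw [← b.ψ_vec]
    have := X.smul_mem F.v_mem (X.σ_mem (b.mem α))
    rwa [zero_add] at this
  exact b.indep.ne_zero _ (eq_zero_of_mem_of_ne X.internal (b.mem (b.perm α)) h1 h)

theorem ψ_pow_vec (α : Ω) (t : ℕ) : (F.ψ X ^ t) (b.vec α) = b.vec ((b.perm ^ t) α) := by
  induction t with
  | zero => rfl
  | succ t ih =>
    rw [pow_succ', Module.End.mul_apply, ih, pow_succ', Equiv.Perm.mul_apply, ← b.ψ_vec]
    rfl

theorem perm_pow : b.perm ^ n = 1 := by
  ext α
  refine b.indep.injective ?_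
  rw [← b.ψ_pow_vec, F.ψ_pow_n (b.e_vec α)]
  rfl

/-- The permutation of the basis vectors of a given degree. -/
def permAt (d : ℤ) : Equiv.Perm {α // b.wt α = d} :=
  b.perm.subtypePerm fun α => by rw [b.wt_perm]

theorem finrank_eig [Fintype Ω] (ω : k) (d : ℤ) (i : ℕ) :
    Module.finrank k (F.eig ω d i X) = Module.finrank k (permEig (b.permAt d) (ω ^ i)) := by
  classical
  have hlin : LinearIndependent k fun α : {α // b.wt α = d} => b.vec α.1 :=
    b.indep.comp _ Subtype.val_injective
  have hψ : ∀ f : {α // b.wt α = d} → k, F.v • X.σ (∑ α, f α • b.vec α.1) =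
      ∑ α, f ((b.permAt d).symm α) • b.vec α.1 := by
    intro f
    rw [map_sum, Finset.smul_sum,
      ← Equiv.sum_comp (b.permAt d) fun α => f ((b.permAt d).symm α) • b.vec α.1]
    refine Finset.sum_congr rfl fun α _ => ?_
    rw [map_smul, smul_comm, b.ψ_vec, Equiv.symm_apply_apply]
    rfl
  have hiff : ∀ f : {α // b.wt α = d} → k,
      (∑ α, f α • b.vec α.1) ∈ F.eig ω d i X ↔ f ∈ permEig (b.permAt d) (ω ^ i) := by
    intro f
    have h1 : (∑ α, f α • b.vec α.1) ∈ X.deg d := sum_mem fun α _ =>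
      Submodule.smul_mem _ _ (by have := b.mem α.1; rwa [α.2] at this)
    have h2 : F.e • (∑ α, f α • b.vec α.1) = ∑ α, f α • b.vec α.1 := by
      rw [Finset.smul_sum]
      exact Finset.sum_congr rfl fun α _ => by rw [smul_comm, b.e_vec]
    have h3 : ω ^ i • (∑ α, f α • b.vec α.1) = ∑ α, (ω ^ i * f α) • b.vec α.1 := by
      rw [Finset.smul_sum]
      exact Finset.sum_congr rfl fun α _ => smul_smul _ _ _
    constructor
    · rintro ⟨-, -, h4⟩ α
      rw [hψ, h3] at h4
      have h5 := Fintype.linearIndependent_iff.1 hlin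
        (fun α => f ((b.permAt d).symm α) - ω ^ i * f α) (by
          simp only [sub_smul, Finset.sum_sub_distrib]
          rw [h4, sub_self]) (b.permAt d α)
      rw [Equiv.symm_apply_apply, sub_eq_zero] at h5
      exact h5
    · intro hf
      refine ⟨h1, h2, ?_⟩
      rw [hψ, h3]
      refine Finset.sum_congr rfl fun α _ => ?_
      rw [hf, Equiv.apply_symm_apply]
  have hsurj : ∀ y ∈ F.eig ω d i X, ∃ f : {α // b.wt α = d} → k, ∑ α, f α • b.vec α.1 = y := by
    rintro y ⟨hy, hey, -⟩
    have h1 := b.span y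
    rw [hey, Submodule.mem_span_range_iff_exists_fun] at h1
    obtain ⟨c, hc⟩ := h1
    refine ⟨fun α => c α.1, ?_⟩
    rw [← component_of_mem X.internal hy, ← hc, map_sum]
    refine (Finset.sum_subtype (Finset.univ.filter fun α => b.wt α = d) (by simp)
      fun α => c α • b.vec α).symm.trans ?_
    rw [Finset.sum_filter]
    refine Finset.sum_congr rfl fun α _ => ?_
    rw [map_smul]
    split_ifs with h
    · rw [component_of_mem X.internal (by rw [← h]; exact b.mem α)]
    · rw [component_of_mem_ne X.internal (b.mem α) h, smul_zero]
  let g : permEig (b.permAt d) (ω ^ i) →ₗ[k] F.eig ω d i X :=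
    { toFun := fun f => ⟨∑ α, f.1 α • b.vec α.1, (hiff f.1).2 f.2⟩
      map_add' := fun f f' => Subtype.ext (by
        change ∑ α, (f.1 α + f'.1 α) • _ = _ + _
        rw [← Finset.sum_add_distrib]
        exact Finset.sum_congr rfl fun α _ => add_smul _ _ _)
      map_smul' := fun c f => Subtype.ext (by
        change ∑ α, (c * f.1 α) • _ = c • _
        rw [Finset.smul_sum]
        exact Finset.sum_congr rfl fun α _ => mul_smul _ _ _) }
  refine (LinearEquiv.ofBijective g ⟨?_, ?_⟩).finrank_eq.symm
  · rw [← LinearMap.ker_eq_bot, LinearMap.ker_eq_bot']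
    intro f hf
    exact Subtype.ext (funext (Fintype.linearIndependent_iff.1 hlin f.1 (congrArg Subtype.val hf)))
  · rintro ⟨y, hy⟩
    obtain ⟨f, rfl⟩ := hsurj y hy
    exact ⟨⟨f, (hiff f).1 hy⟩, rfl⟩

theorem charCoeff_eq [Fintype Ω] {O : Type} [CommRing O] [IsDomain O] {ζ : O} (hn : n ≠ 0)
    (hζ : IsPrimitiveRoot ζ n) {ω : k} (hω : IsPrimitiveRoot ω n) (s d : ℤ) :
    F.charCoeff ζ ω s X d = (Nat.card {α : Ω // b.wt α = d + s ∧ b.perm α = α} : O) := by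
  rw [Frame.charCoeff]
  simp only [b.finrank_eig]
  classical
  rw [sum_finrank_permEig (b.permAt (d + s)) hn hζ hω (by
    ext α
    have := b.perm_pow
    rw [permAt, Equiv.Perm.subtypePerm_pow]
    simp [this])]
  congr 1
  refine Nat.card_congr
    { toFun := fun α => ⟨α.1.1, α.1.2, congrArg Subtype.val α.2⟩
      invFun := fun α => ⟨⟨α.1, α.2.1⟩, Subtype.ext α.2.2⟩
      left_inv := fun _ => rfl
      right_inv := fun _ => rfl }

/-- The character is given by the fixed basis vectors. -/
theorem char_eq [Fintype Ω] {O : Type} [CommRing O] [IsDomain O] {ζ : O} (hn : n ≠ 0)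
    (hζ : IsPrimitiveRoot ζ n) {ω : k} (hω : IsPrimitiveRoot ω n) (s : ℤ)
    {S : Finset Ω} (hS : ∀ α, α ∈ S ↔ b.perm α = α) :
    F.char ζ ω s X = ∑ α ∈ S, T (b.wt α - s) := by
  classical
  obtain rfl : S = ({α | b.perm α = α} : Finset Ω) := by ext; simp [hS]
  have h1 : ∀ d, F.charCoeff ζ ω s X d =
      (∑ α with b.perm α = α, T (b.wt α - s) : O[T;T⁻¹]).coeff d := by
    intro d
    rw [b.charCoeff_eq hn hζ hω, AddMonoidAlgebra.coeff_sum, Finsupp.finsetSum_apply,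
      Nat.card_eq_fintype_card, Fintype.card_subtype, Finset.natCast_card_filter,
      Finset.sum_filter]
    refine Finset.sum_congr rfl fun α _ => ?_
    have h2 : (T (b.wt α - s) : O[T;T⁻¹]).coeff d =
        if b.wt α - s = d then 1 else 0 := by
      classical
      exact (DFunLike.congr_fun (AddMonoidAlgebra.coeff_single _ _) d).trans
        Finsupp.single_apply
    rw [h2]
    have h3 : b.wt α = d + s ↔ b.wt α - s = d := by omega
    by_cases c1 : b.wt α - s = d <;> by_cases c2 : b.perm α = α <;> simp [c1, c2, h3]
  refine laurent_ext fun d => ?_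
  rw [Frame.char, gsum_coeff, h1]
  refine ((∑ α with b.perm α = α, T (b.wt α - s) :
    O[T;T⁻¹]).coeff.support.finite_toSet).subset fun d hd => ?_
  simpa [h1 d] using hd

/-- The tensor product of permuted bases. -/
def tensor {G : Frame B} {Y : Obj B} {Ω' : Type} (c : G.PermBasis Y Ω') :
    (F.tensor G).PermBasis (X.tensor Y) (Ω × Ω') where
  vec p := Obj.tmul (b.vec p.1) (c.vec p.2)
  wt p := b.wt p.1 + c.wt p.2
  perm := Equiv.prodCongr b.perm c.perm
  indep := b.indep.tmul_of_isDomain c.indep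
  mem p := Obj.tmul_mem (b.mem p.1) (c.mem p.2)
  e_vec p := (tmul_smul_tmul F.e G.e _ _).trans (by rw [b.e_vec, c.e_vec])
  span y := by
    change tmul F.e G.e • y ∈ _
    refine Obj.tensor_induction (p := fun y => tmul F.e G.e • y ∈ Submodule.span k
      (Set.range fun p : Ω × Ω' => Obj.tmul (b.vec p.1) (c.vec p.2))) (by simp) (fun x y => ?_)
      (fun x y hx hy => by rw [smul_add]; exact add_mem hx hy) y
    rw [tmul_smul_tmul]
    have h := Submodule.apply_mem_map₂ (TensorProduct.mk k X.carrier Y.carrier) (b.span x) (c.span y)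
    rw [Submodule.map₂_span_span] at h
    refine Submodule.span_mono ?_ h
    rintro _ ⟨_, ⟨α, rfl⟩, _, ⟨β, rfl⟩, rfl⟩
    exact ⟨(α, β), rfl⟩
  ψ_vec p := (tmul_smul_tmul F.v G.v (X.σ (b.vec p.1)) (Y.σ (c.vec p.2))).trans
    (by rw [b.ψ_vec, c.ψ_vec]; rfl)

/-- The character of a tensor product. -/
theorem char_tensor [Fintype Ω] (b : F.PermBasis X Ω) {G : Frame B} {Y : Obj B} {Ω' : Type} [Fintype Ω']
    (c : G.PermBasis Y Ω') {O : Type} [CommRing O] [IsDomain O] {ζ : O} (hn : n ≠ 0)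
    (hζ : IsPrimitiveRoot ζ n) {ω : k} (hω : IsPrimitiveRoot ω n) (s s' : ℤ) :
    (F.tensor G).char ζ ω (s + s') (X.tensor Y) = F.char ζ ω s X * G.char ζ ω s' Y := by
  classical
  rw [b.char_eq hn hζ hω s fun _ => Finset.mem_filter_univ _,
    c.char_eq hn hζ hω s' fun _ => Finset.mem_filter_univ _, Finset.sum_mul_sum,
    ← Finset.sum_product']
  refine ((b.tensor c).char_eq hn hζ hω _ fun α => ?_).trans
    (Finset.sum_congr rfl fun p _ => ?_)
  · simp [tensor, Prod.ext_iff]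
  · rw [← LaurentPolynomial.T_add]
    congr 1
    change b.wt p.1 + c.wt p.2 - _ = _
    ring

end Frame.PermBasis

end

section

namespace NilHecke

section Monomials

variable {A : Type*} [Ring A] {W : Type*} [Fintype W] [DecidableEq W] {C : Type*} [DecidableEq C]
  {H : NilHecke A W C} {ls : List ℕ} {w w' : W}

theorem ymon_add (α β : ℕ → ℕ) (p : ℕ) : H.ymon (α + β) p = H.ymon α p * H.ymon β p := by
  induction p with
  | zero => simp [ymon]
  | succ p ih =>
    rw [ymon, ymon, ymon, ih, Pi.add_apply, pow_add, mul_assoc (H.ymon α p), mul_assoc (H.ymon α p),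
      ← mul_assoc (H.ymon β p), ymon_y_pow β p p (α p)]
    simp only [mul_assoc]

theorem ymon_zero (p : ℕ) : H.ymon 0 p = 1 := by
  induction p with
  | zero => rfl
  | succ p ih => rw [ymon, ih, Pi.zero_apply, pow_zero, mul_one]

theorem ymon_single (i c p : ℕ) :
    H.ymon (Finsupp.single i c) p = if i < p then H.y i ^ c else 1 := by
  induction p with
  | zero => simp [ymon]
  | succ p ih =>
    rw [ymon, ih]
    rcases lt_trichotomy i p with h | rfl | h
    · rw [if_pos h, if_pos (by omega), Finsupp.single_eq_of_ne (by omega), pow_zero, mul_one]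
    · rw [if_neg (by omega), if_pos (by omega), Finsupp.single_eq_same, one_mul]
    · rw [if_neg (by omega), if_neg (by omega), Finsupp.single_eq_of_ne (by omega), pow_zero,
        mul_one]

theorem Path.placePerm_lt_iff (h : Path H ls w w') (i : ℕ) :
    placePerm ls i < H.len ↔ i < H.len := by
  refine ⟨fun hi => ?_, h.placePerm_lt⟩
  by_contra hn
  have hmaps : Set.MapsTo (placePerm ls) (Finset.range H.len) (Finset.range H.len) := fun x hx => by
    simpa using h.placePerm_lt (by simpa using hx)
  obtain ⟨x, hx, hxi⟩ := (Finset.surjOn_of_injOn_of_card_le _ hmaps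
    ((placePerm ls).injective.injOn) le_rfl) (by simpa using hi)
  rw [(placePerm ls).injective hxi] at hx
  exact hn (by simpa using hx)

theorem Path.cross_y_pow (h : Path H ls w w') (i c : ℕ) :
    H.cross ls * H.y i ^ c * H.e w = H.y (placePerm ls i) ^ c * H.cross ls * H.e w := by
  induction c with
  | zero => simp
  | succ c ih =>
    rw [pow_succ, ← mul_assoc, mul_assoc _ (H.y i), H.y_e, ← mul_assoc, ih, mul_assoc, ← H.y_e,
      mul_assoc, ← mul_assoc (H.cross ls), h.cross_y, pow_succ]
    simp only [mul_assoc]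

theorem Path.cross_ymon (h : Path H ls w w') (α : ℕ →₀ ℕ) : H.cross ls * H.ymon α H.len * H.e w =
    H.ymon (α.equivMapDomain (placePerm ls)) H.len * H.cross ls * H.e w := by
  induction α using Finsupp.induction_linear with
  | zero => simp [Finsupp.equivMapDomain_zero, ymon_zero]
  | add α β ha hb =>
    have e1 : (α + β).equivMapDomain (placePerm ls) =
        α.equivMapDomain (placePerm ls) + β.equivMapDomain (placePerm ls) := by
      ext i; simp [Finsupp.equivMapDomain_apply]
    rw [e1, Finsupp.coe_add, Finsupp.coe_add, ymon_add, ymon_add, ← mul_assoc,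
      mul_assoc _ (H.ymon β _), ymon_e, ← mul_assoc, ha, mul_assoc, ← ymon_e, mul_assoc,
      ← mul_assoc (H.cross ls), hb]
    simp only [mul_assoc]
  | single i c =>
    rw [Finsupp.equivMapDomain_single, ymon_single, ymon_single]
    simp only [h.placePerm_lt_iff]
    split_ifs
    · exact h.cross_y_pow i c
    · simp

end Monomials

variable {k : Type u} [Field k] {n : ℕ} {A : FoldedAlg.{u, w} k n} {W : Type v} [Fintype W]
  [DecidableEq W] {C : Type v} [DecidableEq C]

/-- A frame given by an idempotent `e b` and a product of crossings of distinct letters. -/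
structure IsFrame (H : NilHecke A.carrier W C) (g : ℤ) (E : Frame A) (b : W) (ls : List ℕ) :
    Prop where
  graded : H.IsGraded A.deg g
  aut_y : ∀ l, A.aut (H.y l) = H.y l
  e_eq : E.e = H.e b
  exists_path : ∃ b', H.Path ls b' b ∧ E.v = H.cross ls * H.e b'

namespace IsFrame

open IsGraded

variable {H : NilHecke A.carrier W C} {g : ℤ} {E : Frame A} {b : W} {ls : List ℕ}
  (h : H.IsFrame g E b ls)

theorem idem_v_aut (h : H.IsFrame g E b ls) :
    idem H b * E.v * A.aut (idem H b) = idem H b * E.v := by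
  have h1 := h.graded.e_sub_mem b le_rfl
  have : IsGraded.leftIdeal H A.deg g 0 ≤
      LinearMap.ker (LinearMap.mulLeft k (idem H b * E.v) ∘ₗ A.aut.toLinearMap) := by
    refine Submodule.span_le.2 ?_
    rintro _ ⟨a, ha, l, rfl⟩
    change idem H b * E.v * A.aut (a * H.y l) = 0
    have h2 := A.mul_mem E.v_mem (A.aut_mem ha)
    have hg := h.graded.g_pos
    rw [map_mul, mul_assoc, ← mul_assoc E.v, ← mul_assoc,
      h.graded.idem_mul_eq_zero b (by omega) h2, zero_mul]
  have h3 : idem H b * E.v * A.aut (H.e b - idem H b) = 0 := this h1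
  rw [map_sub, mul_sub, sub_eq_zero, mul_assoc, ← h.e_eq, E.v_mul_e] at h3
  exact h3.symm

/-- The frame of a primitive idempotent. -/
def core (hconn : ∀ w, ∃ ls, H.Path ls b w) : Core A where
  e := idem H b
  v := idem H b * E.v
  e_mem := h.graded.idem_mem b
  v_mem := by
    have := A.mul_mem (h.graded.idem_mem b) E.v_mem
    rwa [add_zero] at this
  e_mul_e := h.graded.idem_idem b
  e_mul_v := by rw [← mul_assoc, h.graded.idem_idem]
  v_mul_e := h.idem_v_aut
  pow_n := by
    have key : ∀ t, twistedPow A (idem H b) (idem H b * E.v) t =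
        idem H b * twistedPow A E.e E.v t := by
      intro t
      induction t with
      | zero => rw [twistedPow, twistedPow, h.e_eq, idem_e]
      | succ t ih =>
        rw [twistedPow, ih, map_mul, ← mul_assoc, h.idem_v_aut, mul_assoc]
        rfl
    rw [key, E.pow_n, h.e_eq, idem_e]
  neg d hd a ha := by rw [h.graded.idem_mul_eq_zero b hd ha, zero_mul]
  zero a ha := by
    obtain ⟨c, hc⟩ := h.graded.exists_idem_mul_e b ha
    refine ⟨c, ?_⟩
    rw [show idem H b * a * idem H b = idem H b * a * H.e b * idem H b by rw [mul_assoc _ (H.e b), e_idem], hc, smul_mul_assoc, h.graded.idem_idem]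
  full := by
    rw [← H.e_sum]
    refine sum_mem fun w _ => ?_
    obtain ⟨ls', hls⟩ := hconn w
    have h1 := hls.reverse.cross_reverse_mul
    rw [List.reverse_reverse, mul_assoc, hls.reverse.cross_e, ← mul_assoc] at h1
    rw [← h1]
    have h2 := h.graded.e_mem_span_idem b
    refine map_mem_of_mem_span
      (LinearMap.mulRight k (H.cross ls'.reverse) ∘ₗ LinearMap.mulLeft k (H.cross ls')) ?_ h2
    rintro _ ⟨a, a', rfl⟩
    exact Submodule.subset_span ⟨H.cross ls' * a, a' * H.cross ls'.reverse, by simp [mul_assoc]⟩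

end IsFrame

/-- A generating vector on which the frame acts trivially, and which is killed by the `y l`. -/
structure IsTop (H : NilHecke A.carrier W C) (E : Frame A) (b : W) (X : Obj A) (s : ℤ)
    (x : X.carrier) : Prop where
  ne : x ≠ 0
  mem : x ∈ X.deg s
  e_x : H.e b • x = x
  y_x : ∀ l, H.y l • x = 0
  ψ_x : E.v • X.σ x = x
  gen : ∀ y : X.carrier, ∃ a : A.carrier, y = a • x

namespace IsFrame

open IsGraded

variable {H : NilHecke A.carrier W C} {g : ℤ} {E : Frame A} {b : W} {ls : List ℕ}
  (h : H.IsFrame g E b ls) {X : Obj A} {s : ℤ} {x : X.carrier} (hx : H.IsTop E b X s x)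

theorem exists_idem_smul (h : H.IsFrame g E b ls) (hx : H.IsTop E b X s x) (y : X.carrier) :
    ∃ c : k, idem H b • y = c • x := by
  obtain ⟨a, rfl⟩ := hx.gen y
  refine homogeneous_induction A.internal (p := fun a => ∃ c : k, idem H b • a • x = c • x)
    ⟨0, by simp⟩ ?_ ?_ a
  · intro d a ha
    obtain ⟨c, hc⟩ := NilHecke.exists_idem_smul h.graded hx.y_x hx.e_x ha
    exact ⟨c, by rw [← hc, mul_smul]⟩
  · rintro a b ⟨c, hc⟩ ⟨c', hc'⟩
    exact ⟨c + c', by rw [add_smul, smul_add, hc, hc', add_smul]⟩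

/-- The object generated by a vector as above is simple. -/
def cover (hconn : ∀ w, ∃ ls, H.Path ls b w) : Cover (h.core hconn) X s where
  x := x
  x_mem := hx.mem
  x_ne := hx.ne
  e_x := idem_smul h.graded hx.y_x hx.e_x
  ψ_x := by
    change (idem H b * E.v) • X.σ x = x
    rw [mul_smul, hx.ψ_x, idem_smul h.graded hx.y_x hx.e_x]
  span := h.exists_idem_smul hx

/-- The exponents of the monomials which occur in a basis. -/
def bound (H : NilHecke A.carrier W C) (b : W) : ℕ →₀ ℕ :=
  Finsupp.onFinset (Finset.range H.len) (fun i => if i < H.len then H.δ b i else 0) fun i hi => by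
    by_contra hn
    exact hi (if_neg (by simpa using hn))

theorem bound_apply (i : ℕ) : bound H b i = if i < H.len then H.δ b i else 0 := rfl

/-- The action of the permutation of places on exponents. -/
def boundPerm (hp : ∀ i, bound H b (placePerm ls i) = bound H b i) :
    Equiv.Perm {α : ℕ →₀ ℕ // α ≤ bound H b} :=
  (Finsupp.equivCongrLeft (placePerm ls)).subtypeEquiv fun α => by
    rw [Finsupp.le_def, Finsupp.le_def]
    constructor
    · intro h i
      have h1 := h ((placePerm ls).symm i)
      have h2 := hp ((placePerm ls).symm i)
      rw [Equiv.apply_symm_apply] at h2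
      rw [h2]
      exact h1
    · intro h i
      have h1 := h (placePerm ls i)
      rw [hp] at h1
      simpa using h1

instance (β : ℕ →₀ ℕ) : Fintype {α : ℕ →₀ ℕ // α ≤ β} :=
  Fintype.subtype (Finset.Iic β) fun _ => Finset.mem_Iic

/-- The vectors of a basis of `e b X`. -/
def basisVec (H : NilHecke A.carrier W C) (b : W) (x : X.carrier)
    (α : {α : ℕ →₀ ℕ // α ≤ bound H b}) : X.carrier :=
  H.ymon α.1 H.len • H.low b x H.len

/-- The degrees of the vectors of the basis. -/
def basisDeg (H : NilHecke A.carrier W C) (b : W) (g s : ℤ)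
    (α : {α : ℕ →₀ ℕ // α ≤ bound H b}) : ℤ :=
  s + g * ∑ i ∈ Finset.range H.len, ((α.1 i : ℤ) - H.δ b i)

theorem basisVec_mem (h : H.IsFrame g E b ls) (hx : H.IsTop E b X s x)
    (α : {α : ℕ →₀ ℕ // α ≤ bound H b}) :
    basisVec H b x α ∈ X.deg (basisDeg H b g s α) := by
  have h1 := h.graded.mul_mem (h.graded.e_mem b) (h.graded.X_mem le_rfl b)
  have h2 := X.smul_mem h1 hx.mem
  rw [mul_smul, mul_smul (H.X H.len), hx.e_x, ← mul_smul] at h2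
  have h3 := X.smul_mem (h.graded.ymon_mem α.1 H.len) h2
  have e1 : basisDeg H b g s α = g * ∑ i ∈ Finset.range H.len, (α.1 i : ℤ) +
      (0 + -g * H.pairs b H.len + s) := by
    rw [basisDeg, Finset.sum_sub_distrib, sum_δ b le_rfl]
    ring
  rw [e1]
  exact h3

theorem basisVec_independent (h : H.IsFrame g E b ls) (hx : H.IsTop E b X s x) :
    LinearIndependent k (basisVec H b x) := by
  rw [linearIndependent_iff']
  intro S c h0
  have hle : ∀ α : {α : ℕ →₀ ℕ // α ≤ bound H b}, ∀ i < H.len, α.1 i ≤ H.δ b i := fun α i hi => by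
    have := α.2 i
    rwa [bound_apply, if_pos hi] at this
  refine ymon_low_independent h.graded hx.y_x hx.e_x hx.ne (fun α : {α : ℕ →₀ ℕ // α ≤ bound H b} => ⇑α.1) hle c le_rfl S ?_ h0
  intro α _ β _ hαβ
  refine Subtype.ext (Finsupp.ext fun i => ?_)
  by_cases hi : i < H.len
  · exact hαβ i hi
  · have h1 := α.2 i
    have h2 := β.2 i
    rw [bound_apply, if_neg hi] at h1 h2
    omega

theorem basisVec_span (h : H.IsFrame g E b ls) (hx : H.IsTop E b X s x) (y : X.carrier) :
    H.e b • y ∈ Submodule.span k (Set.range (basisVec H b x)) := by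
  refine Submodule.span_mono ?_ (e_smul_mem_span h.graded hx.e_x (h.exists_idem_smul hx) y)
  rintro _ ⟨α, hα, rfl⟩
  refine ⟨⟨Finsupp.onFinset (Finset.range H.len) (fun i => if i < H.len then α i else 0)
    fun i hi => ?_, fun i => ?_⟩, ?_⟩
  · by_contra hn
    exact hi (if_neg (by simpa using hn))
  · rw [bound_apply]
    change (if i < H.len then α i else 0) ≤ _
    split_ifs
    · exact hα i
    · exact le_rfl
  · rw [basisVec]
    congr 1
    exact ymon_congr fun i hi => if_pos hi

theorem v_ymon (h : H.IsFrame g E b ls) (α : ℕ →₀ ℕ) (y : X.carrier) :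
    E.v • X.σ (H.ymon α H.len • y) =
      H.ymon (α.equivMapDomain (placePerm ls)) H.len • E.v • X.σ y := by
  have h1 : ∀ p, A.aut (H.ymon α p) = H.ymon α p := by
    intro p
    induction p with
    | zero => exact map_one _
    | succ p ih => rw [ymon, map_mul, map_pow, ih, h.aut_y]
  obtain ⟨b', hp, hv⟩ := h.exists_path
  rw [X.σ_smul, h1, smul_smul, smul_smul, hv, mul_assoc, ← ymon_e, ← mul_assoc, hp.cross_ymon,
    mul_assoc]

/-- The vector of lowest degree is fixed. -/
theorem v_low (h : H.IsFrame g E b ls) (hx : H.IsTop E b X s x)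
    (hp : ∀ i, bound H b (placePerm ls i) = bound H b i) :
    E.v • X.σ (H.low b x H.len) = H.low b x H.len := by
  have hz : basisVec H b x ⟨0, zero_le⟩ = H.low b x H.len := by
    rw [basisVec, Finsupp.coe_zero, ymon_zero, one_smul]
  have h1 := h.basisVec_mem hx ⟨0, zero_le⟩
  have h2 := X.smul_mem E.v_mem (X.σ_mem h1)
  have h3 := h.basisVec_span hx (E.v • X.σ (H.low b x H.len))
  rw [hz, zero_add] at h2
  rw [← h.e_eq, smul_smul, E.e_mul_v, Submodule.mem_span_range_iff_exists_fun] at h3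
  obtain ⟨c, hc⟩ := h3
  have h4 : E.v • X.σ (H.low b x H.len) = c ⟨0, zero_le⟩ • H.low b x H.len := by
    rw [← component_of_mem X.internal h2, ← hc, map_sum, Finset.sum_eq_single ⟨0, zero_le⟩]
    · rw [map_smul, component_of_mem X.internal h1, hz]
    · intro α _ hα
      rw [map_smul, component_of_mem_ne X.internal (h.basisVec_mem hx α), smul_zero]
      intro hd
      refine hα (Subtype.ext (Finsupp.ext fun i => ?_))
      rw [basisDeg, basisDeg] at hd
      have h5 := mul_left_cancel₀ h.graded.g_pos.ne' (add_left_cancel hd)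
      simp only [Finset.sum_sub_distrib, Finsupp.coe_zero, Pi.zero_apply, Nat.cast_zero,
        zero_sub, Finset.sum_neg_distrib] at h5
      have h6 : ∑ i ∈ Finset.range H.len, (α.1 i : ℤ) = 0 := by linarith
      by_cases hi : i < H.len
      · have := (Finset.sum_eq_zero_iff_of_nonneg fun i _ => by positivity).1 h6 i
          (Finset.mem_range.2 hi)
        simpa using this
      · have := α.2 i
        rw [bound_apply, if_neg hi] at this
        simpa using this
    · simp
  have h5 : H.ymon (bound H b) H.len • H.low b x H.len = x := by
    refine Eq.trans ?_ (ymon_low h.graded hx.y_x hx.e_x le_rfl)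
    congr 1
    exact ymon_congr fun i hi => if_pos hi
  have h6 : (bound H b).equivMapDomain (placePerm ls) = bound H b := by
    ext i
    rw [Finsupp.equivMapDomain_apply, ← hp, Equiv.apply_symm_apply]
  have h7 := h.v_ymon (X := X) (bound H b) (H.low b x H.len)
  rw [h5, hx.ψ_x, h6, h4, smul_comm, h5] at h7
  have h8 : c ⟨0, zero_le⟩ = 1 := smul_left_injective k hx.ne (h7.symm.trans (one_smul k x).symm)
  rw [h4, h8, one_smul]

/-- The basis of `e b X`. -/
def permBasis (hp : ∀ i, bound H b (placePerm ls i) = bound H b i) :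
    E.PermBasis X {α : ℕ →₀ ℕ // α ≤ bound H b} where
  vec := basisVec H b x
  wt := basisDeg H b g s
  perm := boundPerm hp
  indep := h.basisVec_independent hx
  mem := h.basisVec_mem hx
  e_vec α := by
    rw [h.e_eq, basisVec, smul_smul, ← ymon_e, mul_smul, e_low]
  span y := by
    rw [h.e_eq]
    exact h.basisVec_span hx y
  ψ_vec α := by
    rw [basisVec, h.v_ymon, h.v_low hx hp]
    rfl

end IsFrame

end NilHecke

end

section

variable {k : Type u} [Field k] {I : Type v} {D : FoldedDatum I k} {lam μ ν : I →₀ ℕ}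

namespace KLR

variable (h : lam + μ = ν)

theorem incMap_e (v : Word lam) (w : Word μ) :
    incMap D h (e D v ⊗ₜ e D w) = e D (Word.append h v w) := by
  rw [incMap_tmul, Extension.inc_e, Extension.inc_e, Extension.idem, Extension.idem,
    Finset.sum_mul, Finset.sum_eq_single w]
  · rw [Finset.mul_sum, Finset.sum_eq_single v]
    · exact e_self _
    · intro v' _ hv
      exact e_ne fun h' => hv (Word.append_inj h h').1.symm
    · simp
  · intro w' _ hw
    rw [Finset.mul_sum]
    exact Finset.sum_eq_zero fun v' _ => e_ne fun h' => hw (Word.append_inj h h').2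
  · simp

theorem incMap_one : incMap D h (1 ⊗ₜ 1) = corner D h := by
  rw [incMap_tmul, map_one, cornerVal_one, map_one, cornerVal_one, corner_idempotent]

theorem corner_mul_incMap (x : KLR D lam ⊗[k] KLR D μ) :
    corner D h * incMap D h x = incMap D h x := by
  rw [← incMap_one h, ← incMap_mul, ← Algebra.TensorProduct.one_def, one_mul]

theorem incMap_y_left (l : ℕ) (hl : l < lam.degree) (hl' : l < ν.degree) :
    incMap D h (y D ⟨l, hl⟩ ⊗ₜ 1) = y D ⟨l, hl'⟩ * corner D h := by
  have h1 := (leftExt h).inc_y (D := D) (hε := corner_idempotent h) (hX := corner_left h) ⟨l, hl⟩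
    (by change 0 + l < _; omega)
  rw [incMap_tmul, map_one, cornerVal_one, h1, mul_assoc, corner_idempotent]
  congr 3
  exact Nat.zero_add l

theorem incMap_y_right (l : ℕ) (hl : l < μ.degree) (hl' : lam.degree + l < ν.degree) :
    incMap D h (1 ⊗ₜ y D ⟨l, hl⟩) = y D ⟨lam.degree + l, hl'⟩ * corner D h := by
  have h1 := (rightExt h).inc_y (D := D) (hε := corner_idempotent h) (hX := corner_right h) ⟨l, hl⟩
    hl'
  rw [incMap_tmul, map_one, cornerVal_one, Extension.inc_eps, h1]
  rfl

theorem incMap_tau_left (l : ℕ) (hl : l + 1 < lam.degree) (hl' : l + 1 < ν.degree) :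
    incMap D h (tau D l hl ⊗ₜ 1) = tau D l hl' * corner D h := by
  have h1 := (leftExt h).inc_tau (D := D) (hε := corner_idempotent h) (hX := corner_left h) l hl
    (by change 0 + l + 1 < _; omega)
  rw [incMap_tmul, map_one, cornerVal_one, h1, mul_assoc, corner_idempotent]
  congr 1
  congr 1
  exact Nat.zero_add l

theorem incMap_tau_right (l : ℕ) (hl : l + 1 < μ.degree) (hl' : lam.degree + l + 1 < ν.degree) :
    incMap D h (1 ⊗ₜ tau D l hl) = tau D (lam.degree + l) hl' * corner D h := by
  have h1 := (rightExt h).inc_tau (D := D) (hε := corner_idempotent h) (hX := corner_right h) l hl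
    hl'
  rw [incMap_tmul, map_one, cornerVal_one, Extension.inc_eps, h1]
  rfl

end KLR

namespace Orbit.Scaling

open NilHecke
open scoped Classical

variable {j : Orbit D} (g : Scaling j) (h : lam + μ = ν) (hl : j.Covers lam) (hm : j.Covers μ)
  (hν : j.Covers ν)

theorem degree_eq (h : lam + μ = ν) : ν.degree = lam.degree + μ.degree := by rw [← h, map_add]

theorem letter_append (v : Word lam) (w : Word μ) (l : ℕ) : letter j (Word.append h v w) l =
    if l < lam.degree then letter j v l else letter j w (l - lam.degree) := by
  have hd := degree_eq h
  by_cases c : l < lam.degree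
  · rw [if_pos c, letter_of_lt _ (by omega), letter_of_lt _ c, Word.append_left]
  · rw [if_neg c]
    by_cases c' : l < ν.degree
    · have h1 := Word.append_right h v w (l - lam.degree) (by omega) (by omega)
      rw [letter_of_lt _ c', letter_of_lt _ (by omega), ← h1]
      congr 2
      omega
    · rw [letter, dif_neg c', letter, dif_neg (by omega)]

theorem swap_append_left (v : Word lam) (w : Word μ) {l : ℕ} (hl : l + 1 < lam.degree) :
    swap l (Word.append h v w) = Word.append h (swap l v) w := by
  have hd := degree_eq h
  rw [swap_of_lt (by omega), swap_of_lt hl, Word.append_swap_left]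

theorem swap_append_right (v : Word lam) (w : Word μ) {l : ℕ} (hl : l + 1 < μ.degree) :
    swap (lam.degree + l) (Word.append h v w) = Word.append h v (swap l w) := by
  have hd := degree_eq h
  rw [swap_of_lt (by omega), swap_of_lt hl, Word.append_swap_right]

theorem path_append_left {ls : List ℕ} {v v' : Word lam} (hp : (g.nilHecke hl).Path ls v v')
    (w : Word μ) : (g.nilHecke hν).Path ls (Word.append h v w) (Word.append h v' w) := by
  have hd := degree_eq h
  induction hp with
  | nil v => exact Path.nil _
  | @cons ls v v' l hp hlen hne ih =>
    change l + 1 < lam.degree at hlen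
    rw [show (g.nilHecke hl).sw l v' = swap l v' from rfl, ← swap_append_left h _ _ hlen]
    refine Path.cons ih (show l + 1 < ν.degree by omega) ?_
    change letter j _ _ ≠ letter j _ _
    rw [letter_append, letter_append, if_pos (by omega), if_pos hlen]
    exact hne

theorem path_append_right {ls : List ℕ} {w w' : Word μ} (hp : (g.nilHecke hm).Path ls w w')
    (v : Word lam) : (g.nilHecke hν).Path (ls.map (lam.degree + ·)) (Word.append h v w)
      (Word.append h v w') := by
  have hd := degree_eq h
  induction hp with
  | nil v => exact Path.nil _
  | @cons ls w w' l hp hlen hne ih =>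
    change l + 1 < μ.degree at hlen
    rw [show (g.nilHecke hm).sw l w' = swap l w' from rfl, ← swap_append_right h _ _ hlen,
      List.map_cons]
    refine Path.cons ih (show lam.degree + l + 1 < ν.degree by omega) ?_
    change letter j _ _ ≠ letter j _ _
    rw [letter_append, letter_append, if_neg (by omega), if_neg (by omega),
      Nat.add_sub_cancel_left, show lam.degree + l + 1 - lam.degree = l + 1 by omega]
    exact hne

theorem incMap_cross_left {ls : List ℕ} {v v' : Word lam} (hp : (g.nilHecke hl).Path ls v v')
    (w : Word μ) : KLR.incMap D h (((g.nilHecke hl).cross ls * KLR.e D v) ⊗ₜ KLR.e D w) =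
      (g.nilHecke hν).cross ls * KLR.e D (Word.append h v w) := by
  have hd := degree_eq h
  induction hp with
  | nil v => rw [NilHecke.cross, NilHecke.cross, List.map_nil, List.map_nil, List.prod_nil,
      List.prod_nil, one_mul, one_mul, KLR.incMap_e]
  | @cons ls v v' l hp hlen hne ih =>
    change l + 1 < lam.degree at hlen
    have e1 : (g.nilHecke hl).cross (l :: ls) * KLR.e D v =
        g.factor (letter j v' l) (letter j v' (l + 1)) •
          (KLR.tau D l hlen * ((g.nilHecke hl).cross ls * KLR.e D v)) := by
      have h1 : (g.nilHecke hl).cross ls * KLR.e D v = KLR.e D v' * (g.nilHecke hl).cross ls :=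
        hp.cross_e
      rw [cross_cons, mul_assoc, h1, ← mul_assoc, ← mul_assoc, ← smul_mul_assoc,
        ← g.cross_e l hlen]
      rfl
    have e2 : (g.nilHecke hν).cross (l :: ls) * KLR.e D (Word.append h v w) =
        g.factor (letter j v' l) (letter j v' (l + 1)) • (KLR.tau D l (by omega) *
          ((g.nilHecke hν).cross ls * KLR.e D (Word.append h v w))) := by
      have h1 : (g.nilHecke hν).cross ls * KLR.e D (Word.append h v w) =
          KLR.e D (Word.append h v' w) * (g.nilHecke hν).cross ls :=
        (g.path_append_left h hl hν hp w).cross_e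
      have h2 := g.cross_e l (by omega) (Word.append h v' w)
      rw [letter_append, letter_append, if_pos (by omega), if_pos hlen] at h2
      rw [cross_cons, mul_assoc, h1, ← mul_assoc, ← mul_assoc, ← smul_mul_assoc, ← h2]
      rfl
    have e3 : (KLR.tau D l hlen * ((g.nilHecke hl).cross ls * KLR.e D v)) ⊗ₜ[k] KLR.e D w =
        (KLR.tau D l hlen ⊗ₜ[k] 1) * (((g.nilHecke hl).cross ls * KLR.e D v) ⊗ₜ[k] KLR.e D w) := by
      rw [Algebra.TensorProduct.tmul_mul_tmul, one_mul]
    rw [e1, e2, ← TensorProduct.smul_tmul', map_smul, e3, KLR.incMap_mul,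
      KLR.incMap_tau_left h l hlen (by omega), mul_assoc, KLR.corner_mul_incMap, ih]

theorem incMap_cross_right {ls : List ℕ} {w w' : Word μ} (hp : (g.nilHecke hm).Path ls w w')
    (v : Word lam) : KLR.incMap D h (KLR.e D v ⊗ₜ ((g.nilHecke hm).cross ls * KLR.e D w)) =
      (g.nilHecke hν).cross (ls.map (lam.degree + ·)) * KLR.e D (Word.append h v w) := by
  have hd := degree_eq h
  induction hp with
  | nil v => rw [NilHecke.cross, NilHecke.cross, List.map_nil, List.map_nil, List.map_nil,
      List.prod_nil, List.prod_nil, one_mul, one_mul, KLR.incMap_e]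
  | @cons ls w w' l hp hlen hne ih =>
    change l + 1 < μ.degree at hlen
    have e1 : (g.nilHecke hm).cross (l :: ls) * KLR.e D w =
        g.factor (letter j w' l) (letter j w' (l + 1)) •
          (KLR.tau D l hlen * ((g.nilHecke hm).cross ls * KLR.e D w)) := by
      have h1 : (g.nilHecke hm).cross ls * KLR.e D w = KLR.e D w' * (g.nilHecke hm).cross ls :=
        hp.cross_e
      rw [cross_cons, mul_assoc, h1, ← mul_assoc, ← mul_assoc, ← smul_mul_assoc,
        ← g.cross_e l hlen]
      rfl
    have e2 : (g.nilHecke hν).cross ((l :: ls).map (lam.degree + ·)) *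
        KLR.e D (Word.append h v w) =
        g.factor (letter j w' l) (letter j w' (l + 1)) • (KLR.tau D (lam.degree + l) (by omega) *
          ((g.nilHecke hν).cross (ls.map (lam.degree + ·)) * KLR.e D (Word.append h v w))) := by
      have h1 : (g.nilHecke hν).cross (ls.map (lam.degree + ·)) * KLR.e D (Word.append h v w) =
          KLR.e D (Word.append h v w') * (g.nilHecke hν).cross (ls.map (lam.degree + ·)) :=
        (g.path_append_right h hm hν hp v).cross_e
      have h2 := g.cross_e (lam.degree + l) (by omega) (Word.append h v w')
      rw [letter_append, letter_append, if_neg (by omega), if_neg (by omega),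
        Nat.add_sub_cancel_left, show lam.degree + l + 1 - lam.degree = l + 1 by omega] at h2
      rw [List.map_cons, cross_cons, mul_assoc, h1, ← mul_assoc, ← mul_assoc, ← smul_mul_assoc,
        ← h2]
      rfl
    have e3 : KLR.e D v ⊗ₜ[k] (KLR.tau D l hlen * ((g.nilHecke hm).cross ls * KLR.e D w)) =
        (1 ⊗ₜ[k] KLR.tau D l hlen) * (KLR.e D v ⊗ₜ[k] ((g.nilHecke hm).cross ls * KLR.e D w)) := by
      rw [Algebra.TensorProduct.tmul_mul_tmul, one_mul]
    rw [e1, e2, TensorProduct.tmul_smul, map_smul, e3, KLR.incMap_mul,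
      KLR.incMap_tau_right h l hlen (by omega), mul_assoc, KLR.corner_mul_incMap, ih]

theorem path_append {ls ls' : List ℕ} {v v' : Word lam} {w w' : Word μ}
    (hp : (g.nilHecke hl).Path ls v v') (hp' : (g.nilHecke hm).Path ls' w w') :
    (g.nilHecke hν).Path (ls ++ ls'.map (lam.degree + ·)) (Word.append h v w)
      (Word.append h v' w') :=
  (g.path_append_right h hm hν hp' v).trans (g.path_append_left h hl hν hp w')

theorem incMap_cross {ls ls' : List ℕ} {v v' : Word lam} {w w' : Word μ}
    (hp : (g.nilHecke hl).Path ls v v') (hp' : (g.nilHecke hm).Path ls' w w') :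
    KLR.incMap D h (((g.nilHecke hl).cross ls * KLR.e D v) ⊗ₜ
      ((g.nilHecke hm).cross ls' * KLR.e D w)) =
      (g.nilHecke hν).cross (ls ++ ls'.map (lam.degree + ·)) * KLR.e D (Word.append h v w) := by
  have h1 : (g.nilHecke hm).cross ls' * KLR.e D w = KLR.e D w' * (g.nilHecke hm).cross ls' :=
    hp'.cross_e
  have e1 : ((g.nilHecke hl).cross ls * KLR.e D v) ⊗ₜ[k] ((g.nilHecke hm).cross ls' * KLR.e D w) =
      (((g.nilHecke hl).cross ls * KLR.e D v) ⊗ₜ[k] KLR.e D w') *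
        (KLR.e D v ⊗ₜ[k] ((g.nilHecke hm).cross ls' * KLR.e D w)) := by
    rw [Algebra.TensorProduct.tmul_mul_tmul, mul_assoc, KLR.e_self, h1, ← mul_assoc, KLR.e_self]
  have h2 : (g.nilHecke hν).cross (ls'.map (lam.degree + ·)) * KLR.e D (Word.append h v w) =
      KLR.e D (Word.append h v w') * (g.nilHecke hν).cross (ls'.map (lam.degree + ·)) :=
    (g.path_append_right h hm hν hp' v).cross_e
  rw [e1, KLR.incMap_mul, g.incMap_cross_left h hl hν hp, g.incMap_cross_right h hm hν hp',
    cross_append, h2, mul_assoc, ← mul_assoc (KLR.e D _), KLR.e_self, ← h2, mul_assoc]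

theorem incMap_dot_left {l : ℕ} (hlt : l < lam.degree) :
    KLR.incMap D h (dot l ⊗ₜ 1) = dot l * KLR.corner D h := by
  have hd := degree_eq h
  rw [dot, dot, dif_pos hlt, dif_pos (by omega), KLR.incMap_y_left]

theorem incMap_dot_right {l : ℕ} (hle : lam.degree ≤ l) :
    KLR.incMap D h (1 ⊗ₜ dot (l - lam.degree)) = dot l * KLR.corner D h := by
  have hd := degree_eq h
  by_cases hlt : l < ν.degree
  · rw [dot, dot, dif_pos hlt, dif_pos (by omega), KLR.incMap_y_right h _ _ (by omega)]
    congr 3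
    omega
  · rw [dot, dot, dif_neg hlt, dif_neg (by omega), TensorProduct.tmul_zero, map_zero, zero_mul]

theorem aut_dot (hfix : Finsupp.mapDomain D.a ν = ν) (l : ℕ) :
    KLR.aut hfix (dot l) = dot l := by
  rw [dot]
  split_ifs
  · rw [KLR.aut_y]
  · rw [map_zero]

end Orbit.Scaling

end

section

/-- A frame for which the condition on the descent datum is checked on a vector. -/
def Frame.ofVector {k : Type u} [Field k] {n : ℕ} {A : FoldedAlg.{u, w} k n} {e v : A.carrier}
    (e_mem : e ∈ A.deg 0) (v_mem : v ∈ A.deg 0) (e_mul_e : e * e = e) (e_mul_v : e * v = v)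
    (v_mul_e : v * A.aut e = v) (hz : ∀ a ∈ A.deg 0, ∃ c : k, e * a * e = c • e) (X : Obj A)
    (y : X.carrier) (hy : y ≠ 0) (hey : e • y = y) (hvy : v • X.σ y = y) : Frame A where
  e := e
  v := v
  e_mem := e_mem
  v_mem := v_mem
  e_mul_e := e_mul_e
  e_mul_v := e_mul_v
  v_mul_e := v_mul_e
  pow_n := by
    have h1 : ∀ t, twistedPow A e v t • (⇑X.σ)^[t] y = y := by
      intro t
      induction t with
      | zero => exact hey
      | succ t ih =>
        rw [twistedPow, Function.iterate_succ_apply', mul_smul, ← X.σ_smul, ih, hvy]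
    have h2 : ∀ t, e * twistedPow A e v t = twistedPow A e v t := by
      intro t
      cases t with
      | zero => exact e_mul_e
      | succ t => rw [twistedPow, ← mul_assoc, e_mul_v]
    have h3 : ∀ t, twistedPow A e v t * (⇑A.aut)^[t] e = twistedPow A e v t := by
      intro t
      induction t with
      | zero => exact e_mul_e
      | succ t ih => rw [twistedPow, Function.iterate_succ_apply', mul_assoc, ← map_mul, ih]
    have h4 : ∀ t, twistedPow A e v t ∈ A.deg 0 := by
      intro t
      induction t with
      | zero => exact e_mem
      | succ t ih =>
        have := A.mul_mem v_mem (A.aut_mem ih)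
        rwa [add_zero] at this
    obtain ⟨c, hc⟩ := hz _ (h4 n)
    have h5 := h3 n
    rw [A.aut_pow] at h5
    rw [h2, h5] at hc
    have h6 := h1 n
    rw [X.σ_pow, hc, smul_assoc, hey] at h6
    rw [hc, smul_left_injective k hy (h6.trans (one_smul k y).symm), one_smul]

theorem Word.nonempty {I : Type*} (ν : I →₀ ℕ) : Nonempty (Word ν) := by
  induction ν using Finsupp.induction_linear with
  | zero =>
    have hd : (0 : I →₀ ℕ).degree = 0 := map_zero _
    have : IsEmpty (Fin (0 : I →₀ ℕ).degree) := by rw [hd]; infer_instance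
    exact ⟨⟨isEmptyElim, by simp⟩⟩
  | add a b ha hb =>
    obtain ⟨v⟩ := ha
    obtain ⟨w⟩ := hb
    exact ⟨v.append rfl w⟩
  | single i c => exact ⟨⟨fun _ => i, by simp⟩⟩

namespace NilHecke

variable {k : Type*} [Field k] {A : Type*} [Ring A] [Algebra k A] {W : Type*} [Fintype W]
  [DecidableEq W] {C : Type*} [DecidableEq C] {H : NilHecke A W C} {deg : ℤ → Submodule k A} {g : ℤ}

/-- For words with distinct letters the idempotents are primitive. -/
theorem IsGraded.idem_eq_e (hH : H.IsGraded deg g) {b : W} (hδ : ∀ i < H.len, H.δ b i = 0) :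
    idem H b = H.e b := by
  have h1 : ∀ α : ℕ → ℕ, (∀ i, α i ≤ H.δ b i) → H.ymon α H.len = 1 := fun α hα => by
    rw [← ymon_zero (H := H) H.len]
    exact ymon_congr fun i hi => Nat.le_zero.1 ((hα i).trans (hδ i hi).le)
  have h2 : idem H b = bottom H b := by rw [idem, h1 _ fun _ => le_rfl, one_mul]
  have h3 : ∀ a ∈ Submodule.span k {z | ∃ α : ℕ → ℕ, (∀ i, α i ≤ H.δ b i) ∧
      ∃ a, z = H.ymon α H.len * (H.e b * H.X H.len * H.e b * a)}, idem H b * a = a := by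
    intro a ha
    induction ha using Submodule.span_induction with
    | zero => simp
    | add a b _ _ ha hb => rw [mul_add, ha, hb]
    | smul c a _ ha => rw [mul_smul_comm, ha]
    | mem z hz =>
      obtain ⟨α, hα, a, rfl⟩ := hz
      rw [h1 α hα, one_mul]
      change idem H b * (bottom H b * a) = bottom H b * a
      rw [← h2, ← mul_assoc, hH.idem_idem]
  have h4 := h3 _ (hH.e_mem_span b le_rfl)
  rwa [idem_e] at h4

end NilHecke

variable {k : Type u} [Field k] {I : Type v} {D : FoldedDatum I k} {ν : I →₀ ℕ}

namespace Orbit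

variable {j : Orbit D}

theorem covers_wt (j : Orbit D) : j.Covers j.wt := fun i hi => by
  classical
  rw [Finsupp.mem_support_iff, wt_apply] at hi
  by_contra h
  exact hi (if_neg h)

theorem covers_nsmul (j : Orbit D) (n : ℕ) : j.Covers (n • j.wt) := fun i hi =>
  j.covers_wt i (Finsupp.support_smul hi)

namespace Scaling

open NilHecke
open scoped Classical

variable (g : Scaling j)

theorem count_degree (hν : j.Covers ν) (w : Word ν) (c : I) :
    (g.nilHecke hν).count w c ν.degree = ν c := by
  conv_rhs => rw [← w.2]
  rw [NilHecke.count, Finset.sum_range, Finsupp.finsetSum_apply]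
  refine Finset.sum_congr rfl fun i _ => ?_
  rw [Finsupp.single_apply]
  change (if letter j w i = c then 1 else 0) = _
  rw [letter_of_lt w i.2]

theorem connected (hν : j.Covers ν) (w w' : Word ν) :
    ∃ ls, (g.nilHecke hν).Path ls w w' := by
  refine (g.nilHecke hν).exists_path (fun v v' h => ?_) (p := ν.degree) le_rfl w w' ?_ fun c => ?_
  · refine Word.ext (funext fun l => ?_)
    have h1 : letter j v l = letter j v' l := h l.1 l.2
    rwa [letter_of_lt v l.2, letter_of_lt v' l.2] at h1
  · intro i hi hi'
    exact absurd hi (not_lt.2 hi')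
  · rw [count_degree, count_degree]

/-- The elements of `NilHecke` in the algebra with its automorphism. -/
abbrev hecke (hν : j.Covers ν) (hfix : Finsupp.mapDomain D.a ν = ν) :
    NilHecke (KLR.folded D ν hfix).carrier (Word ν) I := g.nilHecke hν

variable (j) in
/-- A word whose letters are the elements of the orbit. -/
def word : Word j.wt := (Word.nonempty j.wt).some

/-- Crossings which relate a word to its image under the automorphism. -/
def list : List ℕ := (g.connected j.covers_wt ((word j).relabel D.a j.mapDomain_wt) (word j)).choose

theorem path_list : (g.nilHecke j.covers_wt).Path g.list
    ((word j).relabel D.a j.mapDomain_wt) (word j) :=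
  (g.connected j.covers_wt ((word j).relabel D.a j.mapDomain_wt) (word j)).choose_spec

theorem cross_smul_single {l : ℕ} (h : l + 1 < j.wt.degree) (w : Word j.wt) :
    g.op (g.cross l) (Finsupp.single w 1) = Finsupp.single (swap l w) 1 := by
  have h1 : g.op (g.cross l) (Finsupp.single w 1) =
      g.op (g.cross l * KLR.e D w) (Finsupp.single w 1) := by
    rw [map_mul, Module.End.mul_apply, g.op_e, opE_single, if_pos rfl]
  have hne := j.letter_ne w (l := ⟨l, by omega⟩) (m := ⟨l + 1, h⟩)
    (Fin.ne_of_val_ne (by dsimp; omega))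
  rw [h1, g.cross_e l h, map_smul, map_mul, LinearMap.smul_apply, Module.End.mul_apply, g.op_e,
    opE_single, if_pos rfl, g.op_tau, opT_single, letter_of_lt w (by omega : l < _),
    letter_of_lt w h, factor, if_neg hne, Finsupp.smul_single, one_mul, smul_eq_mul,
    inv_mul_cancel₀ (g.γ_ne (j.letter_mem _ _) (j.letter_mem _ _) hne), swap_of_lt h]

theorem path_smul_single {ls : List ℕ} {w w' : Word j.wt}
    (hp : (g.nilHecke j.covers_wt).Path ls w w') :
    g.op ((g.nilHecke j.covers_wt).cross ls) (Finsupp.single w 1) = Finsupp.single w' 1 := by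
  induction hp with
  | nil w => rw [NilHecke.cross, List.map_nil, List.prod_nil, map_one]; rfl
  | cons hp hlen hne ih =>
    rw [cross_cons, map_mul, Module.End.mul_apply, ih]
    exact g.cross_smul_single hlen _

theorem e_mul_cross_list : KLR.e D (word j) * ((g.nilHecke j.covers_wt).cross g.list *
    KLR.e D ((word j).relabel D.a j.mapDomain_wt)) =
    (g.nilHecke j.covers_wt).cross g.list * KLR.e D ((word j).relabel D.a j.mapDomain_wt) := by
  have h : (g.nilHecke j.covers_wt).cross g.list * KLR.e D _ = KLR.e D _ * _ := g.path_list.cross_e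
  rw [h, ← mul_assoc, KLR.e_self]

theorem cross_list_mul_aut : (g.nilHecke j.covers_wt).cross g.list *
    KLR.e D ((word j).relabel D.a j.mapDomain_wt) * KLR.aut j.mapDomain_wt (KLR.e D (word j)) =
    (g.nilHecke j.covers_wt).cross g.list * KLR.e D ((word j).relabel D.a j.mapDomain_wt) := by
  rw [KLR.aut_e, mul_assoc, KLR.e_self]

theorem δ_word (i : ℕ) (hi : i < j.wt.degree) : (g.nilHecke j.covers_wt).δ (word j) i = 0 := by
  rw [NilHecke.δ, NilHecke.count]
  refine Finset.sum_eq_zero fun i' hi' => if_neg ?_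
  rw [Finset.mem_range] at hi'
  change letter j _ _ ≠ letter j _ _
  rw [letter_of_lt _ hi, letter_of_lt _ (hi'.trans hi)]
  exact j.letter_ne _ (Fin.ne_of_val_ne hi'.ne)

/-- The idempotent of a word with distinct letters and its descent datum. -/
def simpleFrame : Frame (KLR.folded D j.wt j.mapDomain_wt) :=
  Frame.ofVector (e := KLR.e D (word j))
    (v := (g.nilHecke j.covers_wt).cross g.list * KLR.e D ((word j).relabel D.a j.mapDomain_wt))
    ((g.isGraded j.covers_wt).e_mem (word j))
    (g.path_list.cross_mem (g.isGraded j.covers_wt))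
    (KLR.e_self _)
    g.e_mul_cross_list
    g.cross_list_mul_aut
    (fun a ha => by
      have h1 : IsGraded.idem (g.nilHecke j.covers_wt) (word j) = KLR.e D (word j) :=
        (g.isGraded j.covers_wt).idem_eq_e g.δ_word
      obtain ⟨c, hc⟩ := (g.isGraded j.covers_wt).exists_idem_mul_e (word j) ha
      rw [h1] at hc
      exact ⟨c, hc⟩)
    g.simple (Finsupp.single (word j) 1) (Finsupp.single_ne_zero.2 one_ne_zero)
    (by
      change g.op _ _ = _
      rw [g.op_e, opE_single, if_pos rfl])
    (by
      change g.op _ (sig _) = _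
      rw [sig_single, map_mul, Module.End.mul_apply, g.op_e, opE_single, if_pos rfl,
        g.path_smul_single g.path_list])

theorem isFrame_simpleFrame :
    (g.hecke j.covers_wt j.mapDomain_wt).IsFrame j.size g.simpleFrame (word j) g.list where
  graded := g.isGraded j.covers_wt
  aut_y l := aut_dot _ l
  e_eq := rfl
  exists_path := ⟨_, g.path_list, rfl⟩

theorem isTop_simple : (g.hecke j.covers_wt j.mapDomain_wt).IsTop g.simpleFrame (word j) g.simple 0
    (Finsupp.single (word j) 1 : Word j.wt →₀ k) where
  ne := Finsupp.single_ne_zero.2 one_ne_zero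
  mem := by
    have h : (⊤ : Submodule k (Word j.wt →₀ k)) ≤ if (0 : ℤ) = 0 then ⊤ else ⊥ :=
      (if_pos rfl).ge
    exact h trivial
  e_x := by
    change g.op _ _ = _
    rw [show (g.hecke j.covers_wt j.mapDomain_wt).e (word j) = KLR.e D (word j) from rfl, g.op_e,
      opE_single, if_pos rfl]
  y_x l := by
    change g.op (dot l) _ = 0
    rw [dot]
    split_ifs
    · rw [g.op_y]; rfl
    · rw [map_zero]; rfl
  ψ_x := by
    change g.op ((g.nilHecke j.covers_wt).cross g.list * KLR.e D _) (sig _) = _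
    rw [sig_single, map_mul, Module.End.mul_apply, g.op_e, opE_single, if_pos rfl,
      g.path_smul_single g.path_list]
  gen y := by
    change ∃ a : KLR D j.wt, y = g.op a (Finsupp.single (word j) 1)
    change Word j.wt →₀ k at y
    induction y using Finsupp.induction_linear with
    | zero => exact ⟨0, by rw [map_zero]; rfl⟩
    | add a b ha hb =>
      obtain ⟨a', rfl⟩ := ha
      obtain ⟨b', rfl⟩ := hb
      exact ⟨a' + b', by rw [map_add]; rfl⟩
    | single w c =>
      obtain ⟨ls, hls⟩ := g.connected j.covers_wt (word j) w
      refine ⟨c • (g.nilHecke j.covers_wt).cross ls, ?_⟩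
      rw [map_smul, LinearMap.smul_apply, g.path_smul_single hls, Finsupp.smul_single, smul_eq_mul,
        mul_one]

end Scaling

end Orbit

end

section

section Core

variable {k : Type u} [Field k] {n : ℕ} {A B : FoldedAlg.{u, w} k n}

/-- A nonzero primitive idempotent has a simple object. -/
theorem Core.exists_cover (F : Core A) (hn : (n : k) ≠ 0) {ω : k} (hω : IsPrimitiveRoot ω n)
    (he : F.e ≠ 0) : ∃ Y : Obj A, Nonempty (Cover F Y 0) := by
  have hn0 : n ≠ 0 := by rintro rfl; simp at hn
  let R := F.toFrame.rep hn0 0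
  have hz0 : R.z ≠ 0 := by
    obtain ⟨f, hf⟩ := R.exists_map (Obj.regular A) F.e F.e_mul_e
    intro h
    rw [h, map_zero] at hf
    exact he hf.symm
  have hlow : ∀ (x : (F.proj hn0 0).carrier), ∀ c < 0,
      F.e • component (F.proj hn0 0).internal c x = 0 := by
    intro x c hc
    obtain ⟨a, rfl⟩ := R.gen x
    refine homogeneous_induction A.internal
      (p := fun a => F.e • component (F.proj hn0 0).internal c (a • R.z) = 0) (by simp) ?_ ?_ a
    · intro d a ha
      have h1 := (F.proj hn0 0).smul_mem ha R.z_mem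
      rw [add_zero] at h1
      by_cases hd : c = d
      · rw [hd, component_of_mem _ h1, ← R.e_z, smul_smul, smul_smul,
          F.neg d (by omega) a ha, zero_smul]
      · rw [component_of_mem_ne _ h1 (Ne.symm hd), smul_zero]
    · intro a b ha hb
      rw [add_smul, map_add, smul_add, ha, hb, add_zero]
  have hy := R.eig_z ω
  obtain ⟨Y, p, -, hpy, hspan⟩ := F.exists_quotient hn hω hy hz0 hlow
  refine ⟨Y, ⟨p.map R.z, p.map_mem R.z_mem, hpy, ?_, ?_, hspan⟩⟩
  · rw [← map_smul, R.e_z]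
  · rw [← p.map_σ, ← map_smul, R.ψ_z]

theorem Frame.eq_of_e_v {E E' : Frame A} (h : E.e = E'.e) (h' : E.v = E'.v) : E = E' := by
  cases E; cases E'; cases h; cases h'; rfl

end Core

namespace NilHecke

section Path

variable {A : Type*} [Ring A] {W : Type*} [Fintype W] [DecidableEq W] {C : Type*} [DecidableEq C]
  {H : NilHecke A W C} {ls : List ℕ} {w v w' : W}

theorem Path.unique (h : H.Path ls w w') (h' : H.Path ls v w') : w = v := by
  induction h generalizing v with
  | nil w => cases h'; rfl
  | @cons ls w w' l h hl hne ih =>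
    generalize hu : H.sw l w' = u at h'
    cases h' with
    | @cons _ _ v' _ h' hl' hne' =>
      have h1 := congrArg (H.sw l) hu
      rw [H.sw_sw _ _ hl, H.sw_sw _ _ hl] at h1
      subst h1
      exact ih h'

end Path

variable {k : Type u} [Field k] {n : ℕ} {A : FoldedAlg.{u, w} k n} {W : Type v} [Fintype W]
  [DecidableEq W] {C : Type v} [DecidableEq C] {H : NilHecke A.carrier W C} {g : ℤ} {E E' : Frame A}
  {b : W} {ls : List ℕ}

theorem IsFrame.unique (h : H.IsFrame g E b ls) (h' : H.IsFrame g E' b ls) : E = E' := by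
  obtain ⟨v, hv, e⟩ := h.exists_path
  obtain ⟨v', hv', e'⟩ := h'.exists_path
  obtain rfl := hv.unique hv'
  exact Frame.eq_of_e_v (h.e_eq.trans h'.e_eq.symm) (e.trans e'.symm)

theorem IsTop.shift {X : Obj A} {s : ℤ} {x : X.carrier} (h : H.IsTop E b X s x) (t : ℤ) :
    H.IsTop E b (X.shift t) (s + t) x where
  ne := h.ne
  mem := by
    change x ∈ X.deg (s + t - t)
    rw [add_sub_cancel_right]
    exact h.mem
  e_x := h.e_x
  y_x := h.y_x
  ψ_x := h.ψ_x
  gen := h.gen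

end NilHecke

variable {k : Type u} [Field k] {I : Type v} {D : FoldedDatum I k} {lam μ ν : I →₀ ℕ}

namespace Orbit.Scaling

open NilHecke
open scoped Classical

variable {j : Orbit D} (g : Scaling j) (h : lam + μ = ν) (hl : j.Covers lam) (hm : j.Covers μ)
  (hν : j.Covers ν) (fl : Finsupp.mapDomain D.a lam = lam) (fm : Finsupp.mapDomain D.a μ = μ)
  (fν : Finsupp.mapDomain D.a ν = ν)
  {F : Frame (KLR.folded D lam fl)} {G : Frame (KLR.folded D μ fm)} {b : Word lam} {b' : Word μ}
  {ls ls' : List ℕ}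

theorem isFrame_map (hF : (g.hecke hl fl).IsFrame j.size F b ls)
    (hG : (g.hecke hm fm).IsFrame j.size G b' ls') :
    (g.hecke hν fν).IsFrame j.size ((F.tensor G).map (KLR.inclusion D h fl fm fν))
      (Word.append h b b') (ls ++ ls'.map (lam.degree + ·)) where
  graded := g.isGraded hν
  aut_y l := aut_dot fν l
  e_eq := by
    change KLR.incMap D h (F.e ⊗ₜ G.e) = _
    rw [hF.e_eq, hG.e_eq]
    exact KLR.incMap_e h b b'
  exists_path := by
    obtain ⟨v, hv, e⟩ := hF.exists_path
    obtain ⟨v', hv', e'⟩ := hG.exists_path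
    refine ⟨Word.append h v v', g.path_append h hl hm hν hv hv', ?_⟩
    change KLR.incMap D h (F.v ⊗ₜ G.v) = _
    rw [e, e']
    exact g.incMap_cross h hl hm hν hv hv'

theorem dot_smul_unit (Z : Obj ((KLR.folded D lam fl).tensor (KLR.folded D μ fm))) (l : ℕ)
    (z : Z.carrier) : (g.hecke hν fν).y l • (KLR.inclusion D h fl fm fν).unit Z z =
      (KLR.inclusion D h fl fm fν).unit Z ((if l < lam.degree then
        tmul ((g.hecke hl fl).y l) 1 else tmul 1 ((g.hecke hm fm).y (l - lam.degree))) • z) := by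
  have h1 : (KLR.inclusion D h fl fm fν).unit Z z =
      (KLR.inclusion D h fl fm fν).map 1 • (KLR.inclusion D h fl fm fν).unit Z z := by
    rw [CornerHom.map_smul_unit, one_smul]
  have h2 : (KLR.inclusion D h fl fm fν).map (if l < lam.degree then
        tmul ((g.hecke hl fl).y l) 1 else tmul 1 ((g.hecke hm fm).y (l - lam.degree))) =
      (g.hecke hν fν).y l * (KLR.inclusion D h fl fm fν).map 1 := by
    have h3 : (KLR.inclusion D h fl fm fν).map 1 = KLR.corner D h := KLR.incMap_one h
    rw [h3]
    split_ifs with c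
    · exact incMap_dot_left h c
    · exact incMap_dot_right h (by omega)
  rw [h1, ← mul_smul, ← h2, CornerHom.map_smul_unit]

/-- The vector which generates an induced object. -/
theorem isTop_ind [Infinite k] (hn : (D.order : k) ≠ 0) {ω : k} (hω : IsPrimitiveRoot ω D.order)
    (hF : (g.hecke hl fl).IsFrame j.size F b ls) (hG : (g.hecke hm fm).IsFrame j.size G b' ls')
    {X : Obj (KLR.folded D lam fl)} {Y : Obj (KLR.folded D μ fm)} {s s' : ℤ} {x : X.carrier}
    {y : Y.carrier} (hx : (g.hecke hl fl).IsTop F b X s x)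
    (hy : (g.hecke hm fm).IsTop G b' Y s' y) :
    (g.hecke hν fν).IsTop ((F.tensor G).map (KLR.inclusion D h fl fm fν)) (Word.append h b b')
      ((KLR.inclusion D h fl fm fν).ind (X.tensor Y)) (s + s')
      ((KLR.inclusion D h fl fm fν).unit (X.tensor Y) (Obj.tmul x y)) := by
  have hE := g.isFrame_map h hl hm hν fl fm fν hF hG
  have e_smul : (F.tensor G).e • Obj.tmul x y = Obj.tmul x y := by
    refine (tmul_smul_tmul F.e G.e x y).trans ?_
    rw [hF.e_eq, hG.e_eq, hx.e_x, hy.e_x]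
  refine ⟨?_, ?_, ?_, ?_, ?_, ?_⟩
  · let K := hE.core (g.connected hν (Word.append h b b'))
    obtain ⟨Z, ⟨C⟩⟩ := K.exists_cover hn hω
      ((g.isGraded hν).idem_ne_zero (g.e_ne_zero hν (Word.append h b b')))
    let C' := (hF.cover hx (g.connected hl b)).tensor (hG.cover hy (g.connected hm b'))
    have hK : K.e = (KLR.inclusion D h fl fm fν).map (F.tensor G).e * K.e := by
      have : (KLR.inclusion D h fl fm fν).map (F.tensor G).e = (g.hecke hν fν).e _ := hE.e_eq
      rw [this]
      exact (IsGraded.e_idem _).symm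
    have hfix : (KLR.inclusion D h fl fm fν).map 1 • C.x = C.x := by
      have h1 := C.e_x
      rw [hK, mul_smul] at h1
      rw [← h1, ← mul_smul, ← CornerHom.map_mul, one_mul]
    have : Nontrivial ((KLR.inclusion D h fl fm fν).res Z).carrier :=
      ⟨⟨C.x, hfix⟩, 0, fun h0 => C.x_ne (congrArg Subtype.val h0)⟩
    obtain ⟨d, i, f, hf⟩ := C'.exists_injective hn hω
      ((KLR.inclusion D h fl fm fν).isFinDim_res C.isFinDim)
    have h2 := (KLR.inclusion D h fl fm fν).frobenius_unit f C'.x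
    intro h0
    have h3 : (KLR.inclusion D h fl fm fν).unit ((X.tensor Y).ts hω.pow_eq_one d i) C'.x = 0 := h0
    rw [h3, map_zero] at h2
    have h4 : f.map C'.x = 0 := Subtype.ext h2.symm
    exact C'.x_ne (hf (h4.trans (map_zero f.map).symm))
  · exact CornerHom.unit_mem _ (Obj.tmul_mem hx.mem hy.mem)
  · rw [← hE.e_eq]
    refine (CornerHom.map_smul_unit _ _ _).trans (congrArg _ e_smul)
  · intro l
    rw [g.dot_smul_unit h hl hm hν fl fm fν]
    split_ifs
    · rw [tmul_smul_tmul, hx.y_x]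
      exact (congrArg _ (TensorProduct.zero_tmul _ _)).trans (map_zero _)
    · rw [tmul_smul_tmul, hy.y_x]
      exact (congrArg _ (TensorProduct.tmul_zero _ _)).trans (map_zero _)
  · rw [CornerHom.σ_unit]
    refine (CornerHom.map_smul_unit _ _ _).trans (congrArg _ ?_)
    refine (tmul_smul_tmul F.v G.v (X.σ x) (Y.σ y)).trans ?_
    rw [hx.ψ_x, hy.ψ_x]
  · intro z
    refine CornerHom.ind_induction _ (p := fun z => ∃ a, z = a • _) ⟨0, by rw [zero_smul]⟩
      (fun a z => ?_) ?_ z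
    · obtain ⟨c, rfl⟩ : ∃ c : ((KLR.folded D lam fl).tensor (KLR.folded D μ fm)).carrier,
          z = c • Obj.tmul x y := by
        refine Obj.tensor_induction (p := fun z =>
          ∃ c : ((KLR.folded D lam fl).tensor (KLR.folded D μ fm)).carrier, z = c • Obj.tmul x y)
          ⟨0, by rw [zero_smul]⟩ (fun x' y' => ?_) ?_ z
        · obtain ⟨a, rfl⟩ := hx.gen x'
          obtain ⟨a', rfl⟩ := hy.gen y'
          exact ⟨tmul a a', (tmul_smul_tmul a a' x y).symm⟩
        · rintro _ _ ⟨c, rfl⟩ ⟨c', rfl⟩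
          exact ⟨c + c', by rw [add_smul]⟩
      exact ⟨a * (KLR.inclusion D h fl fm fν).map c, by
        rw [mul_smul, CornerHom.map_smul_unit]⟩
    · rintro _ _ ⟨c, rfl⟩ ⟨c', rfl⟩
      exact ⟨c + c', by rw [add_smul]⟩

end Orbit.Scaling

end

section

theorem NilHecke.Path.mem_lt {A : Type*} [Ring A] {W : Type*} [Fintype W] [DecidableEq W]
    {C : Type*} [DecidableEq C] {H : NilHecke A W C} {ls : List ℕ} {w w' : W}
    (h : H.Path ls w w') : ∀ l ∈ ls, l + 1 < H.len := by
  induction h with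
  | nil w => simp
  | cons h hl hne ih =>
    intro m hm
    rcases List.mem_cons.1 hm with rfl | hm
    · exact hl
    · exact ih m hm

variable {k : Type u} [Field k] {I : Type v} {D : FoldedDatum I k}

namespace Orbit

variable (j : Orbit D)

theorem degree_nsmul (n : ℕ) : (n • j.wt).degree = n * j.wt.degree := by
  rw [map_nsmul, smul_eq_mul]

theorem degree_wt_pos : 0 < j.wt.degree := by
  classical
  rw [Nat.pos_iff_ne_zero, Ne, Finsupp.degree_eq_zero_iff]
  intro h
  have := DFunLike.congr_fun h j.base
  rw [wt_apply, if_pos j.base_mem] at this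
  exact one_ne_zero this

instance : Subsingleton (Word (0 • j.wt)) := by
  refine ⟨fun w w' => Word.ext (funext fun l => ?_)⟩
  have := l.2.trans_eq ((j.degree_nsmul 0).trans (zero_mul _))
  omega

namespace Scaling

open NilHecke
open scoped Classical

variable {j} (g : Scaling j)

variable (j) in
/-- The concatenation of copies of the chosen word. -/
def powWord : (n : ℕ) → Word (n • j.wt)
  | 0 => (Word.nonempty _).some
  | n + 1 => Word.append (succ_nsmul j.wt n).symm (powWord n) (word j)

/-- Crossings which relate the concatenation to its image under the automorphism. -/
def powList : ℕ → List ℕ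
  | 0 => []
  | n + 1 => powList n ++ g.list.map ((n • j.wt).degree + ·)

/-- The idempotents of the concatenations with their descent data. -/
def powFrame : (n : ℕ) → Frame (j.alg n)
  | 0 =>
    { e := 1
      v := 1
      e_mem := (j.alg 0).one_mem
      v_mem := (j.alg 0).one_mem
      e_mul_e := mul_one 1
      e_mul_v := mul_one 1
      v_mul_e := by rw [map_one, mul_one]
      pow_n := by
        have : ∀ t, twistedPow (j.alg 0) 1 1 t = 1 := by
          intro t
          induction t with
          | zero => rfl
          | succ t ih => rw [twistedPow, ih, map_one, mul_one]
        exact this _ }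
  | n + 1 => ((powFrame n).tensor g.simpleFrame).map (KLR.inclusion D (succ_nsmul j.wt n).symm
      (j.mapDomain_nsmul n) j.mapDomain_wt (j.mapDomain_nsmul (n + 1)))

/-- The generators of the powers of `L(j)`. -/
def powVec : (n : ℕ) → (g.power n).carrier
  | 0 => (1 : (j.alg 0).carrier)
  | n + 1 => (KLR.inclusion D (succ_nsmul j.wt n).symm (j.mapDomain_nsmul n) j.mapDomain_wt
      (j.mapDomain_nsmul (n + 1))).unit ((g.power n).tensor g.simple)
      (Obj.tmul (powVec n) (Finsupp.single (word j) 1 : Word j.wt →₀ k))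

theorem e_powWord_zero : KLR.e D (powWord j 0) = 1 := by
  rw [← KLR.e_sum, Finset.sum_eq_single (powWord j 0)]
  · intro w _ hw
    exact absurd (Subsingleton.elim _ _) hw
  · simp

theorem dot_zero (l : ℕ) : (dot l : KLR D (0 • j.wt)) = 0 := by
  rw [dot, dif_neg]
  rw [degree_nsmul]
  omega

theorem path_powList (n : ℕ) : (g.nilHecke (j.covers_nsmul n)).Path (g.powList n)
    ((powWord j n).relabel D.a (j.mapDomain_nsmul n)) (powWord j n) := by
  induction n with
  | zero =>
    rw [Subsingleton.elim ((powWord j 0).relabel D.a (j.mapDomain_nsmul 0)) (powWord j 0)]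
    exact Path.nil _
  | succ n ih =>
    have := g.path_append (succ_nsmul j.wt n).symm (j.covers_nsmul n) j.covers_wt
      (j.covers_nsmul (n + 1)) ih g.path_list
    rw [← Word.relabel_append] at this
    exact this

theorem isFrame_powFrame (n : ℕ) :
    (g.hecke (j.covers_nsmul n) (j.mapDomain_nsmul n)).IsFrame j.size (g.powFrame n) (powWord j n)
      (g.powList n) := by
  induction n with
  | zero => exact
    { graded := g.isGraded _
      aut_y := fun l => aut_dot _ l
      e_eq := e_powWord_zero.symm
      exists_path := ⟨powWord j 0, Path.nil _, by
        change (1 : KLR D (0 • j.wt)) = NilHecke.cross _ [] * KLR.e D (powWord j 0)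
        rw [e_powWord_zero, mul_one]
        rfl⟩ }
  | succ n ih =>
    exact g.isFrame_map (succ_nsmul j.wt n).symm (j.covers_nsmul n) j.covers_wt
      (j.covers_nsmul (n + 1)) (j.mapDomain_nsmul n) j.mapDomain_wt (j.mapDomain_nsmul (n + 1)) ih
      g.isFrame_simpleFrame

theorem isTop_power [Infinite k] (hn : (D.order : k) ≠ 0) {ω : k}
    (hω : IsPrimitiveRoot ω D.order) (n : ℕ) :
    (g.hecke (j.covers_nsmul n) (j.mapDomain_nsmul n)).IsTop (g.powFrame n) (powWord j n)
      (g.power n) 0 (g.powVec n) := by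
  induction n with
  | zero => exact
    { ne := fun h => g.e_ne_zero (j.covers_nsmul 0) (powWord j 0) (e_powWord_zero.trans h)
      mem := (j.alg 0).one_mem
      e_x := (mul_one (KLR.e D (powWord j 0))).trans e_powWord_zero
      y_x := fun l => (mul_one (dot l : KLR D (0 • j.wt))).trans (dot_zero l)
      ψ_x := (one_mul (KLR.aut (j.mapDomain_nsmul 0) (1 : KLR D (0 • j.wt)))).trans
        (map_one (KLR.aut (j.mapDomain_nsmul 0)))
      gen := fun (y : KLR D (0 • j.wt)) => ⟨y, (mul_one y).symm⟩ }
  | succ n ih =>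
    have := g.isTop_ind (succ_nsmul j.wt n).symm (j.covers_nsmul n) j.covers_wt
      (j.covers_nsmul (n + 1)) (j.mapDomain_nsmul n) j.mapDomain_wt (j.mapDomain_nsmul (n + 1))
      hn hω (g.isFrame_powFrame n) g.isFrame_simpleFrame ih g.isTop_simple
    rw [add_zero] at this
    exact this

theorem isTop_L [Infinite k] (hn : (D.order : k) ≠ 0) {ω : k}
    (hω : IsPrimitiveRoot ω D.order) (n : ℕ) :
    (g.hecke (j.covers_nsmul n) (j.mapDomain_nsmul n)).IsTop (g.powFrame n) (powWord j n)
      (g.L n) (j.d * n.choose 2) (g.powVec n) := by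
  have := (g.isTop_power hn hω n).shift (j.d * n.choose 2)
  rw [zero_add] at this
  exact this

/-- The primitive idempotents of the algebras of one colour. -/
def core (n : ℕ) : Core (j.alg n) :=
  (g.isFrame_powFrame n).core (g.connected (j.covers_nsmul n) (powWord j n))

/-- The objects `L(j^n)` are simple. -/
def cover [Infinite k] (hn : (D.order : k) ≠ 0) {ω : k} (hω : IsPrimitiveRoot ω D.order) (n : ℕ) :
    Cover (g.core n) (g.L n) (j.d * n.choose 2) :=
  (g.isFrame_powFrame n).cover (g.isTop_L hn hω n) _

theorem letter_powWord {n l : ℕ} (h : l < n * j.wt.degree) :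
    letter j (powWord j n) l = letter j (word j) (l % j.wt.degree) := by
  induction n with
  | zero => omega
  | succ n ih =>
    rw [powWord, letter_append, degree_nsmul]
    split_ifs with c
    · exact ih c
    · congr 1
      rw [add_mul, one_mul] at h
      rw [show l % j.wt.degree = (l - n * j.wt.degree) % j.wt.degree by
        conv_lhs => rw [show l = l - n * j.wt.degree + n * j.wt.degree by omega]
        rw [Nat.add_mul_mod_self_right]]
      rw [Nat.mod_eq_of_lt (by omega)]

theorem append_powWord {a b s : ℕ} (h : a + b = s) :
    Word.append (by rw [← h, add_nsmul]) (powWord j a) (powWord j b) = powWord j s := by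
  have hs := j.degree_nsmul s
  have ha := j.degree_nsmul a
  have hb := j.degree_nsmul b
  have e : s * j.wt.degree = a * j.wt.degree + b * j.wt.degree := by rw [← h, add_mul]
  refine Word.ext (funext fun l => ?_)
  rw [← letter_of_lt (j := j) _ l.2, ← letter_of_lt (j := j) _ l.2, letter_append]
  have hl := l.2.trans_eq hs
  rw [letter_powWord hl]
  split_ifs with c
  · rw [letter_powWord (by omega)]
  · rw [letter_powWord (by omega), ha]
    congr 1
    conv_rhs => rw [show l.1 = l.1 - a * j.wt.degree + a * j.wt.degree by omega]
    rw [Nat.add_mul_mod_self_right]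

theorem powList_add (a b : ℕ) :
    g.powList (a + b) = g.powList a ++ (g.powList b).map ((a • j.wt).degree + ·) := by
  induction b with
  | zero => simp [powList]
  | succ b ih =>
    rw [← add_assoc, powList, ih, powList, List.map_append, List.map_map, List.append_assoc]
    congr 2
    refine List.map_congr_left fun l _ => ?_
    simp only [Function.comp_apply, degree_nsmul]
    ring

theorem powFrame_map {a b s : ℕ} (h : a + b = s) :
    ((g.powFrame a).tensor (g.powFrame b)).map (j.inclusion h) = g.powFrame s := by
  have h1 := g.isFrame_map (by rw [← h, add_nsmul]) (j.covers_nsmul a) (j.covers_nsmul b)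
    (j.covers_nsmul s) (j.mapDomain_nsmul a) (j.mapDomain_nsmul b) (j.mapDomain_nsmul s)
    (g.isFrame_powFrame a) (g.isFrame_powFrame b)
  rw [append_powWord h, ← powList_add] at h1
  subst h
  exact h1.unique (g.isFrame_powFrame _)

end Scaling

end Orbit

end

section

open LaurentPolynomial (T)

section QuantumIntegers

variable (O : Type) [CommRing O]

theorem qint_eq_sum (d : ℤ) (m : ℕ) : qint O d (m + 1) =
    ∑ t ∈ Finset.range (m + 1), T (d * (2 * t - m)) := by
  rw [qint, ← Finset.sum_range_reflect]
  refine Finset.sum_congr rfl fun t ht => ?_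
  rw [Finset.mem_range] at ht
  congr 2
  rw [Nat.cast_sub (by omega), Nat.cast_sub (by omega)]
  push_cast
  ring

theorem T_sum {ι : Type*} (s : Finset ι) (f : ι → ℤ) :
    (T (∑ i ∈ s, f i) : O[T;T⁻¹]) = ∏ i ∈ s, T (f i) := by
  classical
  induction s using Finset.induction_on with
  | empty => simp
  | insert a s ha ih => rw [Finset.sum_insert ha, Finset.prod_insert ha, LaurentPolynomial.T_add, ih]

theorem qfac_eq_sum (d : ℤ) (n : ℕ) : qfac O d n =
    ∑ f ∈ Fintype.piFinset fun q : Fin n => Finset.range (q + 1),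
      T (∑ q : Fin n, d * (2 * f q - (q : ℕ))) := by
  rw [qfac, Finset.prod_range]
  simp only [qint_eq_sum, T_sum]
  exact Finset.prod_univ_sum _ _

end QuantumIntegers

theorem sum_range_mul_div {M : Type*} [AddCommMonoid M] {r : ℕ} (hr : 0 < r) (F : ℕ → M) (n : ℕ) :
    ∑ i ∈ Finset.range (n * r), F (i / r) = r • ∑ q ∈ Finset.range n, F q := by
  induction n with
  | zero => simp
  | succ n ih =>
    rw [add_mul, one_mul, Finset.sum_range_add, ih, Finset.sum_range_succ, smul_add]
    congr 1
    rw [Finset.sum_congr rfl fun i hi => ?_, Finset.sum_const, Finset.card_range]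
    rw [mul_comm, Nat.mul_add_div hr, Nat.div_eq_of_lt (Finset.mem_range.1 hi), add_zero]

theorem sum_ite_mod_eq {r : ℕ} (hr : 0 < r) (l : ℕ) :
    ∑ i ∈ Finset.range l, (if i % r = l % r then 1 else 0) = l / r := by
  have h := Nat.count_modEq_card l hr l
  rw [if_neg (lt_irrefl _), add_zero, Nat.count_eq_card_filter_range, Finset.card_filter] at h
  exact h

variable {k : Type u} [Field k] {I : Type v} {D : FoldedDatum I k}

namespace Orbit

variable {j : Orbit D}

variable (j) in
theorem size_mul_degree : j.size * j.wt.degree = 2 * j.d := by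
  have h1 : ∑ i ∈ j.carrier, ∑ i' ∈ j.carrier, D.form i i' = j.carrier.card * j.size := by
    rw [← nsmul_eq_mul, ← Finset.sum_const]
    refine Finset.sum_congr rfl fun i hi => ?_
    rw [Finset.sum_eq_single_of_mem i hi fun i' hi' hne => form_ne hi hi' hne.symm, form_self hi]
  have h2 : j.wt.degree = j.carrier.card := by
    rw [wt, map_sum]
    simp
  obtain ⟨c, hc⟩ := (D.diag j.base).2
  have h3 : j.size = 2 * c := by rw [size, hc, two_mul]
  rw [d, h1, h2, h3, show (j.carrier.card : ℤ) * (2 * c) = 2 * (j.carrier.card * c) by ring,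
    Int.mul_ediv_cancel_left _ two_ne_zero]
  ring

namespace Scaling

open NilHecke
open scoped Classical

variable (g : Scaling j)

theorem letter_word_injective {l m : ℕ} (hl : l < j.wt.degree) (hm : m < j.wt.degree)
    (h : letter j (word j) l = letter j (word j) m) : l = m := by
  rw [letter_of_lt _ hl, letter_of_lt _ hm] at h
  by_contra hne
  exact j.letter_ne _ (Fin.ne_of_val_ne hne) h

theorem letter_powWord_eq_iff {n l m : ℕ} (hl : l < n * j.wt.degree) (hm : m < n * j.wt.degree) :
    letter j (powWord j n) l = letter j (powWord j n) m ↔ l % j.wt.degree = m % j.wt.degree := by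
  rw [letter_powWord hl, letter_powWord hm]
  exact ⟨letter_word_injective (Nat.mod_lt _ j.degree_wt_pos) (Nat.mod_lt _ j.degree_wt_pos),
    fun h => by rw [h]⟩

theorem δ_powWord {n l : ℕ} (hl : l < n * j.wt.degree) :
    (g.nilHecke (j.covers_nsmul n)).δ (powWord j n) l = l / j.wt.degree := by
  rw [NilHecke.δ, NilHecke.count, ← sum_ite_mod_eq j.degree_wt_pos]
  refine Finset.sum_congr rfl fun i hi => if_congr ?_ rfl rfl
  exact letter_powWord_eq_iff ((Finset.mem_range.1 hi).trans hl) hl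

theorem powList_div (n : ℕ) :
    ∀ l ∈ g.powList n, l / j.wt.degree = (l + 1) / j.wt.degree := by
  induction n with
  | zero => simp [powList]
  | succ n ih =>
    intro l hl
    rw [powList, List.mem_append, List.mem_map] at hl
    rcases hl with hl | ⟨m, hm, rfl⟩
    · exact ih l hl
    · have hm' : m + 1 < j.wt.degree := g.path_list.mem_lt m hm
      rw [degree_nsmul, add_assoc, mul_comm, Nat.mul_add_div j.degree_wt_pos,
        Nat.mul_add_div j.degree_wt_pos, Nat.div_eq_of_lt hm', Nat.div_eq_of_lt (by omega)]

theorem placePerm_powList_div (n i : ℕ) :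
    placePerm (g.powList n) i / j.wt.degree = i / j.wt.degree :=
  placePerm_div (g.powList_div n) i

theorem placePerm_powList_lt_iff (n i : ℕ) :
    placePerm (g.powList n) i < n * j.wt.degree ↔ i < n * j.wt.degree := by
  have h := (g.path_powList n).placePerm_lt_iff i
  have e : (g.nilHecke (j.covers_nsmul n)).len = n * j.wt.degree := j.degree_nsmul n
  rwa [e] at h

theorem bound_powWord (n i : ℕ) :
    IsFrame.bound (g.hecke (j.covers_nsmul n) (j.mapDomain_nsmul n)) (powWord j n) i =
      if i < n * j.wt.degree then i / j.wt.degree else 0 := by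
  rw [IsFrame.bound_apply]
  have e : (g.hecke (j.covers_nsmul n) (j.mapDomain_nsmul n)).len = n * j.wt.degree :=
    j.degree_nsmul n
  rw [e]
  split_ifs with h
  · exact g.δ_powWord h
  · rfl

theorem bound_placePerm (n i : ℕ) :
    IsFrame.bound (g.hecke (j.covers_nsmul n) (j.mapDomain_nsmul n)) (powWord j n)
        (placePerm (g.powList n) i) =
      IsFrame.bound (g.hecke (j.covers_nsmul n) (j.mapDomain_nsmul n)) (powWord j n) i := by
  rw [bound_powWord, bound_powWord, placePerm_powList_div]
  simp only [placePerm_powList_lt_iff]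

/-- The permutation of the places moves the letters by the automorphism. -/
theorem letter_placePerm (n : ℕ) {i : ℕ} (hi : i < n * j.wt.degree) :
    letter j (powWord j n) (placePerm (g.powList n) i) = D.a (letter j (powWord j n) i) := by
  refine ((g.path_powList n).ltr_placePerm i).trans ?_
  have hi' : i < (n • j.wt).degree := by rwa [degree_nsmul]
  change letter j _ i = _
  rw [letter_of_lt _ hi', letter_of_lt _ hi']
  rfl

/-- The permutation of the places is transitive on each of the blocks. -/
theorem exists_placePerm_pow (n : ℕ) {i i' : ℕ} (hi : i < n * j.wt.degree)
    (hi' : i' < n * j.wt.degree) (h : i / j.wt.degree = i' / j.wt.degree) :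
    ∃ t : ℕ, (placePerm (g.powList n))^[t] i = i' := by
  have hc := j.covers_nsmul n
  obtain ⟨z, hz⟩ := j.sameCycle (letter_mem hc (powWord j n) i) (letter_mem hc (powWord j n) i')
  have hz' : D.a ^ z ∈ Submonoid.powers D.a := by
    rw [D.finite_order.mem_powers_iff_mem_zpowers]
    exact ⟨z, rfl⟩
  obtain ⟨t, ht⟩ := hz'
  have ht : D.a ^ t = D.a ^ z := ht
  rw [← ht] at hz
  have key : ∀ t : ℕ, (placePerm (g.powList n))^[t] i < n * j.wt.degree ∧
      (placePerm (g.powList n))^[t] i / j.wt.degree = i / j.wt.degree ∧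
      letter j (powWord j n) ((placePerm (g.powList n))^[t] i) =
        (D.a ^ t) (letter j (powWord j n) i) := by
    intro t
    induction t with
    | zero => exact ⟨hi, rfl, rfl⟩
    | succ t ih =>
      rw [Function.iterate_succ_apply']
      refine ⟨(g.placePerm_powList_lt_iff n _).2 ih.1,
        (g.placePerm_powList_div n _).trans ih.2.1, ?_⟩
      rw [g.letter_placePerm n ih.1, ih.2.2, pow_succ', Equiv.Perm.mul_apply]
  refine ⟨t, ?_⟩
  obtain ⟨h1, h2, h3⟩ := key t
  rw [hz, letter_powWord_eq_iff h1 hi'] at h3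
  rw [← Nat.div_add_mod ((placePerm (g.powList n))^[t] i) j.wt.degree, h2, h3, h,
    Nat.div_add_mod]

theorem boundPerm_eq_iff (n : ℕ) (α : {α : ℕ →₀ ℕ // α ≤ IsFrame.bound
      (g.hecke (j.covers_nsmul n) (j.mapDomain_nsmul n)) (powWord j n)}) :
    IsFrame.boundPerm (g.bound_placePerm n) α = α ↔
      ∀ i < n * j.wt.degree, α.1 i = α.1 (i / j.wt.degree * j.wt.degree) := by
  have h1 : IsFrame.boundPerm (g.bound_placePerm n) α = α ↔
      ∀ i, α.1 (placePerm (g.powList n) i) = α.1 i := by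
    rw [Subtype.ext_iff, Finsupp.ext_iff]
    constructor
    · intro h i
      have := h (placePerm (g.powList n) i)
      change α.1 ((placePerm (g.powList n)).symm (placePerm (g.powList n) i)) = _ at this
      rw [Equiv.symm_apply_apply] at this
      exact this.symm
    · intro h i
      change α.1 ((placePerm (g.powList n)).symm i) = _
      have := h ((placePerm (g.powList n)).symm i)
      rw [Equiv.apply_symm_apply] at this
      exact this.symm
  rw [h1]
  constructor
  · intro h i hi
    obtain ⟨t, ht⟩ := g.exists_placePerm_pow n hi
      ((Nat.div_mul_le_self i j.wt.degree).trans_lt hi)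
      (Nat.mul_div_cancel _ j.degree_wt_pos).symm
    rw [← ht]
    have : ∀ t : ℕ, α.1 ((placePerm (g.powList n))^[t] i) = α.1 i := by
      intro t
      induction t with
      | zero => rfl
      | succ t ih => rw [Function.iterate_succ_apply', h, ih]
    exact (this t).symm
  · intro h i
    by_cases hi : i < n * j.wt.degree
    · rw [h i hi, h _ ((g.placePerm_powList_lt_iff n i).2 hi), placePerm_powList_div]
    · have h2 := α.2 i
      have h3 := α.2 (placePerm (g.powList n) i)
      rw [bound_powWord, if_neg hi] at h2
      rw [bound_powWord, if_neg fun h => hi ((g.placePerm_powList_lt_iff n i).1 h)] at h3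
      omega

theorem div_lt_of_lt {n r i : ℕ} (h : i < n * r) : i / r < n :=
  Nat.div_lt_of_lt_mul (by rwa [mul_comm])

/-- Exponents which are constant on blocks. -/
def blockExponent (n : ℕ) (f : Fin n → ℕ) : ℕ →₀ ℕ :=
  Finsupp.onFinset (Finset.range (n * j.wt.degree))
    (fun i => if h : i < n * j.wt.degree then f ⟨i / j.wt.degree, div_lt_of_lt h⟩ else 0)
    fun i hi => by
      by_contra hn
      exact hi (dif_neg (by simpa using hn))

theorem blockExponent_apply {n : ℕ} (f : Fin n → ℕ) {i : ℕ} (h : i < n * j.wt.degree) :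
    blockExponent (j := j) n f i = f ⟨i / j.wt.degree, div_lt_of_lt h⟩ := dif_pos h

theorem eq_blockExponent {n : ℕ} {α : {α : ℕ →₀ ℕ // α ≤ IsFrame.bound
      (g.hecke (j.covers_nsmul n) (j.mapDomain_nsmul n)) (powWord j n)}}
    (h : IsFrame.boundPerm (g.bound_placePerm n) α = α) :
    blockExponent (j := j) n (fun q => α.1 (q * j.wt.degree)) = α.1 := by
  refine Finsupp.ext fun i => ?_
  rw [boundPerm_eq_iff] at h
  by_cases hi : i < n * j.wt.degree
  · rw [blockExponent_apply _ hi]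
    exact (h i hi).symm
  · have h2 := α.2 i
    rw [bound_powWord, if_neg hi] at h2
    refine Eq.trans ?_ (Nat.le_zero.1 h2).symm
    exact dif_neg hi

theorem sum_fixed {M : Type*} [AddCommMonoid M] (n : ℕ) (F : (ℕ →₀ ℕ) → M) (G : (Fin n → ℕ) → M)
    (hFG : ∀ f, F (blockExponent (j := j) n f) = G f) (S : Finset {α : ℕ →₀ ℕ // α ≤ IsFrame.bound
      (g.hecke (j.covers_nsmul n) (j.mapDomain_nsmul n)) (powWord j n)})
    (hS : ∀ α, α ∈ S ↔ IsFrame.boundPerm (g.bound_placePerm n) α = α) :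
    ∑ α ∈ S, F α.1 =
      ∑ f ∈ Fintype.piFinset fun q : Fin n => Finset.range (q + 1), G f := by
  have hr := j.degree_wt_pos
  have hq : ∀ q : Fin n, (q : ℕ) * j.wt.degree < n * j.wt.degree := fun q =>
    Nat.mul_lt_mul_of_pos_right q.2 hr
  refine Finset.sum_bij' (fun α _ q => α.1 (q * j.wt.degree))
    (fun f hf => ⟨blockExponent (j := j) n f, fun i => ?_⟩) ?_ ?_ ?_ ?_ ?_
  · rw [bound_powWord]
    split_ifs with h
    · rw [blockExponent_apply (j := j) f h]
      have := Fintype.mem_piFinset.1 hf ⟨i / j.wt.degree, div_lt_of_lt h⟩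
      rw [Finset.mem_range] at this
      exact Nat.lt_succ_iff.1 this
    · have : blockExponent (j := j) n f i = 0 := dif_neg h
      exact this.le
  · intro α hα
    rw [Fintype.mem_piFinset]
    intro q
    have := α.2 (q * j.wt.degree)
    rw [bound_powWord, if_pos (hq q), Nat.mul_div_cancel _ hr] at this
    exact Finset.mem_range.2 (Nat.lt_succ_iff.2 this)
  · intro f hf
    rw [hS, boundPerm_eq_iff]
    intro i hi
    rw [blockExponent_apply f hi,
      blockExponent_apply f ((Nat.div_mul_le_self i j.wt.degree).trans_lt hi)]
    congr 2
    exact (Nat.mul_div_cancel _ hr).symm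
  · intro α hα
    exact Subtype.ext (g.eq_blockExponent ((hS α).1 hα))
  · intro f hf
    funext q
    refine (blockExponent_apply f (hq q)).trans ?_
    congr 1
    exact Fin.ext (Nat.mul_div_cancel _ hr)
  · intro α hα
    rw [← hFG]
    exact congrArg F (g.eq_blockExponent ((hS α).1 hα)).symm

variable [Infinite k] {O : Type} [CommRing O] [IsDomain O] {ζ : O} {ω : k}

/-- The basis of the weight space of `L(j^n)`. -/
def permBasis (hn : (D.order : k) ≠ 0) (hω : IsPrimitiveRoot ω D.order) (n : ℕ) :=
  (g.isFrame_powFrame n).permBasis (g.isTop_L hn hω n) (g.bound_placePerm n)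

theorem char_powFrame_L (hn : (D.order : k) ≠ 0) (hζ : IsPrimitiveRoot ζ D.order)
    (hω : IsPrimitiveRoot ω D.order) (n : ℕ) :
    (g.powFrame n).char ζ ω 0 (g.L n) = qfac O j.d n := by
  have hn0 : D.order ≠ 0 := by intro h; simp [h] at hn
  have hS : ∀ α, α ∈ Finset.univ.filter (fun α => IsFrame.boundPerm (g.bound_placePerm n) α = α) ↔
      IsFrame.boundPerm (g.bound_placePerm n) α = α := fun α => by simp
  refine ((g.permBasis hn hω n).char_eq hn0 hζ hω 0 hS).trans ?_
  rw [qfac_eq_sum]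
  refine g.sum_fixed n (fun α => (T : ℤ → O[T;T⁻¹]) (j.d * n.choose 2 + j.size *
    ∑ i ∈ Finset.range (g.hecke (j.covers_nsmul n) (j.mapDomain_nsmul n)).len,
      ((α i : ℤ) - (g.hecke (j.covers_nsmul n) (j.mapDomain_nsmul n)).δ (powWord j n) i) - 0))
    _ (fun f => ?_) _ hS
  have e : (g.hecke (j.covers_nsmul n) (j.mapDomain_nsmul n)).len = n * j.wt.degree :=
    j.degree_nsmul n
  congr 1
  let f' : ℕ → ℤ := fun q => if h : q < n then (f ⟨q, h⟩ : ℤ) - q else 0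
  rw [e, Finset.sum_congr rfl (g := fun i => f' (i / j.wt.degree)) fun i hi => ?_,
    sum_range_mul_div j.degree_wt_pos, nsmul_eq_mul, sub_zero, ← mul_assoc, size_mul_degree,
    Finset.sum_range]
  · have h1 : ((n.choose 2 : ℕ) : ℤ) = ∑ q : Fin n, ((q : ℕ) : ℤ) := by
      rw [← Finset.sum_range (fun q => (q : ℤ)), ← Nat.cast_sum, Finset.sum_range_id,
        Nat.choose_two_right]
    rw [h1, Finset.mul_sum, Finset.mul_sum, ← Finset.sum_add_distrib]
    refine Finset.sum_congr rfl fun q _ => ?_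
    simp only [f', dif_pos q.2]
    ring
  · rw [Finset.mem_range] at hi
    simp only [f', dif_pos (div_lt_of_lt hi)]
    rw [blockExponent_apply f hi]
    congr 2
    exact g.δ_powWord hi

end Scaling

end Orbit

end

section

section QuantumBinomials

variable {O : Type} [CommRing O] (d : ℤ)

theorem qfac_ne_zero [IsDomain O] [CharZero O] (n : ℕ) : qfac O d n ≠ 0 := by
  refine Finset.prod_ne_zero_iff.2 fun m _ h => ?_
  have h1 := congrArg (LaurentPolynomial.eval₂ (RingHom.id O) 1) h
  rw [qint, map_sum, map_zero] at h1
  simp only [LaurentPolynomial.eval₂_T, one_zpow, Units.val_one, Finset.sum_const,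
    Finset.card_range, nsmul_eq_mul, mul_one] at h1
  exact Nat.cast_ne_zero.2 m.succ_ne_zero h1

theorem invert_qfac (n : ℕ) : LaurentPolynomial.invert (qfac O d n) = qfac O d n := by
  rw [qfac, map_prod]
  refine Finset.prod_congr rfl fun m _ => ?_
  conv_rhs => rw [qint_eq_sum]
  rw [qint, map_sum]
  refine Finset.sum_congr rfl fun t _ => ?_
  rw [LaurentPolynomial.invert_T]
  congr 1
  push_cast
  ring

theorem qbinom_coeff_intCast : ∀ n m e, ∃ c : ℤ, (qbinom O d n m).coeff e = c
  | _, 0, e => ⟨if e = 0 then 1 else 0, by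
      rw [qbinom, ← LaurentPolynomial.T_zero, LaurentPolynomial.T_apply]
      simp [eq_comm]⟩
  | 0, _ + 1, e => ⟨0, by rw [qbinom]; simp⟩
  | n + 1, m + 1, e => by
    obtain ⟨c, hc⟩ := qbinom_coeff_intCast n (m + 1) (e - d * ((m : ℤ) + 1))
    obtain ⟨c', hc'⟩ := qbinom_coeff_intCast n m (e - d * ((m : ℤ) - n))
    refine ⟨c + c', ?_⟩
    rw [qbinom, AddMonoidAlgebra.coeff_add, Finsupp.add_apply, coeff_T_mul, coeff_T_mul, hc, hc',
      Int.cast_add]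

variable [IsDomain O] [CharZero O]

theorem qbinom_unique {m l : ℕ} {p : O[T;T⁻¹]}
    (h : p * (qfac O d m * qfac O d l) = qfac O d (m + l)) : p = qbinom O d (m + l) m :=
  mul_right_cancel₀ (mul_ne_zero (qfac_ne_zero d m) (qfac_ne_zero d l))
    (h.trans (qbinom_mul d m l).symm)

theorem qbinom_symm (m l : ℕ) : qbinom O d (m + l) m = qbinom O d (m + l) l := by
  refine (qbinom_unique d ?_).symm
  rw [add_comm, mul_comm (qfac O d m), qbinom_mul, add_comm]

theorem invert_qbinom (m l : ℕ) :
    LaurentPolynomial.invert (qbinom O d (m + l) m) = qbinom O d (m + l) m := by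
  refine qbinom_unique d ?_
  conv_rhs => rw [← invert_qfac, ← qbinom_mul]
  rw [map_mul, map_mul, invert_qfac, invert_qfac]

theorem map_coeff_qbinom (bar : O →+* O) (m l : ℕ) (e : ℤ) :
    bar ((qbinom O d (m + l) m).coeff (-e)) = (qbinom O d (m + l) m).coeff e := by
  rw [← LaurentPolynomial.invert_apply, invert_qbinom]
  obtain ⟨c, hc⟩ := qbinom_coeff_intCast (O := O) d (m + l) m e
  rw [hc, map_intCast]

end QuantumBinomials

section RootsOfUnity

theorem isPrimitiveRoot_map {O : Type*} [CommRing O] [IsDomain O] [CharZero O] {k : Type*} [Field k]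
    (φ : O →+* k) {n : ℕ} (hn : (n : k) ≠ 0) {ζ : O} (h : IsPrimitiveRoot ζ n) :
    IsPrimitiveRoot (φ ζ) n := by
  have hn0 : n ≠ 0 := by rintro rfl; simp at hn
  have : NeZero (n : O) := ⟨Nat.cast_ne_zero.2 hn0⟩
  have : NeZero (n : k) := ⟨hn⟩
  rw [← Polynomial.isRoot_cyclotomic_iff, ← Polynomial.map_cyclotomic n φ]
  exact (Polynomial.isRoot_cyclotomic_iff.2 h).map

/-- Complex conjugation on `ℤ[ζ]`. -/
theorem exists_conj {n : ℕ} (hn : n ≠ 0) {z : ℂ} (hz : IsPrimitiveRoot z n)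
    (ζ : Algebra.adjoin ℤ {z}) (hζ : (ζ : ℂ) = z) :
    ∃ bar : Algebra.adjoin ℤ {z} →+* Algebra.adjoin ℤ {z}, bar ζ * ζ = 1 := by
  have h1 : (starRingEnd ℂ) z * z = 1 := by
    rw [Complex.conj_mul', hz.norm'_eq_one hn]
    simp
  have h2 : (starRingEnd ℂ) z = z ^ (n - 1) := by
    have h3 : z ^ (n - 1) * z = 1 := by
      rw [← pow_succ, Nat.sub_add_cancel (Nat.pos_of_ne_zero hn), hz.pow_eq_one]
    exact mul_right_cancel₀ (hz.ne_zero hn) (h1.trans h3.symm)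
  have h4 : ∀ x : Algebra.adjoin ℤ {z}, ((starRingEnd ℂ).toIntAlgHom.comp
      (Algebra.adjoin ℤ {z}).val) x ∈ Algebra.adjoin ℤ {z} := by
    rintro ⟨x, hx⟩
    change (starRingEnd ℂ) x ∈ _
    induction hx using Algebra.adjoin_induction with
    | mem x hx =>
      rw [Set.mem_singleton_iff.1 hx, h2]
      exact pow_mem (Algebra.self_mem_adjoin_singleton ℤ z) _
    | algebraMap c => simp
    | add x y _ _ hx hy => rw [map_add]; exact add_mem hx hy
    | mul x y _ _ hx hy => rw [map_mul]; exact mul_mem hx hy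
  refine ⟨(((starRingEnd ℂ).toIntAlgHom.comp (Algebra.adjoin ℤ {z}).val).codRestrict _ h4).toRingHom,
    Subtype.ext ?_⟩
  change (starRingEnd ℂ) (ζ : ℂ) * (ζ : ℂ) = 1
  rw [hζ, h1]

end RootsOfUnity

namespace Orbit.Scaling

variable {k : Type u} [Field k] [Infinite k] {I : Type v} {D : FoldedDatum I k} {j : Orbit D}
  (g : j.Scaling) {O : Type} [CommRing O] [IsDomain O] [CharZero O] {φ : O →+* k} {ζ : O}

theorem char_res (hn : (D.order : k) ≠ 0) (hζ : IsPrimitiveRoot ζ D.order)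
    (hω : IsPrimitiveRoot (φ ζ) D.order) {a b s : ℕ} (h : a + b = s) :
    ((g.core a).tensor (g.core b)).char ζ (φ ζ) (j.d * a.choose 2 + j.d * b.choose 2)
      ((j.inclusion h).res (g.L s)) = qbinom O j.d s a := by
  have hn0 : D.order ≠ 0 := by intro h; simp [h] at hn
  have C := (g.cover hn hω a).tensor (g.cover hn hω b)
  have hs : IsFinDim (g.L s) := (g.cover hn hω s).isFinDim
  have h1 := C.eval hω hζ.pow_eq_one hn
    (((g.powFrame a).tensor (g.powFrame b)).char_isEval (φ := φ) hω hζ.pow_eq_one hn (0 + 0))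
    ⟨(j.inclusion h).res (g.L s), (j.inclusion h).isFinDim_res hs⟩
  have h2 : ((g.powFrame a).tensor (g.powFrame b)).char ζ (φ ζ) (0 + 0)
      ((g.L a).tensor (g.L b)) = qfac O j.d a * qfac O j.d b := by
    rw [← g.char_powFrame_L hn hζ hω a, ← g.char_powFrame_L hn hζ hω b]
    exact (g.permBasis hn hω a).char_tensor (g.permBasis hn hω b) hn0 hζ hω 0 0
  have h3 : ((g.powFrame a).tensor (g.powFrame b)).char ζ (φ ζ) (0 + 0)
      ((j.inclusion h).res (g.L s)) = qfac O j.d s := by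
    rw [Frame.char_res, g.powFrame_map h, add_zero, g.char_powFrame_L hn hζ hω s]
  subst h
  exact qbinom_unique j.d ((congrArg _ h2).symm.trans (h1.symm.trans h3))

end Orbit.Scaling

end

end FoldedKLR

end

theorem theorem7p3 {k : Type*} [Field k] [IsAlgClosed k] {I : Type*} (D : FoldedDatum I k)
    (hn : (D.order : k) ≠ 0) (z : ℂ) (hz : IsPrimitiveRoot z D.order)
    (φ : Algebra.adjoin ℤ {z} →+* k) (ζ : Algebra.adjoin ℤ {z}) (hζ : (ζ : ℂ) = z)
    (j : Orbit D) (g : j.Scaling) :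
    -- the covers `P(j)^(n)` of the objects `L(j^n)` exist
    (∀ n : ℕ, ∃ P : Obj (j.alg n), IsFGProjective P ∧ IsProjectiveCover P (g.L n)) ∧
    -- the product on the sum of the groups of projectives
    (∃ mul : (⨁ n : ℕ, KP ζ φ (j.alg n)) →ₗ[(Algebra.adjoin ℤ {z})[T;T⁻¹]]
        (⨁ n : ℕ, KP ζ φ (j.alg n)) →ₗ[(Algebra.adjoin ℤ {z})[T;T⁻¹]]
          ⨁ n : ℕ, KP ζ φ (j.alg n),
      (∀ (m n : ℕ) (X : Obj (j.alg m)) (Y : Obj (j.alg n)) (hX : IsFGProjective X)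
        (hY : IsFGProjective Y), ∃ h : IsFGProjective (j.prod rfl X Y),
          mul (DirectSum.of (fun n => KP ζ φ (j.alg n)) m (clsP ζ φ X hX))
              (DirectSum.of (fun n => KP ζ φ (j.alg n)) n (clsP ζ φ Y hY)) =
            DirectSum.of (fun n => KP ζ φ (j.alg n)) (m + n) (clsP ζ φ (j.prod rfl X Y) h)) ∧
      ∀ (P : ∀ n, Obj (j.alg n)) (hP : ∀ n, IsFGProjective (P n)),
        (∀ n, IsProjectiveCover (P n) (g.L n)) → ∀ m n : ℕ,
          mul (DirectSum.of (fun n => KP ζ φ (j.alg n)) m (clsP ζ φ (P m) (hP m)))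
              (DirectSum.of (fun n => KP ζ φ (j.alg n)) n (clsP ζ φ (P n) (hP n))) =
            qbinom (Algebra.adjoin ℤ {z}) j.d (m + n) n •
              DirectSum.of (fun n => KP ζ φ (j.alg n)) (m + n)
                (clsP ζ φ (P (m + n)) (hP (m + n)))) ∧
    -- the coproduct on the sum of the groups of finite dimensional objects
    ∃ hL : ∀ n : ℕ, IsFinDim (g.L n),
    ∃ t : ∀ a b : ℕ, KL ζ φ (j.alg a) ⊗[(Algebra.adjoin ℤ {z})[T;T⁻¹]] KL ζ φ (j.alg b)
        ≃ₗ[(Algebra.adjoin ℤ {z})[T;T⁻¹]] KL ζ φ ((j.alg a).tensor (j.alg b)),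
      (∀ (a b : ℕ) (X : Obj (j.alg a)) (Y : Obj (j.alg b)) (hX : IsFinDim X) (hY : IsFinDim Y),
        ∃ h : IsFinDim (X.tensor Y),
          t a b (clsL ζ φ X hX ⊗ₜ clsL ζ φ Y hY) = clsL ζ φ (X.tensor Y) h) ∧
      ∃ r : (⨁ n : ℕ, KL ζ φ (j.alg n)) →ₗ[(Algebra.adjoin ℤ {z})[T;T⁻¹]]
          ⨁ p : ℕ × ℕ, KL ζ φ (j.alg p.1) ⊗[(Algebra.adjoin ℤ {z})[T;T⁻¹]] KL ζ φ (j.alg p.2),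
        (∀ (n a b : ℕ) (h : a + b = n) (X : Obj (j.alg n)) (hX : IsFinDim X),
          ∃ hR : IsFinDim (j.res h X),
            t a b (r (DirectSum.of (fun n => KL ζ φ (j.alg n)) n (clsL ζ φ X hX)) (a, b)) =
              clsL ζ φ (j.res h X) hR) ∧
        (∀ (n a b : ℕ), a + b ≠ n → ∀ x : KL ζ φ (j.alg n),
          r (DirectSum.of (fun n => KL ζ φ (j.alg n)) n x) (a, b) = 0) ∧
        ∀ n : ℕ, r (DirectSum.of (fun n => KL ζ φ (j.alg n)) n (clsL ζ φ (g.L n) (hL n))) =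
          ∑ p ∈ Finset.HasAntidiagonal.antidiagonal n, qbinom (Algebra.adjoin ℤ {z}) j.d n p.1 •
            DirectSum.of (fun p : ℕ × ℕ => KL ζ φ (j.alg p.1)
                ⊗[(Algebra.adjoin ℤ {z})[T;T⁻¹]] KL ζ φ (j.alg p.2)) p
              (clsL ζ φ (g.L p.1) (hL p.1) ⊗ₜ clsL ζ φ (g.L p.2) (hL p.2)) := by
  have hn0 : D.order ≠ 0 := by intro h; simp [h] at hn
  have hζ' : IsPrimitiveRoot ζ D.order :=
    IsPrimitiveRoot.of_map_of_injective (f := (Algebra.adjoin ℤ {z}).val) (by rwa [← hζ] at hz)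
      Subtype.val_injective
  have hω := isPrimitiveRoot_map φ hn hζ'
  obtain ⟨bar, hbar⟩ := exists_conj hn0 hz ζ hζ
  have hL : ∀ n, IsFinDim (g.L n) := fun n => (g.cover hn hω n).isFinDim
  refine ⟨fun n => ?_, ?_, hL, ?_⟩
  · have R := (g.core n).toFrame.rep hn0 (j.d * n.choose 2)
    exact ⟨_, R.isFGProjective hω hn, R.isProjectiveCover (g.cover hn hω n) hω hn⟩
  · refine exists_product (fun a b => j.inclusion rfl) (g.cover hn hω) hω hζ' hn bar hbar
      (fun a b => qbinom (Algebra.adjoin ℤ {z}) j.d (a + b) b) (fun a b => ?_) (fun a b e => ?_)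
    · rw [g.char_res hn hζ' hω rfl, qbinom_symm]
    · rw [← qbinom_symm, map_coeff_qbinom]
  · exact exists_coproduct (fun h => j.inclusion h) (g.cover hn hω) hω hζ' hn hL
      (qbinom (Algebra.adjoin ℤ {z}) j.d) fun a b => g.char_res hn hζ' hω rfl
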